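/- **Setting.** Let $k$ be a field, $A$ an associative unital $k$-algebra, $\mathfrak g$ a Lie $k$-algebra with a basis $(g_i)_{i\in I}$ indexed by a totally ordered set $I$, and let $E=A\#_fU(\mathfrak g)$ be a crossed product. That is, $U(\mathfrak g)$ acts weakly on $A$ by $(h,a)\mapsto a^h$ (a $k$-bilinear map with $(ab)^h=\sum a^{h^{(1)}}b^{h^{(2)}}$, $1^h=\epsilon(h)1$, $a^1=a$), $f\colon U(\mathfrak g)\otimes_kU(\mathfrak g)\to A$ is $k$-linear, and the space $A\otimes_kU(\mathfrak g)$ (with $a\# h:=a\otimes_k h$) with the product $(a\# h)(b\# l)=\sum a\,b^{h^{(1)}}f(h^{(2)},l^{(1)})\# h^{(3)}l^{(2)}$ is associative with identity $1\# 1$. Let $K\subseteq A$ be a subalgebra with $\lambda^x\in K$ for all $\lambda\in K$, $x\in\mathfrak g$. Write $\otimes=\otimes_K$, $\overline A=A/K$, identify $a$ with $a\# 1$, and let $k$ act centrally on all bimodules. Put $$X_{rs}=(E\otimes_k\mathfrak g^{\wedge s})\otimes\overline A^{\otimes r}\otimes E,\qquad X_n=\bigoplus_{r+s=n}X_{rs},$$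 where $(c\otimes_k\mathbf x)\lambda=c\lambda\otimes_k\mathbf x$ for $\lambda\in K$; these are $E$-bimodules through the outer factors $E$. Write $\mathbf x=x_1\wedge\dots\wedge x_s$. **The algebra $Y_*$.** It is the graded $k$-algebra generated by the algebra $A$ and elements $y_x,z_x$ of degree $0$ and $e_x$ of degree $1$ ($x\in\mathfrak g$), all $k$-linear in $x$, with relations $y_xa=a^x+ay_x$, $z_xa=a^x+az_x$, $e_xa=ae_x$, $e_{x'}y_x=y_xe_{x'}+e_{[x',x]}$, $e_{x'}z_x=z_xe_{x'}$, $e_x^2=0$, and, with $\hat f(x',x)=f(x',x)-f(x,x')$, $$y_{x'}y_x=y_xy_{x'}+y_{[x',x]}+\hat f(x',x),\quad z_{x'}y_x=y_xz_{x'}+z_{[x',x]}+\hat f(x',x),\quad z_{x'}z_x=z_xz_{x'}+z_{[x',x]}+\hat f(x',x).$$ Let $\rho_x=z_x-y_x$, $\rho_i=\rho_{g_i}$, $e_i=e_{g_i}$. **The maps.** The following maps exist, have the indicated (bi)degrees, and are uniquely determined by the given properties. * Algebra maps $\iota_y,\iota_z\colon E\to Y_0$ with $a\mapsto a$ and $1\#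 x\mapsto y_x$, resp. $1\# x\mapsto z_x$. Through them $Y_*$ is a left, resp. right, $E$-module. * The graded derivation $\partial\colon Y_*\to Y_{*-1}$ with $\partial(e_x)=z_x-y_x$. * The left $E$-linear maps $\sigma^{-1}_{s+1}\colon Y_s\to Y_{s+1}$ which, on the products $\rho_{i_1}^{m_1}e_{i_1}^{\delta_1}\cdots\rho_{i_l}^{m_l}e_{i_l}^{\delta_l}$ with $i_1<\dots<i_l$, $m_j\ge0$, $\delta_j\in\{0,1\}$, $m_j+\delta_j>0$, take the value $\rho_{i_1}^{m_1-1}e_{i_1}\rho_{i_2}^{m_2}e_{i_2}^{\delta_2}\cdots\rho_{i_l}^{m_l}e_{i_l}^{\delta_l}$ if $l>0$ and $\delta_1=0$, and $0$ if $l=0$ or $\delta_1=1$; also the left $E$-linear map $\sigma^{-1}_0\colon E\to Y_0$ with $1\mapsto1$. * The bimodule maps $\overline\mu\colon X_0\to E$, $c\otimes c'\mapsto cc'$, and $\mu_s\colon X_{0s}\to Y_s$, $1\otimes_k\mathbf x\otimes1\mapsto e_{x_1}\cdots e_{x_s}$. * The left $E$-linear maps $\sigma^0\colon Y_s\to X_{0s}$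 with $\sigma^0(e_{x_1}\cdots e_{x_s}z_{x_{s+1}}\cdots z_{x_n})=\sum_ja_j\otimes_k\mathbf x\otimes1\# w_j$ whenever $\sum_ja_j\# w_j=(1\# x_{s+1})\cdots(1\# x_n)$, and $\sigma^0\colon X_{rs}\to X_{r+1,s}$ with $$\sigma^0(1\otimes_k\mathbf x\otimes a_1\otimes\dots\otimes a_r\otimes a_{r+1}\# w)=(-1)^{r+s+1}\,1\otimes_k\mathbf x\otimes a_1\otimes\dots\otimes a_{r+1}\otimes1\# w.$$ * The $E$-bimodule maps $d^l\colon X_{rs}\to X_{r+l-1,s-l}$ ($0\le l\le s$, $r+l>0$) given on $\mathbf y=1\otimes_k\mathbf x\otimes a_1\otimes\dots\otimes a_r\otimes1$ by $$d^0(\mathbf y)=(-1)^sa_1\otimes_k\mathbf x\otimes a_2\otimes\dots\otimes a_r\otimes1+\sum_{i=1}^{r-1}(-1)^{i+s}1\otimes_k\mathbf x\otimes a_1\otimes\dots\otimes a_ia_{i+1}\otimes\dots\otimes a_r\otimes1+(-1)^{r+s}1\otimes_k\mathbf x\otimes a_1\otimes\dots\otimes a_{r-1}\otimes a_r$$ and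 recursively by $d^1(\mathbf y)=-\sigma^0\partial\mu(\mathbf y)$ for $r=0$, $d^1(\mathbf y)=-\sigma^0d^1d^0(\mathbf y)$ for $r>0$, and, for $l>1$, $d^l(\mathbf y)=-\sum_{j=1}^{l-1}\sigma^0d^{l-j}d^j(\mathbf y)$ for $r=0$, $d^l(\mathbf y)=-\sum_{j=0}^{l-1}\sigma^0d^{l-j}d^j(\mathbf y)$ for $r>0$. * The maps $\sigma^l\colon Y_s\to X_{l,s-l}$ and $\sigma^l\colon X_{rs}\to X_{r+l+1,s-l}$ ($0<l\le s$), recursively $\sigma^l=-\sum_{j=0}^{l-1}\sigma^0d^{l-j}\sigma^j$. **Theorem 1.3.** With $d_n=\sum_{r+s=n}\ \sum_{0\le l\le s,\ r+l>0}d^l_{rs}$, the sequence $$E\xleftarrow{\ \overline\mu\ }X_0\xleftarrow{\ d_1\ }X_1\xleftarrow{\ d_2\ }X_2\longleftarrow\cdots$$ is a projective resolution of the $E$-bimodule $E$ relative to the family of all epimorphisms of $E$-bimodules which split as $(E,K)$-bimodule maps. That is, it is a complex of $E$-bimodules, each $X_n$ is projective relative to that family, and it is contractible as a complex of $(E,K)$-bimodules.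 Moreover $$\overline\sigma_0=\sigma^0\sigma^{-1}_0\colon E\to X_0,\qquad\overline\sigma_{n+1}=-\sum_{l=0}^{n+1}\sigma^l\,\sigma^{-1}_{n+1}\,\mu_n+\sum_{r=0}^n\sum_{l=0}^{n-r}\sigma^l|_{X_{r,n-r}}\colon X_n\to X_{n+1}\quad(n\ge0)$$ is a contracting homotopy of this complex by left $E$-linear maps. If $K$ is stable under the weak action of all of $U(\mathfrak g)$ (that is, $\lambda^h\in K$ for $\lambda\in K$, $h\in U(\mathfrak g)$), then all $\overline\sigma_n$ are $(E,K)$-bimodule maps. -/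

import Mathlib

open scoped TensorProduct DirectSum
open MulOpposite

noncomputable section

namespace DiffOpRing

attribute [local instance] LieRing.ofAssociativeRing

/-! ### The Hopf algebra `U(g)` -/

section Enveloping

variable (k : Type*) (g : Type*) [Field k] [LieRing g] [LieAlgebra k g]

/-- The enveloping algebra `U(g)`. -/
abbrev U := UniversalEnvelopingAlgebra k g

/-- The Lie map `x ↦ x ⊗ 1 + 1 ⊗ x` from `g` to `U(g) ⊗ U(g)`. -/
def comulLie : g →ₗ⁅k⁆ (U k g ⊗[k] U k g) where
  toFun x := UniversalEnvelopingAlgebra.ι k x ⊗ₜ[k] (1 : U k g)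
    + (1 : U k g) ⊗ₜ[k] UniversalEnvelopingAlgebra.ι k x
  map_add' x y := by
    simp only [map_add, TensorProduct.add_tmul, TensorProduct.tmul_add]
    abel
  map_smul' c x := by
    simp only [map_smul, TensorProduct.smul_tmul', TensorProduct.tmul_smul, smul_add,
      RingHom.id_apply]
  map_lie' := by
    intro x y
    simp only [LieHom.map_lie, LieRing.of_associative_ring_bracket, mul_add, add_mul,
      Algebra.TensorProduct.tmul_mul_tmul, mul_one, one_mul, TensorProduct.sub_tmul,
      TensorProduct.tmul_sub]
    abel

/-- The comultiplication of `U(g)`: the algebra map with `Δ x = x ⊗ 1 + 1 ⊗ x` on `g`. -/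
def comul : U k g →ₐ[k] (U k g ⊗[k] U k g) :=
  UniversalEnvelopingAlgebra.lift k (comulLie k g)

/-- The counit of `U(g)`: the algebra map that vanishes on `g`. -/
def counit : U k g →ₐ[k] k :=
  UniversalEnvelopingAlgebra.lift k (0 : g →ₗ⁅k⁆ k)

/-- `h ↦ ∑ h⁽¹⁾ ⊗ (h⁽²⁾ ⊗ h⁽³⁾)`. -/
def comul3 : U k g →ₗ[k] (U k g ⊗[k] (U k g ⊗[k] U k g)) :=
  (LinearMap.lTensor (U k g) (comul k g).toLinearMap) ∘ₗ (comul k g).toLinearMap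

end Enveloping

/-! ### Crossed products `A #_f U(g)` -/

section Crossed

variable (k A g : Type*) [Field k] [Ring A] [Algebra k A] [LieRing g] [LieAlgebra k g]

variable {k A g} in
/-- `(h₁ ⊗ (h₂ ⊗ h₃)) ⊗ (b ⊗ (l₁ ⊗ l₂)) ↦ b ^ h₁ ⊗ (f(h₂, l₁) ⊗ h₃ l₂)`. -/
def crossedCore (act : U k g →ₗ[k] A →ₗ[k] A) (f : U k g →ₗ[k] U k g →ₗ[k] A) :
    ((U k g ⊗[k] (U k g ⊗[k] U k g)) ⊗[k] (A ⊗[k] (U k g ⊗[k] U k g))) →ₗ[k]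
      (A ⊗[k] (A ⊗[k] U k g)) :=
  (TensorProduct.map (TensorProduct.lift act)
      (TensorProduct.map (TensorProduct.lift f) (LinearMap.mul' k (U k g)))) ∘ₗ
    (LinearMap.lTensor (U k g ⊗[k] A)
      (TensorProduct.tensorTensorTensorComm k (U k g) (U k g) (U k g) (U k g)).toLinearMap) ∘ₗ
    (TensorProduct.tensorTensorTensorComm k (U k g) (U k g ⊗[k] U k g) A
      (U k g ⊗[k] U k g)).toLinearMap

/-- `a ⊗ (b ⊗ h) ↦ a b ⊗ h`. -/
def mulLeftFactor : (A ⊗[k] (A ⊗[k] U k g)) →ₗ[k] (A ⊗[k] U k g) :=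
  (LinearMap.rTensor (U k g) (LinearMap.mul' k A)) ∘ₗ
    (TensorProduct.assoc k A A (U k g)).symm.toLinearMap

variable {k A g} in
/-- The multiplication of `A #_f U(g)`:
`(a ⊗ h)(b ⊗ l) = ∑ a b^{h⁽¹⁾} f(h⁽²⁾, l⁽¹⁾) ⊗ h⁽³⁾ l⁽²⁾`. -/
def crossedMul (act : U k g →ₗ[k] A →ₗ[k] A) (f : U k g →ₗ[k] U k g →ₗ[k] A) :
    (A ⊗[k] U k g) →ₗ[k] (A ⊗[k] U k g) →ₗ[k] (A ⊗[k] U k g) :=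
  TensorProduct.curry <|
    (mulLeftFactor k A g) ∘ₗ (LinearMap.lTensor A (mulLeftFactor k A g)) ∘ₗ
    (LinearMap.lTensor A (crossedCore act f)) ∘ₗ
    (TensorProduct.assoc k A (U k g ⊗[k] (U k g ⊗[k] U k g))
      (A ⊗[k] (U k g ⊗[k] U k g))).toLinearMap ∘ₗ
    (TensorProduct.map (LinearMap.lTensor A (comul3 k g))
      (LinearMap.lTensor A (comul k g).toLinearMap))

/-- A crossed product `A #_f U(g)`: a weak action `a ^ h = act h a` of `U(g)` on `A` and a
linear map `f : U(g) ⊗ U(g) → A` such that the algebra `A #_f U(g)` is associative with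
`1 # 1` as identity element. -/
structure CrossedProduct where
  /-- the weak action -/
  act : U k g →ₗ[k] A →ₗ[k] A
  /-- `(a b)^h = ∑ a^{h⁽¹⁾} b^{h⁽²⁾}` -/
  act_mul : ∀ (h : U k g) (a b : A),
    act h (a * b) =
      LinearMap.mul' k A (TensorProduct.map (act.flip a) (act.flip b) (comul k g h))
  act_one_right : ∀ h : U k g, act h 1 = counit k g h • (1 : A)
  act_one_left : ∀ a : A, act 1 a = a
  /-- the cocycle -/
  f : U k g →ₗ[k] U k g →ₗ[k] A
  mul_assoc' : ∀ u v w : A ⊗[k] U k g,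
    crossedMul act f (crossedMul act f u v) w = crossedMul act f u (crossedMul act f v w)
  one_mul' : ∀ u : A ⊗[k] U k g, crossedMul act f (1 ⊗ₜ 1) u = u
  mul_one' : ∀ u : A ⊗[k] U k g, crossedMul act f u (1 ⊗ₜ 1) = u

variable {k A g}

namespace CrossedProduct

variable (P : CrossedProduct k A g)

/-- The underlying space of the algebra `E = A #_f U(g)`. -/
def Alg (_P : CrossedProduct k A g) : Type _ := A ⊗[k] U k g

instance : AddCommGroup P.Alg := inferInstanceAs (AddCommGroup (A ⊗[k] U k g))
instance : Module k P.Alg := inferInstanceAs (Module k (A ⊗[k] U k g))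

/-- The element `a # h` of `E`, as a linear map in `a ⊗ h`. -/
def ofTensor : (A ⊗[k] U k g) ≃ₗ[k] P.Alg := LinearEquiv.refl k _

/-- The element `a # h` of `E`. -/
def sharp (a : A) (h : U k g) : P.Alg := P.ofTensor (a ⊗ₜ[k] h)

instance : Ring P.Alg :=
  { (inferInstance : AddCommGroup P.Alg) with
    mul := fun u v => crossedMul P.act P.f u v
    one := ((1 : A) ⊗ₜ[k] (1 : U k g) : A ⊗[k] U k g)
    mul_assoc := P.mul_assoc'
    one_mul := P.one_mul'
    mul_one := P.mul_one'
    left_distrib := fun u v w => map_add (crossedMul P.act P.f u) v w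
    right_distrib := fun u v w => LinearMap.map_add₂ (crossedMul P.act P.f) u v w
    zero_mul := fun u => LinearMap.map_zero₂ (crossedMul P.act P.f) u
    mul_zero := fun u => map_zero (crossedMul P.act P.f u) }

instance : Algebra k P.Alg :=
  Algebra.ofModule
    (fun c u v => LinearMap.map_smul₂ (crossedMul P.act P.f) c u v)
    (fun c u v => map_smul (crossedMul P.act P.f u) c v)

/-- The element `a # 1` of `E`; elements of `A` are regarded as elements of `E` in this way. -/
def inA (a : A) : P.Alg := P.sharp a 1

/-- The element `1 # h` of `E`. -/
def inU (h : U k g) : P.Alg := P.sharp 1 h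

/-- The element `1 # x` of `E`, for `x ∈ g`. -/
def inG (x : g) : P.Alg := P.inU (UniversalEnvelopingAlgebra.ι k x)

/-- `K` is stable under the weak action of `g`. -/
def Stable (K : Subalgebra k A) : Prop :=
  ∀ (x : g), ∀ t ∈ K, P.act (UniversalEnvelopingAlgebra.ι k x) t ∈ K

/-- `K` is stable under the weak action of `U(g)`. -/
def UStable (K : Subalgebra k A) : Prop :=
  ∀ (h : U k g), ∀ t ∈ K, P.act h t ∈ K

end CrossedProduct

end Crossed

/-! ### The graded algebra `Y_*` -/

section Y

variable {k A g : Type*} [Field k] [Ring A] [Algebra k A] [LieRing g] [LieAlgebra k g]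

/-- The generators of `Y_*`: the elements of `A` and, for `x ∈ g`, the elements `y_x`, `z_x`
(in degree `0`) and `e_x` (in degree `1`). -/
inductive Gen (A g : Type*)
  | a (a : A) : Gen A g
  | y (x : g) : Gen A g
  | z (x : g) : Gen A g
  | e (x : g) : Gen A g

/-- The degree of a generator. -/
def Gen.deg {A g : Type*} : Gen A g → ℕ
  | .a _ => 0
  | .y _ => 0
  | .z _ => 0
  | .e _ => 1

namespace CrossedProduct

variable (P : CrossedProduct k A g)

/-- `f(x', x) - f(x, x')` for `x', x ∈ g`. -/
def fhat (x' x : g) : A :=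
  P.f (UniversalEnvelopingAlgebra.ι k x') (UniversalEnvelopingAlgebra.ι k x)
    - P.f (UniversalEnvelopingAlgebra.ι k x) (UniversalEnvelopingAlgebra.ι k x')

/-- The action `a ^ x` of `x ∈ g` on `a`. -/
def actG (x : g) (a : A) : A := P.act (UniversalEnvelopingAlgebra.ι k x) a

/-- A generator as an element of the free algebra. -/
abbrev gen (_P : CrossedProduct k A g) (t : Gen A g) : FreeAlgebra k (Gen A g) :=
  FreeAlgebra.ι k t

open Gen in
/-- The defining relations of `Y_*`: those of the algebra `A`, and the listed ones. -/
inductive YRel : FreeAlgebra k (Gen A g) → FreeAlgebra k (Gen A g) → Prop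
  | a_add (c d : A) : YRel (P.gen (a (c + d))) (P.gen (a c) + P.gen (a d))
  | a_mul (c d : A) : YRel (P.gen (a (c * d))) (P.gen (a c) * P.gen (a d))
  | a_scalar (t : k) : YRel (P.gen (a (algebraMap k A t))) (algebraMap k _ t)
  | y_lin (t : k) (x x' : g) : YRel (P.gen (y (t • x + x'))) (t • P.gen (y x) + P.gen (y x'))
  | z_lin (t : k) (x x' : g) : YRel (P.gen (z (t • x + x'))) (t • P.gen (z x) + P.gen (z x'))
  | e_lin (t : k) (x x' : g) : YRel (P.gen (e (t • x + x'))) (t • P.gen (e x) + P.gen (e x'))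
  | y_a (x : g) (c : A) :
      YRel (P.gen (y x) * P.gen (a c)) (P.gen (a (P.actG x c)) + P.gen (a c) * P.gen (y x))
  | z_a (x : g) (c : A) :
      YRel (P.gen (z x) * P.gen (a c)) (P.gen (a (P.actG x c)) + P.gen (a c) * P.gen (z x))
  | e_a (x : g) (c : A) : YRel (P.gen (e x) * P.gen (a c)) (P.gen (a c) * P.gen (e x))
  | e_y (x' x : g) :
      YRel (P.gen (e x') * P.gen (y x)) (P.gen (y x) * P.gen (e x') + P.gen (e ⁅x', x⁆))
  | e_z (x' x : g) : YRel (P.gen (e x') * P.gen (z x)) (P.gen (z x) * P.gen (e x'))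
  | e_e (x : g) : YRel (P.gen (e x) * P.gen (e x)) 0
  | y_y (x' x : g) : YRel (P.gen (y x') * P.gen (y x))
      (P.gen (y x) * P.gen (y x') + P.gen (y ⁅x', x⁆) + P.gen (a (P.fhat x' x)))
  | z_y (x' x : g) : YRel (P.gen (z x') * P.gen (y x))
      (P.gen (y x) * P.gen (z x') + P.gen (z ⁅x', x⁆) + P.gen (a (P.fhat x' x)))
  | z_z (x' x : g) : YRel (P.gen (z x') * P.gen (z x))
      (P.gen (z x) * P.gen (z x') + P.gen (z ⁅x', x⁆) + P.gen (a (P.fhat x' x)))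

/-- The algebra `Y_*`. -/
abbrev Y : Type _ := RingQuot P.YRel

/-- The class of a generator in `Y_*`. -/
def yGen (t : Gen A g) : P.Y := RingQuot.mkAlgHom k P.YRel (FreeAlgebra.ι k t)

/-- `a ∈ A` as an element of `Y_*`. -/
def yA (a : A) : P.Y := P.yGen (.a a)
/-- The element `y_x`. -/
def yy (x : g) : P.Y := P.yGen (.y x)
/-- The element `z_x`. -/
def yz (x : g) : P.Y := P.yGen (.z x)
/-- The element `e_x`. -/
def ye (x : g) : P.Y := P.yGen (.e x)
/-- The element `ρ_x = z_x - y_x`. -/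
def yrho (x : g) : P.Y := P.yz x - P.yy x

/-- The component `Y_s`: the span of the products of generators of total degree `s`. -/
def Ygr (s : ℕ) : Submodule k P.Y :=
  Submodule.span k
    {w | ∃ L : List (Gen A g), (L.map Gen.deg).sum = s ∧ w = (L.map P.yGen).prod}

/-- The product `e_{x_1} ⋯ e_{x_s}`. -/
def eProd {s : ℕ} (x : Fin s → g) : P.Y := (List.ofFn fun i => P.ye (x i)).prod

/-- The product `ρ_{i_1}^{m_1} e_{i_1}^{δ_1} ⋯ ρ_{i_l}^{m_l} e_{i_l}^{δ_l}` in terms of the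
basis `b` of `g`, where `L` is the list of the triples `(i_j, m_j, δ_j)`. -/
def rhoWord {I : Type*} (b : Module.Basis I k g) (L : List (I × ℕ × Bool)) : P.Y :=
  (L.map fun t => P.yrho (b t.1) ^ t.2.1 * (if t.2.2 then P.ye (b t.1) else 1)).prod

/-- `i_1 < ⋯ < i_l` and `m_j + δ_j > 0` for all `j`. -/
def IsAdmissible {I : Type*} [LinearOrder I] (L : List (I × ℕ × Bool)) : Prop :=
  L.Pairwise (fun s t => s.1 < t.1) ∧ ∀ t ∈ L, 0 < t.2.1 ∨ t.2.2 = true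

end CrossedProduct

end Y

/-! ### The bimodules `X_{rs}` -/

section X

variable {k A g : Type*} [Field k] [Ring A] [Algebra k A] [LieRing g] [LieAlgebra k g]
variable (P : CrossedProduct k A g) (K : Subalgebra k A)

/-- `E ⊗_k g^{∧s} ⊗_k A^{⊗_k r} ⊗_k E`. -/
abbrev PreX (r s : ℕ) : Type _ :=
  P.Alg ⊗[k] ((⋀[k]^s g) ⊗[k] ((⨂[k]^r A) ⊗[k] P.Alg))

/-- The pure tensor `c ⊗ x_1 ∧ ⋯ ∧ x_s ⊗ a_1 ⊗ ⋯ ⊗ a_r ⊗ c'`, over `k`. -/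
def preMk {r s : ℕ} (c : P.Alg) (x : Fin s → g) (a : Fin r → A) (c' : P.Alg) : PreX P r s :=
  c ⊗ₜ[k] (exteriorPower.ιMulti k s x ⊗ₜ[k] (PiTensorProduct.tprod k a ⊗ₜ[k] c'))

/-- The relations that turn the tensor products over `k` into tensor products over `K`, and
`A` into `A/K`. The sequence of factors `c, a_1, …, a_r, c'` has `r + 1` tensor signs, numbered
by `i = 0, …, r`, and an element `t` of `K` may be moved across each of them, where `K` acts on
the right of `E ⊗ g^{∧s}` through the factor `E`. A tensor vanishes if some `a_j` is in `K`. -/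
def xRel (r s : ℕ) : Set (PreX P r s) :=
  {w | ∃ (i : Fin (r + 1)) (t : A) (c : P.Alg) (x : Fin s → g) (a : Fin r → A) (c' : P.Alg),
      t ∈ K ∧
      w = preMk P (if i.1 = 0 then c * P.inA t else c) x
            (fun j => if j.1 + 1 = i.1 then a j * t else a j) c'
          - preMk P c x
            (fun j => if j.1 = i.1 then t * a j else a j)
            (if i.1 = r then P.inA t * c' else c')} ∪
  {w | ∃ (j : Fin r) (c : P.Alg) (x : Fin s → g) (a : Fin r → A) (c' : P.Alg),
      a j ∈ K ∧ w = preMk P c x a c'}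

/-- `X_{rs} = (E ⊗_k g^{∧s}) ⊗_K (A/K)^{⊗_K r} ⊗_K E`. -/
def X (r s : ℕ) : Type _ := PreX P r s ⧸ Submodule.span k (xRel P K r s)

instance (r s : ℕ) : AddCommGroup (X P K r s) :=
  inferInstanceAs (AddCommGroup (PreX P r s ⧸ Submodule.span k (xRel P K r s)))
instance (r s : ℕ) : Module k (X P K r s) :=
  inferInstanceAs (Module k (PreX P r s ⧸ Submodule.span k (xRel P K r s)))

/-- The quotient map onto `X_{rs}`. -/
def X.proj (r s : ℕ) : PreX P r s →ₗ[k] X P K r s := Submodule.mkQ _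

/-- The element `c ⊗_k x_1 ∧ ⋯ ∧ x_s ⊗ a_1 ⊗ ⋯ ⊗ a_r ⊗ c'` of `X_{rs}`. -/
def X.mk {r s : ℕ} (c : P.Alg) (x : Fin s → g) (a : Fin r → A) (c' : P.Alg) : X P K r s :=
  X.proj P K r s (preMk P c x a c')

/-- Left multiplication by `c` on the first factor. -/
def preLeft (r s : ℕ) (c : P.Alg) : PreX P r s →ₗ[k] PreX P r s :=
  LinearMap.rTensor _ (LinearMap.mulLeft k c)

/-- Right multiplication by `c` on the last factor. -/
def preRight (r s : ℕ) (c : P.Alg) : PreX P r s →ₗ[k] PreX P r s :=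
  LinearMap.lTensor _ (LinearMap.lTensor _ (LinearMap.lTensor _ (LinearMap.mulRight k c)))

lemma preLeft_preMk {r s : ℕ} (d c : P.Alg) (x : Fin s → g) (a : Fin r → A) (c' : P.Alg) :
    preLeft P r s d (preMk P c x a c') = preMk P (d * c) x a c' := by
  simp [preLeft, preMk]

lemma preRight_preMk {r s : ℕ} (d c : P.Alg) (x : Fin s → g) (a : Fin r → A) (c' : P.Alg) :
    preRight P r s d (preMk P c x a c') = preMk P c x a (c' * d) := by
  simp [preRight, preMk]

lemma preLeft_le (r s : ℕ) (d : P.Alg) :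
    Submodule.span k (xRel P K r s) ≤
      (Submodule.span k (xRel P K r s)).comap (preLeft P r s d) := by
  rw [Submodule.span_le]
  rintro w (⟨i, t, c, x, a, c', ht, rfl⟩ | ⟨j, c, x, a, c', ha, rfl⟩)
  · refine Submodule.subset_span (Or.inl ⟨i, t, d * c, x, a, c', ht, ?_⟩)
    rw [map_sub, preLeft_preMk, preLeft_preMk]
    congr 2
    split_ifs <;> simp [mul_assoc]
  · exact Submodule.subset_span (Or.inr ⟨j, d * c, x, a, c', ha, preLeft_preMk ..⟩)

lemma preRight_le (r s : ℕ) (d : P.Alg) :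
    Submodule.span k (xRel P K r s) ≤
      (Submodule.span k (xRel P K r s)).comap (preRight P r s d) := by
  rw [Submodule.span_le]
  rintro w (⟨i, t, c, x, a, c', ht, rfl⟩ | ⟨j, c, x, a, c', ha, rfl⟩)
  · refine Submodule.subset_span (Or.inl ⟨i, t, c, x, a, c' * d, ht, ?_⟩)
    rw [map_sub, preRight_preMk, preRight_preMk]
    congr 2
    split_ifs <;> simp [mul_assoc]
  · exact Submodule.subset_span (Or.inr ⟨j, c, x, a, c' * d, ha, preRight_preMk ..⟩)

/-- The left action of `E` on `X_{rs}`, as an algebra map. -/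
def X.leftHom (r s : ℕ) : P.Alg →ₐ[k] Module.End k (X P K r s) :=
  AlgHom.ofLinearMap
    { toFun := fun c => Submodule.mapQ _ _ (preLeft P r s c) (preLeft_le P K r s c)
      map_add' := fun c d => by
        refine Submodule.linearMap_qext _ (LinearMap.ext fun w => ?_)
        change Submodule.Quotient.mk (preLeft P r s (c + d) w) =
          Submodule.Quotient.mk (preLeft P r s c w + preLeft P r s d w)
        congr 1
        rw [← LinearMap.add_apply]
        congr 1
        simp only [preLeft, ← LinearMap.rTensor_add]
        congr 1
        ext v
        simp [add_mul]
      map_smul' := fun t c => by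
        refine Submodule.linearMap_qext _ (LinearMap.ext fun w => ?_)
        change Submodule.Quotient.mk (preLeft P r s (t • c) w) =
          Submodule.Quotient.mk (t • preLeft P r s c w)
        congr 1
        rw [← LinearMap.smul_apply]
        congr 1
        simp only [preLeft, ← LinearMap.rTensor_smul]
        congr 1
        ext v
        simp }
    (by
      refine Submodule.linearMap_qext _ (LinearMap.ext fun w => ?_)
      change Submodule.Quotient.mk (preLeft P r s 1 w) = Submodule.Quotient.mk w
      simp [preLeft])
    (fun c d => by
      refine Submodule.linearMap_qext _ (LinearMap.ext fun w => ?_)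
      change Submodule.Quotient.mk (preLeft P r s (c * d) w) =
        Submodule.Quotient.mk (preLeft P r s c (preLeft P r s d w))
      congr 1
      simp only [preLeft, LinearMap.mulLeft_mul, LinearMap.rTensor_comp, LinearMap.comp_apply])

/-- The right action of `E` on `X_{rs}`, as an algebra map. -/
def X.rightHom (r s : ℕ) : P.Algᵐᵒᵖ →ₐ[k] Module.End k (X P K r s) :=
  AlgHom.ofLinearMap
    { toFun := fun c => Submodule.mapQ _ _ (preRight P r s c.unop) (preRight_le P K r s c.unop)
      map_add' := fun c d => by
        refine Submodule.linearMap_qext _ (LinearMap.ext fun w => ?_)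
        change Submodule.Quotient.mk (preRight P r s (c.unop + d.unop) w) =
          Submodule.Quotient.mk (preRight P r s c.unop w + preRight P r s d.unop w)
        congr 1
        rw [← LinearMap.add_apply]
        congr 1
        simp only [preRight, ← LinearMap.lTensor_add]
        congr 3
        ext v
        simp [mul_add]
      map_smul' := fun t c => by
        refine Submodule.linearMap_qext _ (LinearMap.ext fun w => ?_)
        change Submodule.Quotient.mk (preRight P r s (t • c.unop) w) =
          Submodule.Quotient.mk (t • preRight P r s c.unop w)
        congr 1
        rw [← LinearMap.smul_apply]
        congr 1
        simp only [preRight, ← LinearMap.lTensor_smul]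
        congr 3
        ext v
        simp }
    (by
      refine Submodule.linearMap_qext _ (LinearMap.ext fun w => ?_)
      change Submodule.Quotient.mk (preRight P r s 1 w) = Submodule.Quotient.mk w
      simp [preRight])
    (fun c d => by
      refine Submodule.linearMap_qext _ (LinearMap.ext fun w => ?_)
      change Submodule.Quotient.mk (preRight P r s (d.unop * c.unop) w) =
        Submodule.Quotient.mk (preRight P r s c.unop (preRight P r s d.unop w))
      congr 1
      simp only [preRight, LinearMap.mulRight_mul, LinearMap.lTensor_comp, LinearMap.comp_apply])

instance (r s : ℕ) : Module P.Alg (X P K r s) :=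
  Module.compHom _ (X.leftHom P K r s).toRingHom

instance (r s : ℕ) : Module P.Algᵐᵒᵖ (X P K r s) :=
  Module.compHom _ (X.rightHom P K r s).toRingHom

lemma X.smul_def {r s : ℕ} (c : P.Alg) (v : X P K r s) : c • v = X.leftHom P K r s c v := rfl

lemma X.op_smul_def {r s : ℕ} (c : P.Algᵐᵒᵖ) (v : X P K r s) :
    c • v = X.rightHom P K r s c v := rfl

instance (r s : ℕ) : IsScalarTower k P.Alg (X P K r s) where
  smul_assoc t c v := by simp [X.smul_def]

instance (r s : ℕ) : IsScalarTower k P.Algᵐᵒᵖ (X P K r s) where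
  smul_assoc t c v := by simp [X.op_smul_def]

instance (r s : ℕ) : SMulCommClass k P.Alg (X P K r s) where
  smul_comm t c v := by simp [X.smul_def]

instance (r s : ℕ) : SMulCommClass k P.Algᵐᵒᵖ (X P K r s) where
  smul_comm t c v := by simp [X.op_smul_def]

instance (r s : ℕ) : SMulCommClass P.Alg P.Algᵐᵒᵖ (X P K r s) where
  smul_comm c d v := by
    induction v using Submodule.Quotient.induction_on with
    | _ w =>
      change Submodule.Quotient.mk (preLeft P r s c (preRight P r s d.unop w)) =
        Submodule.Quotient.mk (preRight P r s d.unop (preLeft P r s c w))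
      congr 1
      simp only [preLeft, preRight, ← LinearMap.comp_apply, LinearMap.rTensor_comp_lTensor,
        LinearMap.lTensor_comp_rTensor]

lemma X.smul_mk {r s : ℕ} (d c : P.Alg) (x : Fin s → g) (a : Fin r → A) (c' : P.Alg) :
    d • X.mk P K c x a c' = X.mk P K (d * c) x a c' :=
  congrArg (X.proj P K r s) (preLeft_preMk P d c x a c')

lemma X.op_smul_mk {r s : ℕ} (d c : P.Alg) (x : Fin s → g) (a : Fin r → A) (c' : P.Alg) :
    op d • X.mk P K c x a c' = X.mk P K c x a (c' * d) :=
  congrArg (X.proj P K r s) (preRight_preMk P d c x a c')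

/-- The direct sum of all the `X_{rs}`. -/
abbrev XX : Type _ := ⨁ p : ℕ × ℕ, X P K p.1 p.2

/-- The inclusion of the component `X_{rs}`. -/
abbrev inX (r s : ℕ) : X P K r s →ₗ[k] XX P K :=
  DirectSum.lof k (ℕ × ℕ) (fun p => X P K p.1 p.2) (r, s)

/-- The element `c ⊗_k x_1 ∧ ⋯ ∧ x_s ⊗ a_1 ⊗ ⋯ ⊗ a_r ⊗ c'` of `X_{rs}`, in the direct sum. -/
def elt {r s : ℕ} (c : P.Alg) (x : Fin s → g) (a : Fin r → A) (c' : P.Alg) : XX P K :=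
  inX P K r s (X.mk P K c x a c')

/-- `X_n = ⨁_{r+s=n} X_{rs}` (a finite direct sum, written as a product). -/
abbrev Tot (n : ℕ) : Type _ := (p : Finset.HasAntidiagonal.antidiagonal n) → X P K p.1.1 p.1.2

/-- The projection of the direct sum of all the `X_{rs}` onto `X_n`. -/
def toTot (n : ℕ) : XX P K →ₗ[k] Tot P K n :=
  LinearMap.pi fun p => DirectSum.component k (ℕ × ℕ) (fun p => X P K p.1 p.2) p.1

end X

/-! ### Relative homological algebra -/

section Relative

variable {k A g : Type*} [Field k] [Ring A] [Algebra k A] [LieRing g] [LieAlgebra k g]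
variable (P : CrossedProduct k A g) (K : Subalgebra k A)

/-- `φ` is left `E`-linear. -/
def IsLeftLin {M N : Type*} [AddCommGroup M] [AddCommGroup N] [Module k M] [Module k N]
    [Module P.Alg M] [Module P.Alg N] (φ : M →ₗ[k] N) : Prop :=
  ∀ (c : P.Alg) (m : M), φ (c • m) = c • φ m

/-- `φ` is right `E`-linear. -/
def IsRightLin {M N : Type*} [AddCommGroup M] [AddCommGroup N] [Module k M] [Module k N]
    [Module P.Algᵐᵒᵖ M] [Module P.Algᵐᵒᵖ N] (φ : M →ₗ[k] N) : Prop :=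
  ∀ (c : P.Alg) (m : M), φ (op c • m) = op c • φ m

/-- `φ` is right `K`-linear, for the right `K`-module structures underlying right `E`-module
structures. -/
def IsRightKLin {M N : Type*} [AddCommGroup M] [AddCommGroup N] [Module k M] [Module k N]
    [Module P.Algᵐᵒᵖ M] [Module P.Algᵐᵒᵖ N] (φ : M →ₗ[k] N) : Prop :=
  ∀ t ∈ K, ∀ m : M, φ (op (P.inA t) • m) = op (P.inA t) • φ m

/-- The `E`-bimodule `Q` is projective relative to the family of all epimorphisms of
`E`-bimodules that split as `(E, K)`-bimodule maps. Here `k` acts centrally on bimodules. -/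
def RelProjective.{w₁, w₂, u₀, u₁, u₂, u₃} {k : Type u₀} {A : Type u₁} {g : Type u₂}
    [Field k] [Ring A] [Algebra k A]
    [LieRing g] [LieAlgebra k g] (P : CrossedProduct k A g) (K : Subalgebra k A)
    (Q : Type u₃) [AddCommGroup Q] [Module k Q] [Module P.Alg Q] [Module P.Algᵐᵒᵖ Q] : Prop :=
  ∀ (M : Type w₁) (N : Type w₂) [AddCommGroup M] [AddCommGroup N] [Module k M] [Module k N]
    [Module P.Alg M] [Module P.Alg N] [Module P.Algᵐᵒᵖ M] [Module P.Algᵐᵒᵖ N]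
    [IsScalarTower k P.Alg M] [IsScalarTower k P.Algᵐᵒᵖ M] [SMulCommClass P.Alg P.Algᵐᵒᵖ M]
    [IsScalarTower k P.Alg N] [IsScalarTower k P.Algᵐᵒᵖ N] [SMulCommClass P.Alg P.Algᵐᵒᵖ N]
    (π : M →ₗ[k] N), IsLeftLin P π → IsRightLin P π →
    (∃ τ : N →ₗ[k] M, IsLeftLin P τ ∧ IsRightKLin P K τ ∧ π ∘ₗ τ = LinearMap.id) →
    ∀ φ : Q →ₗ[k] N, IsLeftLin P φ → IsRightLin P φ →
      ∃ ψ : Q →ₗ[k] M, IsLeftLin P ψ ∧ IsRightLin P ψ ∧ π ∘ₗ ψ = φ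

section Complex

variable {C : ℕ → Type*} [∀ n, AddCommGroup (C n)] [∀ n, Module k (C n)]

/-- `(σ₀, σ)` is a contracting homotopy of the augmented sequence
`E ← C_0 ← C_1 ← ⋯`, where `σ₀ : E → C_0` and `σ n : C_n → C_{n+1}`. -/
def IsContraction (ε : C 0 →ₗ[k] P.Alg) (d : ∀ n, C (n + 1) →ₗ[k] C n)
    (σ₀ : P.Alg →ₗ[k] C 0) (σ : ∀ n, C n →ₗ[k] C (n + 1)) : Prop :=
  ε ∘ₗ σ₀ = LinearMap.id ∧
  σ₀ ∘ₗ ε + d 0 ∘ₗ σ 0 = LinearMap.id ∧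
  ∀ n, σ n ∘ₗ d n + d (n + 1) ∘ₗ σ (n + 1) = LinearMap.id

/-- The augmented sequence `E ← C_0 ← C_1 ← ⋯` of `E`-bimodules is a projective resolution of
the `E`-bimodule `E`, relative to the family of all epimorphisms of `E`-bimodules that split as
`(E, K)`-bimodule maps: it is a complex of bimodule maps between relatively projective
bimodules, and it is contractible as a complex of `(E, K)`-bimodules. -/
structure IsRelProjectiveResolution.{w₁, w₂, u₀, u₁, u₂, u₃} {k : Type u₀} {A : Type u₁}
    {g : Type u₂} [Field k] [Ring A] [Algebra k A]
    [LieRing g] [LieAlgebra k g] (P : CrossedProduct k A g) (K : Subalgebra k A)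
    {C : ℕ → Type u₃} [∀ n, AddCommGroup (C n)] [∀ n, Module k (C n)]
    [∀ n, Module P.Alg (C n)] [∀ n, Module P.Algᵐᵒᵖ (C n)]
    (ε : C 0 →ₗ[k] P.Alg) (d : ∀ n, C (n + 1) →ₗ[k] C n) : Prop where
  aug_left : IsLeftLin P ε
  aug_right : IsRightLin P ε
  d_left : ∀ n, IsLeftLin P (d n)
  d_right : ∀ n, IsRightLin P (d n)
  aug_comp : ε ∘ₗ d 0 = 0
  d_comp : ∀ n, d n ∘ₗ d (n + 1) = 0
  projective : ∀ n, RelProjective.{w₁, w₂} P K (C n)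
  split : ∃ (σ₀ : P.Alg →ₗ[k] C 0) (σ : ∀ n, C n →ₗ[k] C (n + 1)),
    IsContraction P ε d σ₀ σ ∧ IsLeftLin P σ₀ ∧ IsRightKLin P K σ₀ ∧
    (∀ n, IsLeftLin P (σ n)) ∧ ∀ n, IsRightKLin P K (σ n)

end Complex

end Relative

/-! ### The maps -/

section Maps

variable {k A g I : Type*} [Field k] [Ring A] [Algebra k A] [LieRing g] [LieAlgebra k g]
  [LinearOrder I]

/-- The maps out of which the resolution is built, each pinned down by its defining formula.
Left and right multiplication in `E`-bimodules are written `c • v` and `op c • v`; `Y_*` is a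
left `E`-module through `iotaY` and a right `E`-module through `iotaZ`. -/
structure Maps (P : CrossedProduct k A g) (K : Subalgebra k A) (b : Module.Basis I k g) where
  /-- The algebra map `E → Y_*` with `a ↦ a`, `1 # x ↦ y_x`. -/
  iotaY : P.Alg →ₐ[k] P.Y
  iotaY_A : ∀ a, iotaY (P.inA a) = P.yA a
  iotaY_G : ∀ x, iotaY (P.inG x) = P.yy x
  /-- The algebra map `E → Y_*` with `a ↦ a`, `1 # x ↦ z_x`. -/
  iotaZ : P.Alg →ₐ[k] P.Y
  iotaZ_A : ∀ a, iotaZ (P.inA a) = P.yA a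
  iotaZ_G : ∀ x, iotaZ (P.inG x) = P.yz x
  /-- The (graded) derivation `∂ : Y_* → Y_{*-1}` with `∂ e_x = z_x - y_x`. -/
  del : P.Y →ₗ[k] P.Y
  del_zero : ∀ v ∈ P.Ygr 0, del v = 0
  del_mem : ∀ s, ∀ v ∈ P.Ygr (s + 1), del v ∈ P.Ygr s
  del_mul : ∀ s, ∀ v ∈ P.Ygr s, ∀ w, del (v * w) = del v * w + (-1 : k) ^ s • (v * del w)
  del_e : ∀ x, del (P.ye x) = P.yz x - P.yy x
  /-- The left `E`-linear map `σ⁻¹ : Y_s → Y_{s+1}`. -/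
  sigmaNeg : P.Y →ₗ[k] P.Y
  sigmaNeg_left : ∀ c v, sigmaNeg (iotaY c * v) = iotaY c * sigmaNeg v
  sigmaNeg_one : sigmaNeg 1 = 0
  sigmaNeg_zero : ∀ i m L, CrossedProduct.IsAdmissible ((i, m + 1, false) :: L) →
    sigmaNeg (P.rhoWord b ((i, m + 1, false) :: L)) = P.rhoWord b ((i, m, true) :: L)
  sigmaNeg_succ : ∀ i m L, CrossedProduct.IsAdmissible ((i, m, true) :: L) →
    sigmaNeg (P.rhoWord b ((i, m, true) :: L)) = 0
  /-- The augmentation `X_{00} = E ⊗ E → E`. -/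
  aug : X P K 0 0 →ₗ[k] P.Alg
  aug_mk : ∀ c x a c', aug (X.mk P K c x a c') = c * c'
  /-- The bimodule maps `μ : X_{0s} → Y_s`. -/
  mu : ∀ s, X P K 0 s →ₗ[k] P.Y
  mu_mk : ∀ s c (x : Fin s → g) a c',
    mu s (X.mk P K c x a c') = iotaY c * P.eProd x * iotaZ c'
  /-- The left `E`-linear maps `σ⁰ : Y_s → X_{0s}`. -/
  sigmaY₀ : P.Y →ₗ[k] XX P K
  sigmaY₀_left : ∀ c v, sigmaY₀ (iotaY c * v) = c • sigmaY₀ v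
  sigmaY₀_prod : ∀ (s : ℕ) (x : Fin s → g) (L : List g) (W : List (A × U k g)),
    (W.map fun w => P.sharp w.1 w.2).sum = (L.map P.inG).prod →
    sigmaY₀ (P.eProd x * (L.map P.yz).prod) =
      (W.map fun w => elt P K (P.inA w.1) x (Fin.elim0 : Fin 0 → A) (P.inU w.2)).sum
  /-- The left `E`-linear maps `σ⁰ : X_{rs} → X_{r+1,s}`. -/
  sigmaX₀ : XX P K →ₗ[k] XX P K
  sigmaX₀_left : ∀ (c : P.Alg) v, sigmaX₀ (c • v) = c • sigmaX₀ v
  sigmaX₀_elt : ∀ (r s : ℕ) (x : Fin s → g) (a : Fin r → A) (a' : A) (w : U k g),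
    sigmaX₀ (elt P K 1 x a (P.sharp a' w)) =
      (-1 : k) ^ (r + s + 1) • elt P K 1 x (Fin.snoc a a' : Fin (r + 1) → A) (P.inU w)
  /-- The bimodule maps `d^l : X_{rs} → X_{r+l-1,s-l}`; they are `0` for `l > s` and for
  `l = r = 0`. -/
  d : ℕ → XX P K →ₗ[k] XX P K
  d_left : ∀ l (c : P.Alg) v, d l (c • v) = c • d l v
  d_right : ∀ l (c : P.Alg) v, d l (op c • v) = op c • d l v
  d_big : ∀ l r s (x : Fin s → g) (a : Fin r → A), s < l → d l (elt P K 1 x a 1) = 0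
  d_zero_zero : ∀ s (x : Fin s → g) (a : Fin 0 → A), d 0 (elt P K 1 x a 1) = 0
  d_zero_succ : ∀ r s (x : Fin s → g) (a : Fin (r + 1) → A),
    d 0 (elt P K 1 x a 1) =
      (-1 : k) ^ s • elt P K (P.inA (a 0)) x (Fin.tail a) 1
      + (∑ i : Fin r, (-1 : k) ^ ((i : ℕ) + 1 + s) •
          elt P K 1 x (Fin.contractNth i.castSucc (· * ·) a) 1)
      + (-1 : k) ^ (r + 1 + s) • elt P K 1 x (Fin.init a) (P.inA (a (Fin.last r)))
  d_one_zero : ∀ s (x : Fin s → g) (a : Fin 0 → A), 1 ≤ s →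
    d 1 (elt P K 1 x a 1) = - sigmaY₀ (del (mu s (X.mk P K 1 x a 1)))
  d_one_succ : ∀ r s (x : Fin s → g) (a : Fin (r + 1) → A), 1 ≤ s →
    d 1 (elt P K 1 x a 1) = - sigmaX₀ (d 1 (d 0 (elt P K 1 x a 1)))
  d_zero : ∀ l s (x : Fin s → g) (a : Fin 0 → A), 1 < l → l ≤ s →
    d l (elt P K 1 x a 1) =
      - ∑ j ∈ Finset.Ico 1 l, sigmaX₀ (d (l - j) (d j (elt P K 1 x a 1)))
  d_succ : ∀ l r s (x : Fin s → g) (a : Fin (r + 1) → A), 1 < l → l ≤ s →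
    d l (elt P K 1 x a 1) =
      - ∑ j ∈ Finset.range l, sigmaX₀ (d (l - j) (d j (elt P K 1 x a 1)))

namespace Maps

variable {P : CrossedProduct k A g} {K : Subalgebra k A} {b : Module.Basis I k g}
  (M : Maps P K b)

/-- `σ^l : Y_s → X_{l,s-l}`, recursively `σ^l = -∑_{j<l} σ⁰ d^{l-j} σ^j`. -/
def sigmaY (l : ℕ) : P.Y →ₗ[k] XX P K :=
  if l = 0 then M.sigmaY₀
  else - ∑ j : Fin l, M.sigmaX₀ ∘ₗ M.d (l - j) ∘ₗ sigmaY j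
termination_by l
decreasing_by exact j.2

/-- `σ^l : X_{rs} → X_{r+l+1,s-l}`, recursively `σ^l = -∑_{j<l} σ⁰ d^{l-j} σ^j`. -/
def sigmaX (l : ℕ) : XX P K →ₗ[k] XX P K :=
  if l = 0 then M.sigmaX₀
  else - ∑ j : Fin l, M.sigmaX₀ ∘ₗ M.d (l - j) ∘ₗ sigmaX j
termination_by l
decreasing_by exact j.2

/-- The augmentation `X_0 → E`. -/
def totAug : Tot P K 0 →ₗ[k] P.Alg :=
  M.aug ∘ₗ LinearMap.proj (⟨(0, 0), by simp⟩ : Finset.HasAntidiagonal.antidiagonal 0)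

/-- The differential `d_{n+1} = ∑_{r+s=n+1} ∑_{l=0}^s d^l_{rs} : X_{n+1} → X_n`. -/
def totD (n : ℕ) : Tot P K (n + 1) →ₗ[k] Tot P K n :=
  ∑ p : Finset.HasAntidiagonal.antidiagonal (n + 1), ∑ l ∈ Finset.range (p.1.2 + 1),
    toTot P K n ∘ₗ M.d l ∘ₗ inX P K p.1.1 p.1.2 ∘ₗ LinearMap.proj p

/-- `σ̄_0 = σ⁰ σ⁻¹_0 : E → X_0`, where `σ⁻¹_0 : E → Y_0` is the left `E`-linear map with
`1 ↦ 1`. -/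
def totSigmaZero : P.Alg →ₗ[k] Tot P K 0 :=
  toTot P K 0 ∘ₗ M.sigmaY₀ ∘ₗ M.iotaY.toLinearMap

/-- `σ̄_{n+1} = - ∑_{l=0}^{n+1} σ^l σ⁻¹ μ_n + ∑_{r=0}^n ∑_{l=0}^{n-r} σ^l : X_n → X_{n+1}`. -/
def totSigma (n : ℕ) : Tot P K n →ₗ[k] Tot P K (n + 1) :=
  - (∑ l ∈ Finset.range (n + 2),
      toTot P K (n + 1) ∘ₗ M.sigmaY l ∘ₗ M.sigmaNeg ∘ₗ M.mu n ∘ₗ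
        LinearMap.proj (⟨(0, n), by simp⟩ : Finset.HasAntidiagonal.antidiagonal n))
  + ∑ p : Finset.HasAntidiagonal.antidiagonal n, ∑ l ∈ Finset.range (p.1.2 + 1),
      toTot P K (n + 1) ∘ₗ M.sigmaX l ∘ₗ inX P K p.1.1 p.1.2 ∘ₗ LinearMap.proj p

/-- All the maps have the stated (bi)degrees. -/
structure Homogeneous : Prop where
  iotaY_mem : ∀ c, M.iotaY c ∈ P.Ygr 0
  sigmaNeg_mem : ∀ s, ∀ v ∈ P.Ygr s, M.sigmaNeg v ∈ P.Ygr (s + 1)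
  mu_mem : ∀ s v, M.mu s v ∈ P.Ygr s
  sigmaY_mem : ∀ l s, l ≤ s → ∀ v ∈ P.Ygr s,
    M.sigmaY l v ∈ LinearMap.range (inX P K l (s - l))
  sigmaX_mem : ∀ l r s, l ≤ s → ∀ v,
    M.sigmaX l (inX P K r s v) ∈ LinearMap.range (inX P K (r + l + 1) (s - l))
  d_mem : ∀ l r s, l ≤ s → 0 < r + l → ∀ v,
    M.d l (inX P K r s v) ∈ LinearMap.range (inX P K (r + l - 1) (s - l))

end Maps

end Maps

end DiffOpRing

end

universe w₁ w₂ u₀ u₁ u₂ u₃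

open DiffOpRing

/-!
Everything rests on one fact about the crossed product: by the Poincaré–Birkhoff–Witt theorem the
sorted products of the elements `1 # g_i` form a basis of `E` as a left `A`-module
(`prodMap_bijective`). It follows that `E` is presented by `A`, the elements of `g`, and the
commutation relations (`exists_algHom`), which makes the maps out of `E` available, and that the
last factor of a tensor in `X_{rs}` may be written in coordinates over `A`. These are taken with
respect to a `Section` `θ : U(g) → E`, that is, a choice of the elements `θ(h)` over which `E` is
free. The standard section is `h ↦ 1 # h`; the other one sends sorted monomials to products in `E`.

*The differential.* All the components are treated together, as operators on the sum `XX` of all the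
`X_{rs}`. The map `σ⁰` (`appendOp`) contracts `d⁰` up to the projection `collapseOp` onto the
part coming from `E ⊗ g^{∧s} ⊗_A E` (`dZero_appendOp`). Instead of the recursive definition,
`d¹` and `d²` are given by a Cartan calculus: there are Lie derivatives `Ł_x` and insertions `H_x` of
the cocycle `f̂`, and `d¹`, `d²` are determined by `d¹ (y ∧ -) + y ∧ d¹ = Ł_y`,
`d² (y ∧ -) + y ∧ d² = H_y`, and by being zero in exterior degree zero. The curvature of `Ł` is
`{d⁰, h_{f̂}}` (`lieOp_lieOp`), and `f̂` satisfies the cocycle identity coming from the Jacobi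
identity in `E`; hence `d⁰ + d¹ + d²` has square zero (`sum_dMap_dMap`). These operators satisfy the
recursion (`dMap_eq`), because `σ⁰` kills its own image and they preserve normalized tensors; so the
recursively defined `d^l` are zero for `l > 2`.

*The algebra `Y_*`.* For `K = A` only the components with `r = 0` survive, and `Y_*` acts on them from
the right by generators and relations. Applied to `1 ⊗ 1` this gives the inverse `toX` of `μ`, so
`Y_s ≅ E ⊗ g^{∧s} ⊗_A E`, and `∂` becomes `-d¹`. By comparison of leading terms the words in the
`ρ_i` and `e_i` are a basis of `Y_*` over `E` (`wordMap_bijective`), and on this basis `σ⁻¹` is a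
Koszul contraction, one letter at a time (`yContr_yDel`).

*The homotopy.* Since `σ⁰ (d¹ + d²)` lowers the exterior degree, `G = 1 + σ⁰ (d¹ + d²)` is
invertible, and its Neumann series is what the recursion for the `σ^l` computes:
`∑ σ^l = G⁻¹ σ⁰` (`sum_recursion`). Conjugation by `G` turns the total differential `d` into `d⁰` up
to a term from `Y_*` (`pertEquiv_dTot`), so that `S = G⁻¹ σ⁰` contracts `X` onto `Y_*`
(`dTot_sigTot`), and correcting by the contraction of `Y_*` gives the homotopy `S - S_Y σ⁻¹ μ` of the
augmented complex (`dTot_homot`).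

This works for every section. With the standard one it is the homotopy of the theorem, which is
right `K`-linear if `K` is stable under `U(g)`. Stability under `g` alone does not make `1 # U(g)`
compatible with `K`, but it does so for the section by products in `E`; its homotopy is always a
contraction by `(E, K)`-bimodule maps. Together with the relative projectivity of the `X_{rs}`, which
are induced from `(E, K)`-bimodules, this proves that the complex is a relative projective resolution.
-/
set_option linter.unusedSectionVars false

noncomputable section

namespace DiffOpRing

attribute [local instance] LieRing.ofAssociativeRing

/-! ### The Poincaré–Birkhoff–Witt theorem -/

section PBW

variable {k g I : Type*} [Field k] [LieRing g] [LieAlgebra k g] [LinearOrder I]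
  (b : Module.Basis I k g)

/-- The space with a basis indexed by the monomials in the variables `i ∈ I`. -/
abbrev Mons (k I : Type*) [Field k] := Multiset I →₀ k

/-- One step of the recursion for the action of `b i` on monomials: if `i` is at most every letter
of `M`, then it is added to `M`; otherwise `M = j + M'` with `j` the least letter of `M`, and
`i j M' = j i M' + [i, j] M'`, where the product `j (i + M')` is already sorted. -/
def pbwStep (ρ : I → (Mons k I →ₗ[k] Mons k I)) (i : I) : Mons k I →ₗ[k] Mons k I :=
  open Classical in
  Finsupp.linearCombination k fun M : Multiset I =>
    Finsupp.single (i ::ₘ M) (1 : k) +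
      if h : ∃ j ∈ M, (∀ l ∈ M, j ≤ l) ∧ j < i then
        ρ h.choose (ρ i (Finsupp.single (M.erase h.choose) 1)
            - Finsupp.single (i ::ₘ M.erase h.choose) 1)
          + b.constr k ρ ⁅b i, b h.choose⁆ (Finsupp.single (M.erase h.choose) 1)
      else 0

/-- The iterates of `pbwStep`; the `n`-th one is final on monomials of degree less than `n`. -/
def pbwIter : ℕ → I → (Mons k I →ₗ[k] Mons k I)
  | 0 => fun _ => 0
  | n + 1 => pbwStep b (pbwIter n)

/-- The span of the monomials of degree at most `d`. -/
abbrev monsLE (k I : Type*) [Field k] (d : ℕ) : Submodule k (Mons k I) :=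
  Finsupp.supported k k {M : Multiset I | M.card ≤ d}

lemma monsLE_single {d : ℕ} {M : Multiset I} (h : M.card ≤ d) (c : k) :
    Finsupp.single M c ∈ monsLE k I d :=
  Finsupp.single_mem_supported k c h

lemma monsLE_mono {d e : ℕ} (h : d ≤ e) : monsLE k I d ≤ monsLE k I e :=
  Finsupp.supported_mono fun _ hM => le_trans hM h

lemma monsLE_induction {d : ℕ} {p : Mons k I → Prop} (h0 : p 0)
    (hadd : ∀ u v, p u → p v → p (u + v)) (hsmul : ∀ (c : k) u, p u → p (c • u))
    (hs : ∀ M : Multiset I, M.card ≤ d → p (Finsupp.single M 1)) :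
    ∀ v ∈ monsLE k I d, p v := by
  intro v hv
  rw [monsLE, Finsupp.supported_eq_span_single] at hv
  induction hv using Submodule.span_induction with
  | mem x hx => obtain ⟨M, hM, rfl⟩ := hx; exact hs M hM
  | zero => exact h0
  | add x y _ _ hx hy => exact hadd x y hx hy
  | smul c x _ hx => exact hsmul c x hx

lemma pbwStep_of_le (ρ : I → (Mons k I →ₗ[k] Mons k I)) {i : I} {M : Multiset I}
    (h : ∀ l ∈ M, i ≤ l) :
    pbwStep b ρ i (Finsupp.single M 1) = Finsupp.single (i ::ₘ M) 1 := by
  classical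
  rw [pbwStep, Finsupp.linearCombination_single, one_smul, dif_neg, add_zero]
  rintro ⟨j, hj, -, hji⟩
  exact absurd (h j hj) (not_le.2 hji)

lemma pbwStep_of_lt (ρ : I → (Mons k I →ₗ[k] Mons k I)) {i j : I} {M : Multiset I}
    (h : ∀ l ∈ M, j ≤ l) (hji : j < i) :
    pbwStep b ρ i (Finsupp.single (j ::ₘ M) 1) = Finsupp.single (i ::ₘ j ::ₘ M) 1 +
      (ρ j (ρ i (Finsupp.single M 1) - Finsupp.single (i ::ₘ M) 1)
        + b.constr k ρ ⁅b i, b j⁆ (Finsupp.single M 1)) := by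
  classical
  have hex : ∃ j' ∈ j ::ₘ M, (∀ l ∈ j ::ₘ M, j' ≤ l) ∧ j' < i :=
    ⟨j, Multiset.mem_cons_self _ _, by simpa using h, hji⟩
  have hc : hex.choose = j := by
    obtain ⟨h1, h2, -⟩ := hex.choose_spec
    refine le_antisymm (h2 j (Multiset.mem_cons_self _ _)) ?_
    rcases Multiset.mem_cons.1 h1 with h1 | h1
    · exact h1.ge
    · exact h _ h1
  rw [pbwStep, Finsupp.linearCombination_single, one_smul, dif_pos hex, hc,
    Multiset.erase_cons_head]

lemma exists_min_cons {M : Multiset I} (hM : M ≠ 0) :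
    ∃ j M', M = j ::ₘ M' ∧ ∀ l ∈ M', j ≤ l := by
  classical
  obtain ⟨j, hj, hmin⟩ := M.toFinset.exists_min_image id
    (by simpa [Finset.nonempty_iff_ne_empty] using hM)
  refine ⟨j, M.erase j, (Multiset.cons_erase (by simpa using hj)).symm, fun l hl => ?_⟩
  exact hmin l (by simpa using Multiset.mem_of_mem_erase hl)

lemma constr_apply_mem {N : Type*} [AddCommGroup N] [Module k N] (ρ : I → (Mons k I →ₗ[k] N))
    (v : Mons k I) (Q : Submodule k N) (h : ∀ i, ρ i v ∈ Q) (x : g) : b.constr k ρ x v ∈ Q := by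
  rw [Module.Basis.constr_apply, Finsupp.sum, LinearMap.sum_apply]
  exact Q.sum_mem fun i _ => by simpa using Q.smul_mem _ (h i)

lemma constr_apply_congr {N : Type*} [AddCommGroup N] [Module k N]
    (ρ ρ' : I → (Mons k I →ₗ[k] N)) (v : Mons k I) (h : ∀ i, ρ i v = ρ' i v) (x : g) :
    b.constr k ρ x v = b.constr k ρ' x v := by
  simp [Module.Basis.constr_apply, Finsupp.sum, LinearMap.sum_apply, h]

/-- On monomials of degree `d` the iterates stabilize after step `d`, and they agree with the
commutative multiplication up to terms of degree at most `d`. -/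
lemma pbwIter_spec (d : ℕ) : ∀ M : Multiset I, M.card ≤ d → ∀ i,
    (∀ n, d < n → pbwIter b n i (Finsupp.single M 1) - Finsupp.single (i ::ₘ M) 1
      ∈ monsLE k I d) ∧
    ∀ n m, d < n → d < m →
      pbwIter b n i (Finsupp.single M 1) = pbwIter b m i (Finsupp.single M 1) := by
  induction d with
  | zero =>
    intro M hM i
    obtain rfl : M = 0 := by simpa using hM
    have key : ∀ n, 0 < n → pbwIter b n i (Finsupp.single 0 1)
        = Finsupp.single (i ::ₘ (0 : Multiset I)) 1 := by
      intro n hn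
      obtain ⟨n, rfl⟩ := Nat.exists_eq_succ_of_ne_zero hn.ne'
      exact pbwStep_of_le b _ (by simp)
    exact ⟨fun n hn => by rw [key n hn, sub_self]; exact zero_mem _,
      fun n m hn hm => by rw [key n hn, key m hm]⟩
  | succ d ih =>
    have ih1 : ∀ n, d < n → ∀ i, ∀ v ∈ monsLE k I d, pbwIter b n i v ∈ monsLE k I (d + 1) := by
      intro n hn i
      refine monsLE_induction (by simp) (fun u v hu hv => by rw [map_add]; exact add_mem hu hv)
        (fun c u hu => by rw [map_smul]; exact Submodule.smul_mem _ c hu) fun M hM => ?_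
      rw [← sub_add_cancel (pbwIter b n i (Finsupp.single M 1)) (Finsupp.single (i ::ₘ M) 1)]
      exact add_mem (monsLE_mono d.le_succ ((ih M hM i).1 n hn))
        (monsLE_single (by simpa using hM) 1)
    have ih2 : ∀ n m, d < n → d < m → ∀ i, ∀ v ∈ monsLE k I d,
        pbwIter b n i v = pbwIter b m i v := by
      intro n m hn hm i
      refine monsLE_induction (by simp) (fun u v hu hv => by rw [map_add, map_add, hu, hv])
        (fun c u hu => by rw [map_smul, map_smul, hu]) fun M hM => (ih M hM i).2 n m hn hm
    intro M hM i
    have hle : ∀ n, d + 1 < n → ∀ h : ∀ l ∈ M, i ≤ l,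
        pbwIter b n i (Finsupp.single M 1) = Finsupp.single (i ::ₘ M) 1 := by
      intro n hn h
      obtain ⟨n, rfl⟩ := Nat.exists_eq_succ_of_ne_zero (by omega : n ≠ 0)
      exact pbwStep_of_le b _ h
    by_cases h : ∀ l ∈ M, i ≤ l
    · exact ⟨fun n hn => by rw [hle n hn h, sub_self]; exact zero_mem _,
        fun n m hn hm => by rw [hle n hn h, hle m hm h]⟩
    · obtain ⟨j, M', rfl, hj⟩ := exists_min_cons (M := M) (by rintro rfl; simp at h)
      have hji : j < i := by
        by_contra hcon
        refine h fun l hl => (not_lt.1 hcon).trans ?_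
        rcases Multiset.mem_cons.1 hl with rfl | hl
        exacts [le_rfl, hj l hl]
      have hM' : M'.card ≤ d := by simpa using hM
      constructor
      · intro n hn
        obtain ⟨n, rfl⟩ := Nat.exists_eq_succ_of_ne_zero (by omega : n ≠ 0)
        rw [pbwIter, pbwStep_of_lt b _ hj hji, add_sub_cancel_left]
        refine add_mem (ih1 n (by omega) _ _ ((ih M' hM' i).1 n (by omega))) ?_
        exact constr_apply_mem b _ _ _ (fun l => ih1 n (by omega) l _ (monsLE_single hM' 1)) _
      · intro n m hn hm
        obtain ⟨n, rfl⟩ := Nat.exists_eq_succ_of_ne_zero (by omega : n ≠ 0)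
        obtain ⟨m, rfl⟩ := Nat.exists_eq_succ_of_ne_zero (by omega : m ≠ 0)
        rw [pbwIter, pbwIter, pbwStep_of_lt b _ hj hji, pbwStep_of_lt b _ hj hji,
          (ih M' hM' i).2 n m (by omega) (by omega),
          ih2 n m (by omega) (by omega) j _ ((ih M' hM' i).1 m (by omega)),
          constr_apply_congr b _ _ _ fun l => (ih M' hM' l).2 n m (by omega) (by omega)]

/-- The action of the basis vector `b i` on the space of monomials. -/
def pbwOp (i : I) : Mons k I →ₗ[k] Mons k I :=
  Finsupp.linearCombination k fun M : Multiset I =>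
    pbwIter b (M.card + 1) i (Finsupp.single M 1)

lemma pbwOp_eq {d n : ℕ} (hn : d < n) (i : I) (v : Mons k I) (hv : v ∈ monsLE k I d) :
    pbwOp b i v = pbwIter b n i v := by
  revert v hv
  refine monsLE_induction (by simp) (fun u v hu hv => by rw [map_add, map_add, hu, hv])
    (fun c u hu => by rw [map_smul, map_smul, hu]) fun M hM => ?_
  rw [pbwOp, Finsupp.linearCombination_single, one_smul]
  exact (pbwIter_spec b M.card M le_rfl i).2 _ _ (by omega) (by omega)

lemma pbwOp_of_le {i : I} {M : Multiset I} (h : ∀ l ∈ M, i ≤ l) :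
    pbwOp b i (Finsupp.single M 1) = Finsupp.single (i ::ₘ M) 1 := by
  rw [pbwOp, Finsupp.linearCombination_single, one_smul]
  exact pbwStep_of_le b _ h

lemma pbwOp_sub_mem {d : ℕ} (i : I) {M : Multiset I} (hM : M.card ≤ d) :
    pbwOp b i (Finsupp.single M 1) - Finsupp.single (i ::ₘ M) 1 ∈ monsLE k I d := by
  rw [pbwOp_eq b d.lt_succ_self i _ (monsLE_single hM 1)]
  exact (pbwIter_spec b d M hM i).1 _ d.lt_succ_self

/-- The action of `x ∈ g` on the space of monomials. -/
def pbwAct : g →ₗ[k] (Mons k I →ₗ[k] Mons k I) := b.constr k (pbwOp b)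

lemma pbwAct_basis (i : I) : pbwAct b (b i) = pbwOp b i := by simp [pbwAct]

lemma pbwOp_of_lt {i j : I} {M : Multiset I} (h : ∀ l ∈ M, j ≤ l) (hji : j < i) :
    pbwOp b i (Finsupp.single (j ::ₘ M) 1) =
      pbwOp b j (pbwOp b i (Finsupp.single M 1))
        + pbwAct b ⁅b i, b j⁆ (Finsupp.single M 1) := by
  have h1 : pbwOp b i (Finsupp.single (j ::ₘ M) 1) =
      pbwStep b (pbwIter b (M.card + 1)) i (Finsupp.single (j ::ₘ M) 1) := by
    rw [pbwOp, Finsupp.linearCombination_single, one_smul, Multiset.card_cons, pbwIter]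
  have h2 := pbwOp_sub_mem b i (le_refl M.card)
  rw [h1, pbwStep_of_lt b _ h hji, ← pbwOp_eq b (Nat.lt_succ_self _) i _ (monsLE_single le_rfl 1),
    ← pbwOp_eq b (Nat.lt_succ_self _) j _ h2, map_sub, pbwOp_of_le b (i := j) (M := i ::ₘ M),
    Multiset.cons_swap]
  · rw [pbwAct, constr_apply_congr b (pbwIter b (M.card + 1)) (pbwOp b) _ fun l =>
      (pbwOp_eq b (Nat.lt_succ_self _) l _ (monsLE_single le_rfl 1)).symm]
    abel
  · intro l hl
    rcases Multiset.mem_cons.1 hl with rfl | hl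
    exacts [hji.le, h l hl]

/-- `[b i, b j]` acts as the commutator on a monomial whose letters are all at least `j < i`. -/
lemma pbwAct_comm_of_le {i j : I} {M : Multiset I} (h : ∀ l ∈ M, j ≤ l) (hji : j < i) :
    pbwAct b (b i) (pbwAct b (b j) (Finsupp.single M 1))
      = pbwAct b (b j) (pbwAct b (b i) (Finsupp.single M 1))
        + pbwAct b ⁅b i, b j⁆ (Finsupp.single M 1) := by
  simp only [pbwAct_basis]
  rw [pbwOp_of_le b h, pbwOp_of_lt b h hji]

lemma pbwAct_comm_of_basis {v : Mons k I}
    (h : ∀ i j, j < i → pbwAct b (b i) (pbwAct b (b j) v)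
      = pbwAct b (b j) (pbwAct b (b i) v) + pbwAct b ⁅b i, b j⁆ v) (x y : g) :
    pbwAct b x (pbwAct b y v) = pbwAct b y (pbwAct b x v) + pbwAct b ⁅x, y⁆ v := by
  have key : ∀ i j, pbwAct b (b i) (pbwAct b (b j) v)
      = pbwAct b (b j) (pbwAct b (b i) v) + pbwAct b ⁅b i, b j⁆ v := by
    intro i j
    rcases lt_trichotomy i j with hij | rfl | hij
    · rw [h j i hij, ← lie_skew (b i) (b j), map_neg, LinearMap.neg_apply]
      abel
    · simp
    · exact h i j hij
  induction b.mem_span x using Submodule.span_induction with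
  | mem x hx =>
    obtain ⟨i, rfl⟩ := hx
    induction b.mem_span y using Submodule.span_induction with
    | mem y hy => obtain ⟨j, rfl⟩ := hy; exact key i j
    | zero => simp
    | add y y' _ _ hy hy' =>
      simp only [map_add, lie_add, LinearMap.add_apply]
      rw [hy, hy']
      abel
    | smul c y _ hy =>
      simp only [map_smul, lie_smul, LinearMap.smul_apply]
      rw [hy, smul_add]
  | zero => simp
  | add x x' _ _ hx hx' =>
    simp only [map_add, add_lie, LinearMap.add_apply]
    rw [hx, hx']
    abel
  | smul c x _ hx =>
    simp only [map_smul, smul_lie, LinearMap.smul_apply]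
    rw [hx, smul_add]

lemma pbwAct_comm (d : ℕ) : ∀ M : Multiset I, M.card ≤ d → ∀ x y : g,
    pbwAct b x (pbwAct b y (Finsupp.single M 1))
      = pbwAct b y (pbwAct b x (Finsupp.single M 1))
        + pbwAct b ⁅x, y⁆ (Finsupp.single M 1) := by
  induction d with
  | zero =>
    intro M hM
    obtain rfl : M = 0 := by simpa using hM
    exact pbwAct_comm_of_basis b fun i j hij => pbwAct_comm_of_le b (by simp) hij
  | succ d ih =>
    have ih' : ∀ v ∈ monsLE k I d, ∀ x y : g, pbwAct b x (pbwAct b y v)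
        = pbwAct b y (pbwAct b x v) + pbwAct b ⁅x, y⁆ v := by
      refine monsLE_induction (by simp) (fun u v hu hv x y => ?_) (fun c u hu x y => ?_) ih
      · simp only [map_add]
        rw [hu x y, hv x y]
        abel
      · simp only [map_smul]
        rw [hu x y, smul_add]
    intro M hM
    refine pbwAct_comm_of_basis b fun i j hij => ?_
    by_cases h : ∀ l ∈ M, j ≤ l
    · exact pbwAct_comm_of_le b h hij
    obtain ⟨l, M', rfl, hl⟩ := exists_min_cons (M := M) (by rintro rfl; simp at h)
    have hlj : l < j := by
      by_contra hcon
      refine h fun l' hl' => (not_lt.1 hcon).trans ?_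
      rcases Multiset.mem_cons.1 hl' with rfl | hl'
      exacts [le_rfl, hl l' hl']
    have hM' : M'.card ≤ d := by simpa using hM
    -- the commutation rule with the least letter `l`, for the vector `i' M'`
    have key : ∀ i' j' : I, l < i' → l < j' →
        pbwAct b (b j') (pbwAct b (b l) (pbwAct b (b i') (Finsupp.single M' 1)))
          = pbwAct b (b l) (pbwAct b (b j') (pbwAct b (b i') (Finsupp.single M' 1)))
            + pbwAct b ⁅b j', b l⁆ (pbwAct b (b i') (Finsupp.single M' 1)) := by
      intro i' j' hi' hj'
      have h1 := pbwOp_sub_mem b i' hM'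
      rw [← pbwAct_basis] at h1
      have h2 := ih' _ h1 (b j') (b l)
      have h3 := pbwAct_comm_of_le b (i := j') (j := l) (M := i' ::ₘ M') (by
        intro l' hl'
        rcases Multiset.mem_cons.1 hl' with rfl | hl'
        exacts [hi'.le, hl l' hl']) hj'
      simp only [map_sub] at h2
      rw [sub_eq_iff_eq_add] at h2
      rw [h2, h3]
      abel
    have hlM : Finsupp.single (l ::ₘ M') (1 : k) = pbwAct b (b l) (Finsupp.single M' 1) := by
      rw [pbwAct_basis, pbwOp_of_le b hl]
    have e := ih M' hM'
    rw [hlM, e (b j) (b l), e (b i) (b l), map_add, map_add, key j i hlj (hlj.trans hij),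
      key i j (hlj.trans hij) hlj, e ⁅b i, b j⁆ (b l), e (b i) (b j), e (b i) ⁅b j, b l⁆,
      e (b j) ⁅b i, b l⁆, map_add]
    have jac : ⁅⁅b i, b j⁆, b l⁆ = ⁅b i, ⁅b j, b l⁆⁆ - ⁅b j, ⁅b i, b l⁆⁆ := lie_lie _ _ _
    rw [jac, map_sub, LinearMap.sub_apply]
    abel

/-- The representation of `U(g)` on the space of monomials. -/
def pbwRep : U k g →ₐ[k] Module.End k (Mons k I) :=
  UniversalEnvelopingAlgebra.lift k
    { pbwAct b with
      map_lie' := by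
        intro x y
        refine Finsupp.lhom_ext' fun M => LinearMap.ext_ring ?_
        have := pbwAct_comm b _ M le_rfl x y
        simp only [LinearMap.comp_apply, Finsupp.lsingle_apply, LieRing.of_associative_ring_bracket,
          LinearMap.sub_apply, Module.End.mul_apply]
        exact eq_sub_of_add_eq' this.symm }

/-- The product of the letters of `M`, in increasing order, for an assignment `c` of elements of
an algebra to the letters. -/
def sortedProd {R : Type*} [Monoid R] (c : I → R) (M : Multiset I) : R :=
  ((M.sort (· ≤ ·)).map c).prod

/-- The Poincaré–Birkhoff–Witt monomials. -/
def pbwMon (M : Multiset I) : U k g :=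
  sortedProd (fun i => UniversalEnvelopingAlgebra.ι k (b i)) M

lemma pbwRep_pbwMon (M : Multiset I) :
    pbwRep b (pbwMon b M) (Finsupp.single 0 1) = Finsupp.single M 1 := by
  have key : ∀ L : List I, L.Pairwise (· ≤ ·) →
      pbwRep b (L.map fun i => UniversalEnvelopingAlgebra.ι k (b i)).prod (Finsupp.single 0 1)
        = Finsupp.single (L : Multiset I) 1 := by
    intro L
    induction L with
    | nil => intro _; simp
    | cons i L ih =>
      intro h
      rw [List.pairwise_cons] at h
      rw [List.map_cons, List.prod_cons, map_mul, Module.End.mul_apply, ih h.2, pbwRep,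
        UniversalEnvelopingAlgebra.lift_ι_apply]
      change pbwAct b (b i) _ = _
      rw [pbwAct_basis, pbwOp_of_le b (by simpa using h.1)]
      rfl
  have := key (M.sort (· ≤ ·)) (Multiset.pairwise_sort M (· ≤ ·))
  rwa [Multiset.sort_eq] at this

lemma pbwMon_linearIndependent : LinearIndependent k (pbwMon b) := by
  have h : LinearIndependent k fun M : Multiset I => (Finsupp.single M (1 : k)) := by
    simpa using (Finsupp.basisSingleOne (R := k) (ι := Multiset I)).linearIndependent
  refine LinearIndependent.of_comp
    ((LinearMap.applyₗ (Finsupp.single 0 (1 : k))) ∘ₗ (pbwRep b).toLinearMap) ?_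
  convert h using 2 with M
  exact pbwRep_pbwMon b M

end PBW

/-! ### Locally nilpotent and triangular endomorphisms -/

section Triangular

variable {k V : Type*} [Field k] [AddCommGroup V] [Module k V]

/-- `1 + T` is bijective for a locally nilpotent `T`, and its inverse is the Neumann series. -/
lemma exists_neumann (T : Module.End k V) (hT : ∀ v, ∃ n, (T ^ n) v = 0) :
    Function.Bijective ((1 + T : Module.End k V)) ∧ ∀ (Q : Submodule k V), (∀ v ∈ Q, T v ∈ Q) →
      ∀ v, (1 + T : Module.End k V) v ∈ Q → v ∈ Q := by
  have hpow : ∀ (Q : Submodule k V), (∀ v ∈ Q, T v ∈ Q) → ∀ n, ∀ v ∈ Q, (T ^ n) v ∈ Q := by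
    intro Q hQ n
    induction n with
    | zero => intro v hv; simpa using hv
    | succ n ih => intro v hv; rw [pow_succ]; exact ih _ (hQ v hv)
  have hinj : ∀ v, (1 + T : Module.End k V) v = 0 → v = 0 := by
    intro v hv
    have h1 : T v = -v := eq_neg_of_add_eq_zero_right (by simpa using hv)
    obtain ⟨n, hn⟩ := hT v
    have h2 : ∀ n, (T ^ n) v = (-1 : k) ^ n • v := by
      intro n
      induction n with
      | zero => simp
      | succ n ih =>
        rw [pow_succ', Module.End.mul_apply, ih, map_smul, h1, pow_succ]
        simp
    rw [h2] at hn
    exact (smul_eq_zero.1 hn).resolve_left (pow_ne_zero _ (by simp))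
  have hser : ∀ v n, (T ^ n) v = 0 →
      (1 + T : Module.End k V) ((∑ i ∈ Finset.range n, (-T) ^ i) v) = v := by
    intro v n hn
    have h3 : (-T) ^ n = (-1 : k) ^ n • T ^ n := by
      rw [show -T = (-1 : k) • T by simp, smul_pow]
    have h := mul_neg_geom_sum (-T) n
    rw [sub_neg_eq_add, h3] at h
    have := LinearMap.congr_fun h v
    simpa [hn] using this
  refine ⟨⟨(injective_iff_map_eq_zero _).2 hinj, fun v => ?_⟩, fun Q hQ v hv => ?_⟩
  · obtain ⟨n, hn⟩ := hT v
    exact ⟨_, hser v n hn⟩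
  · obtain ⟨n, hn⟩ := hT ((1 + T : Module.End k V) v)
    have h := hser _ n hn
    have h4 : (∑ i ∈ Finset.range n, (-T) ^ i) ((1 + T : Module.End k V) v) = v := by
      rw [← sub_eq_zero]
      refine hinj _ ?_
      rw [map_sub, h, sub_self]
    rw [← h4, LinearMap.sum_apply]
    refine Q.sum_mem fun i _ => ?_
    rw [show -T = (-1 : k) • T by simp, smul_pow]
    exact Q.smul_mem _ (hpow Q hQ i _ hv)

/-- An endomorphism of `J →₀ V` which is unitriangular with respect to a degree function on `J`
is bijective. -/
lemma bijective_of_unitriangular {J : Type*} (deg : J → ℕ)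
    (T : (J →₀ V) →ₗ[k] (J →₀ V))
    (hT : ∀ j v, T (Finsupp.single j v) - Finsupp.single j v
      ∈ Finsupp.supported V k {i | deg i < deg j}) : Function.Bijective T := by
  set N : Module.End k (J →₀ V) := T - 1 with hN
  have h1 : ∀ n, ∀ v ∈ Finsupp.supported V k {i | deg i < n + 1},
      N v ∈ Finsupp.supported V k {i | deg i < n} := by
    intro n v hv
    rw [← Finsupp.sum_single v, Finsupp.sum, map_sum]
    refine Submodule.sum_mem _ fun j hj => ?_
    have : deg j < n + 1 := hv hj
    exact Finsupp.supported_mono (fun i (hi : deg i < deg j) => show deg i < n by omega) (hT j (v j))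
  have h2 : ∀ n, ∀ v ∈ Finsupp.supported V k {i | deg i < n}, (N ^ n) v = 0 := by
    intro n
    induction n with
    | zero =>
      intro v hv
      have : v ∈ Finsupp.supported V k (∅ : Set J) := by
        convert hv using 2
        ext
        simp
      simpa [Finsupp.supported_empty] using this
    | succ n ih => intro v hv; rw [pow_succ]; exact ih _ (h1 n v hv)
  have h3 := (exists_neumann N fun v => ⟨v.support.sup deg + 1, h2 _ v fun j hj =>
    Nat.lt_succ_of_le (Finset.le_sup hj)⟩).1
  rwa [hN, add_sub_cancel] at h3

end Triangular

/-! ### Straightening products -/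

section Straighten

variable {k A I R : Type*} [Field k] [Ring A] [Algebra k A] [Ring R] [Algebra k R]
  (α : A →ₐ[k] R) (c : I → R)

/-- The span of the products `a c_{i_1} ⋯ c_{i_m}` with `m < n`. -/
def letterFil (n : ℕ) : Submodule k R :=
  Submodule.span k {r | ∃ (a : A) (L : List I), L.length < n ∧ r = α a * (L.map c).prod}

lemma letterFil_mono {m n : ℕ} (h : m ≤ n) : letterFil α c m ≤ letterFil α c n := by
  refine Submodule.span_mono ?_
  rintro r ⟨a, L, hL, rfl⟩
  exact ⟨a, L, hL.trans_le h, rfl⟩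

lemma mem_letterFil (a : A) (L : List I) {n : ℕ} (h : L.length < n) :
    α a * (L.map c).prod ∈ letterFil α c n :=
  Submodule.subset_span ⟨a, L, h, rfl⟩

lemma prod_mem_letterFil (L : List I) {n : ℕ} (h : L.length < n) :
    (L.map c).prod ∈ letterFil α c n := by
  simpa using mem_letterFil α c 1 L h

/-- A submodule that is stable under left multiplication by the generators. -/
lemma coeff_mul_mem_letterFil (a : A) {n : ℕ} {r : R} (hr : r ∈ letterFil α c n) :
    α a * r ∈ letterFil α c n := by
  induction hr using Submodule.span_induction with
  | mem x hx =>
    obtain ⟨a', L, hL, rfl⟩ := hx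
    rw [← mul_assoc, ← map_mul]
    exact mem_letterFil α c _ _ hL
  | zero => simp
  | add x y _ _ hx hy => rw [mul_add]; exact add_mem hx hy
  | smul t x _ hx => rw [mul_smul_comm]; exact Submodule.smul_mem _ _ hx

variable (hA : ∀ i a, ∃ a', c i * α a = α a' + α a * c i)

include hA in
lemma letter_mul_mem_letterFil (i : I) {n : ℕ} {r : R} (hr : r ∈ letterFil α c n) :
    c i * r ∈ letterFil α c (n + 1) := by
  induction hr using Submodule.span_induction with
  | mem x hx =>
    obtain ⟨a, L, hL, rfl⟩ := hx
    obtain ⟨a', ha'⟩ := hA i a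
    rw [← mul_assoc, ha', add_mul, mul_assoc]
    exact add_mem (mem_letterFil α c _ _ (by omega))
      (mem_letterFil α c _ (i :: L) (by simpa using hL))
  | zero => simp
  | add x y _ _ hx hy => rw [mul_add]; exact add_mem hx hy
  | smul t x _ hx => rw [mul_smul_comm]; exact Submodule.smul_mem _ _ hx

include hA in
lemma mul_mem_letterFil {m n : ℕ} {r r' : R} (hr : r ∈ letterFil α c (m + 1))
    (hr' : r' ∈ letterFil α c n) : r * r' ∈ letterFil α c (m + n) := by
  have key : ∀ L : List I, (L.map c).prod * r' ∈ letterFil α c (L.length + n) := by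
    intro L
    induction L with
    | nil => simpa using hr'
    | cons i L ih =>
      rw [List.map_cons, List.prod_cons, mul_assoc, List.length_cons, add_right_comm]
      exact letter_mul_mem_letterFil α c hA i ih
  induction hr using Submodule.span_induction with
  | mem x hx =>
    obtain ⟨a, L, hL, rfl⟩ := hx
    rw [mul_assoc]
    exact letterFil_mono α c (by omega) (coeff_mul_mem_letterFil α c a (key L))
  | zero => simp
  | add x y _ _ hx hy => rw [add_mul]; exact add_mem hx hy
  | smul t x _ hx => rw [smul_mul_assoc]; exact Submodule.smul_mem _ _ hx

variable (hC : ∀ i j, c i * c j - c j * c i ∈ letterFil α c 2)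

include hA hC in
/-- Permuting the letters changes a product by terms with fewer letters. -/
lemma prod_sub_prod_mem_of_perm {L L' : List I} (h : L.Perm L') :
    (L.map c).prod - (L'.map c).prod ∈ letterFil α c L.length := by
  induction h with
  | nil => simp
  | cons i h ih =>
    rw [List.map_cons, List.map_cons, List.prod_cons, List.prod_cons, ← mul_sub, List.length_cons]
    exact letter_mul_mem_letterFil α c hA i ih
  | swap i j L =>
    simp only [List.map_cons, List.prod_cons, ← mul_assoc, ← sub_mul, List.length_cons]
    refine letterFil_mono α c (by omega) (mul_mem_letterFil α c hA (m := 1) (hC j i)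
      (prod_mem_letterFil α c L L.length.lt_succ_self))
  | trans h1 _ ih1 ih2 =>
    rw [← sub_add_sub_cancel]
    refine add_mem ih1 ?_
    rwa [h1.length_eq]

include hA hC in
/-- Every product is a combination of sorted ones. -/
lemma letterFil_le_sorted [LinearOrder I] (n : ℕ) : letterFil α c n ≤
    Submodule.span k {r | ∃ (a : A) (M : Multiset I), M.card < n ∧
      r = α a * sortedProd c M} := by
  induction n with
  | zero =>
    rw [letterFil, Submodule.span_le]
    rintro r ⟨a, L, hL, rfl⟩
    omega
  | succ n ih =>
    have hmono : Submodule.span k {r | ∃ (a : A) (M : Multiset I), M.card < n ∧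
        r = α a * sortedProd c M} ≤ Submodule.span k {r | ∃ (a : A) (M : Multiset I),
        M.card < n + 1 ∧ r = α a * sortedProd c M} := by
      refine Submodule.span_mono ?_
      rintro r ⟨a, M, hM, rfl⟩
      exact ⟨a, M, by omega, rfl⟩
    conv_lhs => rw [letterFil]
    rw [Submodule.span_le]
    rintro r ⟨a, L, hL, rfl⟩
    have h1 : α a * (L.map c).prod =
        α a * ((L.map c).prod - sortedProd c (L : Multiset I))
          + α a * sortedProd c (L : Multiset I) := by noncomm_ring
    rw [h1]
    have h2 : L.Perm ((L : Multiset I).sort (· ≤ ·)) :=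
      Multiset.coe_eq_coe.1 (Multiset.sort_eq _ _).symm
    refine add_mem (hmono (ih (coeff_mul_mem_letterFil α c a ?_)))
      (Submodule.subset_span ⟨a, L, by simpa using hL, rfl⟩)
    exact letterFil_mono α c (by omega) (prod_sub_prod_mem_of_perm α c hA hC h2)

lemma sortedProd_mem_letterFil [LinearOrder I] (M : Multiset I) {n : ℕ} (h : M.card < n) :
    sortedProd c M ∈ letterFil α c n :=
  prod_mem_letterFil α c _ (by simpa using h)

end Straighten

/-! ### The basis of `U(g)` and its filtration -/

section UBasis

variable {k g I : Type*} [Field k] [LieRing g] [LieAlgebra k g] [LinearOrder I]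
  (b : Module.Basis I k g)

/-- The span of the products of less than `n` elements of `g`. -/
def uFil (n : ℕ) : Submodule k (U k g) :=
  letterFil (Algebra.ofId k (U k g)) (fun i => UniversalEnvelopingAlgebra.ι k (b i)) n

lemma ι_mem_letterFil {A R : Type*} [Ring A] [Algebra k A] [Ring R] [Algebra k R]
    (α : A →ₐ[k] R) (β : g →ₗ[k] R) (x : g) : β x ∈ letterFil α (fun i => β (b i)) 2 := by
  induction b.mem_span x using Submodule.span_induction with
  | mem x hx =>
    obtain ⟨i, rfl⟩ := hx
    simpa using prod_mem_letterFil α (fun i => β (b i)) [i] (n := 2) (by simp)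
  | zero => simp
  | add x y _ _ hx hy => rw [map_add]; exact add_mem hx hy
  | smul t x _ hx => rw [map_smul]; exact Submodule.smul_mem _ _ hx

lemma uComm (i : I) (a : k) : ∃ a' : k, (UniversalEnvelopingAlgebra.ι k (b i) : U k g) *
    Algebra.ofId k (U k g) a = Algebra.ofId k (U k g) a' +
      Algebra.ofId k (U k g) a * UniversalEnvelopingAlgebra.ι k (b i) :=
  ⟨0, by rw [map_zero, zero_add]; exact (Algebra.commutes a _).symm⟩

lemma uStraight (i j : I) : (UniversalEnvelopingAlgebra.ι k (b i) : U k g) *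
    UniversalEnvelopingAlgebra.ι k (b j) - UniversalEnvelopingAlgebra.ι k (b j) *
      UniversalEnvelopingAlgebra.ι k (b i) ∈ letterFil (Algebra.ofId k (U k g))
        (fun i => UniversalEnvelopingAlgebra.ι k (b i)) 2 := by
  rw [← LieRing.of_associative_ring_bracket, ← LieHom.map_lie]
  exact ι_mem_letterFil b (Algebra.ofId k (U k g))
    (UniversalEnvelopingAlgebra.ι k : g →ₗ⁅k⁆ U k g).toLinearMap ⁅b i, b j⁆

lemma one_mem_uFil {n : ℕ} (hn : 0 < n) : (1 : U k g) ∈ uFil b n := by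
  have := prod_mem_letterFil (Algebra.ofId k (U k g)) (fun i =>
    UniversalEnvelopingAlgebra.ι k (b i)) [] (n := n) hn
  rwa [List.map_nil, List.prod_nil] at this

lemma uFil_mono {m n : ℕ} (h : m ≤ n) : uFil b m ≤ uFil b n := letterFil_mono _ _ h

lemma ι_mul_mem_uFil (x : g) {n : ℕ} {h : U k g} (hh : h ∈ uFil b n) :
    UniversalEnvelopingAlgebra.ι k x * h ∈ uFil b (n + 1) := by
  rw [add_comm]
  exact mul_mem_letterFil _ _ (uComm b) (m := 1)
    (ι_mem_letterFil b _ (UniversalEnvelopingAlgebra.ι k : g →ₗ⁅k⁆ U k g).toLinearMap x) hh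

/-- Induction along multiplication by elements of `g` on the left. -/
lemma U_induction {p : U k g → Prop} (one : p 1)
    (mul : ∀ (x : g) h, p h → p (UniversalEnvelopingAlgebra.ι k x * h))
    (add : ∀ h h', p h → p h' → p (h + h')) (smul : ∀ (t : k) h, p h → p (t • h)) (h : U k g) :
    p h := by
  have zero : p 0 := by simpa using smul 0 1 one
  let Q : Submodule k (U k g) :=
    { carrier := {h | p h}, add_mem' := fun {u v} hu hv => add u v hu hv, zero_mem' := zero,
      smul_mem' := fun t u hu => smul t u hu }
  -- the elements that act on `Q` by left multiplication form a subalgebra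
  let S : Subalgebra k (U k g) :=
    { carrier := {u | ∀ v ∈ Q, u * v ∈ Q}
      mul_mem' := fun {u u'} hu hu' v hv => by rw [mul_assoc]; exact hu _ (hu' _ hv)
      add_mem' := fun {u u'} hu hu' v hv => by rw [add_mul]; exact Q.add_mem (hu _ hv) (hu' _ hv)
      algebraMap_mem' := fun t v hv => by rw [← Algebra.smul_def]; exact Q.smul_mem t hv }
  let φ : g →ₗ⁅k⁆ S :=
    { toFun := fun x => ⟨UniversalEnvelopingAlgebra.ι k x, fun v hv => mul x v hv⟩
      map_add' := fun x y => Subtype.ext (map_add _ _ _)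
      map_smul' := fun t x => Subtype.ext (map_smul _ _ _)
      map_lie' := fun {x y} => Subtype.ext (LieHom.map_lie _ _ _) }
  have hφ : S.val.comp (UniversalEnvelopingAlgebra.lift k φ) = AlgHom.id k (U k g) := by
    refine UniversalEnvelopingAlgebra.hom_ext k (LieHom.ext fun x => ?_)
    simp [φ]
  have h1 : h ∈ S := by
    have := congrArg (fun ψ : U k g →ₐ[k] U k g => ψ h) hφ
    simp only [AlgHom.comp_apply, AlgHom.id_apply] at this
    rw [← this]
    exact (UniversalEnvelopingAlgebra.lift k φ h).2
  have h2 : h * 1 ∈ Q := h1 1 one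
  rw [mul_one] at h2
  exact h2

lemma exists_mem_uFil (h : U k g) : ∃ n, h ∈ uFil b n := by
  induction h using U_induction with
  | one => exact ⟨1, one_mem_uFil b one_pos⟩
  | mul x h hh => obtain ⟨n, hn⟩ := hh; exact ⟨n + 1, ι_mul_mem_uFil b x hn⟩
  | add h h' hh hh' =>
    obtain ⟨n, hn⟩ := hh
    obtain ⟨m, hm⟩ := hh'
    exact ⟨max n m, add_mem (uFil_mono b (le_max_left _ _) hn)
      (uFil_mono b (le_max_right _ _) hm)⟩
  | smul t h hh => obtain ⟨n, hn⟩ := hh; exact ⟨n, Submodule.smul_mem _ _ hn⟩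

lemma uFil_le_span (n : ℕ) :
    uFil b n ≤ Submodule.span k (pbwMon b '' {M | M.card < n}) := by
  refine (letterFil_le_sorted _ _ (uComm b) (uStraight b) n).trans (Submodule.span_le.2 ?_)
  rintro r ⟨a, M, hM, rfl⟩
  have := Submodule.smul_mem (Submodule.span k (pbwMon b '' {M | M.card < n})) a
    (Submodule.subset_span ⟨M, hM, rfl⟩)
  rwa [Algebra.smul_def] at this

/-- The Poincaré–Birkhoff–Witt basis of `U(g)`. -/
def pbwBasis : Module.Basis (Multiset I) k (U k g) :=
  Module.Basis.mk (pbwMon_linearIndependent b) fun h _ => by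
    obtain ⟨n, hn⟩ := exists_mem_uFil b h
    exact Submodule.span_mono (Set.image_subset_range _ _) (uFil_le_span b n hn)

@[simp] lemma pbwBasis_apply (M : Multiset I) : pbwBasis b M = pbwMon b M := by
  simp [pbwBasis]

lemma pbwMon_zero : pbwMon b 0 = 1 := by simp [pbwMon, sortedProd]

lemma pbwMon_singleton (i : I) : pbwMon b {i} = UniversalEnvelopingAlgebra.ι k (b i) := by
  simp [pbwMon, sortedProd]

/-- The comultiplication does not increase the degree of the right factor. -/
lemma comul_mem (n : ℕ) {h : U k g} (hh : h ∈ uFil b n) :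
    comul k g h ∈ Submodule.span k {t | ∃ u, ∃ v ∈ uFil b n, t = u ⊗ₜ[k] v} := by
  have key : ∀ L : List I, ∀ n, L.length < n → comul k g (L.map fun i =>
      UniversalEnvelopingAlgebra.ι k (b i)).prod ∈
      Submodule.span k {t | ∃ u, ∃ v ∈ uFil b n, t = u ⊗ₜ[k] v} := by
    intro L
    induction L with
    | nil =>
      intro n hn
      refine Submodule.subset_span ⟨1, 1, one_mem_uFil b (by omega), by
        simp [Algebra.TensorProduct.one_def]⟩
    | cons i L ih =>
      intro n hn
      obtain ⟨n, rfl⟩ := Nat.exists_eq_succ_of_ne_zero (by omega : n ≠ 0)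
      have h1 := ih n (by simpa using hn)
      rw [List.map_cons, List.prod_cons, map_mul]
      have h2 : comul k g (UniversalEnvelopingAlgebra.ι k (b i)) =
          UniversalEnvelopingAlgebra.ι k (b i) ⊗ₜ[k] (1 : U k g)
            + (1 : U k g) ⊗ₜ[k] UniversalEnvelopingAlgebra.ι k (b i) := by
        rw [comul, UniversalEnvelopingAlgebra.lift_ι_apply]; rfl
      rw [h2]
      generalize comul k g (L.map fun i => UniversalEnvelopingAlgebra.ι k (b i)).prod = t at h1
      induction h1 using Submodule.span_induction with
      | mem t ht =>
        obtain ⟨u, v, hv, rfl⟩ := ht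
        rw [add_mul, Algebra.TensorProduct.tmul_mul_tmul, Algebra.TensorProduct.tmul_mul_tmul,
          one_mul, one_mul]
        exact add_mem (Submodule.subset_span ⟨_, _, uFil_mono b n.le_succ hv, rfl⟩)
          (Submodule.subset_span ⟨_, _, ι_mul_mem_uFil b _ hv, rfl⟩)
      | zero => simp
      | add x y _ _ hx hy => rw [mul_add]; exact add_mem hx hy
      | smul t x _ hx => rw [mul_smul_comm]; exact Submodule.smul_mem _ _ hx
  rw [uFil, letterFil] at hh
  induction hh using Submodule.span_induction with
  | mem x hx =>
    obtain ⟨a, L, hL, rfl⟩ := hx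
    change comul k g (algebraMap k _ a * _) ∈ _
    rw [← Algebra.smul_def, map_smul]
    exact Submodule.smul_mem _ _ (key L n hL)
  | zero => simp
  | add x y _ _ hx hy => rw [map_add]; exact add_mem hx hy
  | smul t x _ hx => rw [map_smul]; exact Submodule.smul_mem _ _ hx

end UBasis

/-! ### The multiplication of the crossed product -/

section CrossedFacts

variable {k A g I : Type*} [Field k] [Ring A] [Algebra k A] [LieRing g] [LieAlgebra k g]
  [LinearOrder I]

/-- The letter `x ∈ g` as an element of `U(g)`. -/
abbrev uι (k : Type*) {g : Type*} [Field k] [LieRing g] [LieAlgebra k g] (x : g) : U k g :=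
  UniversalEnvelopingAlgebra.ι k x

lemma comul_ι (x : g) : comul k g (uι k x) = uι k x ⊗ₜ[k] (1 : U k g) + 1 ⊗ₜ[k] uι k x := by
  rw [comul, UniversalEnvelopingAlgebra.lift_ι_apply]; rfl

lemma counit_ι (x : g) : counit k g (uι k x) = 0 := by
  rw [counit, UniversalEnvelopingAlgebra.lift_ι_apply]; rfl

lemma counit_comul (h : U k g) :
    TensorProduct.lid k (U k g) (LinearMap.rTensor (U k g) (counit k g).toLinearMap
      (comul k g h)) = h := by
  let φ : U k g →ₐ[k] U k g := ((Algebra.TensorProduct.lid k (U k g)).toAlgHom.comp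
    (Algebra.TensorProduct.map (counit k g) (AlgHom.id k (U k g)))).comp (comul k g)
  have hφ : φ = AlgHom.id k (U k g) := by
    refine UniversalEnvelopingAlgebra.hom_ext k (LieHom.ext fun x => ?_)
    change φ (uι k x) = uι k x
    simp [φ, -UniversalEnvelopingAlgebra.ι_apply, comul_ι, counit_ι]
  exact congrArg (fun ψ : U k g →ₐ[k] U k g => ψ h) hφ

lemma comul3_ι (x : g) : comul3 k g (uι k x) = uι k x ⊗ₜ[k] ((1 : U k g) ⊗ₜ[k] (1 : U k g)) +
    (1 : U k g) ⊗ₜ[k] (uι k x ⊗ₜ[k] (1 : U k g) + (1 : U k g) ⊗ₜ[k] uι k x) := by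
  rw [comul3, LinearMap.comp_apply, AlgHom.toLinearMap_apply, comul_ι]
  simp only [map_add, LinearMap.lTensor_tmul, AlgHom.toLinearMap_apply, comul_ι, map_one,
    Algebra.TensorProduct.one_def]

lemma mulLeftFactor_tmul (a : A) (w : A ⊗[k] U k g) :
    mulLeftFactor k A g (a ⊗ₜ w) = LinearMap.rTensor (U k g) (LinearMap.mulLeft k a) w := by
  induction w using TensorProduct.induction_on with
  | zero => simp
  | tmul b h => simp [mulLeftFactor]
  | add x y hx hy => rw [TensorProduct.tmul_add, map_add, map_add, hx, hy]

lemma mulLeftFactor_one (w : A ⊗[k] U k g) : mulLeftFactor k A g (1 ⊗ₜ w) = w := by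
  simp [mulLeftFactor_tmul]

variable (act : U k g →ₗ[k] A →ₗ[k] A) (f : U k g →ₗ[k] U k g →ₗ[k] A)

lemma crossedMul_tmul (a : A) (h : U k g) (t : A ⊗[k] U k g) :
    crossedMul act f (a ⊗ₜ h) t = mulLeftFactor k A g (a ⊗ₜ mulLeftFactor k A g
      (crossedCore act f (comul3 k g h ⊗ₜ (LinearMap.lTensor A (comul k g).toLinearMap) t))) := by
  simp [crossedMul]

lemma crossedCore_tmul (h₁ h₂ h₃ : U k g) (b : A) (t : U k g ⊗[k] U k g) :
    crossedCore act f ((h₁ ⊗ₜ (h₂ ⊗ₜ h₃)) ⊗ₜ (b ⊗ₜ t)) =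
      act h₁ b ⊗ₜ TensorProduct.map (f h₂) (LinearMap.mulLeft k h₃) t := by
  induction t using TensorProduct.induction_on with
  | zero => simp
  | tmul u v => simp [crossedCore]
  | add x y hx hy => simp only [TensorProduct.tmul_add, map_add, hx, hy]

lemma crossedCore_tmul_one (h : U k g) (w : U k g ⊗[k] U k g) (b : A) :
    crossedCore act f ((h ⊗ₜ w) ⊗ₜ (b ⊗ₜ ((1 : U k g) ⊗ₜ (1 : U k g)))) =
      act h b ⊗ₜ LinearMap.rTensor (U k g) (f.flip 1) w := by
  induction w using TensorProduct.induction_on with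
  | zero => simp
  | tmul u v => simp [crossedCore]
  | add x y hx hy => simp only [TensorProduct.tmul_add, TensorProduct.add_tmul, map_add, hx, hy]

namespace CrossedProduct

variable (P : CrossedProduct k A g)

lemma mul_def (s t : A ⊗[k] U k g) :
    P.ofTensor s * P.ofTensor t = P.ofTensor (crossedMul P.act P.f s t) := rfl

lemma inA_mul_ofTensor (a : A) (t : A ⊗[k] U k g) : P.inA a * P.ofTensor t =
    P.ofTensor (LinearMap.rTensor (U k g) (LinearMap.mulLeft k a) t) := by
  have h := P.one_mul' t
  rw [crossedMul_tmul, mulLeftFactor_one] at h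
  rw [inA, sharp, mul_def, crossedMul_tmul, h, mulLeftFactor_tmul]

lemma inA_mul_sharp (a a' : A) (h : U k g) : P.inA a * P.sharp a' h = P.sharp (a * a') h := by
  rw [sharp, inA_mul_ofTensor]; simp [sharp]

lemma sharp_eq (a : A) (h : U k g) : P.sharp a h = P.inA a * P.inU h := by
  rw [inU, inA_mul_sharp, mul_one]

/-- The inclusion of `A` in `E`, as an algebra map. -/
def inAHom : A →ₐ[k] P.Alg :=
  AlgHom.ofLinearMap (P.ofTensor.toLinearMap ∘ₗ (TensorProduct.mk k A (U k g)).flip 1) rfl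
    fun a a' => (P.inA_mul_sharp a a' 1).symm

@[simp] lemma inAHom_apply (a : A) : P.inAHom a = P.inA a := rfl

/-- The map `h ↦ 1 # h`. -/
def inULin : U k g →ₗ[k] P.Alg := P.ofTensor.toLinearMap ∘ₗ TensorProduct.mk k A (U k g) 1

@[simp] lemma inULin_apply (h : U k g) : P.inULin h = P.inU h := rfl

/-- The map `x ↦ 1 # x`. -/
def inGLin : g →ₗ[k] P.Alg := P.inULin ∘ₗ (UniversalEnvelopingAlgebra.ι k : g →ₗ⁅k⁆ U k g).toLinearMap

@[simp] lemma inGLin_apply (x : g) : P.inGLin x = P.inG x := rfl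

lemma inA_add (a a' : A) : P.inA (a + a') = P.inA a + P.inA a' := map_add P.inAHom a a'
lemma inA_mul (a a' : A) : P.inA (a * a') = P.inA a * P.inA a' := map_mul P.inAHom a a'
lemma inA_sub (a a' : A) : P.inA (a - a') = P.inA a - P.inA a' := map_sub P.inAHom a a'
@[simp] lemma inA_zero : P.inA 0 = 0 := map_zero P.inAHom
@[simp] lemma inA_one : P.inA 1 = 1 := rfl
@[simp] lemma inU_one : P.inU 1 = 1 := rfl

lemma inA_injective : Function.Injective P.inA := by
  intro a a' h
  have h' : a ⊗ₜ[k] (1 : U k g) = a' ⊗ₜ[k] (1 : U k g) := h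
  have := congrArg (fun t : A ⊗[k] U k g => TensorProduct.rid k A
    (LinearMap.lTensor A (counit k g).toLinearMap t)) h'
  simpa using this

lemma f_one_comul (h : U k g) :
    LinearMap.rTensor (U k g) (P.f 1) (comul k g h) = (1 : A) ⊗ₜ h := by
  have e := P.one_mul' (1 ⊗ₜ h)
  rw [crossedMul_tmul, mulLeftFactor_one, comul3, LinearMap.comp_apply, AlgHom.toLinearMap_apply,
    map_one, Algebra.TensorProduct.one_def, LinearMap.lTensor_tmul, AlgHom.toLinearMap_apply,
    map_one, Algebra.TensorProduct.one_def, LinearMap.lTensor_tmul, crossedCore_tmul,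
    P.act_one_left, mulLeftFactor_one, LinearMap.mulLeft_one] at e
  exact e

lemma f_one_one : P.f 1 1 = 1 := by
  have h := P.f_one_comul 1
  rw [map_one (comul k g), Algebra.TensorProduct.one_def, LinearMap.rTensor_tmul] at h
  exact P.inA_injective h

lemma inG_mul_inU (x : g) (h : U k g) : P.inG x * P.inU h = P.inU (uι k x * h) +
    P.ofTensor (LinearMap.rTensor (U k g) (P.f (uι k x)) (comul k g h)) := by
  have h0 : P.act (uι k x) 1 = 0 := by rw [P.act_one_right, counit_ι, zero_smul]
  have h1 : TensorProduct.map (P.f 1) (LinearMap.mulLeft k (uι k x)) (comul k g h)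
      = (1 : A) ⊗ₜ (uι k x * h) := by
    have e := congrArg (LinearMap.lTensor A (LinearMap.mulLeft k (uι k x))) (P.f_one_comul h)
    rw [← LinearMap.comp_apply, LinearMap.lTensor_comp_rTensor, LinearMap.lTensor_tmul] at e
    exact e
  rw [inG, inU, sharp, inU, sharp, mul_def, crossedMul_tmul, mulLeftFactor_one, comul3_ι,
    TensorProduct.tmul_add, TensorProduct.add_tmul, TensorProduct.add_tmul,
    LinearMap.lTensor_tmul, AlgHom.toLinearMap_apply]
  simp only [map_add, crossedCore_tmul]
  rw [h0, P.act_one_left, TensorProduct.zero_tmul, h1, map_zero, map_zero, zero_add,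
    mulLeftFactor_one, mulLeftFactor_one, add_comm, inU, sharp, LinearMap.mulLeft_one]
  rfl

lemma f_ι_one (x : g) : P.f (uι k x) 1 = 0 := by
  have h := P.inG_mul_inU x 1
  rw [inU_one, mul_one, mul_one, map_one, Algebra.TensorProduct.one_def, LinearMap.rTensor_tmul,
    inG, left_eq_add] at h
  refine P.inA_injective (h.trans ?_)
  simp

lemma inG_mul_inA (x : g) (a : A) :
    P.inG x * P.inA a = P.inA (P.actG x a) + P.inA a * P.inG x := by
  have e : P.inA a * P.inG x = P.ofTensor (a ⊗ₜ uι k x) := by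
    rw [inG, ← sharp_eq]; rfl
  rw [e, inG, inU, sharp, inA, sharp, mul_def, crossedMul_tmul, mulLeftFactor_one, comul3_ι,
    LinearMap.lTensor_tmul, AlgHom.toLinearMap_apply, map_one, Algebra.TensorProduct.one_def,
    TensorProduct.add_tmul, map_add, crossedCore_tmul_one, crossedCore_tmul_one, map_add, map_add]
  simp only [LinearMap.rTensor_tmul, LinearMap.flip_apply, f_one_one, f_ι_one, map_add,
    TensorProduct.zero_tmul, zero_add, P.act_one_left, mulLeftFactor_tmul, LinearMap.mulLeft_apply,
    mul_one]
  rfl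

lemma inG_mul_inG (x y : g) : P.inG x * P.inG y =
    P.inU (uι k x * uι k y) + P.inA (P.f (uι k x) (uι k y)) := by
  rw [inG, inG, ← inG, inG_mul_inU, comul_ι, map_add, LinearMap.rTensor_tmul,
    LinearMap.rTensor_tmul, f_ι_one, TensorProduct.zero_tmul, add_zero]
  rfl

lemma inG_comm (x y : g) : P.inG x * P.inG y - P.inG y * P.inG x =
    P.inG ⁅x, y⁆ + P.inA (P.fhat x y) := by
  have h : P.inG ⁅x, y⁆ = P.inU (uι k x * uι k y) - P.inU (uι k y * uι k x) := by
    rw [inG, LieHom.map_lie, LieRing.of_associative_ring_bracket, ← inULin_apply, map_sub]; rfl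
  rw [inG_mul_inG, inG_mul_inG, h, fhat, inA_sub]
  abel

lemma inU_mul_inA (h : U k g) (t : A) : P.inU h * P.inA t =
    P.ofTensor (LinearMap.rTensor (U k g) (P.act.flip t) (comul k g h)) := by
  -- the general shape of a product with an element of `A`
  have key : ∀ (s : A) (w : U k g ⊗[k] U k g), mulLeftFactor k A g (crossedCore P.act P.f
      ((LinearMap.lTensor (U k g) (comul k g).toLinearMap w) ⊗ₜ
        (s ⊗ₜ ((1 : U k g) ⊗ₜ (1 : U k g))))) =
      mulLeftFactor k A g (LinearMap.lTensor A (LinearMap.rTensor (U k g) (P.f.flip 1) ∘ₗ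
        (comul k g).toLinearMap) (LinearMap.rTensor (U k g) (P.act.flip s) w)) := by
    intro s w
    induction w using TensorProduct.induction_on with
    | zero => simp
    | tmul u v =>
      rw [LinearMap.lTensor_tmul, crossedCore_tmul_one]
      rfl
    | add x y hx hy => simp only [TensorProduct.add_tmul, map_add, hx, hy]
  have h1 : ∀ h : U k g, LinearMap.rTensor (U k g) (P.f.flip 1) (comul k g h) = 1 ⊗ₜ h := by
    intro h
    have e := P.mul_one' (1 ⊗ₜ h)
    rw [crossedMul_tmul, mulLeftFactor_one, comul3, LinearMap.comp_apply, LinearMap.lTensor_tmul,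
      AlgHom.toLinearMap_apply, AlgHom.toLinearMap_apply, map_one, Algebra.TensorProduct.one_def,
      key] at e
    rw [← e]
    have h2 : P.act.flip 1 = (LinearMap.toSpanSingleton k A 1) ∘ₗ (counit k g).toLinearMap := by
      ext h
      simp [P.act_one_right]
    rw [h2]
    conv_lhs => rw [← counit_comul h]
    generalize comul k g h = w
    induction w using TensorProduct.induction_on with
    | zero => simp
    | tmul u v =>
      rw [LinearMap.rTensor_tmul, LinearMap.rTensor_tmul, TensorProduct.lid_tmul, map_smul,
        map_smul, LinearMap.lTensor_tmul, LinearMap.comp_apply,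
        LinearMap.toSpanSingleton_apply, ← TensorProduct.smul_tmul', map_smul, mulLeftFactor_one]
      rfl
    | add x y hx hy => simp only [map_add, hx, hy]
  rw [inU, sharp, inA, sharp, mul_def, crossedMul_tmul, mulLeftFactor_one, comul3,
    LinearMap.comp_apply, LinearMap.lTensor_tmul, AlgHom.toLinearMap_apply,
    AlgHom.toLinearMap_apply, map_one, Algebra.TensorProduct.one_def, key]
  congr 1
  generalize comul k g h = w
  induction w using TensorProduct.induction_on with
  | zero => simp
  | tmul u v =>
    rw [LinearMap.rTensor_tmul, LinearMap.lTensor_tmul, LinearMap.comp_apply,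
      AlgHom.toLinearMap_apply, h1, mulLeftFactor_tmul, LinearMap.rTensor_tmul]
    simp
  | add x y hx hy => simp only [map_add, hx, hy]

end CrossedProduct

end CrossedFacts

/-! ### Bases of `E` over `A`, and the presentation of `E` -/

section Presentation

variable {k A g I : Type*} [Field k] [Ring A] [Algebra k A] [LieRing g] [LieAlgebra k g]
  [LinearOrder I]

/-- The combinations of sorted products, with coefficients in `A`. -/
def prodMap {R : Type*} [Ring R] [Algebra k R] (α : A →ₐ[k] R) (c : I → R) :
    (Multiset I →₀ A) →ₗ[k] R :=
  Finsupp.lsum k fun M => LinearMap.mulRight k (sortedProd c M) ∘ₗ α.toLinearMap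

lemma prodMap_single {R : Type*} [Ring R] [Algebra k R] (α : A →ₐ[k] R)
    (c : I → R) (M : Multiset I) (a : A) :
    prodMap α c (Finsupp.single M a) = α a * sortedProd c M := by
  simp [prodMap]

namespace CrossedProduct

variable (P : CrossedProduct k A g)

lemma Alg_induction {p : P.Alg → Prop} (sharp : ∀ a h, p (P.sharp a h))
    (add : ∀ u v, p u → p v → p (u + v)) (u : P.Alg) : p u := by
  have h : ∀ t : A ⊗[k] U k g, p (P.ofTensor t) := by
    intro t
    induction t using TensorProduct.induction_on with
    | zero => simpa [CrossedProduct.sharp] using sharp 0 0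
    | tmul a h => exact sharp a h
    | add x y hx hy => rw [map_add]; exact add _ _ hx hy
  exact h (P.ofTensor.symm u)

lemma actG_mul (x : g) (a a' : A) :
    P.actG x (a * a') = P.actG x a * a' + a * P.actG x a' := by
  apply P.inA_injective
  have h := P.inG_mul_inA x (a * a')
  rw [inA_mul, ← mul_assoc, inG_mul_inA, add_mul, mul_assoc, inG_mul_inA] at h
  rw [inA_add, inA_mul, inA_mul]
  refine add_right_cancel (b := P.inA a * P.inA a' * P.inG x) ?_
  rw [← h]
  noncomm_ring

/-- The action of `g` on `A` is projective, with the inner derivations by `fhat` as defect. -/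
lemma fhat_comm (x y : g) (a : A) : P.fhat x y * a - a * P.fhat x y =
    P.actG x (P.actG y a) - P.actG y (P.actG x a) - P.actG ⁅x, y⁆ a := by
  apply P.inA_injective
  have e : P.inA (P.fhat x y) = P.inG x * P.inG y - P.inG y * P.inG x - P.inG ⁅x, y⁆ := by
    rw [inG_comm]; abel
  have h1 : ∀ z c, P.inA (P.actG z c) = P.inG z * P.inA c - P.inA c * P.inG z := by
    intro z c; rw [inG_mul_inA]; abel
  simp only [inA_sub, inA_mul, e, h1]
  noncomm_ring

lemma inG_add (x y : g) : P.inG (x + y) = P.inG x + P.inG y := map_add P.inGLin x y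
lemma inG_sub (x y : g) : P.inG (x - y) = P.inG x - P.inG y := map_sub P.inGLin x y
lemma inG_smul (t : k) (x : g) : P.inG (t • x) = t • P.inG x := map_smul P.inGLin t x

lemma fhat_add_right (x y y' : g) : P.fhat x (y + y') = P.fhat x y + P.fhat x y' := by
  simp only [fhat, map_add, LinearMap.add_apply]; abel

lemma fhat_smul_right (t : k) (x y : g) : P.fhat x (t • y) = t • P.fhat x y := by
  simp only [fhat, map_smul, LinearMap.smul_apply, smul_sub]

lemma fhat_self (x : g) : P.fhat x x = 0 := sub_self _

lemma fhat_swap (x y : g) : P.fhat x y = - P.fhat y x := by simp [fhat]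

/-- The cocycle identity for `fhat`: it expresses the Jacobi identity in `E`. -/
lemma fhat_cocycle (x y z : g) :
    P.fhat x ⁅y, z⁆ + P.actG x (P.fhat y z) - P.fhat y ⁅x, z⁆ - P.actG y (P.fhat x z)
      = P.fhat ⁅x, y⁆ z - P.actG z (P.fhat x y) := by
  apply P.inA_injective
  have e : ∀ x y, P.inA (P.fhat x y) = P.inG x * P.inG y - P.inG y * P.inG x - P.inG ⁅x, y⁆ := by
    intro x y; rw [inG_comm]; abel
  have h1 : ∀ z c, P.inA (P.actG z c) = P.inG z * P.inA c - P.inA c * P.inG z := by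
    intro z c; rw [inG_mul_inA]; abel
  have jac : P.inG ⁅⁅x, y⁆, z⁆ = P.inG ⁅x, ⁅y, z⁆⁆ - P.inG ⁅y, ⁅x, z⁆⁆ := by
    rw [← inG_sub, lie_lie]
  simp only [inA_sub, inA_add, h1, e, jac]
  noncomm_ring

variable (b : Module.Basis I k g)

/-- The span of the elements `a # h` with `h` of degree less than `n`. -/
def lowFil (n : ℕ) : Submodule k P.Alg :=
  Submodule.span k {u | ∃ a, ∃ h ∈ uFil b n, u = P.inA a * P.inU h}

variable {b} in
lemma mem_lowFil (a : A) {n : ℕ} {h : U k g} (hh : h ∈ uFil b n) :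
    P.inA a * P.inU h ∈ P.lowFil b n :=
  Submodule.subset_span ⟨a, h, hh, rfl⟩

lemma lowFil_mono {m n : ℕ} (h : m ≤ n) : P.lowFil b m ≤ P.lowFil b n := by
  refine Submodule.span_mono ?_
  rintro u ⟨a, v, hv, rfl⟩
  exact ⟨a, v, uFil_mono b h hv, rfl⟩

lemma ofTensor_rTensor_comul_mem (φ : U k g →ₗ[k] A) {n : ℕ} {h : U k g} (hh : h ∈ uFil b n) :
    P.ofTensor (LinearMap.rTensor (U k g) φ (comul k g h)) ∈ P.lowFil b n := by
  have h1 := comul_mem b n hh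
  generalize comul k g h = t at h1
  induction h1 using Submodule.span_induction with
  | mem t ht =>
    obtain ⟨u, v, hv, rfl⟩ := ht
    rw [LinearMap.rTensor_tmul]
    change P.sharp _ _ ∈ _
    rw [sharp_eq]
    exact P.mem_lowFil _ hv
  | zero => simp
  | add x y _ _ hx hy => rw [map_add, map_add]; exact add_mem hx hy
  | smul t x _ hx => rw [map_smul, map_smul]; exact Submodule.smul_mem _ _ hx

lemma inG_mul_inU_sub_mem (x : g) {n : ℕ} {h : U k g} (hh : h ∈ uFil b n) :
    P.inG x * P.inU h - P.inU (uι k x * h) ∈ P.lowFil b n := by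
  rw [inG_mul_inU, add_sub_cancel_left]
  exact P.ofTensor_rTensor_comul_mem b _ hh

lemma inG_mul_mem_lowFil (x : g) {n : ℕ} {u : P.Alg} (hu : u ∈ P.lowFil b n) :
    P.inG x * u ∈ P.lowFil b (n + 1) := by
  induction hu using Submodule.span_induction with
  | mem u hu =>
    obtain ⟨a, h, hh, rfl⟩ := hu
    have e : P.inG x * (P.inA a * P.inU h) = P.inA (P.actG x a) * P.inU h +
        (P.inA a * (P.inG x * P.inU h - P.inU (uι k x * h)) +
          P.inA a * P.inU (uι k x * h)) := by
      rw [← mul_assoc, inG_mul_inA]; noncomm_ring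
    have hA : ∀ v ∈ P.lowFil b n, P.inA a * v ∈ P.lowFil b n := by
      intro v hv
      induction hv using Submodule.span_induction with
      | mem v hv =>
        obtain ⟨a', h', hh', rfl⟩ := hv
        rw [← mul_assoc, ← inA_mul]
        exact P.mem_lowFil _ hh'
      | zero => simp
      | add x y _ _ hx hy => rw [mul_add]; exact add_mem hx hy
      | smul t x _ hx => rw [mul_smul_comm]; exact Submodule.smul_mem _ _ hx
    rw [e]
    refine add_mem (P.mem_lowFil _ (uFil_mono b n.le_succ hh)) (add_mem ?_ ?_)
    · exact P.lowFil_mono b n.le_succ (hA _ (P.inG_mul_inU_sub_mem b x hh))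
    · exact P.mem_lowFil _ (ι_mul_mem_uFil b x hh)
  | zero => simp
  | add x y _ _ hx hy => rw [mul_add]; exact add_mem hx hy
  | smul t x _ hx => rw [mul_smul_comm]; exact Submodule.smul_mem _ _ hx

/-- Products in `E` and in `U(g)` agree up to terms of lower degree. -/
lemma prod_sub_inU_prod_mem (L : List I) :
    (L.map fun i => P.inG (b i)).prod - P.inU (L.map fun i => uι k (b i)).prod
      ∈ P.lowFil b L.length := by
  induction L with
  | nil => simp
  | cons i L ih =>
    have hL : (L.map fun i => uι k (b i)).prod ∈ uFil b (L.length + 1) :=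
      prod_mem_letterFil _ _ L L.length.lt_succ_self
    simp only [List.map_cons, List.prod_cons, List.length_cons]
    have e := add_mem (P.inG_mul_mem_lowFil b (b i) ih) (P.inG_mul_inU_sub_mem b (b i) hL)
    convert e using 1
    noncomm_ring

/-- The basis of `E` over `A` formed by the elements `1 # h`, for monomials `h`. -/
def monEquiv : (Multiset I →₀ A) ≃ₗ[k] P.Alg :=
  (TensorProduct.equivFinsuppOfBasisRight (pbwBasis b)).symm ≪≫ₗ P.ofTensor

lemma monEquiv_single (M : Multiset I) (a : A) :
    P.monEquiv b (Finsupp.single M a) = P.inA a * P.inU (pbwMon b M) := by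
  rw [← sharp_eq, monEquiv, LinearEquiv.trans_apply,
    TensorProduct.equivFinsuppOfBasisRight_symm_apply]
  simp [sharp]

lemma monEquiv_symm_mem {n : ℕ} {u : P.Alg} (hu : u ∈ P.lowFil b n) :
    (P.monEquiv b).symm u ∈ Finsupp.supported A k {M : Multiset I | M.card < n} := by
  induction hu using Submodule.span_induction with
  | mem u hu =>
    obtain ⟨a, h, hh, rfl⟩ := hu
    have h1 := uFil_le_span b n hh
    clear hh
    induction h1 using Submodule.span_induction with
    | mem h hh =>
      obtain ⟨M, hM, rfl⟩ := hh
      rw [← monEquiv_single, LinearEquiv.symm_apply_apply]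
      exact Finsupp.single_mem_supported k a hM
    | zero => rw [← inULin_apply, map_zero, mul_zero, map_zero]; exact zero_mem _
    | add x y _ _ hx hy =>
      rw [← inULin_apply, map_add, mul_add, map_add]; exact add_mem hx hy
    | smul t x _ hx =>
      rw [← inULin_apply, map_smul, mul_smul_comm, map_smul]; exact Submodule.smul_mem _ _ hx
  | zero => rw [map_zero]; exact zero_mem _
  | add x y _ _ hx hy => rw [map_add]; exact add_mem hx hy
  | smul t x _ hx => rw [map_smul]; exact Submodule.smul_mem _ _ hx

/-- The sorted products in `E` form a basis of `E` over `A`. -/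
lemma prodMap_bijective :
    Function.Bijective (prodMap P.inAHom fun i => P.inG (b i)) := by
  have h := bijective_of_unitriangular (k := k) (V := A) (fun M : Multiset I => M.card)
    ((P.monEquiv b).symm.toLinearMap ∘ₗ prodMap P.inAHom fun i => P.inG (b i)) fun M a => by
      have h1 := P.prod_sub_inU_prod_mem b (M.sort (· ≤ ·))
      rw [Multiset.length_sort] at h1
      have h2 : P.inA a * (sortedProd (fun i => P.inG (b i)) M - P.inU (pbwMon b M))
          ∈ P.lowFil b M.card := by
        have h3 := h1
        change sortedProd (fun i => P.inG (b i)) M - P.inU (pbwMon b M) ∈ _ at h3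
        generalize sortedProd (fun i => P.inG (b i)) M - P.inU (pbwMon b M) = v at h3
        induction h3 using Submodule.span_induction with
        | mem v hv =>
          obtain ⟨a', h', hh', rfl⟩ := hv
          rw [← mul_assoc, ← inA_mul]
          exact P.mem_lowFil _ hh'
        | zero => simp
        | add x y _ _ hx hy => rw [mul_add]; exact add_mem hx hy
        | smul t x _ hx => rw [mul_smul_comm]; exact Submodule.smul_mem _ _ hx
      have h3 := P.monEquiv_symm_mem b h2
      rw [mul_sub, map_sub, ← monEquiv_single, LinearEquiv.symm_apply_apply] at h3
      rw [LinearMap.comp_apply, prodMap_single]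
      exact h3
  have e : ⇑(prodMap P.inAHom fun i => P.inG (b i)) = P.monEquiv b ∘
      ((P.monEquiv b).symm.toLinearMap ∘ₗ prodMap P.inAHom fun i => P.inG (b i)) := by
    ext v
    simp
  rw [e]
  exact (P.monEquiv b).bijective.comp h

include b in
/-- `E` is presented by the algebra `A`, the elements `x ∈ g`, and the relations
`x a = a ^ x + a x` and `x y - y x = [x, y] + fhat x y`. In the product of `E` with another algebra
with such elements, the sorted products span a subalgebra; it is the graph of the map. -/
lemma exists_algHom {R : Type*} [Ring R] [Algebra k R] (α : A →ₐ[k] R) (β : g →ₗ[k] R)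
    (h1 : ∀ x a, β x * α a = α (P.actG x a) + α a * β x)
    (h2 : ∀ x y, β x * β y - β y * β x = β ⁅x, y⁆ + α (P.fhat x y)) :
    ∃ φ : P.Alg →ₐ[k] R, (∀ a, φ (P.inA a) = α a) ∧ ∀ x, φ (P.inG x) = β x := by
  set α' : A →ₐ[k] P.Alg × R := P.inAHom.prod α with hα'
  set β' : g →ₗ[k] P.Alg × R := P.inGLin.prod β with hβ'
  set c : I → P.Alg × R := fun i => β' (b i) with hc
  have hA : ∀ i a, ∃ a', c i * α' a = α' a' + α' a * c i := fun i a =>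
    ⟨P.actG (b i) a, Prod.ext (P.inG_mul_inA _ _) (h1 _ _)⟩
  have hC : ∀ i j, c i * c j - c j * c i ∈ letterFil α' c 2 := fun i j => by
    have : c i * c j - c j * c i = β' ⁅b i, b j⁆ + α' (P.fhat (b i) (b j)) :=
      Prod.ext (P.inG_comm _ _) (h2 _ _)
    rw [this]
    refine add_mem (ι_mem_letterFil b α' β' _) ?_
    simpa using mem_letterFil α' c (P.fhat (b i) (b j)) [] (n := 2) (by simp)
  set G := LinearMap.range (prodMap α' c) with hG
  have hle : ∀ n, letterFil α' c n ≤ G := by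
    intro n
    refine (letterFil_le_sorted α' c hA hC n).trans (Submodule.span_le.2 ?_)
    rintro r ⟨a, M, -, rfl⟩
    exact ⟨Finsupp.single M a, prodMap_single _ _ _ _⟩
  have hmem : ∀ w ∈ G, ∃ n, w ∈ letterFil α' c (n + 1) := by
    rintro w ⟨v, rfl⟩
    refine ⟨v.support.sup fun M : Multiset I => M.card, ?_⟩
    have hv : prodMap α' c v = ∑ M ∈ v.support, prodMap α' c (Finsupp.single M (v M)) := by
      conv_lhs => rw [← Finsupp.sum_single v, Finsupp.sum, map_sum]
    rw [hv]
    refine Submodule.sum_mem _ fun M hM => ?_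
    rw [prodMap_single]
    exact coeff_mul_mem_letterFil _ _ _ (sortedProd_mem_letterFil _ _ _
      (Nat.lt_succ_of_le (Finset.le_sup (f := fun M : Multiset I => M.card) hM)))
  have hmul : ∀ w ∈ G, ∀ w' ∈ G, w * w' ∈ G := by
    intro w hw w' hw'
    obtain ⟨n, hn⟩ := hmem w hw
    obtain ⟨m, hm⟩ := hmem w' hw'
    exact hle _ (mul_mem_letterFil α' c hA hn hm)
  have hone : (1 : P.Alg × R) ∈ G := hle 1 (by
    simpa using mem_letterFil α' c 1 [] (n := 1) (by simp))
  -- the first projection is injective on the graph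
  set Φ := LinearEquiv.ofBijective _ (P.prodMap_bijective b)
  set φ : P.Alg →ₗ[k] R := LinearMap.snd k P.Alg R ∘ₗ prodMap α' c ∘ₗ Φ.symm.toLinearMap
  have hfst : ∀ v, (prodMap α' c v).1 = Φ v := by
    intro v
    have : LinearMap.fst k P.Alg R ∘ₗ prodMap α' c = Φ.toLinearMap := by
      refine Finsupp.lhom_ext fun M a => ?_
      change (prodMap α' c (Finsupp.single M a)).1 = prodMap P.inAHom (fun i => P.inG (b i)) _
      rw [prodMap_single, prodMap_single]
      change P.inA a * _ = P.inA a * _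
      congr 1
      change RingHom.fst P.Alg R (sortedProd c M) = _
      rw [sortedProd, map_list_prod, List.map_map]
      rfl
    exact LinearMap.congr_fun this v
  have hφ : ∀ w ∈ G, φ w.1 = w.2 := by
    rintro w ⟨v, rfl⟩
    simp [φ, hfst]
  have hsurj : ∀ u, ∃ w ∈ G, w.1 = u := fun u => ⟨_, ⟨Φ.symm u, rfl⟩, by simp [hfst]⟩
  refine ⟨AlgHom.ofLinearMap φ (hφ 1 hone) fun u v => ?_, fun a => ?_, fun x => ?_⟩
  · obtain ⟨w, hw, rfl⟩ := hsurj u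
    obtain ⟨w', hw', rfl⟩ := hsurj v
    rw [hφ w hw, hφ w' hw', ← Prod.fst_mul, hφ _ (hmul w hw w' hw'), Prod.snd_mul]
  · exact hφ (α' a) (hle 1 (by simpa using mem_letterFil α' c a [] (n := 1) (by simp)))
  · exact hφ (β' x) (hle 2 (ι_mem_letterFil b α' β' x))

include b in
/-- `E` is generated by `A` and `g`, by multiplications on the left. -/
lemma Alg_induction_left {p : P.Alg → Prop} (one : p 1)
    (mulA : ∀ a u, p u → p (P.inA a * u)) (mulG : ∀ x u, p u → p (P.inG x * u))
    (add : ∀ u v, p u → p v → p (u + v)) (u : P.Alg) : p u := by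
  obtain ⟨v, rfl⟩ := (P.prodMap_bijective b).2 u
  induction v using Finsupp.induction_linear with
  | zero => rw [map_zero]; simpa using mulA 0 1 one
  | add x y hx hy => rw [map_add]; exact add _ _ hx hy
  | single M a =>
    rw [prodMap_single]
    refine mulA _ _ ?_
    rw [sortedProd]
    generalize M.sort (· ≤ ·) = L
    induction L with
    | nil => simpa using one
    | cons i L ih => simpa using mulG _ _ ih

include b in
lemma algHom_ext {R : Type*} [Ring R] [Algebra k R] {φ ψ : P.Alg →ₐ[k] R}
    (hA : ∀ a, φ (P.inA a) = ψ (P.inA a)) (hG : ∀ x, φ (P.inG x) = ψ (P.inG x)) : φ = ψ := by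
  refine AlgHom.ext fun u => ?_
  induction u using P.Alg_induction_left b with
  | one => simp
  | mulA a u hu => rw [map_mul, map_mul, hA, hu]
  | mulG x u hu => rw [map_mul, map_mul, hG, hu]
  | add u v hu hv => rw [map_add, map_add, hu, hv]

/-- A linear map `θ : U(g) → E` with `θ 1 = 1` and `θ x = 1 # x` such that `E` is freely generated
by the image of `θ`, as a left `A`-module. The standard one is `h ↦ 1 # h`. -/
structure Section where
  /-- the map `θ` -/
  toLin : U k g →ₗ[k] P.Alg
  /-- the isomorphism `a ⊗ h ↦ a θ(h)` -/
  equiv : (A ⊗[k] U k g) ≃ₗ[k] P.Alg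
  equiv_tmul : ∀ a h, equiv (a ⊗ₜ h) = P.inA a * toLin h
  map_one : toLin 1 = 1
  map_ι : ∀ x, toLin (uι k x) = P.inG x

/-- The standard section `h ↦ 1 # h`. -/
def stdSection : P.Section where
  toLin := P.inULin
  equiv := P.ofTensor
  equiv_tmul a h := P.sharp_eq a h
  map_one := rfl
  map_ι _ := rfl

/-- The section that sends sorted monomials to the corresponding products in `E`. -/
def pbwSection : P.Section where
  toLin := (pbwBasis b).constr k fun M => sortedProd (fun i => P.inG (b i)) M
  equiv := (TensorProduct.equivFinsuppOfBasisRight (pbwBasis b)) ≪≫ₗ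
    LinearEquiv.ofBijective _ (P.prodMap_bijective b)
  equiv_tmul a h := by
    induction (pbwBasis b).mem_span h using Submodule.span_induction with
    | mem h hh =>
      obtain ⟨M, rfl⟩ := hh
      rw [Module.Basis.constr_basis, LinearEquiv.trans_apply, LinearEquiv.ofBijective_apply]
      refine Eq.trans (congrArg _ ?_) (prodMap_single P.inAHom (fun i => P.inG (b i)) M a)
      ext M'
      rw [TensorProduct.equivFinsuppOfBasisRight_apply_tmul_apply, Module.Basis.repr_self]
      by_cases hM : M = M'
      · subst hM; simp
      · simp [hM]
    | zero => rw [TensorProduct.tmul_zero, map_zero, map_zero, mul_zero]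
    | add x y _ _ hx hy => rw [TensorProduct.tmul_add, map_add, map_add, hx, hy, mul_add]
    | smul t x _ hx => rw [TensorProduct.tmul_smul, map_smul, map_smul, hx, mul_smul_comm]
  map_one := by
    rw [← pbwMon_zero b, ← pbwBasis_apply, Module.Basis.constr_basis]
    simp [sortedProd]
  map_ι x := by
    have : (pbwBasis b).constr k (fun M => sortedProd (fun i => P.inG (b i)) M) ∘ₗ
        (UniversalEnvelopingAlgebra.ι k : g →ₗ⁅k⁆ U k g).toLinearMap = P.inGLin := by
      refine b.ext fun i => ?_
      change (pbwBasis b).constr k _ (uι k (b i)) = P.inG (b i)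
      rw [uι, ← pbwMon_singleton, ← pbwBasis_apply, Module.Basis.constr_basis]
      simp [sortedProd]
    exact LinearMap.congr_fun this x

variable {P} in
/-- The section `θ` is compatible with the right multiplication by `K`. -/
def Section.KStable (θ : P.Section) (K : Subalgebra k A) : Prop :=
  ∀ h, ∀ t ∈ K, θ.toLin h * P.inA t ∈
    Submodule.span k {u | ∃ t' ∈ K, ∃ h', u = P.inA t' * θ.toLin h'}

lemma stdSection_kStable {K : Subalgebra k A} (hK : P.UStable K) : P.stdSection.KStable K := by
  intro h t ht
  change P.inU h * P.inA t ∈ _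
  rw [inU_mul_inA]
  generalize comul k g h = w
  induction w using TensorProduct.induction_on with
  | zero => simp
  | tmul u v => exact Submodule.subset_span ⟨P.act u t, hK u t ht, v, P.sharp_eq _ _⟩
  | add x y hx hy => rw [map_add, map_add]; exact add_mem hx hy

/-- Moving an element of `K` to the left through a sorted product leaves sorted products. -/
lemma pbwSection_kStable {K : Subalgebra k A} (hK : P.Stable K) :
    (P.pbwSection b).KStable K := by
  have key : ∀ L : List I, L.Pairwise (· ≤ ·) → ∀ t ∈ K,
      (L.map fun i => P.inG (b i)).prod * P.inA t ∈ Submodule.span k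
        {u | ∃ t' ∈ K, ∃ L' : List I, L'.Pairwise (· ≤ ·) ∧ L'.Sublist L ∧
          u = P.inA t' * (L'.map fun i => P.inG (b i)).prod} := by
    intro L
    induction L with
    | nil => intro _ t ht; exact Submodule.subset_span ⟨t, ht, [], by simp⟩
    | cons i L ih =>
      intro hL t ht
      rw [List.pairwise_cons] at hL
      rw [List.map_cons, List.prod_cons, mul_assoc]
      have h1 := ih hL.2 t ht
      generalize (L.map fun i => P.inG (b i)).prod * P.inA t = v at h1 ⊢
      induction h1 using Submodule.span_induction with
      | mem u hu =>
        obtain ⟨t', ht', L', hL', hs, rfl⟩ := hu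
        rw [← mul_assoc, inG_mul_inA, add_mul, mul_assoc]
        refine add_mem (Submodule.subset_span ⟨_, hK _ _ ht', L', hL', hs.cons _, rfl⟩)
          (Submodule.subset_span ⟨_, ht', i :: L', ?_, hs.cons_cons _, by simp⟩)
        exact List.pairwise_cons.2 ⟨fun j hj => hL.1 j (hs.subset hj), hL'⟩
      | zero => simp
      | add x y _ _ hx hy => rw [mul_add]; exact add_mem hx hy
      | smul t x _ hx => rw [mul_smul_comm]; exact Submodule.smul_mem _ _ hx
  have hlin : ∀ M, (P.pbwSection b).toLin (pbwMon b M) = sortedProd (fun i => P.inG (b i)) M := by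
    intro M
    rw [← pbwBasis_apply]
    exact Module.Basis.constr_basis _ _ _ _
  intro h t ht
  induction (pbwBasis b).mem_span h using Submodule.span_induction with
  | mem h hh =>
    obtain ⟨M, rfl⟩ := hh
    rw [pbwBasis_apply, hlin]
    refine Submodule.span_mono ?_ (key _ (Multiset.pairwise_sort M (· ≤ ·)) t ht)
    rintro u ⟨t', ht', L', hL', -, rfl⟩
    refine ⟨t', ht', pbwMon b (L' : Multiset I), ?_⟩
    rw [hlin, sortedProd]
    congr 3
    refine List.Perm.eq_of_pairwise' hL' (Multiset.pairwise_sort _ _) ?_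
    exact Multiset.coe_eq_coe.1 (Multiset.sort_eq _ _).symm
  | zero => simp
  | add x y _ _ hx hy => rw [map_add, add_mul]; exact add_mem hx hy
  | smul c x _ hx => rw [map_smul, smul_mul_assoc]; exact Submodule.smul_mem _ _ hx

end CrossedProduct

end Presentation

/-! ### Linear maps on the bimodules `X_{rs}` -/

section XBasics

variable {k A g I : Type*} [Field k] [Ring A] [Algebra k A] [LieRing g] [LieAlgebra k g]
  [LinearOrder I] (P : CrossedProduct k A g) (K : Subalgebra k A)


variable {P K} in
lemma X.hom_ext {r s : ℕ} {N : Type*} [AddCommGroup N] [Module k N] {f f' : X P K r s →ₗ[k] N}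
    (h : ∀ c x a c', f (X.mk P K c x a c') = f' (X.mk P K c x a c')) : f = f' := by
  refine Submodule.linearMap_qext _ ?_
  refine TensorProduct.ext (LinearMap.ext fun c => ?_)
  refine TensorProduct.ext (exteriorPower.linearMap_ext (AlternatingMap.ext fun x => ?_))
  refine TensorProduct.ext (PiTensorProduct.ext (MultilinearMap.ext fun a => ?_))
  exact LinearMap.ext fun c' => h c x a c'

variable {P K} in
lemma X.induction {r s : ℕ} {p : X P K r s → Prop} (mk : ∀ c x a c', p (X.mk P K c x a c'))
    (add : ∀ u v, p u → p v → p (u + v)) (smul : ∀ (t : k) u, p u → p (t • u))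
    (v : X P K r s) : p v := by
  have zero : p 0 := by simpa using smul 0 _ (mk 0 0 0 0)
  let Q : Submodule k (X P K r s) :=
    { carrier := {h | p h}, add_mem' := fun {u v} hu hv => add u v hu hv, zero_mem' := zero,
      smul_mem' := fun t u hu => smul t u hu }
  have h : Q.mkQ = 0 := X.hom_ext fun c x a c' => by
    rw [LinearMap.zero_apply, Submodule.mkQ_apply, Submodule.Quotient.mk_eq_zero]
    exact mk c x a c'
  have h2 := LinearMap.congr_fun h v
  rw [LinearMap.zero_apply, Submodule.mkQ_apply, Submodule.Quotient.mk_eq_zero] at h2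
  exact h2

variable {P K} in
lemma XX.induction {p : XX P K → Prop}
    (elt : ∀ (r s : ℕ) c (x : Fin s → g) (a : Fin r → A) c', p (elt P K c x a c'))
    (add : ∀ u v, p u → p v → p (u + v)) (smul : ∀ (t : k) u, p u → p (t • u))
    (v : XX P K) : p v := by
  induction v using DirectSum.induction_on with
  | zero => simpa using smul 0 _ (elt 0 0 0 0 0 0)
  | of i v =>
    induction v using X.induction with
    | mk c x a c' => exact elt _ _ c x a c'
    | add u v hu hv => rw [map_add]; exact add _ _ hu hv
    | smul t v hv => rw [DirectSum.of_smul]; exact smul _ _ hv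
  | add u v hu hv => exact add _ _ hu hv

variable {P K} in
lemma XX.hom_ext {N : Type*} [AddCommGroup N] [Module k N] {f f' : XX P K →ₗ[k] N}
    (h : ∀ (r s : ℕ) c (x : Fin s → g) (a : Fin r → A) c',
      f (elt P K c x a c') = f' (elt P K c x a c')) : f = f' :=
  DirectSum.linearMap_ext _ fun _ => X.hom_ext fun c x a c' => h _ _ c x a c'

lemma smul_inX {r s : ℕ} (c : P.Alg) (v : X P K r s) :
    c • inX P K r s v = inX P K r s (c • v) :=
  (DirectSum.of_smul P.Alg (M := fun p : ℕ × ℕ => X P K p.1 p.2) (r, s) c v).symm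

lemma op_smul_inX {r s : ℕ} (c : P.Alg) (v : X P K r s) :
    op c • inX P K r s v = inX P K r s (op c • v) :=
  (DirectSum.of_smul P.Algᵐᵒᵖ (M := fun p : ℕ × ℕ => X P K p.1 p.2) (r, s) (op c) v).symm

lemma smul_elt {r s : ℕ} (d c : P.Alg) (x : Fin s → g) (a : Fin r → A) (c' : P.Alg) :
    d • elt P K c x a c' = elt P K (d * c) x a c' := by
  rw [elt, smul_inX, X.smul_mk, elt]

lemma op_smul_elt {r s : ℕ} (d c : P.Alg) (x : Fin s → g) (a : Fin r → A) (c' : P.Alg) :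
    op d • elt P K c x a c' = elt P K c x a (c' * d) := by
  rw [elt, op_smul_inX, X.op_smul_mk, elt]

lemma elt_eq {r s : ℕ} (c : P.Alg) (x : Fin s → g) (a : Fin r → A) (c' : P.Alg) :
    elt P K c x a c' = c • op c' • elt P K 1 x a 1 := by
  rw [op_smul_elt, smul_elt, mul_one, one_mul]

/-- The relation of moving an element of `K` across a tensor sign. -/
lemma X.mk_balanced {r s : ℕ} (i : Fin (r + 1)) {t : A} (ht : t ∈ K) (c : P.Alg) (x : Fin s → g)
    (a : Fin r → A) (c' : P.Alg) :
    X.mk P K (if i.1 = 0 then c * P.inA t else c) x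
        (fun j => if j.1 + 1 = i.1 then a j * t else a j) c' =
      X.mk P K c x (fun j => if j.1 = i.1 then t * a j else a j)
        (if i.1 = r then P.inA t * c' else c') := by
  rw [← sub_eq_zero]
  exact (Submodule.Quotient.mk_eq_zero _).2
    (Submodule.subset_span (Or.inl ⟨i, t, c, x, a, c', ht, rfl⟩))

lemma X.mk_eq_zero {r s : ℕ} {j : Fin r} (c : P.Alg) (x : Fin s → g)
    {a : Fin r → A} (c' : P.Alg) (ha : a j ∈ K) : X.mk P K c x a c' = 0 :=
  (Submodule.Quotient.mk_eq_zero _).2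
    (Submodule.subset_span (Or.inr ⟨j, c, x, a, c', ha, rfl⟩))

/-- A linear map on the tensor product over `k` that respects the relations descends. -/
lemma X.exists_desc {r s : ℕ} {N : Type*} [AddCommGroup N] [Module k N]
    (F : PreX P r s →ₗ[k] N)
    (h1 : ∀ (i : Fin (r + 1)) (t : A) (c : P.Alg) (x : Fin s → g) (a : Fin r → A) (c' : P.Alg),
      t ∈ K → F (preMk P (if i.1 = 0 then c * P.inA t else c) x
            (fun j => if j.1 + 1 = i.1 then a j * t else a j) c') =
          F (preMk P c x (fun j => if j.1 = i.1 then t * a j else a j)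
            (if i.1 = r then P.inA t * c' else c')))
    (h2 : ∀ (j : Fin r) (c : P.Alg) (x : Fin s → g) (a : Fin r → A) (c' : P.Alg), a j ∈ K →
      F (preMk P c x a c') = 0) :
    ∃ T : X P K r s →ₗ[k] N, ∀ c x a c', T (X.mk P K c x a c') = F (preMk P c x a c') := by
  refine ⟨Submodule.liftQ _ F ?_, fun c x a c' => rfl⟩
  rw [Submodule.span_le]
  rintro w (⟨i, t, c, x, a, c', ht, rfl⟩ | ⟨j, c, x, a, c', ha, rfl⟩)
  · change F _ = 0
    rw [map_sub, h1 i t c x a c' ht, sub_self]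
  · exact h2 j c x a c' ha

/-- Maps out of `X_{0s}`. -/
lemma X.exists_lift_zero {s : ℕ} {N : Type*} [AddCommGroup N] [Module k N]
    (F : P.Alg →ₗ[k] (⋀[k]^s g) →ₗ[k] P.Alg →ₗ[k] N)
    (hF : ∀ t ∈ K, ∀ c ω c', F (c * P.inA t) ω c' = F c ω (P.inA t * c')) :
    ∃ T : X P K 0 s →ₗ[k] N, ∀ c x a c',
      T (X.mk P K c x a c') = F c (exteriorPower.ιMulti k s x) c' := by
  let e : (⨂[k]^0 A) ≃ₗ[k] k := PiTensorProduct.isEmptyEquiv (Fin 0)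
  let F' : PreX P 0 s →ₗ[k] N := TensorProduct.lift <|
    { toFun := fun c => TensorProduct.lift
        { toFun := fun ω => TensorProduct.lift
            { toFun := fun τ => e τ • F c ω
              map_add' := fun τ τ' => by rw [map_add, add_smul]
              map_smul' := fun u τ => by rw [map_smul, smul_eq_mul, mul_smul]; rfl }
          map_add' := fun ω ω' => by ext; simp
          map_smul' := fun u ω => by ext τ c'; simpa using smul_comm _ _ _ }
      map_add' := fun c c' => by ext; simp
      map_smul' := fun u c => by ext ω τ c'; simpa using smul_comm _ _ _ }
  have hF' : ∀ c x a c', F' (preMk P c x a c') = F c (exteriorPower.ιMulti k s x) c' := by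
    intro c x a c'
    simp [F', preMk, e]
  obtain ⟨T, hT⟩ := X.exists_desc P K F' (fun i t c x a c' ht => by
    obtain rfl : i = 0 := Fin.ext (by omega)
    simp [hF', hF t ht]) (fun j => j.elim0)
  exact ⟨T, fun c x a c' => by rw [hT, hF']⟩

/-- Removing the last factor of a tensor power. -/
def tpowInit (r : ℕ) {R : Type*} [Ring R] [Algebra k R] (α : A →ₗ[k] R) :
    (⨂[k]^(r + 1) A) →ₗ[k] (⨂[k]^r A) ⊗[k] R :=
  PiTensorProduct.lift <| MultilinearMap.uncurryRight (M := fun _ : Fin (r + 1) => A) <|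
    (LinearMap.lcomp k _ α ∘ₗ TensorProduct.mk k (⨂[k]^r A) R).compMultilinearMap
      (PiTensorProduct.tprod k)

lemma tpowInit_tprod (r : ℕ) {R : Type*} [Ring R] [Algebra k R] (α : A →ₗ[k] R)
    (a : Fin (r + 1) → A) : tpowInit r α (PiTensorProduct.tprod k a) =
      PiTensorProduct.tprod k (Fin.init a) ⊗ₜ α (a (Fin.last r)) := by
  rw [tpowInit, PiTensorProduct.lift.tprod, MultilinearMap.uncurryRight_apply]
  rfl

/-- Appending a factor to a tensor power. -/
def tpowSnoc (r : ℕ) : (⨂[k]^r A) →ₗ[k] A →ₗ[k] (⨂[k]^(r + 1) A) :=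
  PiTensorProduct.lift (MultilinearMap.curryRight (M := fun _ : Fin (r + 1) => A)
    (PiTensorProduct.tprod k))

lemma tpowSnoc_tprod (r : ℕ) (a : Fin r → A) (a' : A) :
    tpowSnoc (k := k) r (PiTensorProduct.tprod k a) a' =
      PiTensorProduct.tprod k (Fin.snoc a a' : Fin (r + 1) → A) := by
  rw [tpowSnoc, PiTensorProduct.lift.tprod, MultilinearMap.curryRight_apply]

/-- Maps out of `X_{r+1,s}`: they are determined by their values on the elements
`c ⊗ x ⊗ a_1 ⊗ ⋯ ⊗ a_r ⊗ a_{r+1} ⊗ 1`, which depend on `c ⊗ x ⊗ a_1 ⊗ ⋯ ⊗ a_r ⊗ a_{r+1} ∈ X_{rs}`. -/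
lemma X.exists_lift_snoc {r s : ℕ} {N : Type*} [AddCommGroup N] [Module k N]
    [Module P.Algᵐᵒᵖ N] [IsScalarTower k P.Algᵐᵒᵖ N] [SMulCommClass k P.Algᵐᵒᵖ N]
    (G : X P K r s →ₗ[k] N)
    (h1 : ∀ c x a, ∀ t ∈ K, G (X.mk P K c x a (P.inA t)) = 0)
    (h2 : ∀ c x a a', ∀ t ∈ K, G (X.mk P K c x a (P.inA (a' * t))) =
      op (P.inA t) • G (X.mk P K c x a (P.inA a'))) :
    ∃ T : X P K (r + 1) s →ₗ[k] N, ∀ c x a c', T (X.mk P K c x a c') =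
      op c' • G (X.mk P K c x (Fin.init a) (P.inA (a (Fin.last r)))) := by
  let ρ : N →ₗ[k] P.Alg →ₗ[k] N := LinearMap.mk₂ k (fun n c' => op c' • n)
    (fun n n' c => smul_add _ _ _) (fun t n c => smul_comm _ _ _)
    (fun n c c' => by rw [op_add, add_smul]) (fun t n c => by rw [op_smul, smul_assoc])
  let F : PreX P (r + 1) s →ₗ[k] N :=
    TensorProduct.lift (ρ ∘ₗ G ∘ₗ X.proj P K r s ∘ₗ LinearMap.lTensor P.Alg
      (LinearMap.lTensor (⋀[k]^s g) (tpowInit r P.inAHom.toLinearMap))) ∘ₗ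
    (TensorProduct.assoc k P.Alg ((⋀[k]^s g) ⊗[k] (⨂[k]^(r + 1) A)) P.Alg).symm.toLinearMap ∘ₗ
    LinearMap.lTensor P.Alg
      (TensorProduct.assoc k (⋀[k]^s g) (⨂[k]^(r + 1) A) P.Alg).symm.toLinearMap
  have hF : ∀ c x a c', F (preMk P c x a c') =
      op c' • G (X.mk P K c x (Fin.init a) (P.inA (a (Fin.last r)))) := by
    intro c x a c'
    simp only [F, preMk, LinearMap.comp_apply, LinearMap.lTensor_tmul, LinearEquiv.coe_coe,
      TensorProduct.assoc_symm_tmul, TensorProduct.lift.tmul, tpowInit_tprod]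
    rfl
  suffices h : ∃ T : X P K (r + 1) s →ₗ[k] N, ∀ c x a c',
      T (X.mk P K c x a c') = F (preMk P c x a c') by
    obtain ⟨T, hT⟩ := h
    exact ⟨T, fun c x a c' => by rw [hT, hF]⟩
  refine X.exists_desc P K F (fun i t c x a c' ht => ?_) (fun j c x a c' ha => ?_)
  · rw [hF, hF]
    rcases eq_or_ne i.1 (r + 1) with hi | hi
    · have e1 : (Fin.init fun j : Fin (r + 1) => if j.1 + 1 = i.1 then a j * t else a j)
          = Fin.init a := by
        funext j
        simp only [Fin.init, Fin.val_castSucc]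
        rw [if_neg (by omega)]
      have e2 : (fun j : Fin (r + 1) => if j.1 = i.1 then t * a j else a j) = a := by
        funext j
        rw [if_neg (by omega)]
      rw [e1, e2, if_neg (by omega), if_pos hi]
      simp only [Fin.val_last, hi, if_true]
      rw [h2 _ _ _ _ t ht, op_mul, mul_smul, if_neg (by omega)]
    · have e1 : (Fin.init fun j : Fin (r + 1) => if j.1 + 1 = i.1 then a j * t else a j)
          = fun j => if j.1 + 1 = i.1 then Fin.init a j * t else Fin.init a j := rfl
      have e2 : (Fin.init fun j : Fin (r + 1) => if j.1 = i.1 then t * a j else a j)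
          = fun j => if j.1 = i.1 then t * Fin.init a j else Fin.init a j := rfl
      have hb := X.mk_balanced P K (⟨i.1, by omega⟩ : Fin (r + 1)) ht c x (Fin.init a)
        (P.inA (a (Fin.last r)))
      rw [e1, e2, if_neg (show ¬ i.1 = r + 1 by omega)]
      simp only [Fin.val_last]
      rw [if_neg (show ¬ r + 1 = i.1 by omega)]
      simp only at hb
      rw [hb]
      congr 3
      by_cases hr : i.1 = r
      · rw [if_pos hr, if_pos hr.symm, P.inA_mul]
      · rw [if_neg hr, if_neg (Ne.symm hr)]
  · rw [hF]
    refine Fin.lastCases (fun ha => ?_) (fun j ha => ?_) j ha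
    · rw [h1 _ _ _ _ ha, smul_zero]
    · rw [X.mk_eq_zero P K (j := j) c x (a := Fin.init a) _ ha, map_zero, smul_zero]

/-- Maps out of `X_{r,s+1}`: they are given by maps `F y` on `X_{rs}`, for `y ∈ g`, such that
`F y` vanishes on the elements with `y` as first factor of the exterior product. -/
lemma X.exists_lift_cons {r s : ℕ} {N : Type*} [AddCommGroup N] [Module k N]
    (F : g →ₗ[k] X P K r s →ₗ[k] N)
    (hF : ∀ c (x : Fin (s + 1) → g) a c' (i : Fin s), (i : ℕ) = 0 → x i.succ = x 0 →
      F (x 0) (X.mk P K c (Fin.tail x) a c') = 0) :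
    ∃ T : X P K r (s + 1) →ₗ[k] N, ∀ c x a c', T (X.mk P K c x a c') =
      F (x 0) (X.mk P K c (Fin.tail x) a c') := by
  let Z := (⨂[k]^r A) ⊗[k] P.Alg
  let Q : g →ₗ[k] (g [⋀^Fin s]→ₗ[k] (P.Alg ⊗[k] Z →ₗ[k] N)) :=
    { toFun := fun y => exteriorPower.alternatingMapLinearEquiv.symm (TensorProduct.curry
        (F y ∘ₗ X.proj P K r s ∘ₗ (TensorProduct.leftComm k (⋀[k]^s g) P.Alg Z).toLinearMap))
      map_add' := fun y y' => by
        rw [← map_add]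
        congr 1
        ext
        simp
      map_smul' := fun t y => by
        rw [RingHom.id_apply, ← map_smul]
        congr 1
        ext
        simp }
  have hQ : ∀ y x c a c', Q y x (c ⊗ₜ (PiTensorProduct.tprod k a ⊗ₜ c'))
      = F y (X.mk P K c x a c') := fun y x c a c' => rfl
  let Q' : g →ₗ[k] MultilinearMap k (fun _ : Fin s => g) (P.Alg ⊗[k] Z →ₗ[k] N) :=
    { toFun := fun y => (Q y).toMultilinearMap
      map_add' := fun y y' => by rw [map_add]; rfl
      map_smul' := fun t y => by rw [map_smul]; rfl }
  have hext : ∀ f f' : P.Alg ⊗[k] Z →ₗ[k] N,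
      (∀ c a c', f (c ⊗ₜ (PiTensorProduct.tprod k a ⊗ₜ c')) =
        f' (c ⊗ₜ (PiTensorProduct.tprod k a ⊗ₜ c'))) → f = f' := by
    intro f f' h
    refine TensorProduct.ext (LinearMap.ext fun c => ?_)
    refine TensorProduct.ext (PiTensorProduct.ext (MultilinearMap.ext fun a => ?_))
    exact LinearMap.ext fun c' => h c a c'
  have h0 : ∀ (v : Fin (s + 1) → g) (j : Fin s), v 0 = v j.succ → Q (v 0) (Fin.tail v) = 0 := by
    intro v j hj
    obtain ⟨s, rfl⟩ := Nat.exists_eq_succ_of_ne_zero (Nat.ne_of_gt j.pos)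
    have key : ∀ v : Fin (s + 1 + 1) → g, v 1 = v 0 → Q (v 0) (Fin.tail v) = 0 := by
      intro v hv
      refine hext _ _ fun c a c' => ?_
      rw [hQ, hF c v a c' 0 rfl hv, LinearMap.zero_apply]
    rcases eq_or_ne j 0 with rfl | hj0
    · exact key v hj.symm
    · have h1 := (Q (v 0)).map_swap (Fin.tail v) hj0.symm
      have h2 := key (Fin.cons (v 0) (Fin.tail v ∘ Equiv.swap 0 j)) (by
        change Fin.tail v (Equiv.swap 0 j 0) = v 0
        rw [Equiv.swap_apply_left]
        exact hj.symm)
      rw [Fin.cons_zero, Fin.tail_cons] at h2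
      rw [← neg_eq_zero, ← h1, h2]
  let W : g [⋀^Fin (s + 1)]→ₗ[k] (P.Alg ⊗[k] Z →ₗ[k] N) :=
    { LinearMap.uncurryLeft (M := fun _ : Fin (s + 1) => g) Q' with
      map_eq_zero_of_eq' := by
        intro v i j hv hij
        change Q (v 0) (Fin.tail v) = 0
        rcases Fin.eq_zero_or_eq_succ i with rfl | ⟨i, rfl⟩
        · rcases Fin.eq_zero_or_eq_succ j with rfl | ⟨j, rfl⟩
          · exact absurd rfl hij
          · exact h0 v j hv
        · rcases Fin.eq_zero_or_eq_succ j with rfl | ⟨j, rfl⟩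
          · exact h0 v i hv.symm
          · exact (Q (v 0)).map_eq_zero_of_eq (Fin.tail v) hv fun h => hij (by rw [h]) }
  let F' : PreX P r (s + 1) →ₗ[k] N :=
    TensorProduct.lift (exteriorPower.alternatingMapLinearEquiv W) ∘ₗ
      (TensorProduct.leftComm k P.Alg (⋀[k]^(s + 1) g) Z).toLinearMap
  have hF' : ∀ c x a c', F' (preMk P c x a c') = F (x 0) (X.mk P K c (Fin.tail x) a c') := by
    intro c x a c'
    simp only [F', preMk, LinearMap.comp_apply, LinearEquiv.coe_coe,
      TensorProduct.leftComm_tmul, TensorProduct.lift.tmul,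
      exteriorPower.alternatingMapLinearEquiv_apply_ιMulti]
    exact hQ (x 0) (Fin.tail x) c a c'
  obtain ⟨T, hT⟩ := X.exists_desc P K F' (fun i t c x a c' ht => by
    rw [hF', hF', X.mk_balanced P K i ht]) (fun j c x a c' ha => by
    rw [hF', X.mk_eq_zero P K (j := j) c _ c' ha, map_zero])
  exact ⟨T, fun c x a c' => by rw [hT, hF']⟩

end XBasics


/-! ### Wedging, appending and collapsing on the bimodules `X_{rs}` -/

section Operators

variable {k A g I : Type*} [Field k] [Ring A] [Algebra k A] [LieRing g] [LieAlgebra k g]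
  [LinearOrder I] {P : CrossedProduct k A g}

lemma CrossedProduct.Section.induction (θ : P.Section) {p : P.Alg → Prop}
    (mul : ∀ a h, p (P.inA a * θ.toLin h)) (add : ∀ u v, p u → p v → p (u + v))
    (c : P.Alg) : p c := by
  obtain ⟨t, rfl⟩ := θ.equiv.surjective c
  induction t using TensorProduct.induction_on with
  | zero => rw [map_zero]; simpa using mul 0 0
  | tmul a h => rw [θ.equiv_tmul]; exact mul a h
  | add u v hu hv => rw [map_add]; exact add _ _ hu hv

lemma CrossedProduct.Section.equiv_symm_mul (θ : P.Section) (a : A) (h : U k g) :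
    θ.equiv.symm (P.inA a * θ.toLin h) = a ⊗ₜ h := by
  rw [← θ.equiv_tmul, LinearEquiv.symm_apply_apply]

variable (P) (K : Subalgebra k A)

lemma elt_balanced {r s : ℕ} (i : Fin (r + 1)) {t : A} (ht : t ∈ K) (c : P.Alg) (x : Fin s → g)
    (a : Fin r → A) (c' : P.Alg) :
    elt P K (if i.1 = 0 then c * P.inA t else c) x
        (fun j => if j.1 + 1 = i.1 then a j * t else a j) c' =
      elt P K c x (fun j => if j.1 = i.1 then t * a j else a j)
        (if i.1 = r then P.inA t * c' else c') :=
  congrArg (inX P K r s) (X.mk_balanced P K i ht c x a c')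

lemma elt_eq_zero {r s : ℕ} {j : Fin r} (c : P.Alg) (x : Fin s → g)
    {a : Fin r → A} (c' : P.Alg) (ha : a j ∈ K) : elt P K c x a c' = 0 := by
  rw [elt, X.mk_eq_zero P K c x c' ha, map_zero]

lemma elt_snoc_eq_zero {r s : ℕ} (c : P.Alg) (x : Fin s → g)
    {a : Fin r → A} {t : A} (c' : P.Alg) (ht : t ∈ K) :
    elt P K c x (Fin.snoc a t : Fin (r + 1) → A) c' = 0 :=
  elt_eq_zero P K (j := Fin.last r) c x c' (by rwa [Fin.snoc_last])

lemma elt_snoc_mul {r s : ℕ} (c : P.Alg) (x : Fin s → g)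
    (a : Fin r → A) (a' : A) {t : A} (c' : P.Alg) (ht : t ∈ K) :
    elt P K c x (Fin.snoc a (a' * t) : Fin (r + 1) → A) c' =
      elt P K c x (Fin.snoc a a' : Fin (r + 1) → A) (P.inA t * c') := by
  have h := elt_balanced P K (Fin.last (r + 1)) ht c x (Fin.snoc a a' : Fin (r + 1) → A) c'
  have e1 : (fun j : Fin (r + 1) => if j.1 + 1 = (Fin.last (r + 1)).1 then
      (Fin.snoc a a' : Fin (r + 1) → A) j * t else (Fin.snoc a a' : Fin (r + 1) → A) j) =
      Fin.snoc a (a' * t) := by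
    funext j
    refine Fin.lastCases ?_ (fun j => ?_) j
    · simp
    · have := j.2
      simp only [Fin.val_castSucc, Fin.val_last, Fin.snoc_castSucc]
      rw [if_neg (by omega)]
  have e2 : (fun j : Fin (r + 1) => if j.1 = (Fin.last (r + 1)).1 then
      t * (Fin.snoc a a' : Fin (r + 1) → A) j else (Fin.snoc a a' : Fin (r + 1) → A) j) =
      Fin.snoc a a' := by
    funext j
    have := j.2
    rw [if_neg (by simp only [Fin.val_last]; omega)]
  rw [e1, e2, if_neg (by simp), if_pos (by simp)] at h
  exact h

lemma elt_zero_mul {s : ℕ} (c : P.Alg) (x : Fin s → g) (a : Fin 0 → A) {t : A} (c' : P.Alg)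
    (ht : t ∈ K) : elt P K (c * P.inA t) x a c' = elt P K c x a (P.inA t * c') := by
  have h := elt_balanced P K (0 : Fin 1) ht c x a c'
  rw [if_pos (show (0 : Fin 1).1 = 0 from rfl), if_pos (show (0 : Fin 1).1 = 0 from rfl)] at h
  rwa [Subsingleton.elim (fun j : Fin 0 => if j.1 + 1 = (0 : Fin 1).1 then a j * t else a j) a,
    Subsingleton.elim (fun j : Fin 0 => if j.1 = (0 : Fin 1).1 then t * a j else a j) a] at h

lemma elt_add_right {r s : ℕ} (c : P.Alg) (x : Fin s → g) (a : Fin r → A) (c' d : P.Alg) :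
    elt P K c x a (c' + d) = elt P K c x a c' + elt P K c x a d := by
  rw [elt_eq P K c x a (c' + d), op_add, add_smul, smul_add, ← elt_eq, ← elt_eq]

/-- Linear maps out of a component, assembled to a map on the direct sum. -/
lemma exists_desc {N : Type*} [AddCommGroup N] [Module k N]
    (F : ∀ r s, PreX P r s →ₗ[k] N)
    (h1 : ∀ r s (i : Fin (r + 1)) (t : A) (c : P.Alg) (x : Fin s → g) (a : Fin r → A) (c' : P.Alg),
      t ∈ K → F r s (preMk P (if i.1 = 0 then c * P.inA t else c) x
            (fun j => if j.1 + 1 = i.1 then a j * t else a j) c') =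
          F r s (preMk P c x (fun j => if j.1 = i.1 then t * a j else a j)
            (if i.1 = r then P.inA t * c' else c')))
    (h2 : ∀ r s (j : Fin r) (c : P.Alg) (x : Fin s → g) (a : Fin r → A) (c' : P.Alg), a j ∈ K →
      F r s (preMk P c x a c') = 0) :
    ∃ T : XX P K →ₗ[k] N, ∀ r s c (x : Fin s → g) (a : Fin r → A) c',
      T (elt P K c x a c') = F r s (preMk P c x a c') := by
  choose T hT using fun r s => X.exists_desc P K (F r s) (h1 r s) (h2 r s)
  refine ⟨DirectSum.toModule k _ _ fun p => T p.1 p.2, fun r s c x a c' => ?_⟩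
  rw [elt, inX, DirectSum.toModule_lof]
  exact hT r s c x a c'

/-- The map `x_1 ∧ ⋯ ∧ x_s ↦ y ∧ x_1 ∧ ⋯ ∧ x_s`. -/
def extCons (s : ℕ) (y : g) : (⋀[k]^s g) →ₗ[k] (⋀[k]^(s + 1) g) :=
  exteriorPower.alternatingMapLinearEquiv
    (AlternatingMap.curryLeft (exteriorPower.ιMulti k (s + 1)) y)

lemma extCons_ιMulti (s : ℕ) (y : g) (x : Fin s → g) :
    extCons (k := k) s y (exteriorPower.ιMulti k s x) =
      exteriorPower.ιMulti k (s + 1) (Fin.cons y x : Fin (s + 1) → g) := by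
  rw [extCons, exteriorPower.alternatingMapLinearEquiv_apply_ιMulti]
  rfl

lemma exists_wedgeOp : ∃ w : g →ₗ[k] Module.End k (XX P K),
    ∀ y r s c (x : Fin s → g) (a : Fin r → A) c',
      w y (elt P K c x a c') = elt P K c (Fin.cons y x : Fin (s + 1) → g) a c' := by
  have h : ∀ y : g, ∃ T : Module.End k (XX P K), ∀ r s c (x : Fin s → g) (a : Fin r → A) c',
      T (elt P K c x a c') = elt P K c (Fin.cons y x : Fin (s + 1) → g) a c' := by
    intro y
    obtain ⟨T, hT⟩ := exists_desc P K (N := XX P K) (fun r s => inX P K r (s + 1) ∘ₗ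
      X.proj P K r (s + 1) ∘ₗ LinearMap.lTensor P.Alg (LinearMap.rTensor _ (extCons s y)))
      (fun r s i t c x a c' ht => by
        simp only [LinearMap.comp_apply, preMk, LinearMap.lTensor_tmul, LinearMap.rTensor_tmul,
          extCons_ιMulti]
        exact elt_balanced P K i ht c _ a c')
      (fun r s j c x a c' ha => by
        simp only [LinearMap.comp_apply, preMk, LinearMap.lTensor_tmul, LinearMap.rTensor_tmul,
          extCons_ιMulti]
        exact elt_eq_zero P K c _ c' ha)
    refine ⟨T, fun r s c x a c' => ?_⟩
    rw [hT]
    simp only [LinearMap.comp_apply, preMk, LinearMap.lTensor_tmul, LinearMap.rTensor_tmul,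
      extCons_ιMulti]
    rfl
  choose T hT using h
  refine ⟨⟨⟨T, fun y z => XX.hom_ext fun r s c x a c' => ?_⟩,
    fun t y => XX.hom_ext fun r s c x a c' => ?_⟩, hT⟩
  · rw [LinearMap.add_apply, hT, hT, hT, elt, elt, elt, ← map_add, X.mk, X.mk, X.mk, ← map_add]
    congr 2
    simp only [preMk, ← extCons_ιMulti, ← TensorProduct.add_tmul, ← TensorProduct.tmul_add]
    congr 2
    rw [extCons_ιMulti, extCons_ιMulti, extCons_ιMulti]
    exact MultilinearMap.cons_add (exteriorPower.ιMulti k (s + 1)).toMultilinearMap x y z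
  · rw [RingHom.id_apply, LinearMap.smul_apply, hT, hT, elt, elt, ← map_smul, X.mk, X.mk,
      ← map_smul]
    congr 2
    rw [preMk, preMk, ← TensorProduct.tmul_smul, TensorProduct.smul_tmul']
    congr 2
    exact MultilinearMap.cons_smul (exteriorPower.ιMulti k (s + 1)).toMultilinearMap x t y

/-- The operator `c ⊗ x_1 ∧ ⋯ ∧ x_s ⊗ a ⊗ c' ↦ c ⊗ y ∧ x_1 ∧ ⋯ ∧ x_s ⊗ a ⊗ c'`. -/
def wedgeOp : g →ₗ[k] Module.End k (XX P K) := (exists_wedgeOp P K).choose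

lemma wedgeOp_elt (y : g) {r s : ℕ} (c : P.Alg) (x : Fin s → g) (a : Fin r → A) (c' : P.Alg) :
    wedgeOp P K y (elt P K c x a c') = elt P K c (Fin.cons y x : Fin (s + 1) → g) a c' :=
  (exists_wedgeOp P K).choose_spec y r s c x a c'

variable {P K} in
/-- The operator `T` is a bimodule map. -/
structure IsBimod {K' : Subalgebra k A} (T : XX P K →ₗ[k] XX P K') : Prop where
  left : ∀ (c : P.Alg) v, T (c • v) = c • T v
  right : ∀ (c : P.Alg) v, T (op c • v) = op c • T v

lemma left_of_elt {N : Type*} [AddCommGroup N] [Module k N] [Module P.Alg N]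
    [SMulCommClass k P.Alg N] {T : XX P K →ₗ[k] N}
    (h : ∀ (r s : ℕ) d c (x : Fin s → g) (a : Fin r → A) c',
      T (elt P K (d * c) x a c') = d • T (elt P K c x a c')) (c : P.Alg) (v : XX P K) :
    T (c • v) = c • T v := by
  induction v using XX.induction with
  | elt r s d x a c' => rw [smul_elt, h]
  | add u v hu hv => rw [smul_add, map_add, map_add, smul_add, hu, hv]
  | smul t v hv => rw [smul_comm, LinearMap.map_smul, LinearMap.map_smul, hv, smul_comm]

lemma right_of_elt {N : Type*} [AddCommGroup N] [Module k N] [Module P.Algᵐᵒᵖ N]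
    [SMulCommClass k P.Algᵐᵒᵖ N] {T : XX P K →ₗ[k] N}
    (h : ∀ (r s : ℕ) d c (x : Fin s → g) (a : Fin r → A) c',
      T (elt P K c x a (c' * d)) = op d • T (elt P K c x a c')) (c : P.Alg) (v : XX P K) :
    T (op c • v) = op c • T v := by
  induction v using XX.induction with
  | elt r s d x a c' => rw [op_smul_elt, h]
  | add u v hu hv => rw [smul_add, map_add, map_add, smul_add, hu, hv]
  | smul t v hv => rw [smul_comm, LinearMap.map_smul, LinearMap.map_smul, hv, smul_comm]

lemma wedgeOp_bimod (y : g) : IsBimod (wedgeOp P K y) where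
  left := left_of_elt P K fun r s d c x a c' => by rw [wedgeOp_elt, wedgeOp_elt, smul_elt]
  right := right_of_elt P K fun r s d c x a c' => by rw [wedgeOp_elt, wedgeOp_elt, op_smul_elt]

lemma wedgeOp_self (y : g) (v : XX P K) : wedgeOp P K y (wedgeOp P K y v) = 0 := by
  induction v using XX.induction with
  | elt r s d x a c' =>
    rw [wedgeOp_elt, wedgeOp_elt, elt, X.mk, preMk, AlternatingMap.map_eq_zero_of_eq
      (i := 0) (j := 1) _ _ (by rfl) (by simp)]
    simp
  | add u v hu hv => rw [map_add, map_add, hu, hv, add_zero]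
  | smul t v hv => rw [map_smul, map_smul, hv, smul_zero]

lemma wedgeOp_comm (y z : g) (v : XX P K) :
    wedgeOp P K y (wedgeOp P K z v) = - wedgeOp P K z (wedgeOp P K y v) := by
  have h := wedgeOp_self P K (y + z) v
  simp only [map_add, LinearMap.add_apply, wedgeOp_self, zero_add, add_zero] at h
  rwa [eq_neg_iff_add_eq_zero, add_comm]

variable {P} in
/-- Splitting off the coefficient `a` of the last factor `a θ(h)`. -/
def splitLast (θ : P.Section) (r : ℕ) :
    ((⨂[k]^r A) ⊗[k] P.Alg) →ₗ[k] ((⨂[k]^(r + 1) A) ⊗[k] P.Alg) :=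
  TensorProduct.map (TensorProduct.lift (tpowSnoc r)) θ.toLin ∘ₗ
    (TensorProduct.assoc k (⨂[k]^r A) A (U k g)).symm.toLinearMap ∘ₗ
      LinearMap.lTensor _ θ.equiv.symm.toLinearMap

lemma splitLast_tmul (θ : P.Section) {r : ℕ} (a : Fin r → A) (a' : A) (h : U k g) :
    splitLast θ r (PiTensorProduct.tprod k a ⊗ₜ (P.inA a' * θ.toLin h)) =
      PiTensorProduct.tprod k (Fin.snoc a a' : Fin (r + 1) → A) ⊗ₜ θ.toLin h := by
  simp [splitLast, θ.equiv_symm_mul, tpowSnoc_tprod]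

lemma exists_appendOp (θ : P.Section) : ∃ σ : Module.End k (XX P K),
    ∀ r s c (x : Fin s → g) (a : Fin r → A) a' h,
      σ (elt P K c x a (P.inA a' * θ.toLin h)) =
        (-1 : k) ^ (r + s + 1) • elt P K c x (Fin.snoc a a' : Fin (r + 1) → A) (θ.toLin h) := by
  let F : ∀ r s, PreX P r s →ₗ[k] XX P K := fun r s => (-1 : k) ^ (r + s + 1) •
    (inX P K (r + 1) s ∘ₗ
      X.proj P K (r + 1) s ∘ₗ LinearMap.lTensor P.Alg (LinearMap.lTensor _ (splitLast θ r)))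
  have hF : ∀ r s c (x : Fin s → g) (a : Fin r → A) a' h,
      F r s (preMk P c x a (P.inA a' * θ.toLin h)) =
        (-1 : k) ^ (r + s + 1) • elt P K c x (Fin.snoc a a' : Fin (r + 1) → A) (θ.toLin h) := by
    intro r s c x a a' h
    simp only [F, LinearMap.smul_apply, LinearMap.comp_apply, preMk, LinearMap.lTensor_tmul,
      splitLast_tmul]
    rfl
  have hFadd : ∀ r s c (x : Fin s → g) (a : Fin r → A) c' d,
      F r s (preMk P c x a (c' + d)) = F r s (preMk P c x a c') + F r s (preMk P c x a d) := by
    intro r s c x a c' d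
    rw [← map_add]
    simp only [preMk, TensorProduct.tmul_add]
  obtain ⟨T, hT⟩ := exists_desc P K F (fun r s i t c x a c' ht => by
    induction c' using θ.induction with
    | mul a' h =>
      have hb := elt_balanced P K i.castSucc ht c x (Fin.snoc a a' : Fin (r + 1) → A) (θ.toLin h)
      have e1 : (fun j : Fin (r + 1) => if j.1 + 1 = i.castSucc.1 then
          (Fin.snoc a a' : Fin (r + 1) → A) j * t else (Fin.snoc a a' : Fin (r + 1) → A) j) =
          Fin.snoc (fun j => if j.1 + 1 = i.1 then a j * t else a j) a' := by
        funext j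
        refine Fin.lastCases ?_ (fun j => ?_) j
        · have := i.2
          simp only [Fin.val_castSucc, Fin.val_last, Fin.snoc_last]
          rw [if_neg (by omega)]
        · simp
      have e2 : (fun j : Fin (r + 1) => if j.1 = i.castSucc.1 then
          t * (Fin.snoc a a' : Fin (r + 1) → A) j else (Fin.snoc a a' : Fin (r + 1) → A) j) =
          Fin.snoc (fun j => if j.1 = i.1 then t * a j else a j)
            (if i.1 = r then t * a' else a') := by
        funext j
        refine Fin.lastCases ?_ (fun j => ?_) j
        · simp [eq_comm]
        · simp
      have hi := i.2
      rw [e1, e2, if_neg (show ¬ i.castSucc.1 = r + 1 by simp only [Fin.val_castSucc]; omega)] at hb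
      simp only [Fin.val_castSucc] at hb
      rw [hF, hb]
      split_ifs with h1
      · rw [← mul_assoc, ← P.inA_mul, hF]
      · rw [hF]
    | add u v hu hv =>
      rw [hFadd, hu, hv, ← hFadd]
      congr 2
      split_ifs
      · rw [mul_add]
      · rfl) (fun r s j c x a c' ha => by
    induction c' using θ.induction with
    | mul a' h =>
      rw [hF, elt_eq_zero P K (j := j.castSucc) c x _ (by rwa [Fin.snoc_castSucc]), smul_zero]
    | add u v hu hv => rw [hFadd, hu, hv, add_zero])
  exact ⟨T, fun r s c x a a' h => by rw [hT, hF]⟩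

/-- The operator `c ⊗ x ⊗ a ⊗ a' θ(h) ↦ (-1)^{r+s+1} c ⊗ x ⊗ a ⊗ a' ⊗ θ(h)`, which is the map
`σ⁰` when `θ(h) = 1 # h`. -/
def appendOp (θ : P.Section) : Module.End k (XX P K) := (exists_appendOp P K θ).choose

lemma appendOp_elt (θ : P.Section) {r s : ℕ} (c : P.Alg) (x : Fin s → g) (a : Fin r → A)
    (a' : A) (h : U k g) : appendOp P K θ (elt P K c x a (P.inA a' * θ.toLin h)) =
      (-1 : k) ^ (r + s + 1) • elt P K c x (Fin.snoc a a' : Fin (r + 1) → A) (θ.toLin h) :=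
  (exists_appendOp P K θ).choose_spec r s c x a a' h

lemma exists_collapseOp (K' : Subalgebra k A) (θ : P.Section) : ∃ T : XX P K →ₗ[k] XX P K',
    (∀ s c (x : Fin s → g) (a : Fin 0 → A) a' h, T (elt P K c x a (P.inA a' * θ.toLin h)) =
      elt P K' (c * P.inA a') x a (θ.toLin h)) ∧
    ∀ r s c (x : Fin s → g) (a : Fin (r + 1) → A) c', T (elt P K c x a c') = 0 := by
  let m : P.Alg →ₗ[k] A →ₗ[k] P.Alg := (LinearMap.mul k P.Alg).compl₂ P.inAHom.toLinearMap
  let F : ∀ r s, PreX P r s →ₗ[k] XX P K' := fun r s => if r = 0 then inX P K' r s ∘ₗ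
    X.proj P K' r s ∘ₗ TensorProduct.map (TensorProduct.lift m)
      (LinearMap.lTensor _ (LinearMap.lTensor _ θ.toLin)) ∘ₗ
      (TensorProduct.assoc k P.Alg A _).symm.toLinearMap ∘ₗ
      LinearMap.lTensor P.Alg ((TensorProduct.leftComm k (⋀[k]^s g) A _).toLinearMap ∘ₗ
        LinearMap.lTensor _ ((TensorProduct.leftComm k (⨂[k]^r A) A (U k g)).toLinearMap ∘ₗ
        LinearMap.lTensor _ θ.equiv.symm.toLinearMap)) else 0
  have hF : ∀ s c (x : Fin s → g) (a : Fin 0 → A) a' h,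
      F 0 s (preMk P c x a (P.inA a' * θ.toLin h)) = elt P K' (c * P.inA a') x a (θ.toLin h) := by
    intro s c x a a' h
    simp only [F, if_true, preMk, LinearMap.comp_apply, LinearMap.lTensor_tmul,
      LinearEquiv.coe_coe, θ.equiv_symm_mul, TensorProduct.leftComm_tmul,
      TensorProduct.assoc_symm_tmul, TensorProduct.map_tmul, TensorProduct.lift.tmul]
    rfl
  have hF' : ∀ r s w, r ≠ 0 → F r s w = 0 := by
    intro r s w hr
    simp only [F, if_neg hr, LinearMap.zero_apply]
  obtain ⟨T, hT⟩ := exists_desc P K F (fun r s i t c x a c' ht => by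
    rcases Nat.eq_zero_or_pos r with rfl | hr
    · induction c' using θ.induction with
      | mul a' h =>
        obtain rfl : i = 0 := Fin.ext (by omega)
        rw [if_pos (show (0 : Fin 1).1 = 0 from rfl), if_pos (show (0 : Fin 1).1 = 0 from rfl), hF, ← mul_assoc, ← P.inA_mul, hF, P.inA_mul, mul_assoc]
        congr 1
        exact Subsingleton.elim _ _
      | add u v hu hv =>
        have hFadd : ∀ c (x : Fin s → g) (a : Fin 0 → A) c' d,
            F 0 s (preMk P c x a (c' + d)) = F 0 s (preMk P c x a c') + F 0 s (preMk P c x a d) := by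
          intro c x a c' d
          rw [← map_add]
          simp only [preMk, TensorProduct.tmul_add]
        rw [hFadd, hu, hv, ← hFadd]
        congr 2
        split_ifs
        · rw [mul_add]
        · rfl
    · rw [hF' _ _ _ hr.ne', hF' _ _ _ hr.ne']) (fun r s j c x a c' ha => hF' _ _ _ j.pos.ne')
  exact ⟨T, fun s c x a a' h => by rw [hT, hF], fun r s c x a c' => by
    rw [hT, hF' _ _ _ (Nat.succ_ne_zero r)]⟩

/-- The map `X_{0s}(K) → X_{0s}(K')`, `c ⊗ x ⊗ a' θ(h) ↦ c a' ⊗ x ⊗ θ(h)`, extended by zero. -/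
def collapseOp (K' : Subalgebra k A) (θ : P.Section) : XX P K →ₗ[k] XX P K' :=
  (exists_collapseOp P K K' θ).choose

lemma collapseOp_elt (K' : Subalgebra k A) (θ : P.Section) {s : ℕ} (c : P.Alg) (x : Fin s → g)
    (a : Fin 0 → A) (a' : A) (h : U k g) :
    collapseOp P K K' θ (elt P K c x a (P.inA a' * θ.toLin h)) =
      elt P K' (c * P.inA a') x a (θ.toLin h) :=
  (exists_collapseOp P K K' θ).choose_spec.1 s c x a a' h

lemma collapseOp_elt_succ (K' : Subalgebra k A) (θ : P.Section) {r s : ℕ} (c : P.Alg)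
    (x : Fin s → g) (a : Fin (r + 1) → A) (c' : P.Alg) :
    collapseOp P K K' θ (elt P K c x a c') = 0 :=
  (exists_collapseOp P K K' θ).choose_spec.2 r s c x a c'

end Operators


section AppendProperties

variable {k A g I : Type*} [Field k] [Ring A] [Algebra k A] [LieRing g] [LieAlgebra k g]
  [LinearOrder I] (P : CrossedProduct k A g) (K : Subalgebra k A)

/-- The span of the tensors `c ⊗ x ⊗ a_1 ⊗ ⋯ ⊗ a_r ⊗ a'` whose last factor is in `A`. -/
def XA : Submodule k (XX P K) :=
  Submodule.span k {v | ∃ (r s : ℕ) (c : P.Alg) (x : Fin s → g) (a : Fin r → A) (a' : A),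
    v = elt P K c x a (P.inA a')}

/-- The span of the tensors `c ⊗ x ⊗ a_1 ⊗ ⋯ ⊗ a_r ⊗ 1`. -/
def X1 : Submodule k (XX P K) :=
  Submodule.span k {v | ∃ (r s : ℕ) (c : P.Alg) (x : Fin s → g) (a : Fin r → A),
    v = elt P K c x a 1}

/-- Right multiplication by `c`. -/
abbrev opMul (c : P.Alg) : Module.End k (XX P K) :=
  DistribSMul.toLinearMap k (XX P K) (op c)

/-- The submodule `XA + XA·x`. -/
def XG (x : g) : Submodule k (XX P K) := XA P K ⊔ (XA P K).map (opMul P K (P.inG x))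

variable {P K}

lemma elt_mem_XA {r s : ℕ} (c : P.Alg) (x : Fin s → g) (a : Fin r → A) (a' : A) :
    elt P K c x a (P.inA a') ∈ XA P K := Submodule.subset_span ⟨r, s, c, x, a, a', rfl⟩

lemma elt_mem_X1 {r s : ℕ} (c : P.Alg) (x : Fin s → g) (a : Fin r → A) :
    elt P K c x a 1 ∈ X1 P K := Submodule.subset_span ⟨r, s, c, x, a, rfl⟩

/-- Two linear maps agree on a submodule with a given spanning set. -/
lemma XA_le {Q : Submodule k (XX P K)}
    (h : ∀ (r s : ℕ) c (x : Fin s → g) (a : Fin r → A) a', elt P K c x a (P.inA a') ∈ Q) :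
    XA P K ≤ Q := by
  rw [XA, Submodule.span_le]
  rintro _ ⟨r, s, c, x, a, a', rfl⟩
  exact h r s c x a a'

lemma X1_le {Q : Submodule k (XX P K)}
    (h : ∀ (r s : ℕ) c (x : Fin s → g) (a : Fin r → A), elt P K c x a 1 ∈ Q) :
    X1 P K ≤ Q := by
  rw [X1, Submodule.span_le]
  rintro _ ⟨r, s, c, x, a, rfl⟩
  exact h r s c x a

lemma XA_ext {N : Type*} [AddCommGroup N] [Module k N] {f f' : XX P K →ₗ[k] N}
    (h : ∀ (r s : ℕ) c (x : Fin s → g) (a : Fin r → A) a',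
      f (elt P K c x a (P.inA a')) = f' (elt P K c x a (P.inA a'))) {v : XX P K}
    (hv : v ∈ XA P K) : f v = f' v :=
  XA_le (Q := LinearMap.eqLocus f f') (fun r s c x a a' => h r s c x a a') hv

lemma X1_le_XA : X1 P K ≤ XA P K := X1_le fun r s c x a => by
  rw [← P.inA_one]; exact elt_mem_XA c x a 1

lemma smul_mem_XA (d : P.Alg) {v : XX P K} (hv : v ∈ XA P K) : d • v ∈ XA P K := by
  refine XA_le (Q := (XA P K).comap (DistribSMul.toLinearMap k (XX P K) d)) ?_ hv
  intro r s c x a a'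
  rw [Submodule.mem_comap, DistribSMul.toLinearMap_apply, smul_elt]
  exact elt_mem_XA _ _ _ _

lemma op_smul_mem_XA (b : A) {v : XX P K} (hv : v ∈ XA P K) : op (P.inA b) • v ∈ XA P K := by
  refine XA_le (Q := (XA P K).comap (opMul P K (P.inA b))) ?_ hv
  intro r s c x a a'
  rw [Submodule.mem_comap, DistribSMul.toLinearMap_apply, op_smul_elt, ← P.inA_mul]
  exact elt_mem_XA _ _ _ _

lemma smul_mem_X1 (d : P.Alg) {v : XX P K} (hv : v ∈ X1 P K) : d • v ∈ X1 P K := by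
  refine X1_le (Q := (X1 P K).comap (DistribSMul.toLinearMap k (XX P K) d)) ?_ hv
  intro r s c x a
  rw [Submodule.mem_comap, DistribSMul.toLinearMap_apply, smul_elt]
  exact elt_mem_X1 _ _ _

/-- The elements `v a'` with `v = c ⊗ x ⊗ a ⊗ 1`. -/
lemma elt_inA_eq {r s : ℕ} (c : P.Alg) (x : Fin s → g) (a : Fin r → A) (c' : P.Alg) :
    elt P K c x a c' = op c' • elt P K c x a 1 := by
  rw [op_smul_elt, one_mul]

lemma op_mul_smul (c d : P.Alg) (v : XX P K) : op d • op c • v = op (c * d) • v := by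
  rw [op_mul, mul_smul]

variable (θ θ' : P.Section)

lemma appendOp_elt_inA {r s : ℕ} (c : P.Alg) (x : Fin s → g) (a : Fin r → A) (a' : A) :
    appendOp P K θ (elt P K c x a (P.inA a')) =
      (-1 : k) ^ (r + s + 1) • elt P K c x (Fin.snoc a a' : Fin (r + 1) → A) 1 := by
  have h := appendOp_elt P K θ c x a a' 1
  rwa [θ.map_one, mul_one] at h

lemma appendOp_congr {v : XX P K} (hv : v ∈ XA P K) : appendOp P K θ v = appendOp P K θ' v :=
  XA_ext (fun r s c x a a' => by rw [appendOp_elt_inA, appendOp_elt_inA]) hv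

lemma appendOp_left (c : P.Alg) (v : XX P K) : appendOp P K θ (c • v) = c • appendOp P K θ v :=
  left_of_elt P K (fun r s d c x a c' => by
    induction c' using θ.induction with
    | mul a' h => rw [appendOp_elt, appendOp_elt, smul_comm, smul_elt]
    | add u v hu hv => rw [elt_add_right, elt_add_right, map_add, map_add, hu, hv, smul_add]) c v

lemma appendOp_op_toLin (h : U k g) {v : XX P K} (hv : v ∈ XA P K) :
    appendOp P K θ (op (θ.toLin h) • v) = op (θ.toLin h) • appendOp P K θ v := by
  refine XA_ext (f := appendOp P K θ ∘ₗ opMul P K (θ.toLin h))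
    (f' := opMul P K (θ.toLin h) ∘ₗ appendOp P K θ) ?_ hv
  intro r s c x a a'
  change appendOp P K θ (op (θ.toLin h) • _) = op (θ.toLin h) • appendOp P K θ _
  rw [op_smul_elt, appendOp_elt, appendOp_elt_inA, smul_comm, op_smul_elt, one_mul]

lemma appendOp_op_inG (y : g) {v : XX P K} (hv : v ∈ XA P K) :
    appendOp P K θ (op (P.inG y) • v) = op (P.inG y) • appendOp P K θ v := by
  rw [← θ.map_ι]
  exact appendOp_op_toLin θ _ hv

lemma appendOp_op_inA {t : A} (ht : t ∈ K) {v : XX P K} (hv : v ∈ XA P K) :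
    appendOp P K θ (op (P.inA t) • v) = op (P.inA t) • appendOp P K θ v := by
  refine XA_ext (f := appendOp P K θ ∘ₗ opMul P K (P.inA t))
    (f' := opMul P K (P.inA t) ∘ₗ appendOp P K θ) ?_ hv
  intro r s c x a a'
  change appendOp P K θ (op (P.inA t) • _) = op (P.inA t) • appendOp P K θ _
  rw [op_smul_elt, ← P.inA_mul, appendOp_elt_inA, appendOp_elt_inA, smul_comm, op_smul_elt,
    one_mul, elt_snoc_mul P K _ _ _ _ _ ht, mul_one]

lemma appendOp_X1 {v : XX P K} (hv : v ∈ X1 P K) : appendOp P K θ v = 0 := by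
  refine X1_le (Q := LinearMap.ker (appendOp P K θ)) ?_ hv
  intro r s c x a
  rw [LinearMap.mem_ker, ← P.inA_one, appendOp_elt_inA,
    elt_snoc_eq_zero P K c x _ (one_mem K), smul_zero]

lemma appendOp_mem_X1 {v : XX P K} (hv : v ∈ XA P K) : appendOp P K θ v ∈ X1 P K := by
  refine XA_le (Q := (X1 P K).comap (appendOp P K θ)) ?_ hv
  intro r s c x a a'
  rw [Submodule.mem_comap, appendOp_elt_inA]
  exact Submodule.smul_mem _ _ (elt_mem_X1 _ _ _)

lemma appendOp_appendOp (v : XX P K) : appendOp P K θ (appendOp P K θ v) = 0 := by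
  induction v using XX.induction with
  | elt r s c x a c' =>
    induction c' using θ.induction with
    | mul a' h =>
      rw [appendOp_elt, map_smul, ← one_mul (θ.toLin h), ← P.inA_one, appendOp_elt,
        elt_snoc_eq_zero P K c x _ (one_mem K), smul_zero, smul_zero]
    | add u v hu hv => rw [elt_add_right, map_add, map_add, hu, hv, add_zero]
  | add u v hu hv => rw [map_add, map_add, hu, hv, add_zero]
  | smul t v hv => rw [map_smul, map_smul, hv, smul_zero]

lemma appendOp_wedgeOp (y : g) (v : XX P K) :
    appendOp P K θ (wedgeOp P K y v) = - wedgeOp P K y (appendOp P K θ v) := by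
  induction v using XX.induction with
  | elt r s c x a c' =>
    induction c' using θ.induction with
    | mul a' h =>
      rw [wedgeOp_elt, appendOp_elt, appendOp_elt, map_smul, wedgeOp_elt, ← add_assoc, pow_succ]
      simp
    | add u v hu hv => simp only [elt_add_right, map_add, hu, hv, neg_add]
  | add u v hu hv => simp only [map_add, hu, hv, neg_add]
  | smul t v hv => simp only [map_smul, hv, smul_neg]

lemma elt_snoc_eq {r s : ℕ} (c : P.Alg) (x : Fin s → g) (a : Fin r → A) (a' : A) :
    elt P K c x (Fin.snoc a a' : Fin (r + 1) → A) 1 =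
      (-1 : k) ^ (r + s + 1) • appendOp P K θ (op (P.inA a') • elt P K c x a 1) := by
  rw [← elt_inA_eq, appendOp_elt_inA, smul_smul, ← mul_pow]
  simp

variable (K' : Subalgebra k A)

lemma collapseOp_elt_inA {s : ℕ} (c : P.Alg) (x : Fin s → g) (a : Fin 0 → A) (a' : A) :
    collapseOp P K K' θ (elt P K c x a (P.inA a')) = elt P K' (c * P.inA a') x a 1 := by
  have h := collapseOp_elt P K K' θ c x a a' 1
  rwa [θ.map_one, mul_one] at h

lemma collapseOp_elt_one {s : ℕ} (c : P.Alg) (x : Fin s → g) (a : Fin 0 → A) :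
    collapseOp P K K' θ (elt P K c x a 1) = elt P K' c x a 1 := by
  rw [← P.inA_one, collapseOp_elt_inA, P.inA_one, mul_one]

lemma collapseOp_left (c : P.Alg) (v : XX P K) :
    collapseOp P K K' θ (c • v) = c • collapseOp P K K' θ v :=
  left_of_elt P K (fun r s d c x a c' => by
    rcases r with - | r
    · induction c' using θ.induction with
      | mul a' h => rw [collapseOp_elt, collapseOp_elt, smul_elt, mul_assoc]
      | add u v hu hv => rw [elt_add_right, elt_add_right, map_add, map_add, hu, hv, smul_add]
    · rw [collapseOp_elt_succ, collapseOp_elt_succ, smul_zero]) c v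

lemma collapseOp_op_toLin (h : U k g) {v : XX P K} (hv : v ∈ XA P K) :
    collapseOp P K K' θ (op (θ.toLin h) • v) = op (θ.toLin h) • collapseOp P K K' θ v := by
  refine XA_ext (f := collapseOp P K K' θ ∘ₗ opMul P K (θ.toLin h))
    (f' := opMul P K' (θ.toLin h) ∘ₗ collapseOp P K K' θ) ?_ hv
  intro r s c x a a'
  change collapseOp P K K' θ (op (θ.toLin h) • _) = op (θ.toLin h) • collapseOp P K K' θ _
  rcases r with - | r
  · rw [op_smul_elt, collapseOp_elt, collapseOp_elt_inA, op_smul_elt, one_mul]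
  · rw [op_smul_elt, collapseOp_elt_succ, collapseOp_elt_succ, smul_zero]

lemma collapseOp_op_inA {t : A} (ht : t ∈ K') {v : XX P K} (hv : v ∈ XA P K) :
    collapseOp P K K' θ (op (P.inA t) • v) = op (P.inA t) • collapseOp P K K' θ v := by
  refine XA_ext (f := collapseOp P K K' θ ∘ₗ opMul P K (P.inA t))
    (f' := opMul P K' (P.inA t) ∘ₗ collapseOp P K K' θ) ?_ hv
  intro r s c x a a'
  change collapseOp P K K' θ (op (P.inA t) • _) = op (P.inA t) • collapseOp P K K' θ _
  rcases r with - | r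
  · rw [op_smul_elt, ← P.inA_mul, collapseOp_elt_inA, collapseOp_elt_inA, op_smul_elt, one_mul,
      P.inA_mul, ← mul_assoc, elt_zero_mul P K' _ _ _ _ ht, mul_one]
  · rw [op_smul_elt, collapseOp_elt_succ, collapseOp_elt_succ, smul_zero]

lemma collapseOp_congr {v : XX P K} (hv : v ∈ XA P K) :
    collapseOp P K K' θ v = collapseOp P K K' θ' v :=
  XA_ext (fun r s c x a a' => by
    rcases r with - | r
    · rw [collapseOp_elt_inA, collapseOp_elt_inA]
    · rw [collapseOp_elt_succ, collapseOp_elt_succ]) hv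

lemma collapseOp_mem_X1 {v : XX P K} (hv : v ∈ XA P K) :
    collapseOp P K K' θ v ∈ X1 P K' := by
  refine XA_le (Q := (X1 P K').comap (collapseOp P K K' θ)) ?_ hv
  intro r s c x a a'
  rw [Submodule.mem_comap]
  rcases r with - | r
  · rw [collapseOp_elt_inA]
    exact elt_mem_X1 _ _ _
  · rw [collapseOp_elt_succ]
    exact zero_mem _

lemma collapseOp_wedgeOp (y : g) (v : XX P K) :
    collapseOp P K K' θ (wedgeOp P K y v) = wedgeOp P K' y (collapseOp P K K' θ v) := by
  induction v using XX.induction with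
  | elt r s c x a c' =>
    rcases r with - | r
    · induction c' using θ.induction with
      | mul a' h => rw [wedgeOp_elt, collapseOp_elt, collapseOp_elt, wedgeOp_elt]
      | add u v hu hv => simp only [elt_add_right, map_add, hu, hv]
    · rw [wedgeOp_elt, collapseOp_elt_succ, collapseOp_elt_succ, map_zero]
  | add u v hu hv => simp only [map_add, hu, hv]
  | smul t v hv => simp only [map_smul, hv]

lemma collapseOp_appendOp (v : XX P K) :
    collapseOp P K K' θ (appendOp P K θ' v) = 0 := by
  induction v using XX.induction with
  | elt r s c x a c' =>
    induction c' using θ'.induction with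
    | mul a' h => rw [appendOp_elt, map_smul, collapseOp_elt_succ, smul_zero]
    | add u v hu hv => simp only [elt_add_right, map_add, hu, hv, add_zero]
  | add u v hu hv => simp only [map_add, hu, hv, add_zero]
  | smul t v hv => rw [map_smul, map_smul, hv, smul_zero]

lemma appendOp_collapseOp (v : XX P K) :
    appendOp P K' θ (collapseOp P K K' θ v) = 0 := by
  induction v using XX.induction with
  | elt r s c x a c' =>
    rcases r with - | r
    · induction c' using θ.induction with
      | mul a' h =>
        rw [collapseOp_elt, ← one_mul (θ.toLin h), ← P.inA_one, appendOp_elt,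
          elt_snoc_eq_zero P K' _ x _ (one_mem K'), smul_zero]
      | add u v hu hv => simp only [elt_add_right, map_add, hu, hv, add_zero]
    · rw [collapseOp_elt_succ, map_zero]
  | add u v hu hv => simp only [map_add, hu, hv, add_zero]
  | smul t v hv => rw [map_smul, map_smul, hv, smul_zero]

/-- A map is right `K`-linear if it is compatible with the right multiplication by `K` and by the
values of a `K`-stable section on the tensors with last factor in `A`. -/
lemma right_of_kStable {N : Type*} [AddCommGroup N] [Module k N] [Module P.Algᵐᵒᵖ N]
    [IsScalarTower k P.Algᵐᵒᵖ N] {K₀ : Subalgebra k A} (hθ : θ.KStable K)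
    {T : XX P K₀ →ₗ[k] N}
    (h1 : ∀ h, ∀ v ∈ XA P K₀, T (op (θ.toLin h) • v) = op (θ.toLin h) • T v)
    (h2 : ∀ t ∈ K, ∀ v ∈ XA P K₀, T (op (P.inA t) • v) = op (P.inA t) • T v) :
    IsRightKLin P K T := by
  intro t ht v
  have : SMulCommClass k P.Algᵐᵒᵖ N := IsScalarTower.to_smulCommClass
  have key : ∀ u ∈ Submodule.span k {u | ∃ t' ∈ K, ∃ h', u = P.inA t' * θ.toLin h'},
      ∀ v ∈ XA P K₀, T (op u • v) = op u • T v := by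
    intro u hu v hv
    induction hu using Submodule.span_induction with
    | mem u hu =>
      obtain ⟨t', ht', h', rfl⟩ := hu
      rw [op_mul, mul_smul, mul_smul, h1 _ _ (op_smul_mem_XA t' hv), h2 _ ht' _ hv]
    | zero => simp
    | add x y _ _ hx hy => rw [op_add, add_smul, add_smul, map_add, hx, hy]
    | smul c x _ hx => rw [op_smul, smul_assoc, smul_assoc, map_smul, hx]
  induction v using XX.induction with
  | elt r s c x a c' =>
    induction c' using θ.induction with
    | mul a' h =>
      have hv := elt_mem_XA (K := K₀) c x a a'
      rw [← op_smul_elt, op_mul_smul, key _ (hθ h t ht) _ hv, h1 _ _ hv, ← mul_smul, ← op_mul]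
    | add u v hu hv => rw [elt_add_right, smul_add, map_add, map_add, smul_add, hu, hv]
  | add u v hu hv => rw [smul_add, map_add, map_add, smul_add, hu, hv]
  | smul c v hv => rw [smul_comm, LinearMap.map_smul, LinearMap.map_smul, hv, smul_comm]

end AppendProperties


/-! ### Recursive construction of bimodule maps -/

section Recursion

/-- Dependent choice along the natural numbers. -/
lemma exists_seq {α : ℕ → Type*} (p : ∀ n, α n → Prop) (q : ∀ n, α n → α (n + 1) → Prop)
    (h0 : ∃ a, p 0 a) (hs : ∀ n a, p n a → ∃ a', p (n + 1) a' ∧ q n a a') :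
    ∃ f : ∀ n, α n, (∀ n, p n (f n)) ∧ ∀ n, q n (f n) (f (n + 1)) := by
  choose F hF using hs
  obtain ⟨a, ha⟩ := h0
  let f : ∀ n, {a : α n // p n a} := fun n =>
    Nat.rec ⟨a, ha⟩ (fun n x => ⟨F n x.1 x.2, (hF n x.1 x.2).1⟩) n
  exact ⟨fun n => (f n).1, fun n => (f n).2, fun n => (hF n (f n).1 (f n).2).2⟩

variable {k A g I : Type*} [Field k] [Ring A] [Algebra k A] [LieRing g] [LieAlgebra k g]
  [LinearOrder I] {P : CrossedProduct k A g} {K : Subalgebra k A}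

local notation "σ₀" => appendOp P K (CrossedProduct.stdSection P)
local notation "π₀" => collapseOp P K K (CrossedProduct.stdSection P)
local notation "ω" => wedgeOp P K

/-- Induction on the number of factors in `A`. -/
lemma append_induction {p : ∀ r, (Fin r → A) → Prop}
    (h0 : ∀ a, p 0 a) (hs : ∀ r a a', p r a → p (r + 1) (Fin.snoc a a'))
    (r : ℕ) (a : Fin r → A) : p r a := by
  induction r with
  | zero => exact h0 a
  | succ r ih =>
    rw [← Fin.snoc_init_self a]
    exact hs r _ _ (ih _)

/-- Induction on the degree in the exterior algebra. -/
lemma wedge_induction {p : ∀ s, (Fin s → g) → Prop}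
    (h0 : ∀ x, p 0 x) (hs : ∀ s y x, p s x → p (s + 1) (Fin.cons y x))
    (s : ℕ) (x : Fin s → g) : p s x := by
  induction s with
  | zero => exact h0 x
  | succ s ih =>
    rw [← Fin.cons_self_tail x]
    exact hs s _ _ (ih _)

/-- Bimodule maps agree if they agree on the elements without factors in `A` and the
agreement is inherited by `σ⁰`. -/
lemma IsBimod.ext {T T' : XX P K →ₗ[k] XX P K} (hT : IsBimod T) (hT' : IsBimod T')
    (h0 : ∀ s (x : Fin s → g) (a : Fin 0 → A), T (elt P K 1 x a 1) = T' (elt P K 1 x a 1))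
    (hs : ∀ v ∈ XA P K, T v = T' v → T (σ₀ v) = T' (σ₀ v)) : T = T' := by
  refine XX.hom_ext fun r s c x a c' => ?_
  rw [elt_eq, hT.left, hT.right, hT'.left, hT'.right]
  congr 2
  refine append_induction (p := fun r a => T (elt P K 1 x a 1) = T' (elt P K 1 x a 1))
    (h0 s x) (fun r a a' ih => ?_) r a
  rw [elt_snoc_eq P.stdSection, LinearMap.map_smul, LinearMap.map_smul, hs]
  · rw [op_smul_elt, one_mul]
    exact elt_mem_XA _ _ _ _
  · rw [hT.right, hT'.right, ih]

/-- Linear maps agree if they agree in exterior degree zero and the agreement is inherited by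
the operators `y ∧ -`. -/
lemma wedge_ext {N : Type*} [AddCommGroup N] [Module k N] {T T' : XX P K →ₗ[k] N}
    (h0 : ∀ r c (x : Fin 0 → g) (a : Fin r → A) c', T (elt P K c x a c') = T' (elt P K c x a c'))
    (hs : ∀ y v, T v = T' v → T (ω y v) = T' (ω y v)) : T = T' := by
  refine XX.hom_ext fun r s c x a c' => ?_
  refine wedge_induction (p := fun s x => T (elt P K c x a c') = T' (elt P K c x a c'))
    (fun x => h0 r c x a c') (fun s y x ih => ?_) s x
  rw [← wedgeOp_elt]
  exact hs y _ ih

lemma mem_XG {x : g} {v : XX P K} : v ∈ XG P K x ↔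
    ∃ u ∈ XA P K, ∃ w ∈ XA P K, v = u + op (P.inG x) • w := by
  rw [XG, Submodule.mem_sup]
  constructor
  · rintro ⟨u, hu, z, ⟨w, hw, rfl⟩, rfl⟩
    exact ⟨u, hu, w, hw, rfl⟩
  · rintro ⟨u, hu, w, hw, rfl⟩
    exact ⟨u, hu, _, ⟨w, hw, rfl⟩, rfl⟩

lemma XA_le_XG (x : g) : XA P K ≤ XG P K x := le_sup_left

lemma smul_mem_XG {x : g} (d : P.Alg) {v : XX P K} (hv : v ∈ XG P K x) : d • v ∈ XG P K x := by
  obtain ⟨u, hu, w, hw, rfl⟩ := mem_XG.1 hv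
  rw [smul_add, smul_comm]
  exact mem_XG.2 ⟨_, smul_mem_XA d hu, _, smul_mem_XA d hw, rfl⟩

lemma op_inA_inG (x : g) (a : A) (v : XX P K) : op (P.inA a) • op (P.inG x) • v =
    op (P.inA (P.actG x a)) • v + op (P.inG x) • op (P.inA a) • v := by
  rw [op_mul_smul, P.inG_mul_inA, op_add, add_smul, op_mul, mul_smul]

lemma op_smul_mem_XG {x : g} (a : A) {v : XX P K} (hv : v ∈ XG P K x) :
    op (P.inA a) • v ∈ XG P K x := by
  obtain ⟨u, hu, w, hw, rfl⟩ := mem_XG.1 hv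
  rw [smul_add, op_inA_inG, ← add_assoc]
  exact mem_XG.2 ⟨_, add_mem (op_smul_mem_XA a hu) (op_smul_mem_XA _ hw), _,
    op_smul_mem_XA a hw, rfl⟩

lemma appendOp_mem_XG {x : g} {v : XX P K} (hv : v ∈ XG P K x) : σ₀ v ∈ XG P K x := by
  obtain ⟨u, hu, w, hw, rfl⟩ := mem_XG.1 hv
  rw [map_add, appendOp_op_inG _ _ hw]
  exact mem_XG.2 ⟨_, X1_le_XA (appendOp_mem_X1 _ hu), _, X1_le_XA (appendOp_mem_X1 _ hw), rfl⟩

lemma appendOp_XG {x : g} (hx : ∀ t ∈ K, P.actG x t ∈ K) {t : A} (ht : t ∈ K) {v : XX P K}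
    (hv : v ∈ XG P K x) : σ₀ (op (P.inA t) • v) = op (P.inA t) • σ₀ v := by
  obtain ⟨u, hu, w, hw, rfl⟩ := mem_XG.1 hv
  rw [smul_add, op_inA_inG, map_add, map_add, map_add, appendOp_op_inA _ ht hu,
    appendOp_op_inA _ (hx t ht) hw, appendOp_op_inG _ _ (op_smul_mem_XA _ hw),
    appendOp_op_inA _ ht hw, appendOp_op_inG _ _ hw, smul_add, op_inA_inG]

/-- A bimodule map on `X_{0s}` is given by `K`-central values. -/
lemma exists_bimod_zero (L : XX P K →ₗ[k] XX P K)
    (hL : ∀ t ∈ K, ∀ s (y : Fin s → g) (a : Fin 0 → A),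
      P.inA t • L (elt P K 1 y a 1) = op (P.inA t) • L (elt P K 1 y a 1)) (s : ℕ) :
    ∃ T : X P K 0 s →ₗ[k] XX P K, ∀ c y a c',
      T (X.mk P K c y a c') = c • op c' • L (elt P K 1 y a 1) := by
  let e0 : Fin 0 → A := Fin.elim0
  let J : (⋀[k]^s g) →ₗ[k] XX P K := L ∘ₗ inX P K 0 s ∘ₗ X.proj P K 0 s ∘ₗ
    TensorProduct.mk k P.Alg _ 1 ∘ₗ
    (TensorProduct.mk k (⋀[k]^s g) ((⨂[k]^0 A) ⊗[k] P.Alg)).flip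
      (PiTensorProduct.tprod k e0 ⊗ₜ 1)
  have hJ : ∀ y : Fin s → g, J (exteriorPower.ιMulti k s y) = L (elt P K 1 y e0 1) := fun y => rfl
  have hJK : ∀ t ∈ K, ∀ η, P.inA t • J η = op (P.inA t) • J η := by
    intro t ht η
    have : DistribSMul.toLinearMap k (XX P K) (P.inA t) ∘ₗ J = opMul P K (P.inA t) ∘ₗ J := by
      refine exteriorPower.linearMap_ext (AlternatingMap.ext fun y => ?_)
      exact hL t ht s y e0
    exact LinearMap.congr_fun this η
  let F : P.Alg →ₗ[k] (⋀[k]^s g) →ₗ[k] P.Alg →ₗ[k] XX P K :=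
    { toFun := fun c => LinearMap.mk₂ k (fun η c' => c • op c' • J η)
        (fun η η' c' => by rw [map_add, smul_add, smul_add])
        (fun t η c' => by rw [map_smul, smul_comm (op c') t, smul_comm c t])
        (fun η c' d => by rw [op_add, add_smul, smul_add])
        (fun t η c' => by rw [op_smul, smul_assoc, smul_comm c t])
      map_add' := fun c d => by ext; simp [add_smul]
      map_smul' := fun t c => by ext; simp }
  obtain ⟨T, hT⟩ := X.exists_lift_zero P K F (fun t ht c η c' => by
    change (c * P.inA t) • op c' • J η = c • op (P.inA t * c') • J η
    rw [mul_smul, smul_comm (P.inA t), hJK t ht, op_mul, mul_smul])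
  refine ⟨T, fun c y a c' => ?_⟩
  rw [hT, Subsingleton.elim a e0]
  exact congrArg (fun z => c • op c' • z) (hJ y)

/-- Construction of a bimodule map `T` by recursion on the number of factors in `A`: on `X_{0s}`
it is given by `L`, and `T σ⁰ = ε σ⁰ T + C` on `XA`. -/
lemma exists_append_rec (x : g) (hx : ∀ t ∈ K, P.actG x t ∈ K) (ε : k)
    (C L : Module.End k (XX P K)) (hC : ∀ (c : P.Alg) v, C (c • v) = c • C v)
    (hCZ : ∀ v ∈ XA P K, C v ∈ XG P K x)
    (hCK : ∀ t ∈ K, ∀ v ∈ XA P K, C (op (P.inA t) • v) = op (P.inA t) • C v)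
    (hCσ : ∀ v ∈ XA P K, ε • σ₀ (C v) + C (σ₀ v) = 0)
    (hL : ∀ t ∈ K, ∀ s (y : Fin s → g) (a : Fin 0 → A),
      P.inA t • L (elt P K 1 y a 1) = op (P.inA t) • L (elt P K 1 y a 1))
    (hLZ : ∀ s (y : Fin s → g) (a : Fin 0 → A), L (elt P K 1 y a 1) ∈ XG P K x)
    (hLσ : ∀ s (y : Fin s → g) (a : Fin 0 → A),
      ε • σ₀ (L (elt P K 1 y a 1)) + C (elt P K 1 y a 1) = 0) :
    ∃ T : Module.End k (XX P K), IsBimod T ∧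
      (∀ s (y : Fin s → g) (a : Fin 0 → A), T (elt P K 1 y a 1) = L (elt P K 1 y a 1)) ∧
      (∀ v ∈ XA P K, T (σ₀ v) = ε • σ₀ (T v) + C v) ∧
      ∀ v ∈ X1 P K, T v ∈ XG P K x := by
  let p : ∀ r, (∀ s, X P K r s →ₗ[k] XX P K) → Prop := fun r T =>
    (∀ s c y a c', T s (X.mk P K c y a c') = c • op c' • T s (X.mk P K 1 y a 1)) ∧
    (∀ s y a, T s (X.mk P K 1 y a 1) ∈ XG P K x) ∧
    (∀ s y a, ε • σ₀ (T s (X.mk P K 1 y a 1)) + C (elt P K 1 y a 1) = 0) ∧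
    (r = 0 → ∀ s y a, T s (X.mk P K 1 y a 1) = L (elt P K 1 y a 1))
  let q : ∀ r, (∀ s, X P K r s →ₗ[k] XX P K) → (∀ s, X P K (r + 1) s →ₗ[k] XX P K) → Prop :=
    fun r T T' => ∀ s y a a', T' s (X.mk P K 1 y (Fin.snoc a a' : Fin (r + 1) → A) 1) =
      (-1 : k) ^ (r + s + 1) • (ε • σ₀ (T s (X.mk P K 1 y a (P.inA a'))) +
        C (elt P K 1 y a (P.inA a')))
  obtain ⟨T, hp, hq⟩ := exists_seq p q (by
    choose T hT using exists_bimod_zero L hL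
    have h1 : ∀ s y a, T s (X.mk P K 1 y a 1) = L (elt P K 1 y a 1) := fun s y a => by
      rw [hT, op_one, one_smul, one_smul]
    exact ⟨T, fun s c y a c' => by rw [hT, h1], fun s y a => by rw [h1]; exact hLZ _ _ _,
      fun s y a => by rw [h1]; exact hLσ _ _ _, fun _ => h1⟩) (by
    rintro r T ⟨hT1, hT2, hT3, -⟩
    let G : ∀ s, X P K r s →ₗ[k] XX P K := fun s => (-1 : k) ^ (r + s + 1) •
      (ε • (σ₀ ∘ₗ T s) + C ∘ₗ inX P K r s)
    have hG : ∀ s v, G s v = (-1 : k) ^ (r + s + 1) • (ε • σ₀ (T s v) + C (inX P K r s v)) :=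
      fun s v => rfl
    have hTc : ∀ s c y a c', T s (X.mk P K c y a c') = c • T s (X.mk P K 1 y a c') := by
      intro s c y a c'
      rw [hT1, hT1 s 1 y a c', one_smul]
    have hTr : ∀ s y a c', T s (X.mk P K 1 y a c') = op c' • T s (X.mk P K 1 y a 1) := by
      intro s y a c'
      rw [hT1, one_smul]
    have hGc : ∀ s c y a c', G s (X.mk P K c y a c') = c • G s (X.mk P K 1 y a c') := by
      intro s c y a c'
      have e2 : C (inX P K r s (X.mk P K c y a c')) = c • C (inX P K r s (X.mk P K 1 y a c')) := by
        rw [← hC, smul_inX, X.smul_mk, mul_one]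
      rw [hG, hG, hTc, appendOp_left, e2, smul_comm ε c, ← smul_add, smul_comm c]
    have hTZ : ∀ s y a a', T s (X.mk P K 1 y a (P.inA a')) ∈ XG P K x := by
      intro s y a a'
      rw [hTr]
      exact op_smul_mem_XG _ (hT2 s y a)
    have hGt : ∀ s y a a', ∀ t ∈ K, G s (X.mk P K 1 y a (P.inA (a' * t))) =
        op (P.inA t) • G s (X.mk P K 1 y a (P.inA a')) := by
      intro s y a a' t ht
      have e1 : T s (X.mk P K 1 y a (P.inA (a' * t))) =
          op (P.inA t) • T s (X.mk P K 1 y a (P.inA a')) := by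
        rw [hTr, hTr s y a (P.inA a'), op_mul_smul, P.inA_mul]
      have e2 : elt P K 1 y a (P.inA (a' * t)) = op (P.inA t) • elt P K 1 y a (P.inA a') := by
        rw [op_smul_elt, P.inA_mul]
      rw [hG, hG, e1, appendOp_XG hx ht (hTZ _ _ _ _)]
      change _ • (_ + C (elt P K 1 y a (P.inA (a' * t)))) = op (P.inA t) •
        (_ • (_ + C (elt P K 1 y a (P.inA a'))))
      rw [e2, hCK t ht _ (elt_mem_XA _ _ _ _), smul_comm ε, ← smul_add, smul_comm (op (P.inA t))]
    have hG1 : ∀ s y a, ∀ t ∈ K, G s (X.mk P K 1 y a (P.inA t)) = 0 := by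
      intro s y a t ht
      rw [← one_mul t, hGt _ _ _ _ _ ht, P.inA_one, hG]
      change op (P.inA t) • (_ • (_ + C (elt P K 1 y a 1))) = 0
      rw [hT3, smul_zero, smul_zero]
    choose T' hT' using fun s => X.exists_lift_snoc P K (G s)
      (fun c y a t ht => by rw [hGc, hG1 _ _ _ _ ht, smul_zero])
      (fun c y a a' t ht => by rw [hGc, hGt _ _ _ _ _ ht, hGc s c y a, smul_comm])
    have hT'1 : ∀ s y a a', T' s (X.mk P K 1 y (Fin.snoc a a' : Fin (r + 1) → A) 1) =
        G s (X.mk P K 1 y a (P.inA a')) := by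
      intro s y a a'
      rw [hT', op_one, one_smul, Fin.init_snoc, Fin.snoc_last]
    refine ⟨T', ⟨fun s c y a c' => ?_, fun s y a => ?_, fun s y a => ?_, fun h => by omega⟩, hT'1⟩
    · rw [hT', hT', hGc, smul_comm c, op_one, one_smul]
    · rw [← Fin.snoc_init_self a, hT'1, hG]
      exact Submodule.smul_mem _ _ (add_mem (Submodule.smul_mem _ _
        (appendOp_mem_XG (hTZ _ _ _ _))) (hCZ _ (elt_mem_XA _ _ _ _)))
    · have e1 : elt P K 1 y a 1 = (-1 : k) ^ (r + s + 1) • σ₀ (elt P K 1 y (Fin.init a)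
          (P.inA (a (Fin.last r)))) := by
        conv_lhs => rw [← Fin.snoc_init_self a]
        rw [elt_snoc_eq P.stdSection, ← elt_inA_eq]
      conv_lhs =>
        arg 1
        rw [← Fin.snoc_init_self a]
      rw [hT'1, hG, e1, map_smul, map_smul, smul_comm ε, ← smul_add, map_add, map_smul,
        appendOp_appendOp, smul_zero, zero_add]
      have := hCσ (elt P K 1 y (Fin.init a) (P.inA (a (Fin.last r)))) (elt_mem_XA _ _ _ _)
      change _ • (ε • σ₀ (C (elt P K 1 y (Fin.init a) (P.inA (a (Fin.last r))))) + _) = 0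
      rw [this, smul_zero])
  let S : Module.End k (XX P K) := DirectSum.toModule k _ _ fun p => T p.1 p.2
  have hS : ∀ r s c (y : Fin s → g) (a : Fin r → A) c',
      S (elt P K c y a c') = T r s (X.mk P K c y a c') := by
    intro r s c y a c'
    simp only [S, elt, inX, DirectSum.toModule_lof]
  have hSr : ∀ (c : P.Alg) v, S (op c • v) = op c • S v :=
    right_of_elt P K fun r s d c y a c' => by
      rw [hS, hS, (hp r).1, (hp r).1 s c y a c', op_mul, mul_smul, smul_comm c (op d)]
  have hSl : ∀ (c : P.Alg) v, S (c • v) = c • S v := left_of_elt P K fun r s d c y a c' => by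
      rw [hS, hS, (hp r).1, (hp r).1 s c y a c', mul_smul]
  refine ⟨S, ⟨hSl, hSr⟩, fun s y a => ?_, fun v hv => ?_, fun v hv => ?_⟩
  · rw [hS, (hp 0).2.2.2 rfl]
  · refine XA_ext (f := S ∘ₗ σ₀) (f' := ε • (σ₀ ∘ₗ S) + C) ?_ hv
    intro r s c y a a'
    change S (σ₀ _) = ε • σ₀ (S _) + C _
    have e1 : elt P K c y a (P.inA a') = c • elt P K 1 y a (P.inA a') := by
      rw [smul_elt, mul_one]
    rw [e1, appendOp_left, hSl, hSl, appendOp_left, hC, smul_comm ε, ← smul_add]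
    congr 1
    rw [appendOp_elt_inA, map_smul, hS, hq, smul_smul, ← mul_pow, hS]
    simp
  · refine X1_le (Q := (XG P K x).comap S) ?_ hv
    intro r s c y a
    rw [Submodule.mem_comap, hS, (hp r).1, op_one, one_smul]
    exact smul_mem_XG _ ((hp r).2.1 s y a)

/-- Construction of a map `T` by recursion on the exterior degree: it is `T₀` in exterior degree
zero, and `T (y ∧ v) = ε y ∧ T v + B_y v`. -/
lemma exists_wedge_rec (ε : k) (B : g →ₗ[k] Module.End k (XX P K)) (T₀ : Module.End k (XX P K))
    (hT₀ : IsBimod T₀) (hB : ∀ y, IsBimod (B y))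
    (hw : ∀ y v, B y (ω y v) + ε • ω y (B y v) = 0) :
    ∃ T : Module.End k (XX P K), IsBimod T ∧
      (∀ r c (y : Fin 0 → g) (a : Fin r → A) c', T (elt P K c y a c') = T₀ (elt P K c y a c')) ∧
      ∀ y v, T (ω y v) = ε • ω y (T v) + B y v := by
  let p : ∀ s, (∀ r, X P K r s →ₗ[k] XX P K) → Prop := fun s T =>
    (∀ r c y a c', T r (X.mk P K c y a c') = c • op c' • T r (X.mk P K 1 y a 1)) ∧
    (∀ r c (y : Fin s → g) a c' (i : Fin s), i.1 = 0 →
      ε • ω (y i) (T r (X.mk P K c y a c')) + B (y i) (elt P K c y a c') = 0) ∧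
    (s = 0 → ∀ r c y a c', T r (X.mk P K c y a c') = T₀ (elt P K c y a c'))
  let q : ∀ s, (∀ r, X P K r s →ₗ[k] XX P K) → (∀ r, X P K r (s + 1) →ₗ[k] XX P K) → Prop :=
    fun s T T' => ∀ r c y z a c', T' r (X.mk P K c (Fin.cons y z : Fin (s + 1) → g) a c') =
      ε • ω y (T r (X.mk P K c z a c')) + B y (elt P K c z a c')
  obtain ⟨T, hp, hq⟩ := exists_seq p q
    ⟨fun r => T₀ ∘ₗ inX P K r 0, fun r c y a c' => by
      change T₀ (elt P K c y a c') = c • op c' • T₀ (elt P K 1 y a 1)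
      rw [← hT₀.right, ← hT₀.left, ← elt_eq], fun r c y a c' i => i.elim0, fun _ r c y a c' => rfl⟩ (by
    rintro s T ⟨hT1, hT2, -⟩
    let F : ∀ r, g →ₗ[k] X P K r s →ₗ[k] XX P K := fun r =>
      ε • (LinearMap.lcomp k _ (T r) ∘ₗ ω) + LinearMap.lcomp k _ (inX P K r s) ∘ₗ B
    have hF : ∀ r y v, F r y v = ε • ω y (T r v) + B y (inX P K r s v) := fun r y v => rfl
    choose T' hT' using fun r => X.exists_lift_cons P K (F r) (fun c y a c' i hi hy => by
      rw [hF, ← hy]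
      exact hT2 r c (Fin.tail y) a c' i hi)
    have hT'1 : ∀ r c y z a c', T' r (X.mk P K c (Fin.cons y z : Fin (s + 1) → g) a c') =
        ε • ω y (T r (X.mk P K c z a c')) + B y (elt P K c z a c') := by
      intro r c y z a c'
      rw [hT', hF, Fin.cons_zero, Fin.tail_cons]
      rfl
    refine ⟨T', ⟨fun r c y a c' => ?_, fun r c y a c' i hi => ?_,
      fun h => by omega⟩, hT'1⟩
    · rw [← Fin.cons_self_tail y, hT'1, hT'1, hT1, (wedgeOp_bimod P K _).left,
        (wedgeOp_bimod P K _).right, elt_eq, (hB _).left, (hB _).right]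
      simp only [smul_add]
      rw [smul_comm (op c') ε, smul_comm c ε]
    · obtain rfl : i = 0 := Fin.ext hi
      rw [← Fin.cons_self_tail y, hT'1, Fin.cons_zero, map_add, map_smul, wedgeOp_self, smul_zero,
        zero_add, ← wedgeOp_elt, add_comm]
      exact hw _ _)
  let S : Module.End k (XX P K) := DirectSum.toModule k _ _ fun p => T p.2 p.1
  have hS : ∀ r s c (y : Fin s → g) (a : Fin r → A) c',
      S (elt P K c y a c') = T s r (X.mk P K c y a c') := by
    intro r s c y a c'
    simp only [S, elt, inX, DirectSum.toModule_lof]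
  refine ⟨S, ⟨left_of_elt P K fun r s d c y a c' => ?_,
    right_of_elt P K fun r s d c y a c' => ?_⟩, fun r c y a c' => ?_, fun y v => ?_⟩
  · rw [hS, hS, (hp s).1, (hp s).1 r c y a c', mul_smul]
  · rw [hS, hS, (hp s).1, (hp s).1 r c y a c', op_mul, mul_smul, smul_comm c (op d)]
  · rw [hS, (hp 0).2.2 rfl]
  · have : S ∘ₗ ω y = ε • (ω y ∘ₗ S) + B y := XX.hom_ext fun r s c z a c' => by
      change S (ω y _) = ε • ω y (S _) + B y _
      rw [wedgeOp_elt, hS, hq, hS]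
    exact LinearMap.congr_fun this v

end Recursion


/-! ### The differential `d⁰`, the operators `Λ_x` and the insertions `h_q` -/

section Horizontal

variable {k A g I : Type*} [Field k] [Ring A] [Algebra k A] [LieRing g] [LieAlgebra k g]
  [LinearOrder I] {P : CrossedProduct k A g} {K K' K'' : Subalgebra k A}

namespace IsBimod

lemma comp {T : XX P K' →ₗ[k] XX P K''} {T' : XX P K →ₗ[k] XX P K'} (hT : IsBimod T)
    (hT' : IsBimod T') : IsBimod (T ∘ₗ T') where
  left c v := by rw [LinearMap.comp_apply, hT'.left, hT.left, LinearMap.comp_apply]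
  right c v := by rw [LinearMap.comp_apply, hT'.right, hT.right, LinearMap.comp_apply]

lemma add {T T' : XX P K →ₗ[k] XX P K'} (hT : IsBimod T)
    (hT' : IsBimod T') : IsBimod (T + T') where
  left c v := by
    rw [LinearMap.add_apply, hT'.left, hT.left, LinearMap.add_apply, smul_add]
  right c v := by
    rw [LinearMap.add_apply, hT'.right, hT.right, LinearMap.add_apply, smul_add]

lemma smul {T : XX P K →ₗ[k] XX P K'} (hT : IsBimod T) (t : k) : IsBimod (t • T) where
  left c v := by rw [LinearMap.smul_apply, hT.left, LinearMap.smul_apply, smul_comm]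
  right c v := by rw [LinearMap.smul_apply, hT.right, LinearMap.smul_apply, smul_comm]

lemma neg {T : XX P K →ₗ[k] XX P K'} (hT : IsBimod T) : IsBimod (-T) where
  left c v := by rw [LinearMap.neg_apply, hT.left, LinearMap.neg_apply, smul_neg]
  right c v := by rw [LinearMap.neg_apply, hT.right, LinearMap.neg_apply, smul_neg]

lemma sub {T T' : XX P K →ₗ[k] XX P K'} (hT : IsBimod T)
    (hT' : IsBimod T') : IsBimod (T - T') := by
  rw [sub_eq_add_neg]; exact hT.add hT'.neg

lemma zero : IsBimod (0 : XX P K →ₗ[k] XX P K') where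
  left c v := by simp
  right c v := by simp

lemma mem_XA {T : XX P K →ₗ[k] XX P K} (hT : IsBimod T) (h : ∀ v ∈ X1 P K, T v ∈ XA P K)
    {v : XX P K} (hv : v ∈ XA P K) : T v ∈ XA P K := by
  refine XA_le (Q := (XA P K).comap T) (fun r s c x a a' => ?_) hv
  rw [Submodule.mem_comap, elt_inA_eq, hT.right]
  exact op_smul_mem_XA _ (h _ (elt_mem_X1 _ _ _))

end IsBimod

local notation "σ₀" => appendOp P K (CrossedProduct.stdSection P)
local notation "π₀" => collapseOp P K K (CrossedProduct.stdSection P)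
local notation "ω" => wedgeOp P K

lemma P_actG_zero (a : A) : P.actG 0 a = 0 := by simp [CrossedProduct.actG]

lemma inG_zero : P.inG 0 = 0 := by rw [← P.inGLin_apply, map_zero]

lemma XG_zero : XG P K 0 = XA P K := by
  refine le_antisymm (fun v hv => ?_) (XA_le_XG 0)
  obtain ⟨u, hu, w, hw, rfl⟩ := mem_XG.1 hv
  rw [inG_zero, op_zero, zero_smul, add_zero]
  exact hu

variable (P K) in
/-- The span of the components `X_{rs}` with `r > 0`. -/
def XPos : Submodule k (XX P K) :=
  Submodule.span k {v | ∃ (r s : ℕ) (c : P.Alg) (x : Fin s → g) (a : Fin (r + 1) → A) (c' : P.Alg),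
    v = elt P K c x a c'}

lemma elt_mem_XPos {r s : ℕ} (c : P.Alg) (x : Fin s → g) (a : Fin (r + 1) → A) (c' : P.Alg) :
    elt P K c x a c' ∈ XPos P K := Submodule.subset_span ⟨r, s, c, x, a, c', rfl⟩

lemma XPos_le {Q : Submodule k (XX P K)}
    (h : ∀ (r s : ℕ) c (x : Fin s → g) (a : Fin (r + 1) → A) c', elt P K c x a c' ∈ Q) :
    XPos P K ≤ Q := by
  rw [XPos, Submodule.span_le]
  rintro _ ⟨r, s, c, x, a, a', rfl⟩
  exact h r s c x a a'

lemma smul_mem_XPos (d : P.Alg) {v : XX P K} (hv : v ∈ XPos P K) : d • v ∈ XPos P K := by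
  refine XPos_le (Q := (XPos P K).comap (DistribSMul.toLinearMap k (XX P K) d)) ?_ hv
  intro r s c x a a'
  rw [Submodule.mem_comap, DistribSMul.toLinearMap_apply, smul_elt]
  exact elt_mem_XPos _ _ _ _

lemma op_smul_mem_XPos (d : P.Alg) {v : XX P K} (hv : v ∈ XPos P K) : op d • v ∈ XPos P K := by
  refine XPos_le (Q := (XPos P K).comap (opMul P K d)) ?_ hv
  intro r s c x a a'
  rw [Submodule.mem_comap, DistribSMul.toLinearMap_apply, op_smul_elt]
  exact elt_mem_XPos _ _ _ _

lemma collapseOp_XPos (θ : P.Section) {v : XX P K} (hv : v ∈ XPos P K) :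
    collapseOp P K K' θ v = 0 :=
  XPos_le (Q := LinearMap.ker (collapseOp P K K' θ))
    (fun _ _ c x a c' => collapseOp_elt_succ P K K' θ c x a c') hv

lemma appendOp_mem_XPos (θ : P.Section) (v : XX P K) : appendOp P K θ v ∈ XPos P K := by
  induction v using XX.induction with
  | elt r s c x a c' =>
    induction c' using θ.induction with
    | mul a' h =>
      rw [appendOp_elt]
      exact Submodule.smul_mem _ _ (elt_mem_XPos _ _ _ _)
    | add u v hu hv => rw [elt_add_right, map_add]; exact add_mem hu hv
  | add u v hu hv => rw [map_add]; exact add_mem hu hv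
  | smul t v hv => rw [map_smul]; exact Submodule.smul_mem _ _ hv

lemma collapseOp_collapseOp {v : XX P K} (hv : v ∈ XA P K) (a : A) :
    π₀ (op (P.inA a) • π₀ v) = π₀ (op (P.inA a) • v) := by
  refine XA_ext (f := π₀ ∘ₗ opMul P K (P.inA a) ∘ₗ π₀) (f' := π₀ ∘ₗ opMul P K (P.inA a)) ?_ hv
  intro r _ c x a₁ a'
  change π₀ (op (P.inA a) • π₀ _) = π₀ (op (P.inA a) • _)
  rcases r with - | r
  · rw [collapseOp_elt_inA, op_smul_elt, one_mul, collapseOp_elt_inA, op_smul_elt, ← P.inA_mul,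
      collapseOp_elt_inA, P.inA_mul, mul_assoc]
  · rw [collapseOp_elt_succ, op_smul_elt, collapseOp_elt_succ, smul_zero, map_zero]

lemma exists_dZero : ∃ T : Module.End k (XX P K), IsBimod T ∧
      (∀ s (y : Fin s → g) (a : Fin 0 → A), T (elt P K 1 y a 1) = 0) ∧
      (∀ v ∈ XA P K, T (σ₀ v) = v - σ₀ (T v) - π₀ v) ∧
      ∀ v ∈ X1 P K, T v ∈ XA P K := by
  obtain ⟨T, h1, h2, h3, h4⟩ := exists_append_rec (P := P) (K := K) 0
    (fun t _ => by rw [P_actG_zero]; exact zero_mem K) (-1) (1 - π₀) 0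
    (fun c v => by
      rw [LinearMap.sub_apply, LinearMap.sub_apply, collapseOp_left, smul_sub]; rfl)
    (fun v hv => XA_le_XG 0 (sub_mem hv (X1_le_XA (collapseOp_mem_X1 _ _ hv))))
    (fun t ht v hv => by
      rw [LinearMap.sub_apply, LinearMap.sub_apply, collapseOp_op_inA _ _ ht hv, smul_sub]; rfl)
    (fun v hv => by
      simp only [LinearMap.sub_apply, Module.End.one_apply, map_sub, collapseOp_appendOp,
        appendOp_collapseOp]
      simp)
    (fun t ht s y a => by simp)
    (fun s y a => zero_mem _)
    (fun s y a => by simp [collapseOp_elt_one])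
  refine ⟨T, h1, fun s y a => by rw [h2]; rfl, fun v hv => ?_, fun v hv => ?_⟩
  · rw [h3 v hv, LinearMap.sub_apply, Module.End.one_apply]
    simp only [neg_smul, one_smul]
    abel
  · rw [← XG_zero]
    exact h4 v hv

variable (P K) in
/-- The differential `d⁰`. -/
def dZero : Module.End k (XX P K) := exists_dZero.choose

lemma dZero_bimod : IsBimod (dZero P K) := exists_dZero.choose_spec.1

lemma dZero_elt_zero {s : ℕ} (c : P.Alg) (y : Fin s → g) (a : Fin 0 → A) (c' : P.Alg) :
    dZero P K (elt P K c y a c') = 0 := by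
  rw [elt_eq, dZero_bimod.left, dZero_bimod.right, dZero, exists_dZero.choose_spec.2.1, smul_zero,
    smul_zero]

lemma dZero_mem_XA {v : XX P K} (hv : v ∈ XA P K) : dZero P K v ∈ XA P K :=
  dZero_bimod.mem_XA exists_dZero.choose_spec.2.2.2 hv

lemma dZero_appendOp_of_mem {v : XX P K} (hv : v ∈ XA P K) :
    dZero P K (σ₀ v) = v - σ₀ (dZero P K v) - π₀ v := exists_dZero.choose_spec.2.2.1 v hv

/-- `σ⁰` is a contracting homotopy for `d⁰`, up to the projection to `X_{0s}`. -/
lemma dZero_appendOp (θ : P.Section) (v : XX P K) :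
    dZero P K (appendOp P K θ v) = v - appendOp P K θ (dZero P K v) - collapseOp P K K θ v := by
  induction v using XX.induction with
  | elt r s c x a c' =>
    induction c' using θ.induction with
    | mul a' h =>
      have hv := elt_mem_XA (K := K) c x a a'
      rw [← op_smul_elt, appendOp_op_toLin _ _ hv, dZero_bimod.right, dZero_bimod.right,
        appendOp_op_toLin _ _ (dZero_mem_XA hv), collapseOp_op_toLin _ _ _ hv,
        appendOp_congr θ P.stdSection hv, dZero_appendOp_of_mem hv,
        appendOp_congr θ P.stdSection (dZero_mem_XA hv), collapseOp_congr θ P.stdSection _ hv,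
        smul_sub, smul_sub]
    | add u v hu hv =>
      simp only [elt_add_right, map_add, hu, hv]
      abel
  | add u v hu hv =>
    simp only [map_add, hu, hv]
    abel
  | smul t v hv => simp only [map_smul, hv, smul_sub]

lemma dZero_collapseOp (θ : P.Section) (v : XX P K') : dZero P K (collapseOp P K' K θ v) = 0 := by
  induction v using XX.induction with
  | elt r s c x a c' =>
    rcases r with - | r
    · induction c' using θ.induction with
      | mul a' h => rw [collapseOp_elt, dZero_elt_zero]
      | add u v hu hv => rw [elt_add_right, map_add, map_add, hu, hv, add_zero]
    · rw [collapseOp_elt_succ, map_zero]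
  | add u v hu hv => rw [map_add, map_add, hu, hv, add_zero]
  | smul t v hv => rw [map_smul, map_smul, hv, smul_zero]

lemma collapseOp_dZero {v : XX P K} (hv : v ∈ XA P K) : π₀ (dZero P K v) = 0 := by
  refine XA_ext (f := π₀ ∘ₗ dZero P K) (f' := 0) ?_ hv
  intro r s c x a a'
  change π₀ (dZero P K _) = 0
  rcases r with - | r
  · rw [dZero_elt_zero, map_zero]
  · obtain ⟨u, hu, he⟩ : ∃ u ∈ XA P K, elt P K c x a 1 = σ₀ u := by
      refine ⟨(-1 : k) ^ (r + s + 1) • elt P K c x (Fin.init a) (P.inA (a (Fin.last r))),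
        Submodule.smul_mem _ _ (elt_mem_XA _ _ _ _), ?_⟩
      conv_lhs => rw [← Fin.snoc_init_self a]
      rw [elt_snoc_eq P.stdSection, ← elt_inA_eq, map_smul]
    rw [elt_inA_eq, dZero_bimod.right, he, dZero_appendOp, smul_sub, smul_sub, map_sub, map_sub,
      collapseOp_collapseOp hu, collapseOp_XPos _ (op_smul_mem_XPos _ (appendOp_mem_XPos _ _)),
      sub_zero, sub_self]

lemma dZero_dZero (v : XX P K) : dZero P K (dZero P K v) = 0 := by
  have : dZero P K ∘ₗ dZero P K = 0 := by
    refine (dZero_bimod.comp dZero_bimod).ext .zero (fun s x a => ?_) (fun v hv ih => ?_)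
    · change dZero P K (dZero P K _) = 0
      rw [dZero_elt_zero, map_zero]
    · change dZero P K (dZero P K (σ₀ v)) = 0
      replace ih : dZero P K (dZero P K v) = 0 := ih
      rw [dZero_appendOp, map_sub, map_sub, dZero_appendOp, dZero_collapseOp, ih,
        collapseOp_dZero hv]
      simp
  exact LinearMap.congr_fun this v

lemma dZero_wedgeOp (y : g) (v : XX P K) : dZero P K (ω y v) = - ω y (dZero P K v) := by
  have : dZero P K ∘ₗ ω y = - (ω y ∘ₗ dZero P K) := by
    refine (dZero_bimod.comp (wedgeOp_bimod P K y)).ext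
      ((wedgeOp_bimod P K y).comp dZero_bimod).neg (fun s x a => ?_) (fun v hv ih => ?_)
    · change dZero P K (ω y _) = - ω y (dZero P K _)
      rw [wedgeOp_elt, dZero_elt_zero, dZero_elt_zero, map_zero, neg_zero]
    · change dZero P K (ω y _) = - ω y (dZero P K _)
      replace ih : dZero P K (ω y v) = - ω y (dZero P K v) := ih
      have e : ω y (σ₀ v) = - σ₀ (ω y v) := by rw [appendOp_wedgeOp, neg_neg]
      rw [e, map_neg, dZero_appendOp, ih, dZero_appendOp, map_neg, appendOp_wedgeOp,
        collapseOp_wedgeOp, map_sub, map_sub]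
      abel
  exact LinearMap.congr_fun this v

/-! The operators `Λ_x`. -/

lemma exists_lieOp (hK : P.Stable K) (x : g) : ∃ T : Module.End k (XX P K), IsBimod T ∧
      (∀ s (y : Fin s → g) (a : Fin 0 → A), T (elt P K 1 y a 1) =
        P.inG x • elt P K 1 y a 1 - op (P.inG x) • elt P K 1 y a 1) ∧
      (∀ v ∈ XA P K, T (σ₀ v) = σ₀ (T v)) := by
  have hx : ∀ t ∈ K, P.actG x t ∈ K := fun t ht => hK x t ht
  obtain ⟨T, h1, h2, h3, h4⟩ := exists_append_rec (P := P) (K := K) x hx 1 0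
    (DistribSMul.toLinearMap k (XX P K) (P.inG x) - opMul P K (P.inG x))
    (fun c v => by simp) (fun v hv => zero_mem _) (fun t ht v hv => by simp)
    (fun v hv => by simp)
    (fun t ht s y a => by
      change P.inA t • (P.inG x • elt P K 1 y a 1 - op (P.inG x) • elt P K 1 y a 1) =
        op (P.inA t) • (P.inG x • elt P K 1 y a 1 - op (P.inG x) • elt P K 1 y a 1)
      have e : ∀ t ∈ K, op (P.inA t) • elt P K 1 y a 1 = P.inA t • elt P K 1 y a 1 := by
        intro t ht
        rw [op_smul_elt, smul_elt, one_mul, mul_one, ← mul_one (P.inA t), ← elt_zero_mul _ _ _ _ _ _ ht,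
          one_mul, mul_one]
      rw [smul_sub, smul_sub, op_inA_inG, ← smul_comm (P.inG x) (op (P.inA t)), e t ht,
        e _ (hx t ht), ← smul_comm (P.inA t) (op (P.inG x)), ← mul_smul (P.inG x), P.inG_mul_inA, add_smul, mul_smul]
      abel)
    (fun s y a => sub_mem (smul_mem_XG _ (XA_le_XG x (X1_le_XA (elt_mem_X1 _ _ _))))
      (mem_XG.2 ⟨0, zero_mem _, _, X1_le_XA (elt_mem_X1 _ _ _), (zero_add _).symm⟩))
    (fun s y a => by
      change (1 : k) • σ₀ (P.inG x • elt P K 1 y a 1 - op (P.inG x) • elt P K 1 y a 1) + 0 = 0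
      rw [map_sub, appendOp_left, appendOp_op_inG _ _ (X1_le_XA (elt_mem_X1 _ _ _)),
        appendOp_X1 _ (elt_mem_X1 _ _ _)]
      simp)
  refine ⟨T, h1, h2, fun v hv => ?_⟩
  rw [h3 v hv, one_smul, LinearMap.zero_apply, add_zero]

/-- The operators `Λ_x`: on `X_{0s}` it is the commutator with `x`, and it commutes with `σ⁰`
on `XA`. -/
def lieOp (hK : P.Stable K) : g →ₗ[k] Module.End k (XX P K) where
  toFun x := (exists_lieOp hK x).choose
  map_add' x y := by
    obtain ⟨h1, h2, h3⟩ := (exists_lieOp hK x).choose_spec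
    obtain ⟨h1', h2', h3'⟩ := (exists_lieOp hK y).choose_spec
    obtain ⟨h1'', h2'', h3''⟩ := (exists_lieOp hK (x + y)).choose_spec
    refine h1''.ext (h1.add h1') (fun s z a => ?_) (fun v hv ih => ?_)
    · rw [LinearMap.add_apply, h2, h2', h2'', P.inG_add, op_add, add_smul, add_smul]
      abel
    · rw [LinearMap.add_apply, h3 v hv, h3' v hv, h3'' v hv, ih, LinearMap.add_apply, map_add]
  map_smul' t x := by
    obtain ⟨h1, h2, h3⟩ := (exists_lieOp hK x).choose_spec
    obtain ⟨h1'', h2'', h3''⟩ := (exists_lieOp hK (t • x)).choose_spec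
    refine h1''.ext (h1.smul t) (fun s z a => ?_) (fun v hv ih => ?_)
    · rw [LinearMap.smul_apply, h2, h2'', P.inG_smul, op_smul, smul_assoc, smul_assoc, smul_sub,
        RingHom.id_apply]
    · rw [LinearMap.smul_apply, h3 v hv, h3'' v hv, ih, LinearMap.smul_apply, map_smul]

variable (hK : P.Stable K)

lemma lieOp_bimod (x : g) : IsBimod (lieOp hK x) := (exists_lieOp hK x).choose_spec.1

lemma lieOp_elt (x : g) {s : ℕ} (y : Fin s → g) (a : Fin 0 → A) :
    lieOp hK x (elt P K 1 y a 1) =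
        P.inG x • elt P K 1 y a 1 - op (P.inG x) • elt P K 1 y a 1 :=
  (exists_lieOp hK x).choose_spec.2.1 s y a

lemma lieOp_appendOp (x : g) {v : XX P K} (hv : v ∈ XA P K) :
    lieOp hK x (σ₀ v) = σ₀ (lieOp hK x v) := (exists_lieOp hK x).choose_spec.2.2 v hv

lemma op_inG_inA (x : g) (a : A) (v : XX P K) : op (P.inG x) • op (P.inA a) • v =
    op (P.inA a) • op (P.inG x) • v - op (P.inA (P.actG x a)) • v := by
  rw [op_inA_inG, add_sub_cancel_left]

lemma lieOp_add_mem_X1 (x : g) {v : XX P K} (hv : v ∈ X1 P K) :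
    lieOp hK x v + op (P.inG x) • v ∈ X1 P K := by
  refine X1_le (Q := (X1 P K).comap (lieOp hK x + opMul P K (P.inG x))) ?_ hv
  intro r s c y a
  rw [Submodule.mem_comap]
  change lieOp hK x (elt P K c y a 1) + op (P.inG x) • elt P K c y a 1 ∈ X1 P K
  have e : elt P K c y a 1 = c • elt P K 1 y a 1 := by rw [smul_elt, mul_one]
  rw [e, (lieOp_bimod hK x).left, ← smul_comm c, ← smul_add]
  refine smul_mem_X1 _ ?_
  refine append_induction (p := fun r a => lieOp hK x (elt P K 1 y a 1) +
    op (P.inG x) • elt P K 1 y a 1 ∈ X1 P K) (fun a => ?_) (fun r a a' ih => ?_) r a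
  · rw [lieOp_elt, sub_add_cancel]
    exact smul_mem_X1 _ (elt_mem_X1 _ _ _)
  · have hm : op (P.inA a') • elt P K 1 y a 1 ∈ XA P K := op_smul_mem_XA _ (X1_le_XA (elt_mem_X1 _ _ _))
    rw [elt_snoc_eq P.stdSection, LinearMap.map_smul, lieOp_appendOp hK x hm, smul_comm, ← smul_add,
      ← appendOp_op_inG _ _ hm, ← map_add, op_inG_inA, (lieOp_bimod hK x).right, ← add_sub_assoc,
      ← smul_add]
    exact Submodule.smul_mem _ _ (appendOp_mem_X1 _ (sub_mem (op_smul_mem_XA _ (X1_le_XA ih))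
      (op_smul_mem_XA _ (X1_le_XA (elt_mem_X1 _ _ _)))))

lemma lieOp_add_mem_XA (x : g) {v : XX P K} (hv : v ∈ XA P K) :
    lieOp hK x v + op (P.inG x) • v ∈ XA P K := by
  refine XA_le (Q := (XA P K).comap (lieOp hK x + opMul P K (P.inG x))) ?_ hv
  intro r s c y a a'
  rw [Submodule.mem_comap]
  change lieOp hK x (elt P K c y a (P.inA a')) + op (P.inG x) • elt P K c y a (P.inA a') ∈ XA P K
  rw [elt_inA_eq, (lieOp_bimod hK x).right, op_inG_inA, ← add_sub_assoc, ← smul_add]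
  exact sub_mem (op_smul_mem_XA _ (X1_le_XA (lieOp_add_mem_X1 hK x (elt_mem_X1 _ _ _))))
      (op_smul_mem_XA _ (X1_le_XA (elt_mem_X1 _ _ _)))

/-- `Λ_x v` is the sum of an element of `XA` and `-v x`. -/
lemma exists_lieOp_eq (x : g) {v : XX P K} (hv : v ∈ XA P K) :
    ∃ u ∈ XA P K, lieOp hK x v = u - op (P.inG x) • v :=
  ⟨_, lieOp_add_mem_XA hK x hv, (add_sub_cancel_right _ _).symm⟩

end Horizontal


section Insertion

variable {k A g I : Type*} [Field k] [Ring A] [Algebra k A] [LieRing g] [LieAlgebra k g]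
  [LinearOrder I] {P : CrossedProduct k A g} {K : Subalgebra k A}

local notation "σ₀" => appendOp P K (CrossedProduct.stdSection P)
local notation "π₀" => collapseOp P K K (CrossedProduct.stdSection P)
local notation "ω" => wedgeOp P K

lemma op_inA_elt_zero {t : A} (ht : t ∈ K) {s : ℕ} (y : Fin s → g) (a : Fin 0 → A) :
    op (P.inA t) • elt P K 1 y a 1 = P.inA t • elt P K 1 y a 1 := by
  rw [op_smul_elt, smul_elt, one_mul, mul_one, ← mul_one (P.inA t), ← elt_zero_mul _ _ _ _ _ _ ht,
    one_mul, mul_one]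

lemma collapseOp_op_inG {y : g} {v : XX P K} (hv : v ∈ XA P K) :
    π₀ (op (P.inG y) • v) = op (P.inG y) • π₀ v :=
  collapseOp_op_toLin (P.stdSection) K (uι k y) hv

variable (hK : P.Stable K)

lemma lieOp_mem_XPos (x : g) {v : XX P K} (hv : v ∈ XPos P K) : lieOp hK x v ∈ XPos P K := by
  refine XPos_le (Q := (XPos P K).comap (lieOp hK x)) (fun r s c y a c' => ?_) hv
  rw [Submodule.mem_comap, elt_eq, (lieOp_bimod hK x).left, (lieOp_bimod hK x).right,
    ← Fin.snoc_init_self a, elt_snoc_eq P.stdSection, LinearMap.map_smul, lieOp_appendOp]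
  · exact smul_mem_XPos _ (op_smul_mem_XPos _ (Submodule.smul_mem _ _ (appendOp_mem_XPos _ _)))
  · exact op_smul_mem_XA _ (X1_le_XA (elt_mem_X1 _ _ _))

lemma collapseOp_lieOp (x : g) {v : XX P K} (hv : v ∈ XA P K) :
    π₀ (lieOp hK x v) = lieOp hK x (π₀ v) := by
  refine XA_ext (f := π₀ ∘ₗ lieOp hK x) (f' := lieOp hK x ∘ₗ π₀) ?_ hv
  intro r s c y a a'
  change π₀ (lieOp hK x _) = lieOp hK x (π₀ _)
  rcases r with - | r
  · have e1 : ∀ c c', lieOp hK x (elt P K c y a c') =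
        elt P K (c * P.inG x) y a c' - elt P K c y a (P.inG x * c') := by
      intro c c'
      rw [elt_eq, (lieOp_bimod hK x).left, (lieOp_bimod hK x).right, lieOp_elt, smul_sub, smul_sub,
        smul_elt, op_smul_elt, op_smul_elt, op_smul_elt, smul_elt, smul_elt]
      simp
    have e2 : ∀ c d c', elt P K (c + d) y a c' = elt P K c y a c' + elt P K d y a c' := by
      intro c d c'
      rw [← mul_one (c + d), ← smul_elt, add_smul, smul_elt, smul_elt, mul_one, mul_one]
    rw [e1, P.inG_mul_inA, elt_add_right, map_sub, map_add, collapseOp_elt_inA, collapseOp_elt_inA,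
      ← op_smul_elt (P := P) (K := K) (P.inG x), collapseOp_op_inG (elt_mem_XA _ _ _ _),
      collapseOp_elt_inA, e1, mul_assoc, P.inG_mul_inA, op_smul_elt, mul_add, mul_one, one_mul,
      e2, ← mul_assoc]
    abel
  · rw [collapseOp_elt_succ, map_zero, collapseOp_XPos]
    exact lieOp_mem_XPos hK x (elt_mem_XPos _ _ _ _)

lemma dZero_lieOp (x : g) (v : XX P K) :
    dZero P K (lieOp hK x v) = lieOp hK x (dZero P K v) := by
  have : dZero P K ∘ₗ lieOp hK x = lieOp hK x ∘ₗ dZero P K := by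
    refine (dZero_bimod.comp (lieOp_bimod hK x)).ext
      ((lieOp_bimod hK x).comp dZero_bimod) (fun s z a => ?_) (fun v hv ih => ?_)
    · change dZero P K (lieOp hK x _) = lieOp hK x (dZero P K _)
      rw [lieOp_elt, map_sub, dZero_bimod.left, dZero_bimod.right, dZero_elt_zero, map_zero,
        smul_zero, smul_zero, sub_zero]
    · change dZero P K (lieOp hK x _) = lieOp hK x (dZero P K _)
      replace ih : dZero P K (lieOp hK x v) = lieOp hK x (dZero P K v) := ih
      rw [lieOp_appendOp hK x hv, dZero_appendOp, dZero_appendOp, map_sub, map_sub,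
        lieOp_appendOp hK x (dZero_mem_XA hv), ih, collapseOp_lieOp hK x hv]
  exact LinearMap.congr_fun this v

/-- `q` commutes with `K` up to elements of `K`. -/
def CommStable (K : Subalgebra k A) (q : A) : Prop := ∀ t ∈ K, q * t - t * q ∈ K

variable {hK} in
include hK in
lemma CommStable.actG {q : A} (hq : CommStable K q) (z : g) : CommStable K (P.actG z q) := by
  intro t ht
  have h : P.actG z q * t - t * P.actG z q = P.actG z (q * t - t * q) -
      (q * P.actG z t - P.actG z t * q) := by
    have e : P.actG z (q * t - t * q) = P.actG z (q * t) - P.actG z (t * q) := by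
      simp [CrossedProduct.actG]
    rw [e, P.actG_mul, P.actG_mul]
    abel
  rw [h]
  exact sub_mem (hK z _ (hq t ht)) (hq _ (hK z t ht))

include hK in
lemma commStable_fhat (x y : g) : CommStable K (P.fhat x y) := by
  intro t ht
  rw [P.fhat_comm]
  exact sub_mem (sub_mem (hK _ _ (hK _ _ ht)) (hK _ _ (hK _ _ ht))) (hK _ _ ht)

lemma CommStable.add {q q' : A} (hq : CommStable K q) (hq' : CommStable K q') :
    CommStable K (q + q') := fun t ht => by
  have := add_mem (hq t ht) (hq' t ht)
  rwa [show q * t - t * q + (q' * t - t * q') = (q + q') * t - t * (q + q') by noncomm_ring] at this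

lemma CommStable.smul {q : A} (hq : CommStable K q) (c : k) : CommStable K (c • q) := fun t ht => by
  have := K.smul_mem (hq t ht) c
  rwa [smul_sub, ← smul_mul_assoc, ← mul_smul_comm] at this

lemma appendOp_op_commStable {q : A} (hq : CommStable K q) {t : A} (ht : t ∈ K) {v : XX P K}
    (hv : v ∈ XA P K) (h0 : σ₀ v = 0) :
    σ₀ (op (P.inA q) • op (P.inA t) • v) = op (P.inA t) • σ₀ (op (P.inA q) • v) := by
  have e : op (P.inA q) • op (P.inA t) • v =
      op (P.inA t) • op (P.inA q) • v - op (P.inA (q * t - t * q)) • v := by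
    rw [op_mul_smul, op_mul_smul, ← sub_smul, ← op_sub, P.inA_sub, P.inA_mul, P.inA_mul,
      sub_sub_cancel]
  rw [e, map_sub, appendOp_op_inA _ ht (op_smul_mem_XA _ hv), appendOp_op_inA _ (hq t ht) hv, h0,
    smul_zero, sub_zero]

lemma exists_insOp {q : A} (hq : CommStable K q) : ∃ T : Module.End k (XX P K), IsBimod T ∧
      (∀ s (y : Fin s → g) (a : Fin 0 → A), T (elt P K 1 y a 1) =
        σ₀ (op (P.inA q) • elt P K 1 y a 1)) ∧
      (∀ v ∈ XA P K, T (σ₀ v) = - σ₀ (T v) + σ₀ (op (P.inA q) • σ₀ v)) := by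
  obtain ⟨T, h1, h2, h3, h4⟩ := exists_append_rec (P := P) (K := K) 0
    (fun t _ => by rw [P_actG_zero]; exact zero_mem K) (-1)
    (σ₀ ∘ₗ opMul P K (P.inA q) ∘ₗ σ₀) (σ₀ ∘ₗ opMul P K (P.inA q))
    (fun c v => by
      change σ₀ (op (P.inA q) • σ₀ (c • v)) = c • σ₀ (op (P.inA q) • σ₀ v)
      rw [appendOp_left, ← smul_comm c, appendOp_left])
    (fun v hv => XA_le_XG 0 (X1_le_XA (appendOp_mem_X1 _ (op_smul_mem_XA _
      (X1_le_XA (appendOp_mem_X1 _ hv))))))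
    (fun t ht v hv => by
      change σ₀ (op (P.inA q) • σ₀ (op (P.inA t) • v)) = op (P.inA t) • σ₀ (op (P.inA q) • σ₀ v)
      rw [appendOp_op_inA _ ht hv, appendOp_op_commStable hq ht (X1_le_XA (appendOp_mem_X1 _ hv))
        (appendOp_appendOp _ _)])
    (fun v hv => by
      change (-1 : k) • σ₀ (σ₀ (op (P.inA q) • σ₀ v)) + σ₀ (op (P.inA q) • σ₀ (σ₀ v)) = 0
      simp only [appendOp_appendOp, smul_zero, map_zero, add_zero])
    (fun t ht s y a => by
      change P.inA t • σ₀ (op (P.inA q) • elt P K 1 y a 1) =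
        op (P.inA t) • σ₀ (op (P.inA q) • elt P K 1 y a 1)
      rw [← appendOp_op_commStable hq ht (X1_le_XA (elt_mem_X1 _ _ _))
        (appendOp_X1 _ (elt_mem_X1 _ _ _)), op_inA_elt_zero ht, ← appendOp_left, smul_comm])
    (fun s y a => XA_le_XG 0 (X1_le_XA (appendOp_mem_X1 _ (op_smul_mem_XA _
      (X1_le_XA (elt_mem_X1 _ _ _))))))
    (fun s y a => by
      change (-1 : k) • σ₀ (σ₀ (op (P.inA q) • elt P K 1 y a 1)) +
        σ₀ (op (P.inA q) • σ₀ (elt P K 1 y a 1)) = 0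
      rw [appendOp_appendOp, appendOp_X1 _ (elt_mem_X1 _ _ _)]
      simp)
  refine ⟨T, h1, h2, fun v hv => ?_⟩
  rw [h3 v hv, neg_one_smul]
  rfl

open Classical in
variable (P K) in
/-- The operators `h_q` inserting a factor `q`, for the `q` that commute with `K` up to elements
of `K` (and zero for all other `q`). -/
def insOp (q : A) : Module.End k (XX P K) :=
  if h : CommStable K q then (exists_insOp h).choose else 0

lemma insOp_bimod (q : A) : IsBimod (insOp P K q) := by
  rw [insOp]
  split_ifs with h
  · exact (exists_insOp h).choose_spec.1
  · exact .zero

section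

variable {q q' : A} (hq : CommStable K q) (hq' : CommStable K q')

include hq

lemma insOp_elt {s : ℕ} (y : Fin s → g) (a : Fin 0 → A) :
    insOp P K q (elt P K 1 y a 1) = σ₀ (op (P.inA q) • elt P K 1 y a 1) := by
  rw [insOp, dif_pos hq]
  exact (exists_insOp hq).choose_spec.2.1 s y a

lemma insOp_appendOp {v : XX P K} (hv : v ∈ XA P K) :
    insOp P K q (σ₀ v) = - σ₀ (insOp P K q v) + σ₀ (op (P.inA q) • σ₀ v) := by
  rw [insOp, dif_pos hq]
  exact (exists_insOp hq).choose_spec.2.2 v hv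

lemma insOp_elt_mem {r s : ℕ} (y : Fin s → g) (a : Fin r → A) :
    insOp P K q (elt P K 1 y a 1) ∈ X1 P K ⊓ XPos P K := by
  refine append_induction (p := fun r a => insOp P K q (elt P K 1 y a 1) ∈ X1 P K ⊓ XPos P K)
    (fun a => ?_) (fun r a a' ih => ?_) r a
  · rw [insOp_elt hq]
    exact ⟨appendOp_mem_X1 _ (op_smul_mem_XA _ (X1_le_XA (elt_mem_X1 _ _ _))),
      appendOp_mem_XPos _ _⟩
  · have hm := op_smul_mem_XA a' (X1_le_XA (elt_mem_X1 (K := K) (P := P) 1 y a))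
    rw [elt_snoc_eq P.stdSection, LinearMap.map_smul, insOp_appendOp hq hm,
      (insOp_bimod q).right]
    refine Submodule.smul_mem _ _ (add_mem (neg_mem ?_) ?_)
    · exact ⟨appendOp_mem_X1 _ (op_smul_mem_XA _ (X1_le_XA ih.1)), appendOp_mem_XPos _ _⟩
    · exact ⟨appendOp_mem_X1 _ (op_smul_mem_XA _ (X1_le_XA (appendOp_mem_X1 _ hm))),
        appendOp_mem_XPos _ _⟩

lemma insOp_mem_X1 {v : XX P K} (hv : v ∈ X1 P K) : insOp P K q v ∈ X1 P K := by
  refine X1_le (Q := (X1 P K).comap (insOp P K q)) (fun r s c y a => ?_) hv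
  have e : elt P K c y a 1 = c • elt P K 1 y a 1 := by rw [smul_elt, mul_one]
  rw [Submodule.mem_comap, e, (insOp_bimod q).left]
  exact smul_mem_X1 _ (insOp_elt_mem hq _ _).1

lemma insOp_mem_XA {v : XX P K} (hv : v ∈ XA P K) : insOp P K q v ∈ XA P K :=
  (insOp_bimod q).mem_XA (fun _ h => X1_le_XA (insOp_mem_X1 hq h)) hv

lemma insOp_mem_XPos (v : XX P K) : insOp P K q v ∈ XPos P K := by
  induction v using XX.induction with
  | elt r s c x a c' =>
    rw [elt_eq, (insOp_bimod q).left, (insOp_bimod q).right]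
    exact smul_mem_XPos _ (op_smul_mem_XPos _ (insOp_elt_mem hq _ _).2)
  | add u v hu hv => rw [map_add]; exact add_mem hu hv
  | smul t v hv => rw [map_smul]; exact Submodule.smul_mem _ _ hv

lemma insOp_wedgeOp (y : g) (v : XX P K) : insOp P K q (ω y v) = - ω y (insOp P K q v) := by
  have e : ∀ v, ω y (σ₀ v) = - σ₀ (ω y v) := fun v => by rw [appendOp_wedgeOp, neg_neg]
  have : insOp P K q ∘ₗ ω y = - (ω y ∘ₗ insOp P K q) := by
    refine ((insOp_bimod q).comp (wedgeOp_bimod P K y)).ext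
      ((wedgeOp_bimod P K y).comp (insOp_bimod q)).neg (fun s z a => ?_) (fun v hv ih => ?_)
    · change insOp P K q (ω y _) = - ω y (insOp P K q _)
      rw [wedgeOp_elt, insOp_elt hq, insOp_elt hq, e, neg_neg, (wedgeOp_bimod P K y).right,
        wedgeOp_elt]
    · change insOp P K q (ω y _) = - ω y (insOp P K q _)
      replace ih : insOp P K q (ω y v) = - ω y (insOp P K q v) := ih
      have hm : ω y v ∈ XA P K := (wedgeOp_bimod P K y).mem_XA (fun v hv => by
        refine X1_le (Q := (XA P K).comap (ω y)) (fun r s c x a => ?_) hv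
        rw [Submodule.mem_comap, wedgeOp_elt]
        exact X1_le_XA (elt_mem_X1 _ _ _)) hv
      rw [e, map_neg, insOp_appendOp hq hm, ih, insOp_appendOp hq hv, map_add, map_neg, map_neg, e, e,
        (wedgeOp_bimod P K y).right, e, smul_neg, map_neg]
      abel
  exact LinearMap.congr_fun this v

include hq'

lemma insOp_add : insOp P K (q + q') = insOp P K q + insOp P K q' := by
  refine (insOp_bimod _).ext ((insOp_bimod q).add (insOp_bimod q')) (fun s z a => ?_)
    (fun v hv ih => ?_)
  · rw [LinearMap.add_apply, insOp_elt (hq.add hq'), insOp_elt hq, insOp_elt hq', P.inA_add, op_add,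
      add_smul, map_add]
  · rw [LinearMap.add_apply, insOp_appendOp (hq.add hq') hv, insOp_appendOp hq hv,
      insOp_appendOp hq' hv, P.inA_add, op_add, add_smul, map_add, ih, LinearMap.add_apply,
      map_add]
    abel

lemma insOp_insOp (v : XX P K) :
    insOp P K q (insOp P K q' v) + insOp P K q' (insOp P K q v) = 0 := by
  have : insOp P K q ∘ₗ insOp P K q' + insOp P K q' ∘ₗ insOp P K q = 0 := by
    refine (((insOp_bimod q).comp (insOp_bimod q')).add
      ((insOp_bimod q').comp (insOp_bimod q))).ext .zero (fun s z a => ?_) (fun v hv ih => ?_)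
    · change insOp P K q (insOp P K q' _) + insOp P K q' (insOp P K q _) = 0
      have hm := fun a' => op_smul_mem_XA a' (X1_le_XA (elt_mem_X1 (K := K) (P := P) 1 z a))
      rw [insOp_elt hq, insOp_elt hq', insOp_appendOp hq (hm _), insOp_appendOp hq' (hm _),
        (insOp_bimod q).right, (insOp_bimod q').right, insOp_elt hq, insOp_elt hq']
      abel
    · change insOp P K q (insOp P K q' _) + insOp P K q' (insOp P K q _) = 0
      replace ih : insOp P K q (insOp P K q' v) + insOp P K q' (insOp P K q v) = 0 := ih
      have hs := fun a' => op_smul_mem_XA a' (X1_le_XA (appendOp_mem_X1 P.stdSection hv))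
      have ih' := congrArg σ₀ ih
      rw [map_add, map_zero] at ih'
      simp only [insOp_appendOp hq hv, insOp_appendOp hq' hv, map_add, map_neg,
        insOp_appendOp hq (hs _), insOp_appendOp hq' (hs _), (insOp_bimod q).right,
        (insOp_bimod q').right, insOp_appendOp hq (insOp_mem_XA hq' hv),
        insOp_appendOp hq' (insOp_mem_XA hq hv), smul_add, smul_neg, neg_add, neg_neg]
      linear_combination (norm := abel) ih'
  exact LinearMap.congr_fun this v

end

lemma insOp_smul {q : A} (hq : CommStable K q) (t : k) : insOp P K (t • q) = t • insOp P K q := by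
  have e : P.inA (t • q) = t • P.inA q := map_smul P.inAHom t q
  refine (insOp_bimod _).ext ((insOp_bimod q).smul t) (fun s z a => ?_)
    (fun v hv ih => ?_)
  · rw [LinearMap.smul_apply, insOp_elt (hq.smul t), insOp_elt hq, e, op_smul, smul_assoc, map_smul]
  · rw [LinearMap.smul_apply, insOp_appendOp (hq.smul t) hv, insOp_appendOp hq hv, e, op_smul,
      smul_assoc, map_smul, ih, LinearMap.smul_apply, map_smul, smul_add, smul_neg]

/-- `[Λ_z, h_q] = - h_{q^z}`. -/
lemma lieOp_insOp (z : g) {q : A} (hq : CommStable K q) (v : XX P K) :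
    lieOp hK z (insOp P K q v) =
      insOp P K q (lieOp hK z v) - insOp P K (P.actG z q) v := by
  have hz := hq.actG (hK := hK) z
  have : lieOp hK z ∘ₗ insOp P K q = insOp P K q ∘ₗ lieOp hK z - insOp P K (P.actG z q) := by
    refine ((lieOp_bimod hK z).comp (insOp_bimod q)).ext
      (((insOp_bimod q).comp (lieOp_bimod hK z)).sub (insOp_bimod _)) (fun s y a => ?_)
      (fun v hv ih => ?_)
    · change lieOp hK z (insOp P K q _) = insOp P K q (lieOp hK z _) - insOp P K (P.actG z q) _
      have hm := fun a' => op_smul_mem_XA a' (X1_le_XA (elt_mem_X1 (K := K) (P := P) 1 y a))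
      rw [insOp_elt hq, insOp_elt hz, lieOp_appendOp hK z (hm q), (lieOp_bimod hK z).right,
        lieOp_elt, smul_sub, op_inA_inG, map_sub, map_sub, map_add, (insOp_bimod q).left,
        (insOp_bimod q).right, insOp_elt hq, appendOp_op_inG _ _ (hm _),
        ← smul_comm (P.inG z), appendOp_left]
      abel
    · change lieOp hK z (insOp P K q _) = insOp P K q (lieOp hK z _) - insOp P K (P.actG z q) _
      replace ih : lieOp hK z (insOp P K q v) =
        insOp P K q (lieOp hK z v) - insOp P K (P.actG z q) v := ih
      have hs := fun a' => op_smul_mem_XA a' (X1_le_XA (appendOp_mem_X1 P.stdSection hv))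
      obtain ⟨u, hu, he⟩ := exists_lieOp_eq hK z hv
      have e2 : σ₀ (lieOp hK z v) = σ₀ u - op (P.inG z) • σ₀ v := by
        rw [he, map_sub, appendOp_op_inG _ _ hv]
      have e3 : σ₀ (insOp P K q (lieOp hK z v)) =
          σ₀ (insOp P K q u) - op (P.inG z) • σ₀ (insOp P K q v) := by
        rw [he, map_sub, (insOp_bimod q).right, map_sub, appendOp_op_inG _ _ (insOp_mem_XA hq hv)]
      rw [insOp_appendOp hq hv, map_add, map_neg, lieOp_appendOp hK z (insOp_mem_XA hq hv), ih,
        lieOp_appendOp hK z (hs q), (lieOp_bimod hK z).right, lieOp_appendOp hK z hv,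
        insOp_appendOp hz hv, map_sub, e3, e2, smul_sub, map_sub, map_sub, insOp_appendOp hq hu,
        (insOp_bimod q).right, insOp_appendOp hq hv, op_inA_inG, map_add,
        appendOp_op_inG _ _ (hs _), smul_add, smul_neg]
      abel
  exact LinearMap.congr_fun this v

lemma insOp_collapseOp {q : A} (hq : CommStable K q) {v : XX P K} (hv : v ∈ XA P K) :
    insOp P K q (π₀ v) = σ₀ (op (P.inA q) • π₀ v) := by
  refine XA_ext (f := insOp P K q ∘ₗ π₀) (f' := σ₀ ∘ₗ opMul P K (P.inA q) ∘ₗ π₀) ?_ hv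
  intro r s c y a a'
  change insOp P K q (π₀ _) = σ₀ (op (P.inA q) • π₀ _)
  rcases r with - | r
  · have e : elt P K (c * P.inA a') y a 1 = (c * P.inA a') • elt P K 1 y a 1 := by
      rw [smul_elt, mul_one]
    rw [collapseOp_elt_inA, e, (insOp_bimod q).left, insOp_elt hq, ← smul_comm (c * P.inA a'),
      appendOp_left]
  · rw [collapseOp_elt_succ, map_zero, smul_zero, map_zero]

lemma op_inG_comm (x y : g) (v : XX P K) : op (P.inG y) • op (P.inG x) • v =
    op (P.inG x) • op (P.inG y) • v + op (P.inG ⁅x, y⁆) • v + op (P.inA (P.fhat x y)) • v := by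
  rw [op_mul_smul, op_mul_smul, add_assoc, ← add_smul, ← op_add, ← P.inG_comm, op_sub, sub_smul]
  abel

lemma inG_comm_smul (x y : g) (v : XX P K) : P.inG x • P.inG y • v =
    P.inG y • P.inG x • v + P.inG ⁅x, y⁆ • v + P.inA (P.fhat x y) • v := by
  rw [← mul_smul, ← mul_smul, add_assoc, ← add_smul, ← P.inG_comm, sub_smul]
  abel

lemma lieOp_lieOp_appendOp (x y : g) {v : XX P K} (hv : v ∈ XA P K) :
    lieOp hK x (lieOp hK y (σ₀ v)) = σ₀ (lieOp hK x (lieOp hK y v)) +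
      op (P.inG y) • op (P.inG x) • σ₀ v - σ₀ (op (P.inG y) • op (P.inG x) • v) := by
  obtain ⟨u, hu, he⟩ := exists_lieOp_eq hK y hv
  obtain ⟨u', hu', he'⟩ := exists_lieOp_eq hK x hv
  rw [lieOp_appendOp hK y hv, he, map_sub, map_sub, map_sub, map_sub, appendOp_op_inG _ _ hv,
    (lieOp_bimod hK x).right, (lieOp_bimod hK x).right, lieOp_appendOp hK x hu,
    lieOp_appendOp hK x hv, he', smul_sub, map_sub, map_sub, smul_sub, appendOp_op_inG _ _ hu',
    appendOp_op_inG _ _ hv]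
  abel

/-- `[Λ_x, Λ_y] = - Λ_{[x,y]} + {d⁰, h_{f̂(x,y)}}`. -/
lemma lieOp_lieOp (x y : g) (v : XX P K) :
    lieOp hK x (lieOp hK y v) - lieOp hK y (lieOp hK x v) = - lieOp hK ⁅x, y⁆ v +
      (dZero P K (insOp P K (P.fhat x y) v) + insOp P K (P.fhat x y) (dZero P K v)) := by
  have hq := commStable_fhat hK x y
  have : lieOp hK x ∘ₗ lieOp hK y - lieOp hK y ∘ₗ lieOp hK x = - lieOp hK ⁅x, y⁆ +
      (dZero P K ∘ₗ insOp P K (P.fhat x y) + insOp P K (P.fhat x y) ∘ₗ dZero P K) := by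
    refine (((lieOp_bimod hK x).comp (lieOp_bimod hK y)).sub
      ((lieOp_bimod hK y).comp (lieOp_bimod hK x))).ext ((lieOp_bimod hK _).neg.add
        ((dZero_bimod.comp (insOp_bimod _)).add ((insOp_bimod _).comp dZero_bimod)))
      (fun s z a => ?_) (fun v hv ih => ?_)
    · change lieOp hK x (lieOp hK y _) - lieOp hK y (lieOp hK x _) = - lieOp hK ⁅x, y⁆ _ +
        (dZero P K (insOp P K (P.fhat x y) _) + insOp P K (P.fhat x y) (dZero P K _))
      have hm := op_smul_mem_XA (P.fhat x y) (X1_le_XA (elt_mem_X1 (K := K) (P := P) 1 z a))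
      have e1 : π₀ (op (P.inA (P.fhat x y)) • elt P K 1 z a 1) =
          P.inA (P.fhat x y) • elt P K 1 z a 1 := by
        rw [op_smul_elt, one_mul, collapseOp_elt_inA, smul_elt, one_mul, mul_one]
      rw [lieOp_elt, lieOp_elt, lieOp_elt, insOp_elt hq, dZero_appendOp, e1, dZero_bimod.right,
        dZero_elt_zero, map_sub, map_sub, (lieOp_bimod hK x).left, (lieOp_bimod hK x).right,
        (lieOp_bimod hK y).left, (lieOp_bimod hK y).right, lieOp_elt, lieOp_elt, smul_zero, map_zero,
        map_zero]
      simp only [smul_sub]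
      rw [op_inG_comm x y, inG_comm_smul x y, ← smul_comm (P.inG x) (op (P.inG y)),
        ← smul_comm (P.inG y) (op (P.inG x))]
      abel
    · change lieOp hK x (lieOp hK y _) - lieOp hK y (lieOp hK x _) = - lieOp hK ⁅x, y⁆ _ +
        (dZero P K (insOp P K (P.fhat x y) _) + insOp P K (P.fhat x y) (dZero P K _))
      replace ih : lieOp hK x (lieOp hK y v) - lieOp hK y (lieOp hK x v) = - lieOp hK ⁅x, y⁆ v +
        (dZero P K (insOp P K (P.fhat x y) v) + insOp P K (P.fhat x y) (dZero P K v)) := ih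
      have ih' := congrArg σ₀ ih
      simp only [map_sub, map_add, map_neg] at ih'
      rw [lieOp_lieOp_appendOp hK x y hv, lieOp_lieOp_appendOp hK y x hv, lieOp_appendOp hK _ hv,
        insOp_appendOp hq hv, map_add, map_neg, dZero_appendOp, dZero_appendOp,
        dZero_bimod.right, dZero_appendOp, collapseOp_XPos _ (insOp_mem_XPos hq v),
        collapseOp_XPos _ (op_smul_mem_XPos _ (appendOp_mem_XPos _ _)), map_sub, map_sub,
        insOp_appendOp hq (dZero_mem_XA hv), insOp_collapseOp hq hv, smul_sub, smul_sub, map_sub,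
        map_sub, op_inG_comm x y, op_inG_comm x y, map_add, map_add, appendOp_op_inG _ _ hv]
      linear_combination (norm := abel) ih'
  exact LinearMap.congr_fun this v

end Insertion


section Bidegree

variable {k A g I : Type*} [Field k] [Ring A] [Algebra k A] [LieRing g] [LieAlgebra k g]
  [LinearOrder I] {P : CrossedProduct k A g} {K : Subalgebra k A}

local notation "σ₀" => appendOp P K (CrossedProduct.stdSection P)
local notation "π₀" => collapseOp P K K (CrossedProduct.stdSection P)
local notation "ω" => wedgeOp P K

variable (P K) in
/-- The component `X_{rs}` of the direct sum. -/
abbrev XB (r s : ℕ) : Submodule k (XX P K) := LinearMap.range (inX P K r s)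

lemma elt_mem_XB {r s : ℕ} (c : P.Alg) (x : Fin s → g) (a : Fin r → A) (c' : P.Alg) :
    elt P K c x a c' ∈ XB P K r s := LinearMap.mem_range_self _ _

lemma XB_le {r s : ℕ} {Q : Submodule k (XX P K)}
    (h : ∀ c (x : Fin s → g) (a : Fin r → A) c', elt P K c x a c' ∈ Q) : XB P K r s ≤ Q := by
  rintro _ ⟨v, rfl⟩
  induction v using X.induction with
  | mk c x a c' => exact h c x a c'
  | add u v hu hv => rw [map_add]; exact add_mem hu hv
  | smul t v hv => rw [map_smul]; exact Submodule.smul_mem _ _ hv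

lemma XB_ext {r s : ℕ} {N : Type*} [AddCommGroup N] [Module k N] {f f' : XX P K →ₗ[k] N}
    (h : ∀ c (x : Fin s → g) (a : Fin r → A) c', f (elt P K c x a c') = f' (elt P K c x a c'))
    {v : XX P K} (hv : v ∈ XB P K r s) : f v = f' v :=
  XB_le (Q := LinearMap.eqLocus f f') h hv

lemma smul_mem_XB {r s : ℕ} (c : P.Alg) {v : XX P K} (hv : v ∈ XB P K r s) :
    c • v ∈ XB P K r s := by
  obtain ⟨v, rfl⟩ := hv
  rw [smul_inX]
  exact LinearMap.mem_range_self _ _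

lemma op_smul_mem_XB {r s : ℕ} (c : P.Alg) {v : XX P K} (hv : v ∈ XB P K r s) :
    op c • v ∈ XB P K r s := by
  obtain ⟨v, rfl⟩ := hv
  rw [op_smul_inX]
  exact LinearMap.mem_range_self _ _

lemma appendOp_mem_XB (θ : P.Section) {r s : ℕ} {v : XX P K} (hv : v ∈ XB P K r s) :
    appendOp P K θ v ∈ XB P K (r + 1) s := by
  refine XB_le (Q := (XB P K (r + 1) s).comap (appendOp P K θ)) (fun c x a c' => ?_) hv
  rw [Submodule.mem_comap]
  induction c' using θ.induction with
  | mul a' h =>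
    rw [appendOp_elt]
    exact Submodule.smul_mem _ _ (elt_mem_XB _ _ _ _)
  | add u v hu hv => rw [elt_add_right, map_add]; exact add_mem hu hv

lemma collapseOp_mem_XB {K' : Subalgebra k A} (θ : P.Section) {r s : ℕ} {v : XX P K}
    (hv : v ∈ XB P K r s) : collapseOp P K K' θ v ∈ XB P K' r s := by
  refine XB_le (Q := (XB P K' r s).comap (collapseOp P K K' θ)) (fun c x a c' => ?_) hv
  rw [Submodule.mem_comap]
  rcases r with - | r
  · induction c' using θ.induction with
    | mul a' h =>
      rw [collapseOp_elt]
      exact elt_mem_XB _ _ _ _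
    | add u v hu hv => rw [elt_add_right, map_add]; exact add_mem hu hv
  · rw [collapseOp_elt_succ]
    exact zero_mem _

lemma collapseOp_XB_succ {K' : Subalgebra k A} (θ : P.Section) {r s : ℕ} {v : XX P K}
    (hv : v ∈ XB P K (r + 1) s) : collapseOp P K K' θ v = 0 :=
  XB_ext (f := collapseOp P K K' θ) (f' := 0)
    (fun c x a c' => collapseOp_elt_succ P K K' θ c x a c') hv

lemma wedgeOp_mem_XB (y : g) {r s : ℕ} {v : XX P K} (hv : v ∈ XB P K r s) :
    ω y v ∈ XB P K r (s + 1) := by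
  refine XB_le (Q := (XB P K r (s + 1)).comap (ω y)) (fun c x a c' => ?_) hv
  rw [Submodule.mem_comap, wedgeOp_elt]
  exact elt_mem_XB _ _ _ _

/-- Bimodule maps that are constructed by recursion on the number of factors in `A` are
homogeneous. -/
lemma IsBimod.mem_XB {T : XX P K →ₗ[k] XX P K} (hT : IsBimod T) (ρ : ℕ → ℕ) (s : ℕ)
    (h0 : ∀ (x : Fin s → g) (a : Fin 0 → A), T (elt P K 1 x a 1) ∈ XB P K (ρ 0) s)
    (hs : ∀ r, ∀ v ∈ XA P K, v ∈ XB P K r s → T v ∈ XB P K (ρ r) s →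
      T (σ₀ v) ∈ XB P K (ρ (r + 1)) s) {r : ℕ} {v : XX P K} (hv : v ∈ XB P K r s) :
    T v ∈ XB P K (ρ r) s := by
  refine XB_le (Q := (XB P K (ρ r) s).comap T) (fun c x a c' => ?_) hv
  rw [Submodule.mem_comap, elt_eq, hT.left, hT.right]
  refine smul_mem_XB _ (op_smul_mem_XB _ ?_)
  refine append_induction (p := fun r a => T (elt P K 1 x a 1) ∈ XB P K (ρ r) s)
    (h0 x) (fun r a a' ih => ?_) r a
  rw [elt_snoc_eq P.stdSection, LinearMap.map_smul]
  refine Submodule.smul_mem _ _ (hs r _ (op_smul_mem_XA _ (X1_le_XA (elt_mem_X1 _ _ _)))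
    (op_smul_mem_XB _ (elt_mem_XB _ _ _ _)) ?_)
  rw [hT.right]
  exact op_smul_mem_XB _ ih

lemma dZero_XB_zero {s : ℕ} {v : XX P K} (hv : v ∈ XB P K 0 s) : dZero P K v = 0 :=
  XB_ext (f := dZero P K) (f' := 0) (fun c x a c' => dZero_elt_zero c x a c') hv

lemma dZero_mem_XB {r s : ℕ} {v : XX P K} (hv : v ∈ XB P K r s) :
    dZero P K v ∈ XB P K (r - 1) s := by
  refine dZero_bimod.mem_XB (fun r => r - 1) s (fun x a => ?_) (fun r v _ hv ih => ?_) hv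
  · rw [dZero_elt_zero]
    exact zero_mem _
  · rw [dZero_appendOp]
    rcases r with - | r
    · rw [dZero_XB_zero hv, map_zero, sub_zero]
      exact sub_mem hv (collapseOp_mem_XB _ hv)
    · rw [collapseOp_XB_succ _ hv, sub_zero]
      exact sub_mem hv (appendOp_mem_XB _ ih)

lemma lieOp_mem_XB (hK : P.Stable K) (x : g) {r s : ℕ} {v : XX P K} (hv : v ∈ XB P K r s) :
    lieOp hK x v ∈ XB P K r s := by
  refine (lieOp_bimod hK x).mem_XB id s (fun x a => ?_) (fun r v hA hv ih => ?_) hv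
  · rw [lieOp_elt]
    exact sub_mem (smul_mem_XB _ (elt_mem_XB _ _ _ _)) (op_smul_mem_XB _ (elt_mem_XB _ _ _ _))
  · rw [lieOp_appendOp hK _ hA]
    exact appendOp_mem_XB _ ih

lemma insOp_mem_XB {q : A} (hq : CommStable K q) {r s : ℕ} {v : XX P K} (hv : v ∈ XB P K r s) :
    insOp P K q v ∈ XB P K (r + 1) s := by
  refine (insOp_bimod q).mem_XB (fun r => r + 1) s (fun x a => ?_) (fun r v hA hv ih => ?_) hv
  · rw [insOp_elt hq]
    exact appendOp_mem_XB _ (op_smul_mem_XB _ (elt_mem_XB _ _ _ _))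
  · rw [insOp_appendOp hq hA]
    exact add_mem (neg_mem (appendOp_mem_XB _ ih))
      (appendOp_mem_XB _ (op_smul_mem_XB _ (appendOp_mem_XB _ hv)))

/-- The explicit formula for `d⁰`. -/
lemma dZero_elt (r s : ℕ) (x : Fin s → g) (a : Fin (r + 1) → A) :
    dZero P K (elt P K 1 x a 1) =
      (-1 : k) ^ s • elt P K (P.inA (a 0)) x (Fin.tail a) 1
      + (∑ i : Fin r, (-1 : k) ^ ((i : ℕ) + 1 + s) •
          elt P K 1 x (Fin.contractNth i.castSucc (· * ·) a) 1)
      + (-1 : k) ^ (r + 1 + s) • elt P K 1 x (Fin.init a) (P.inA (a (Fin.last r))) := by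
  have hsgn : ∀ n m : ℕ, (n + m) % 2 = 0 → (-1 : k) ^ n = (-1) ^ m := by
    intro n m h
    have h2 : (-1 : k) ^ (n + m) = 1 := Even.neg_one_pow (Nat.even_iff.2 h)
    have h3 : (-1 : k) ^ m * (-1) ^ m = 1 := by rw [← mul_pow]; simp
    rw [pow_add] at h2
    calc (-1 : k) ^ n = (-1) ^ n * ((-1) ^ m * (-1) ^ m) := by rw [h3, mul_one]
      _ = (-1) ^ m := by rw [← mul_assoc, h2, one_mul]
  induction r with
  | zero =>
    have e : elt P K 1 x a 1 = (-1 : k) ^ (0 + s + 1) • σ₀ (elt P K 1 x (Fin.init a)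
        (P.inA (a (Fin.last 0)))) := by
      conv_lhs => rw [← Fin.snoc_init_self a]
      rw [elt_snoc_eq P.stdSection, ← elt_inA_eq]
    rw [e, map_smul, dZero_appendOp, dZero_elt_zero, map_zero, sub_zero, collapseOp_elt_inA,
      one_mul, Subsingleton.elim (Fin.tail a) (Fin.init a), smul_sub,
      hsgn (0 + 1 + s) (0 + s + 1) (by omega), Finset.univ_eq_empty, Finset.sum_empty,
      hsgn s (0 + s + 1 + 1) (by omega), pow_succ (-1 : k) (0 + s + 1)]
    change _ - (-1 : k) ^ (0 + s + 1) • elt P K (P.inA (a 0)) x (Fin.init a) 1 = _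
    simp only [mul_neg, mul_one, neg_smul]
    abel
  | succ r ih =>
    obtain ⟨b, a', rfl⟩ : ∃ (b : Fin (r + 1) → A) (a' : A), a = Fin.snoc b a' :=
      ⟨Fin.init a, a (Fin.last _), (Fin.snoc_init_self a).symm⟩
    have e : elt P K 1 x (Fin.snoc b a' : Fin (r + 1 + 1) → A) 1 = (-1 : k) ^ (r + 1 + s + 1) •
        σ₀ (op (P.inA a') • elt P K 1 x b 1) := elt_snoc_eq _ _ _ _ _
    have hc : ∀ i : Fin r, (Fin.contractNth i.castSucc.castSucc (· * ·)
        (Fin.snoc b a' : Fin (r + 1 + 1) → A)) =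
        (Fin.snoc (Fin.contractNth i.castSucc (· * ·) b) a' : Fin (r + 1) → A) := by
      intro i
      funext j
      refine Fin.lastCases ?_ (fun j => ?_) j
      · have := i.2
        rw [Fin.snoc_last, Fin.contractNth_apply_of_gt _ _ _ _ (by simp), Fin.succ_last,
          Fin.snoc_last]
      · rw [Fin.snoc_castSucc, Fin.contractNth, Fin.contractNth]
        simp only [Fin.snoc_castSucc, Fin.val_castSucc, ← Fin.castSucc_succ]
    have hl : (Fin.contractNth (Fin.last r).castSucc (· * ·)
        (Fin.snoc b a' : Fin (r + 1 + 1) → A)) =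
        (Fin.snoc (Fin.init b) (b (Fin.last r) * a') : Fin (r + 1) → A) := by
      funext j
      refine Fin.lastCases ?_ (fun j => ?_) j
      · rw [Fin.snoc_last, Fin.contractNth_apply_of_eq _ _ _ _ (by simp), Fin.succ_last,
          Fin.snoc_last, Fin.snoc_castSucc]
      · rw [Fin.snoc_castSucc, Fin.contractNth_apply_of_lt _ _ _ _ (by simp), Fin.snoc_castSucc]
        rfl
    have ht : Fin.tail (Fin.snoc b a' : Fin (r + 1 + 1) → A) =
        (Fin.snoc (Fin.tail b) a' : Fin (r + 1) → A) := by
      funext j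
      refine Fin.lastCases ?_ (fun j => ?_) j
      · rw [Fin.snoc_last, Fin.tail, Fin.succ_last, Fin.snoc_last]
      · rw [Fin.snoc_castSucc, Fin.tail, ← Fin.castSucc_succ, Fin.snoc_castSucc, Fin.tail]
    have h0 : (Fin.snoc b a' : Fin (r + 1 + 1) → A) 0 = b 0 :=
      Fin.snoc_castSucc (α := fun _ => A) a' b 0
    have hu : (-1 : k) ^ (r + s + 1) * (-1) ^ (r + s + 1) = 1 := by rw [← mul_pow]; simp
    rw [e, map_smul, dZero_appendOp, collapseOp_XB_succ _ (op_smul_mem_XB _ (elt_mem_XB _ _ _ _)),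
      dZero_bimod.right, ih, Fin.sum_univ_castSucc, hl, ht, Fin.init_snoc, Fin.snoc_last, h0,
      hsgn (r + 1 + 1 + s) (r + s + 1 + 1) (by omega), hsgn (r + 1 + s + 1) (r + s + 1 + 1) (by omega),
      pow_succ _ (r + s + 1)]
    generalize hU : (-1 : k) ^ (r + s + 1) = u at hu ⊢
    have key : ∀ (t : k) c (b₀ : Fin r → A) a'', σ₀ (op (P.inA a') • t • elt P K c x b₀ (P.inA a'')) =
        (t * u) • elt P K c x (Fin.snoc b₀ (a'' * a') : Fin (r + 1) → A) 1 := by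
      intro t c b₀ a''
      rw [← smul_comm t, map_smul, op_smul_elt, ← P.inA_mul, appendOp_elt_inA, smul_smul, hU]
    have key1 : ∀ (t : k) c (b₀ : Fin r → A), σ₀ (op (P.inA a') • t • elt P K c x b₀ 1) =
        (t * u) • elt P K c x (Fin.snoc b₀ a' : Fin (r + 1) → A) 1 := by
      intro t c b₀
      rw [← P.inA_one, key, one_mul, P.inA_one]
    have hcoef : ∀ t : k, u * (t * u) = t := fun t => by rw [mul_left_comm, hu, mul_one]
    simp only [hc, smul_add, map_add, Finset.smul_sum, map_sum, key, key1, smul_sub, smul_smul,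
      mul_neg, mul_one, neg_mul, neg_smul, hcoef, sub_zero, Fin.val_last,
      Fin.val_castSucc, op_smul_elt, one_mul, Finset.sum_neg_distrib]
    abel

end Bidegree


/-! ### The differentials `d¹` and `d²` -/

section Cartan

variable {k A g I : Type*} [Field k] [Ring A] [Algebra k A] [LieRing g] [LieAlgebra k g]
  [LinearOrder I] {P : CrossedProduct k A g} {K : Subalgebra k A}

local notation "σ₀" => appendOp P K (CrossedProduct.stdSection P)
local notation "π₀" => collapseOp P K K (CrossedProduct.stdSection P)
local notation "ω" => wedgeOp P K

lemma fhat_add_left (x x' y : g) : P.fhat (x + x') y = P.fhat x y + P.fhat x' y := by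
  rw [P.fhat_swap, P.fhat_add_right, neg_add, ← P.fhat_swap, ← P.fhat_swap]

lemma fhat_smul_left (t : k) (x y : g) : P.fhat (t • x) y = t • P.fhat x y := by
  rw [P.fhat_swap, P.fhat_smul_right, ← smul_neg, ← P.fhat_swap]

variable (hK : P.Stable K)

lemma exists_cartanLie (x : g) : ∃ T : Module.End k (XX P K), IsBimod T ∧
      (∀ r c (y : Fin 0 → g) (a : Fin r → A) c',
        T (elt P K c y a c') = lieOp hK x (elt P K c y a c')) ∧
      ∀ y v, T (ω y v) = ω y (T v) - ω ⁅x, y⁆ v := by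
  obtain ⟨T, h1, h2, h3⟩ := exists_wedge_rec 1 (- (ω ∘ₗ (LieAlgebra.ad k g x : g →ₗ[k] g)))
    (lieOp hK x) (lieOp_bimod hK x) (fun y => (wedgeOp_bimod P K _).neg) (fun y v => by
      simp only [LinearMap.neg_apply, LinearMap.comp_apply, one_smul, map_neg]
      rw [wedgeOp_comm, neg_neg, add_neg_cancel])
  refine ⟨T, h1, h2, fun y v => ?_⟩
  rw [h3, one_smul, sub_eq_add_neg]
  rfl

/-- The extension `Ł_x` of `Λ_x` to all exterior degrees, with `[Ł_x, y ∧ -] = -[x, y] ∧ -`. -/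
def cartanLie : g →ₗ[k] Module.End k (XX P K) where
  toFun x := (exists_cartanLie hK x).choose
  map_add' x x' := by
    obtain ⟨-, h2, h3⟩ := (exists_cartanLie hK x).choose_spec
    obtain ⟨-, h2', h3'⟩ := (exists_cartanLie hK x').choose_spec
    obtain ⟨-, h2'', h3''⟩ := (exists_cartanLie hK (x + x')).choose_spec
    refine wedge_ext (fun r c z a c' => ?_) (fun y v ih => ?_)
    · rw [LinearMap.add_apply, h2, h2', h2'', map_add, LinearMap.add_apply]
    · rw [LinearMap.add_apply, h3, h3', h3'', ih, LinearMap.add_apply, add_lie, map_add, map_add,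
        LinearMap.add_apply]
      abel
  map_smul' t x := by
    obtain ⟨-, h2, h3⟩ := (exists_cartanLie hK x).choose_spec
    obtain ⟨-, h2'', h3''⟩ := (exists_cartanLie hK (t • x)).choose_spec
    refine wedge_ext (fun r c z a c' => ?_) (fun y v ih => ?_)
    · rw [LinearMap.smul_apply, h2, h2'', map_smul, LinearMap.smul_apply, RingHom.id_apply]
    · rw [LinearMap.smul_apply, h3, h3'', ih, LinearMap.smul_apply, smul_lie, map_smul, map_smul,
        LinearMap.smul_apply, smul_sub, RingHom.id_apply]

lemma cartanLie_bimod (x : g) : IsBimod (cartanLie hK x) := (exists_cartanLie hK x).choose_spec.1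

lemma cartanLie_elt (x : g) {r : ℕ} (c : P.Alg) (y : Fin 0 → g) (a : Fin r → A) (c' : P.Alg) :
    cartanLie hK x (elt P K c y a c') = lieOp hK x (elt P K c y a c') :=
  (exists_cartanLie hK x).choose_spec.2.1 r c y a c'

lemma cartanLie_wedgeOp (x y : g) (v : XX P K) :
    cartanLie hK x (ω y v) = ω y (cartanLie hK x v) - ω ⁅x, y⁆ v :=
  (exists_cartanLie hK x).choose_spec.2.2 y v

/-- The map `y ↦ h_{f̂(x,y)}`. -/
def insFhat (x : g) : g →ₗ[k] Module.End k (XX P K) where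
  toFun y := insOp P K (P.fhat x y)
  map_add' y y' := by
    rw [P.fhat_add_right, insOp_add (commStable_fhat hK x y) (commStable_fhat hK x y')]
  map_smul' t y := by
    rw [P.fhat_smul_right, insOp_smul (commStable_fhat hK x y), RingHom.id_apply]

include hK in
lemma exists_cartanIns (x : g) : ∃ T : Module.End k (XX P K), IsBimod T ∧
      (∀ r c (y : Fin 0 → g) (a : Fin r → A) c', T (elt P K c y a c') = 0) ∧
      ∀ y v, T (ω y v) = ω y (T v) + insOp P K (P.fhat x y) v := by
  obtain ⟨T, h1, h2, h3⟩ := exists_wedge_rec 1 (insFhat hK x) 0 .zero (fun y => insOp_bimod _)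
    (fun y v => by
      change insOp P K (P.fhat x y) (ω y v) + (1 : k) • ω y (insOp P K (P.fhat x y) v) = 0
      rw [insOp_wedgeOp (commStable_fhat hK x y), one_smul, neg_add_cancel])
  refine ⟨T, h1, h2, fun y v => ?_⟩
  rw [h3, one_smul]
  rfl

/-- The operators `H_x`, with `[H_x, y ∧ -] = h_{f̂(x,y)}`. -/
def cartanIns : g →ₗ[k] Module.End k (XX P K) where
  toFun x := (exists_cartanIns hK x).choose
  map_add' x x' := by
    obtain ⟨-, h2, h3⟩ := (exists_cartanIns hK x).choose_spec
    obtain ⟨-, h2', h3'⟩ := (exists_cartanIns hK x').choose_spec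
    obtain ⟨-, h2'', h3''⟩ := (exists_cartanIns hK (x + x')).choose_spec
    refine wedge_ext (fun r c z a c' => ?_) (fun y v ih => ?_)
    · rw [LinearMap.add_apply, h2, h2', h2'', add_zero]
    · rw [LinearMap.add_apply, h3, h3', h3'', ih, LinearMap.add_apply, map_add, fhat_add_left,
        insOp_add (commStable_fhat hK _ _) (commStable_fhat hK _ _), LinearMap.add_apply]
      abel
  map_smul' t x := by
    obtain ⟨-, h2, h3⟩ := (exists_cartanIns hK x).choose_spec
    obtain ⟨-, h2'', h3''⟩ := (exists_cartanIns hK (t • x)).choose_spec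
    refine wedge_ext (fun r c z a c' => ?_) (fun y v ih => ?_)
    · rw [LinearMap.smul_apply, h2, h2'', smul_zero]
    · rw [LinearMap.smul_apply, h3, h3'', ih, LinearMap.smul_apply, map_smul, fhat_smul_left,
        insOp_smul (commStable_fhat hK _ _), LinearMap.smul_apply, smul_add, RingHom.id_apply]

lemma cartanIns_bimod (x : g) : IsBimod (cartanIns hK x) := (exists_cartanIns hK x).choose_spec.1

lemma cartanIns_elt (x : g) {r : ℕ} (c : P.Alg) (y : Fin 0 → g) (a : Fin r → A) (c' : P.Alg) :
    cartanIns hK x (elt P K c y a c') = 0 :=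
  (exists_cartanIns hK x).choose_spec.2.1 r c y a c'

lemma cartanIns_wedgeOp (x y : g) (v : XX P K) :
    cartanIns hK x (ω y v) = ω y (cartanIns hK x v) + insOp P K (P.fhat x y) v :=
  (exists_cartanIns hK x).choose_spec.2.2 y v

lemma exists_dOne : ∃ T : Module.End k (XX P K), IsBimod T ∧
      (∀ r c (y : Fin 0 → g) (a : Fin r → A) c', T (elt P K c y a c') = 0) ∧
      ∀ y v, T (ω y v) = - ω y (T v) + cartanLie hK y v := by
  obtain ⟨T, h1, h2, h3⟩ := exists_wedge_rec (-1) (cartanLie hK) 0 .zero (cartanLie_bimod hK)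
    (fun y v => by rw [cartanLie_wedgeOp, lie_self, map_zero]; simp)
  exact ⟨T, h1, h2, fun y v => by rw [h3, neg_one_smul]⟩

/-- The differential `d¹`, with `d¹ (y ∧ -) + y ∧ d¹ = Ł_y`. -/
def dOne : Module.End k (XX P K) := (exists_dOne hK).choose

lemma dOne_bimod : IsBimod (dOne hK) := (exists_dOne hK).choose_spec.1

lemma dOne_elt {r : ℕ} (c : P.Alg) (y : Fin 0 → g) (a : Fin r → A) (c' : P.Alg) :
    dOne hK (elt P K c y a c') = 0 := (exists_dOne hK).choose_spec.2.1 r c y a c'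

lemma dOne_wedgeOp (y : g) (v : XX P K) :
    dOne hK (ω y v) = - ω y (dOne hK v) + cartanLie hK y v :=
  (exists_dOne hK).choose_spec.2.2 y v

lemma exists_dTwo : ∃ T : Module.End k (XX P K), IsBimod T ∧
      (∀ r c (y : Fin 0 → g) (a : Fin r → A) c', T (elt P K c y a c') = 0) ∧
      ∀ y v, T (ω y v) = - ω y (T v) + cartanIns hK y v := by
  have h0 : insOp P K (0 : A) = 0 := by
    have hc : CommStable K (0 : A) := fun t ht => by simp
    rw [← zero_smul k (0 : A), insOp_smul hc, zero_smul]
  obtain ⟨T, h1, h2, h3⟩ := exists_wedge_rec (-1) (cartanIns hK) 0 .zero (cartanIns_bimod hK)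
    (fun y v => by rw [cartanIns_wedgeOp, P.fhat_self, h0]; simp)
  exact ⟨T, h1, h2, fun y v => by rw [h3, neg_one_smul]⟩

/-- The differential `d²`, with `d² (y ∧ -) + y ∧ d² = H_y`. -/
def dTwo : Module.End k (XX P K) := (exists_dTwo hK).choose

lemma dTwo_bimod : IsBimod (dTwo hK) := (exists_dTwo hK).choose_spec.1

lemma dTwo_elt {r : ℕ} (c : P.Alg) (y : Fin 0 → g) (a : Fin r → A) (c' : P.Alg) :
    dTwo hK (elt P K c y a c') = 0 := (exists_dTwo hK).choose_spec.2.1 r c y a c'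

lemma dTwo_wedgeOp (y : g) (v : XX P K) :
    dTwo hK (ω y v) = - ω y (dTwo hK v) + cartanIns hK y v :=
  (exists_dTwo hK).choose_spec.2.2 y v

section

variable {r : ℕ} {v : XX P K} (hv : v ∈ XB P K r 0)
include hv

lemma cartanLie_XB_zero (x : g) : cartanLie hK x v = lieOp hK x v :=
  XB_ext (cartanLie_elt hK x) hv

lemma cartanIns_XB_zero (x : g) : cartanIns hK x v = 0 :=
  XB_ext (f := cartanIns hK x) (f' := 0) (cartanIns_elt hK x) hv

lemma dOne_XB_zero : dOne hK v = 0 := XB_ext (f := dOne hK) (f' := 0) (dOne_elt hK) hv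

lemma dTwo_XB_zero : dTwo hK v = 0 := XB_ext (f := dTwo hK) (f' := 0) (dTwo_elt hK) hv

end

lemma wedge_ext_apply {N : Type*} [AddCommGroup N] [Module k N] (T T' : XX P K →ₗ[k] N)
    (h0 : ∀ r, ∀ v ∈ XB P K r 0, T v = T' v)
    (hs : ∀ y v, T v = T' v → T (ω y v) = T' (ω y v)) (v : XX P K) : T v = T' v :=
  LinearMap.congr_fun (wedge_ext (fun _ _ _ _ _ => h0 _ _ (elt_mem_XB _ _ _ _)) hs) v

lemma dZero_cartanLie (x : g) (v : XX P K) :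
    dZero P K (cartanLie hK x v) = cartanLie hK x (dZero P K v) := by
  refine wedge_ext_apply (dZero P K ∘ₗ cartanLie hK x) (cartanLie hK x ∘ₗ dZero P K)
    (fun r v hv => ?_) (fun y v ih => ?_) v <;> simp only [LinearMap.comp_apply] at *
  · rw [cartanLie_XB_zero hK hv, cartanLie_XB_zero hK (dZero_mem_XB hv), dZero_lieOp]
  · simp only [cartanLie_wedgeOp, dZero_wedgeOp, map_sub, map_neg, ih]
    abel

lemma cartanLie_insOp (z : g) {q : A} (hq : CommStable K q) (v : XX P K) :
    cartanLie hK z (insOp P K q v) =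
      insOp P K q (cartanLie hK z v) - insOp P K (P.actG z q) v := by
  refine wedge_ext_apply (cartanLie hK z ∘ₗ insOp P K q)
    (insOp P K q ∘ₗ cartanLie hK z - insOp P K (P.actG z q))
    (fun r v hv => ?_) (fun y v ih => ?_) v <;>
      simp only [LinearMap.comp_apply, LinearMap.sub_apply] at *
  · rw [cartanLie_XB_zero hK hv, cartanLie_XB_zero hK (insOp_mem_XB hq hv), lieOp_insOp hK z hq]
  · simp only [cartanLie_wedgeOp, insOp_wedgeOp hq, insOp_wedgeOp (hq.actG (hK := hK) z), map_sub,
      map_neg, ih]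
    abel

lemma cartanIns_insOp (x : g) {q : A} (hq : CommStable K q) (v : XX P K) :
    cartanIns hK x (insOp P K q v) = insOp P K q (cartanIns hK x v) := by
  refine wedge_ext_apply (cartanIns hK x ∘ₗ insOp P K q) (insOp P K q ∘ₗ cartanIns hK x)
    (fun r v hv => ?_) (fun y v ih => ?_) v <;> simp only [LinearMap.comp_apply] at *
  · rw [cartanIns_XB_zero hK hv, cartanIns_XB_zero hK (insOp_mem_XB hq hv), map_zero]
  · have h := insOp_insOp hq (commStable_fhat hK x y) v
    simp only [cartanIns_wedgeOp, insOp_wedgeOp hq, map_add, map_neg, ih]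
    linear_combination (norm := abel) - h

lemma dTwo_insOp {q : A} (hq : CommStable K q) (v : XX P K) :
    dTwo hK (insOp P K q v) = - insOp P K q (dTwo hK v) := by
  refine wedge_ext_apply (dTwo hK ∘ₗ insOp P K q) (- (insOp P K q ∘ₗ dTwo hK))
    (fun r v hv => ?_) (fun y v ih => ?_) v <;>
      simp only [LinearMap.comp_apply, LinearMap.neg_apply] at *
  · rw [dTwo_XB_zero hK hv, dTwo_XB_zero hK (insOp_mem_XB hq hv), map_zero, neg_zero]
  · simp only [dTwo_wedgeOp, insOp_wedgeOp hq, map_add, map_neg, ih, cartanIns_insOp hK _ hq]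

lemma cartanIns_cartanIns (x y : g) (v : XX P K) :
    cartanIns hK x (cartanIns hK y v) = cartanIns hK y (cartanIns hK x v) := by
  refine wedge_ext_apply (cartanIns hK x ∘ₗ cartanIns hK y) (cartanIns hK y ∘ₗ cartanIns hK x)
    (fun r v hv => ?_) (fun z v ih => ?_) v <;> simp only [LinearMap.comp_apply] at *
  · simp only [cartanIns_XB_zero hK hv, map_zero]
  · simp only [cartanIns_wedgeOp, map_add, ih, cartanIns_insOp hK _ (commStable_fhat hK _ _)]
    abel

lemma dTwo_cartanIns (x : g) (v : XX P K) :
    dTwo hK (cartanIns hK x v) = cartanIns hK x (dTwo hK v) := by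
  refine wedge_ext_apply (dTwo hK ∘ₗ cartanIns hK x) (cartanIns hK x ∘ₗ dTwo hK)
    (fun r v hv => ?_) (fun y v ih => ?_) v <;> simp only [LinearMap.comp_apply] at *
  · rw [cartanIns_XB_zero hK hv, dTwo_XB_zero hK hv, map_zero, map_zero]
  · simp only [cartanIns_wedgeOp, dTwo_wedgeOp, map_add, map_neg, ih,
      dTwo_insOp hK (commStable_fhat hK _ _), cartanIns_cartanIns hK x y]
    abel

lemma dTwo_dTwo (v : XX P K) : dTwo hK (dTwo hK v) = 0 := by
  refine wedge_ext_apply (dTwo hK ∘ₗ dTwo hK) 0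
    (fun r v hv => ?_) (fun y v ih => ?_) v <;>
      simp only [LinearMap.comp_apply, LinearMap.zero_apply] at *
  · rw [dTwo_XB_zero hK hv, map_zero]
  · simp only [dTwo_wedgeOp, map_add, map_neg, ih, dTwo_cartanIns]
    simp

lemma cartanLie_cartanLie (x y : g) (v : XX P K) :
    cartanLie hK x (cartanLie hK y v) - cartanLie hK y (cartanLie hK x v) =
      - cartanLie hK ⁅x, y⁆ v +
      (dZero P K (insOp P K (P.fhat x y) v) + insOp P K (P.fhat x y) (dZero P K v)) := by
  refine wedge_ext_apply
    (cartanLie hK x ∘ₗ cartanLie hK y - cartanLie hK y ∘ₗ cartanLie hK x)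
    (- cartanLie hK ⁅x, y⁆ + (dZero P K ∘ₗ insOp P K (P.fhat x y) +
      insOp P K (P.fhat x y) ∘ₗ dZero P K)) (fun r v hv => ?_) (fun z v ih => ?_) v <;>
      simp only [LinearMap.comp_apply, LinearMap.add_apply, LinearMap.neg_apply,
        LinearMap.sub_apply] at *
  · rw [cartanLie_XB_zero hK hv, cartanLie_XB_zero hK hv, cartanLie_XB_zero hK hv,
      cartanLie_XB_zero hK (lieOp_mem_XB hK _ hv), cartanLie_XB_zero hK (lieOp_mem_XB hK _ hv),
      lieOp_lieOp]
  · have ih' := congrArg (ω z) ih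
    simp only [map_sub, map_add, map_neg] at ih'
    simp only [cartanLie_wedgeOp, dZero_wedgeOp, insOp_wedgeOp (commStable_fhat hK _ _), map_sub,
      map_neg, lie_lie, LinearMap.sub_apply]
    linear_combination (norm := abel) ih'

lemma dZero_dOne (v : XX P K) : dZero P K (dOne hK v) + dOne hK (dZero P K v) = 0 := by
  refine wedge_ext_apply (dZero P K ∘ₗ dOne hK + dOne hK ∘ₗ dZero P K) 0
    (fun r v hv => ?_) (fun y v ih => ?_) v <;>
      simp only [LinearMap.comp_apply, LinearMap.zero_apply, LinearMap.add_apply] at *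
  · rw [dOne_XB_zero hK hv, dOne_XB_zero hK (dZero_mem_XB hv), map_zero, add_zero]
  · have ih' := congrArg (ω y) ih
    simp only [map_add, map_zero] at ih'
    simp only [dOne_wedgeOp, dZero_wedgeOp, map_add, map_neg, dZero_cartanLie]
    linear_combination (norm := abel) ih'

lemma dOne_insOp {q : A} (hq : CommStable K q) (z : g) (v : XX P K) :
    dOne hK (insOp P K q (ω z v)) + insOp P K q (dOne hK (ω z v)) =
      ω z (dOne hK (insOp P K q v) + insOp P K q (dOne hK v)) + insOp P K (P.actG z q) v := by
  simp only [dOne_wedgeOp, insOp_wedgeOp hq, map_add, map_neg, cartanLie_insOp hK _ hq]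
  abel

lemma dZero_cartanIns_add (x : g) (v : XX P K) :
    dZero P K (cartanIns hK x v) - cartanIns hK x (dZero P K v) +
      (dOne hK (cartanLie hK x v) - cartanLie hK x (dOne hK v)) = 0 := by
  refine wedge_ext_apply (dZero P K ∘ₗ cartanIns hK x - cartanIns hK x ∘ₗ dZero P K +
      (dOne hK ∘ₗ cartanLie hK x - cartanLie hK x ∘ₗ dOne hK)) 0
    (fun r v hv => ?_) (fun y v ih => ?_) v <;>
      simp only [LinearMap.comp_apply, LinearMap.zero_apply, LinearMap.add_apply,
        LinearMap.sub_apply] at *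
  · rw [cartanIns_XB_zero hK hv, cartanIns_XB_zero hK (dZero_mem_XB hv), dOne_XB_zero hK hv,
      cartanLie_XB_zero hK hv, dOne_XB_zero hK (lieOp_mem_XB hK _ hv)]
    simp
  · have ih' := congrArg (ω y) ih
    have h := cartanLie_cartanLie hK x y v
    simp only [map_add, map_sub, map_zero] at ih'
    simp only [cartanIns_wedgeOp, cartanLie_wedgeOp, dOne_wedgeOp, dZero_wedgeOp, map_add, map_neg,
      map_sub]
    linear_combination (norm := abel) - ih' - h

lemma dZero_dTwo (v : XX P K) :
    dZero P K (dTwo hK v) + dOne hK (dOne hK v) + dTwo hK (dZero P K v) = 0 := by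
  refine wedge_ext_apply (dZero P K ∘ₗ dTwo hK + dOne hK ∘ₗ dOne hK + dTwo hK ∘ₗ dZero P K) 0
    (fun r v hv => ?_) (fun y v ih => ?_) v <;>
      simp only [LinearMap.comp_apply, LinearMap.zero_apply, LinearMap.add_apply] at *
  · rw [dOne_XB_zero hK hv, dTwo_XB_zero hK hv, dTwo_XB_zero hK (dZero_mem_XB hv)]
    simp
  · have ih' := congrArg (ω y) ih
    have h := dZero_cartanIns_add hK y v
    simp only [map_add, map_zero] at ih'
    simp only [dOne_wedgeOp, dTwo_wedgeOp, dZero_wedgeOp, map_add, map_neg]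
    linear_combination (norm := abel) ih' + h

lemma dOne_insOp_fhat (x y : g) (v : XX P K) :
    dOne hK (insOp P K (P.fhat x y) v) + insOp P K (P.fhat x y) (dOne hK v) =
      (cartanLie hK x (cartanIns hK y v) - cartanIns hK y (cartanLie hK x v)) -
      (cartanLie hK y (cartanIns hK x v) - cartanIns hK x (cartanLie hK y v)) +
      cartanIns hK ⁅x, y⁆ v := by
  have hq := commStable_fhat hK
  refine wedge_ext_apply (dOne hK ∘ₗ insOp P K (P.fhat x y) + insOp P K (P.fhat x y) ∘ₗ dOne hK)
    ((cartanLie hK x ∘ₗ cartanIns hK y - cartanIns hK y ∘ₗ cartanLie hK x) -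
      (cartanLie hK y ∘ₗ cartanIns hK x - cartanIns hK x ∘ₗ cartanLie hK y) +
      cartanIns hK ⁅x, y⁆)
    (fun r v hv => ?_) (fun z v ih => ?_) v <;>
      simp only [LinearMap.comp_apply, LinearMap.add_apply, LinearMap.sub_apply] at *
  · rw [dOne_XB_zero hK hv, dOne_XB_zero hK (insOp_mem_XB (hq x y) hv), cartanLie_XB_zero hK hv,
      cartanLie_XB_zero hK hv, cartanIns_XB_zero hK hv, cartanIns_XB_zero hK hv,
      cartanIns_XB_zero hK hv, cartanIns_XB_zero hK (lieOp_mem_XB hK _ hv),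
      cartanIns_XB_zero hK (lieOp_mem_XB hK _ hv)]
    simp
  · have ih' := congrArg (ω z) ih
    simp only [map_add, map_sub] at ih'
    have hc : insOp P K (P.fhat x ⁅y, z⁆) v + insOp P K (P.actG x (P.fhat y z)) v -
        insOp P K (P.fhat y ⁅x, z⁆) v - insOp P K (P.actG y (P.fhat x z)) v =
        insOp P K (P.fhat ⁅x, y⁆ z) v - insOp P K (P.actG z (P.fhat x y)) v := by
      have h : P.fhat x ⁅y, z⁆ + P.actG x (P.fhat y z) + P.actG z (P.fhat x y) =
          P.fhat ⁅x, y⁆ z + P.fhat y ⁅x, z⁆ + P.actG y (P.fhat x z) := by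
        linear_combination (norm := abel) P.fhat_cocycle x y z
      have h2 := congrArg (fun q => insOp P K q v) h
      have ha := fun a b c => (hq a b).actG (hK := hK) c
      simp only [insOp_add ((hq _ _).add (ha _ _ _)) (ha _ _ _), insOp_add (hq _ _) (ha _ _ _),
        insOp_add ((hq _ _).add (hq _ _)) (ha _ _ _), insOp_add (hq _ _) (hq _ _),
        LinearMap.add_apply] at h2
      linear_combination (norm := abel) h2
    rw [dOne_insOp hK (hq x y)]
    simp only [cartanLie_wedgeOp, cartanIns_wedgeOp, map_add, map_sub,
      cartanLie_insOp hK _ (hq _ _)]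
    linear_combination (norm := abel) ih' + hc

lemma dOne_cartanIns_add (x : g) (v : XX P K) :
    dOne hK (cartanIns hK x v) - cartanIns hK x (dOne hK v) +
      (dTwo hK (cartanLie hK x v) - cartanLie hK x (dTwo hK v)) = 0 := by
  refine wedge_ext_apply (dOne hK ∘ₗ cartanIns hK x - cartanIns hK x ∘ₗ dOne hK +
      (dTwo hK ∘ₗ cartanLie hK x - cartanLie hK x ∘ₗ dTwo hK)) 0
    (fun r v hv => ?_) (fun y v ih => ?_) v <;>
      simp only [LinearMap.comp_apply, LinearMap.zero_apply, LinearMap.add_apply,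
        LinearMap.sub_apply] at *
  · rw [cartanIns_XB_zero hK hv, dOne_XB_zero hK hv, dTwo_XB_zero hK hv,
      cartanLie_XB_zero hK hv, dTwo_XB_zero hK (lieOp_mem_XB hK _ hv)]
    simp
  · have ih' := congrArg (ω y) ih
    have h := dOne_insOp_fhat hK x y v
    simp only [map_add, map_sub, map_zero] at ih'
    simp only [cartanIns_wedgeOp, cartanLie_wedgeOp, dOne_wedgeOp, dTwo_wedgeOp, map_add, map_neg,
      map_sub]
    linear_combination (norm := abel) h - ih'

lemma dOne_dTwo (v : XX P K) : dOne hK (dTwo hK v) + dTwo hK (dOne hK v) = 0 := by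
  refine wedge_ext_apply (dOne hK ∘ₗ dTwo hK + dTwo hK ∘ₗ dOne hK) 0
    (fun r v hv => ?_) (fun y v ih => ?_) v <;>
      simp only [LinearMap.comp_apply, LinearMap.zero_apply, LinearMap.add_apply] at *
  · rw [dOne_XB_zero hK hv, dTwo_XB_zero hK hv]
    simp
  · have ih' := congrArg (ω y) ih
    have h := dOne_cartanIns_add hK y v
    simp only [map_add, map_zero] at ih'
    simp only [dOne_wedgeOp, dTwo_wedgeOp, map_add, map_neg]
    linear_combination (norm := abel) ih' + h

end Cartan


section Differentials

variable {k A g I : Type*} [Field k] [Ring A] [Algebra k A] [LieRing g] [LieAlgebra k g]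
  [LinearOrder I] {P : CrossedProduct k A g} {K : Subalgebra k A}

local notation "σ₀" => appendOp P K (CrossedProduct.stdSection P)
local notation "π₀" => collapseOp P K K (CrossedProduct.stdSection P)
local notation "ω" => wedgeOp P K

/-- Maps that are constructed by recursion on the exterior degree are homogeneous. -/
lemma wedge_mem {N : Type*} [AddCommGroup N] [Module k N] {T : XX P K →ₗ[k] N} {r : ℕ}
    (Q : ℕ → Submodule k N) (h0 : ∀ v ∈ XB P K r 0, T v ∈ Q 0)
    (hs : ∀ s y, ∀ v ∈ XB P K r s, T v ∈ Q s → T (ω y v) ∈ Q (s + 1)) {s : ℕ} {v : XX P K}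
    (hv : v ∈ XB P K r s) : T v ∈ Q s := by
  refine XB_le (Q := (Q s).comap T) (fun c x a c' => ?_) hv
  refine wedge_induction (p := fun s x => T (elt P K c x a c') ∈ Q s)
    (fun x => h0 _ (elt_mem_XB _ _ _ _)) (fun s y x ih => ?_) s x
  rw [← wedgeOp_elt]
  exact hs s y _ (elt_mem_XB _ _ _ _) ih

/-- Linear maps on `X_{r*}` agree if they agree in exterior degree zero and the agreement is
inherited by the operators `y ∧ -`. -/
lemma wedge_ext_XB {N : Type*} [AddCommGroup N] [Module k N] {r : ℕ} (T T' : XX P K →ₗ[k] N)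
    (h0 : ∀ v ∈ XB P K r 0, T v = T' v)
    (hs : ∀ s y, ∀ v ∈ XB P K r s, T v = T' v → T (ω y v) = T' (ω y v)) {s : ℕ} {v : XX P K}
    (hv : v ∈ XB P K r s) : T v = T' v := by
  have := wedge_mem (T := T - T') (fun _ => ⊥) (r := r)
    (fun v hv => by rw [LinearMap.sub_apply, h0 v hv, sub_self]; exact zero_mem _)
    (fun s y v hv ih => by
      rw [Submodule.mem_bot, LinearMap.sub_apply, sub_eq_zero] at *
      exact hs s y v hv ih) hv
  rwa [Submodule.mem_bot, LinearMap.sub_apply, sub_eq_zero] at this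

variable (hK : P.Stable K)

lemma cartanLie_mem_XB (x : g) {r s : ℕ} {v : XX P K} (hv : v ∈ XB P K r s) :
    cartanLie hK x v ∈ XB P K r s := by
  refine wedge_mem (fun s => XB P K r s) (fun v hv => ?_) (fun s y v hv ih => ?_) hv
  · rw [cartanLie_XB_zero hK hv]
    exact lieOp_mem_XB hK x hv
  · rw [cartanLie_wedgeOp]
    exact sub_mem (wedgeOp_mem_XB _ ih) (wedgeOp_mem_XB _ hv)

lemma dOne_mem_XB {r s : ℕ} {v : XX P K} (hv : v ∈ XB P K r (s + 1)) :
    dOne hK v ∈ XB P K r s := by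
  refine wedge_mem (T := dOne hK) (r := r) (fun s => if s = 0 then ⊥ else XB P K r (s - 1))
    (fun v hv => ?_) (fun s y v hv ih => ?_) hv
  · rw [dOne_XB_zero hK hv]
    exact zero_mem _
  · rw [dOne_wedgeOp, if_neg (Nat.succ_ne_zero s)]
    refine add_mem (neg_mem ?_) (cartanLie_mem_XB hK y hv)
    rcases s with - | s
    · rw [dOne_XB_zero hK hv, map_zero]
      exact zero_mem _
    · exact wedgeOp_mem_XB y ih

lemma cartanIns_mem_XB (x : g) {r s : ℕ} {v : XX P K} (hv : v ∈ XB P K r (s + 1)) :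
    cartanIns hK x v ∈ XB P K (r + 1) s := by
  refine wedge_mem (T := cartanIns hK x) (r := r)
    (fun s => if s = 0 then ⊥ else XB P K (r + 1) (s - 1))
    (fun v hv => ?_) (fun s y v hv ih => ?_) hv
  · rw [cartanIns_XB_zero hK hv]
    exact zero_mem _
  · rw [cartanIns_wedgeOp, if_neg (Nat.succ_ne_zero s)]
    refine add_mem ?_ (insOp_mem_XB (commStable_fhat hK x y) hv)
    rcases s with - | s
    · rw [cartanIns_XB_zero hK hv, map_zero]
      exact zero_mem _
    · exact wedgeOp_mem_XB y ih

lemma dTwo_XB_one {r : ℕ} {v : XX P K} (hv : v ∈ XB P K r 1) : dTwo hK v = 0 := by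
  refine wedge_mem (T := dTwo hK) (r := r) (fun s => if s ≤ 1 then ⊥ else ⊤)
    (fun v hv => ?_) (fun s y v hv ih => ?_) hv
  · rw [dTwo_XB_zero hK hv]
    exact zero_mem _
  · rcases s with - | s
    · rw [dTwo_wedgeOp, dTwo_XB_zero hK hv, cartanIns_XB_zero hK hv]
      simp
    · simp

lemma dTwo_mem_XB {r s : ℕ} {v : XX P K} (hv : v ∈ XB P K r (s + 2)) :
    dTwo hK v ∈ XB P K (r + 1) s := by
  refine wedge_mem (T := dTwo hK) (r := r)
    (fun s => if s ≤ 1 then ⊥ else XB P K (r + 1) (s - 2))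
    (fun v hv => ?_) (fun s y v hv ih => ?_) hv
  · rw [dTwo_XB_zero hK hv]
    exact zero_mem _
  · rw [dTwo_wedgeOp]
    rcases s with - | s
    · rw [dTwo_XB_zero hK hv, cartanIns_XB_zero hK hv]
      simp
    · rw [if_neg (by omega)]
      refine add_mem (neg_mem ?_) (cartanIns_mem_XB hK y hv)
      rcases s with - | s
      · rw [dTwo_XB_one hK hv, map_zero]
        exact zero_mem _
      · rw [if_neg (by omega)] at ih
        exact wedgeOp_mem_XB y ih

/-- If `σ⁰ T` vanishes on the tensors with last factor `1` in exterior degree zero, and this is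
inherited by the operators `y ∧ -`, then it vanishes on all tensors with last factor `1`. -/
lemma appendOp_comp_eq_zero {T : XX P K →ₗ[k] XX P K}
    (h0 : ∀ r, ∀ v ∈ X1 P K, v ∈ XB P K r 0 → σ₀ (T v) = 0)
    (hs : ∀ y, ∀ v ∈ X1 P K, σ₀ (T v) = 0 → σ₀ (T (ω y v)) = 0) {v : XX P K} (hv : v ∈ X1 P K) :
    σ₀ (T v) = 0 := by
  refine X1_le (Q := LinearMap.ker (σ₀ ∘ₗ T)) (fun r s c x a => ?_) hv
  rw [LinearMap.mem_ker, LinearMap.comp_apply]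
  refine wedge_induction (p := fun s x => σ₀ (T (elt P K c x a 1)) = 0)
    (fun x => h0 r _ (elt_mem_X1 _ _ _) (elt_mem_XB _ _ _ _)) (fun s y x ih => ?_) s x
  rw [← wedgeOp_elt]
  exact hs y _ (elt_mem_X1 _ _ _) ih

lemma appendOp_cartanLie (x : g) {v : XX P K} (hv : v ∈ X1 P K) :
    σ₀ (cartanLie hK x v) = 0 := by
  refine appendOp_comp_eq_zero (fun r v hv hr => ?_) (fun y v hv ih => ?_) hv
  · rw [cartanLie_XB_zero hK hr, ← add_sub_cancel_right (lieOp hK x v) (op (P.inG x) • v), map_sub,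
      appendOp_X1 _ (lieOp_add_mem_X1 hK x hv), appendOp_op_inG _ _ (X1_le_XA hv),
      appendOp_X1 _ hv, smul_zero, sub_zero]
  · rw [cartanLie_wedgeOp, map_sub, appendOp_wedgeOp, appendOp_wedgeOp, ih, appendOp_X1 _ hv]
    simp

lemma appendOp_dOne {v : XX P K} (hv : v ∈ X1 P K) : σ₀ (dOne hK v) = 0 := by
  refine appendOp_comp_eq_zero (fun r v hv hr => ?_) (fun y v hv ih => ?_) hv
  · rw [dOne_XB_zero hK hr, map_zero]
  · rw [dOne_wedgeOp, map_add, map_neg, appendOp_wedgeOp, ih, appendOp_cartanLie hK y hv]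
    simp

lemma appendOp_cartanIns (x : g) {v : XX P K} (hv : v ∈ X1 P K) :
    σ₀ (cartanIns hK x v) = 0 := by
  refine appendOp_comp_eq_zero (fun r v hv hr => ?_) (fun y v hv ih => ?_) hv
  · rw [cartanIns_XB_zero hK hr, map_zero]
  · rw [cartanIns_wedgeOp, map_add, appendOp_wedgeOp, ih,
      appendOp_X1 _ (insOp_mem_X1 (commStable_fhat hK x y) hv)]
    simp

lemma appendOp_dTwo {v : XX P K} (hv : v ∈ X1 P K) : σ₀ (dTwo hK v) = 0 := by
  refine appendOp_comp_eq_zero (fun r v hv hr => ?_) (fun y v hv ih => ?_) hv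
  · rw [dTwo_XB_zero hK hr, map_zero]
  · rw [dTwo_wedgeOp, map_add, map_neg, appendOp_wedgeOp, ih, appendOp_cartanIns hK y hv]
    simp

/-- The differentials `d^l`; those with `l > 2` are zero. -/
def dMap : ℕ → Module.End k (XX P K)
  | 0 => dZero P K
  | 1 => dOne hK
  | 2 => dTwo hK
  | _ => 0

lemma dMap_bimod (l : ℕ) : IsBimod (dMap hK l) := by
  match l with
  | 0 => exact dZero_bimod
  | 1 => exact dOne_bimod hK
  | 2 => exact dTwo_bimod hK
  | l + 3 => exact .zero

lemma dMap_of_lt {l : ℕ} (hl : 2 < l) : dMap hK l = 0 := by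
  obtain ⟨l, rfl⟩ := Nat.exists_eq_add_of_lt hl
  rw [show 2 + l + 1 = l + 3 by omega]
  rfl

lemma dMap_mem_XB (l r s : ℕ) (hl : l ≤ s) {v : XX P K} (hv : v ∈ XB P K r s) :
    dMap hK l v ∈ XB P K (r + l - 1) (s - l) := by
  match l with
  | 0 => exact dZero_mem_XB hv
  | 1 =>
    obtain ⟨s, rfl⟩ := Nat.exists_eq_add_of_le' hl
    exact dOne_mem_XB hK hv
  | 2 =>
    obtain ⟨s, rfl⟩ := Nat.exists_eq_add_of_le' hl
    exact dTwo_mem_XB hK hv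
  | l + 3 => exact zero_mem _

lemma dMap_of_degree_lt {l r s : ℕ} (hl : s < l) {v : XX P K} (hv : v ∈ XB P K r s) :
    dMap hK l v = 0 := by
  match l with
  | 1 =>
    obtain rfl : s = 0 := by omega
    exact dOne_XB_zero hK hv
  | 2 =>
    rcases s with - | s
    · exact dTwo_XB_zero hK hv
    · obtain rfl : s = 0 := by omega
      exact dTwo_XB_one hK hv
  | l + 3 => rfl

lemma appendOp_dMap {l : ℕ} (hl : 0 < l) {v : XX P K} (hv : v ∈ X1 P K) :
    σ₀ (dMap hK l v) = 0 := by
  match l with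
  | 1 => exact appendOp_dOne hK hv
  | 2 => exact appendOp_dTwo hK hv
  | l + 3 => exact map_zero _

/-- The components of `d ∘ d = 0`. -/
lemma sum_dMap_dMap (l : ℕ) (v : XX P K) :
    ∑ j ∈ Finset.range (l + 1), dMap hK (l - j) (dMap hK j v) = 0 := by
  match l with
  | 0 => rw [Finset.sum_range_one]; exact dZero_dZero v
  | 1 =>
    rw [Finset.sum_range_succ, Finset.sum_range_one, add_comm]
    exact dZero_dOne hK v
  | 2 =>
    rw [Finset.sum_range_succ, Finset.sum_range_succ, Finset.sum_range_one]
    have := dZero_dTwo hK v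
    change dTwo hK (dZero P K v) + dOne hK (dOne hK v) + dZero P K (dTwo hK v) = 0
    linear_combination (norm := abel) this
  | 3 =>
    rw [Finset.sum_range_succ, Finset.sum_range_succ, Finset.sum_range_succ, Finset.sum_range_one]
    change (0 : XX P K) + dTwo hK (dOne hK v) + dOne hK (dTwo hK v) + dZero P K 0 = 0
    rw [map_zero, add_zero, zero_add, add_comm]
    exact dOne_dTwo hK v
  | 4 =>
    rw [Finset.sum_range_succ, Finset.sum_range_succ, Finset.sum_range_succ,
      Finset.sum_range_succ, Finset.sum_range_one]
    change (0 : XX P K) + 0 + dTwo hK (dTwo hK v) + dOne hK 0 + dZero P K 0 = 0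
    rw [map_zero, map_zero, dTwo_dTwo]
    simp
  | l + 5 =>
    refine Finset.sum_eq_zero fun j _ => ?_
    rcases le_or_gt j 2 with hj | hj
    · rw [dMap_of_lt hK (by omega : 2 < l + 5 - j), LinearMap.zero_apply]
    · rw [dMap_of_lt hK hj, LinearMap.zero_apply, map_zero]

/-- The recursion formula for the differentials. -/
lemma dMap_eq {l : ℕ} (hl : 0 < l) {v : XX P K} (hv : v ∈ X1 P K) (hπ : π₀ (dMap hK l v) = 0) :
    dMap hK l v = - ∑ j ∈ Finset.range l, σ₀ (dMap hK (l - j) (dMap hK j v)) := by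
  have h := congrArg σ₀ (sum_dMap_dMap hK l v)
  rw [Finset.sum_range_succ, map_add, map_sum, map_zero, Nat.sub_self] at h
  have h2 := dZero_appendOp P.stdSection (dMap hK l v)
  rw [appendOp_dMap hK hl hv, hπ, map_zero, sub_zero, eq_comm, sub_eq_zero] at h2
  change _ + σ₀ (dZero P K (dMap hK l v)) = 0 at h
  rw [← h2] at h
  exact (neg_eq_of_add_eq_zero_right h).symm

end Differentials


/-! ### The algebra `Y_*` -/

section YBasics

variable {k A g I : Type*} [Field k] [Ring A] [Algebra k A] [LieRing g] [LieAlgebra k g]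
  [LinearOrder I] (P : CrossedProduct k A g)

namespace CrossedProduct

lemma Y_rel {u v : FreeAlgebra k (Gen A g)} (h : P.YRel u v) :
    RingQuot.mkAlgHom k P.YRel u = RingQuot.mkAlgHom k P.YRel v :=
  RingQuot.mkAlgHom_rel k h

lemma yA_add (a a' : A) : P.yA (a + a') = P.yA a + P.yA a' := by
  have h := P.Y_rel (.a_add a a')
  simp only [map_add] at h
  exact h

lemma yA_mul (a a' : A) : P.yA (a * a') = P.yA a * P.yA a' := by
  have h := P.Y_rel (.a_mul a a')
  simp only [map_mul] at h
  exact h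

lemma yA_algebraMap (t : k) : P.yA (algebraMap k A t) = algebraMap k P.Y t := by
  have h := P.Y_rel (.a_scalar t)
  rwa [AlgHom.commutes] at h

/-- The map `A → Y_*`. -/
def yAHom : A →ₐ[k] P.Y where
  toFun := P.yA
  map_one' := by rw [← map_one (algebraMap k A), yA_algebraMap, map_one]
  map_mul' := P.yA_mul
  map_zero' := by rw [← map_zero (algebraMap k A), yA_algebraMap, map_zero]
  map_add' := P.yA_add
  commutes' := P.yA_algebraMap

/-- A map from `g` that preserves the combinations `t x + x'` is linear. -/
def linOfRel {N : Type*} [AddCommGroup N] [Module k N] (f : g → N)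
    (h : ∀ (t : k) x x', f (t • x + x') = t • f x + f x') : g →ₗ[k] N where
  toFun := f
  map_add' x x' := by simpa using h 1 x x'
  map_smul' t x := by
    have h0 : f 0 = 0 := by simpa using h 1 0 0
    simpa [h0] using h t x 0

/-- The map `x ↦ y_x`. -/
def yyLin : g →ₗ[k] P.Y := linOfRel P.yy fun t x x' => by
  have h := P.Y_rel (.y_lin t x x')
  simp only [map_add, map_smul] at h
  exact h

/-- The map `x ↦ z_x`. -/
def yzLin : g →ₗ[k] P.Y := linOfRel P.yz fun t x x' => by
  have h := P.Y_rel (.z_lin t x x')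
  simp only [map_add, map_smul] at h
  exact h

/-- The map `x ↦ e_x`. -/
def yeLin : g →ₗ[k] P.Y := linOfRel P.ye fun t x x' => by
  have h := P.Y_rel (.e_lin t x x')
  simp only [map_add, map_smul] at h
  exact h

lemma ye_neg (x : g) : P.ye (-x) = - P.ye x := map_neg P.yeLin x

lemma yy_yA (x : g) (a : A) : P.yy x * P.yA a = P.yA (P.actG x a) + P.yA a * P.yy x := by
  have h := P.Y_rel (.y_a x a)
  simp only [map_add, map_mul] at h
  exact h

lemma yz_yA (x : g) (a : A) : P.yz x * P.yA a = P.yA (P.actG x a) + P.yA a * P.yz x := by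
  have h := P.Y_rel (.z_a x a)
  simp only [map_add, map_mul] at h
  exact h

lemma ye_yA (x : g) (a : A) : P.ye x * P.yA a = P.yA a * P.ye x := by
  have h := P.Y_rel (.e_a x a)
  simp only [map_mul] at h
  exact h

lemma ye_yy (x' x : g) : P.ye x' * P.yy x = P.yy x * P.ye x' + P.ye ⁅x', x⁆ := by
  have h := P.Y_rel (.e_y x' x)
  simp only [map_add, map_mul] at h
  exact h

lemma ye_yz (x' x : g) : P.ye x' * P.yz x = P.yz x * P.ye x' := by
  have h := P.Y_rel (.e_z x' x)
  simp only [map_mul] at h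
  exact h

lemma ye_ye_self (x : g) : P.ye x * P.ye x = 0 := by
  have h := P.Y_rel (.e_e x)
  simp only [map_mul, map_zero] at h
  exact h

lemma yy_yy (x' x : g) : P.yy x' * P.yy x =
    P.yy x * P.yy x' + P.yy ⁅x', x⁆ + P.yA (P.fhat x' x) := by
  have h := P.Y_rel (.y_y x' x)
  simp only [map_add, map_mul] at h
  exact h

lemma yz_yy (x' x : g) : P.yz x' * P.yy x =
    P.yy x * P.yz x' + P.yz ⁅x', x⁆ + P.yA (P.fhat x' x) := by
  have h := P.Y_rel (.z_y x' x)
  simp only [map_add, map_mul] at h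
  exact h

lemma yz_yz (x' x : g) : P.yz x' * P.yz x =
    P.yz x * P.yz x' + P.yz ⁅x', x⁆ + P.yA (P.fhat x' x) := by
  have h := P.Y_rel (.z_z x' x)
  simp only [map_add, map_mul] at h
  exact h

lemma ye_ye (x x' : g) : P.ye x * P.ye x' = - (P.ye x' * P.ye x) := by
  have h := P.ye_ye_self (x + x')
  have ha : P.ye (x + x') = P.ye x + P.ye x' := map_add P.yeLin x x'
  rw [ha, add_mul, mul_add, mul_add, P.ye_ye_self, P.ye_ye_self, zero_add, add_zero] at h
  exact eq_neg_of_add_eq_zero_left h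

lemma yrho_yA (x : g) (a : A) : P.yrho x * P.yA a = P.yA a * P.yrho x := by
  rw [yrho, sub_mul, mul_sub, yy_yA, yz_yA]; abel

lemma yrho_yz (x' x : g) : P.yrho x' * P.yz x = P.yz x * P.yrho x' := by
  have h : P.yy x' * P.yz x = P.yz x * P.yy x' - P.yz ⁅x, x'⁆ - P.yA (P.fhat x x') := by
    rw [yz_yy]; abel
  have h1 : P.yz ⁅x, x'⁆ = - P.yz ⁅x', x⁆ := by
    rw [← lie_skew]; exact map_neg P.yzLin _
  have h2 : P.yA (P.fhat x x') = - P.yA (P.fhat x' x) := by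
    rw [fhat_swap]; exact map_neg P.yAHom _
  rw [yrho, sub_mul, mul_sub, yz_yz, h, h1, h2]; abel

lemma ye_yrho (x' x : g) : P.ye x' * P.yrho x = P.yrho x * P.ye x' - P.ye ⁅x', x⁆ := by
  rw [yrho, sub_mul, mul_sub, ye_yy, ye_yz]; abel

/-- `Y_*` is generated by the generators, by multiplications on the right. -/
lemma Y_le_of_mul {Q : Submodule k P.Y} (h1 : 1 ∈ Q) (hm : ∀ v ∈ Q, ∀ t, v * P.yGen t ∈ Q)
    (v : P.Y) : v ∈ Q := by
  obtain ⟨w, rfl⟩ := RingQuot.mkAlgHom_surjective k P.YRel v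
  suffices h : ∀ v ∈ Q, v * RingQuot.mkAlgHom k P.YRel w ∈ Q by simpa using h 1 h1
  induction w using FreeAlgebra.induction with
  | grade0 t =>
    intro v hv
    rw [AlgHom.commutes, ← Algebra.commutes, ← Algebra.smul_def]
    exact Q.smul_mem _ hv
  | grade1 t => exact fun v hv => hm v hv t
  | mul a b ha hb =>
    intro v hv
    rw [map_mul, ← mul_assoc]
    exact hb _ (ha _ hv)
  | add a b ha hb =>
    intro v hv
    rw [map_add, mul_add]
    exact Q.add_mem (ha _ hv) (hb _ hv)

variable {P} in
lemma Ygr_le {Q : ℕ → Submodule k P.Y} (h1 : 1 ∈ Q 0)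
    (hm : ∀ s, ∀ v ∈ P.Ygr s, v ∈ Q s → ∀ t, v * P.yGen t ∈ Q (s + Gen.deg t)) (s : ℕ) :
    P.Ygr s ≤ Q s := by
  refine Submodule.span_le.2 ?_
  rintro _ ⟨L, rfl, rfl⟩
  induction L using List.reverseRecOn with
  | nil => simpa using h1
  | append_singleton L t ih =>
    simpa using hm _ _ (Submodule.subset_span ⟨L, rfl, rfl⟩) ih t

lemma one_mem_Ygr : (1 : P.Y) ∈ P.Ygr 0 := Submodule.subset_span ⟨[], rfl, rfl⟩

lemma yGen_mem_Ygr (t : Gen A g) : P.yGen t ∈ P.Ygr (Gen.deg t) :=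
  Submodule.subset_span ⟨[t], by simp, by simp⟩

variable {P} in
lemma mul_mem_Ygr {s t : ℕ} {v w : P.Y} (hv : v ∈ P.Ygr s) (hw : w ∈ P.Ygr t) :
    v * w ∈ P.Ygr (s + t) := by
  have h : P.Ygr s * P.Ygr t ≤ P.Ygr (s + t) := by
    rw [Ygr, Ygr, Submodule.span_mul_span]
    refine Submodule.span_le.2 ?_
    rintro _ ⟨_, ⟨L, rfl, rfl⟩, _, ⟨L', rfl, rfl⟩, rfl⟩
    exact Submodule.subset_span ⟨L ++ L', by simp, by simp⟩
  exact h (Submodule.mul_mem_mul hv hw)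

variable {P} in
lemma mul_mem_Ygr_left {s : ℕ} {v w : P.Y} (hv : v ∈ P.Ygr 0) (hw : w ∈ P.Ygr s) :
    v * w ∈ P.Ygr s := by
  have h := mul_mem_Ygr hv hw
  rwa [zero_add] at h

variable {P} in
lemma mul_mem_Ygr_right {s : ℕ} {v w : P.Y} (hv : v ∈ P.Ygr s) (hw : w ∈ P.Ygr 0) :
    v * w ∈ P.Ygr s := by
  have h := mul_mem_Ygr hv hw
  rwa [add_zero] at h

/-! The two ways in which `Y_*` is a ring, as a quotient and as an algebra, are only identified
by unfolding definitions; the following instances of general facts are stated for the first. -/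

variable {P} in
lemma Y_neg_mul (v w : P.Y) : -v * w = -(v * w) := neg_mul v w

variable {P} in
lemma Y_smul_sub (t : k) (v w : P.Y) : t • v - t • w = t • (v - w) := (smul_sub t v w).symm

variable {P} in
lemma Y_smul_neg (t : k) (v : P.Y) : t • -v = -(t • v) := smul_neg t v

variable {P} in
lemma Y_sign_smul (s : ℕ) (v : P.Y) : (-1 : k) ^ s • (-1 : k) ^ s • v = v := by
  rw [smul_smul, ← mul_pow, neg_one_mul, neg_neg, one_pow, one_smul]

lemma yA_mem_Ygr (a : A) : P.yA a ∈ P.Ygr 0 := P.yGen_mem_Ygr (.a a)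
lemma yy_mem_Ygr (x : g) : P.yy x ∈ P.Ygr 0 := P.yGen_mem_Ygr (.y x)
lemma yz_mem_Ygr (x : g) : P.yz x ∈ P.Ygr 0 := P.yGen_mem_Ygr (.z x)
lemma ye_mem_Ygr (x : g) : P.ye x ∈ P.Ygr 1 := P.yGen_mem_Ygr (.e x)
lemma yrho_mem_Ygr (x : g) : P.yrho x ∈ P.Ygr 0 := sub_mem (P.yz_mem_Ygr x) (P.yy_mem_Ygr x)

lemma mem_iSup_Ygr (v : P.Y) : v ∈ ⨆ s, P.Ygr s := by
  refine P.Y_le_of_mul (Submodule.mem_iSup_of_mem 0 P.one_mem_Ygr) (fun v hv t => ?_) v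
  induction hv using Submodule.iSup_induction' with
  | mem s v hv => exact Submodule.mem_iSup_of_mem _ (mul_mem_Ygr hv (P.yGen_mem_Ygr t))
  | zero => simp
  | add v w _ _ hv hw => rw [add_mul]; exact add_mem hv hw

variable {P} in
lemma Ygr_hom_ext {N : Type*} [AddCommGroup N] [Module k N] {T T' : P.Y →ₗ[k] N}
    (h : ∀ s, ∀ v ∈ P.Ygr s, T v = T' v) : T = T' :=
  LinearMap.ext fun v => (iSup_le h : ⨆ s, P.Ygr s ≤ LinearMap.eqLocus T T') (P.mem_iSup_Ygr v)

lemma eProd_cons {s : ℕ} (y : g) (x : Fin s → g) :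
    P.eProd (Fin.cons y x : Fin (s + 1) → g) = P.ye y * P.eProd x := by
  simp [eProd]

lemma eProd_zero (x : Fin 0 → g) : P.eProd x = 1 := by simp [eProd]

lemma eProd_mem_Ygr {s : ℕ} (x : Fin s → g) : P.eProd x ∈ P.Ygr s := by
  refine wedge_induction (p := fun s x => P.eProd x ∈ P.Ygr s) (fun x => ?_)
    (fun s y x hx => ?_) s x
  · rw [eProd_zero]; exact P.one_mem_Ygr
  · rw [eProd_cons, add_comm]; exact mul_mem_Ygr (P.ye_mem_Ygr y) hx

lemma eProd_mul_yA {s : ℕ} (x : Fin s → g) (a : A) : P.eProd x * P.yA a = P.yA a * P.eProd x := by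
  refine wedge_induction (p := fun s x => P.eProd x * P.yA a = P.yA a * P.eProd x)
    (fun x => ?_) (fun s y x hx => ?_) s x
  · rw [eProd_zero, one_mul, mul_one]
  · rw [eProd_cons, mul_assoc, hx, ← mul_assoc, ye_yA, mul_assoc]

lemma eProd_mul_yz {s : ℕ} (x : Fin s → g) (z : g) :
    P.eProd x * P.yz z = P.yz z * P.eProd x := by
  refine wedge_induction (p := fun s x => P.eProd x * P.yz z = P.yz z * P.eProd x)
    (fun x => ?_) (fun s y x hx => ?_) s x
  · rw [eProd_zero, one_mul, mul_one]
  · rw [eProd_cons, mul_assoc, hx, ← mul_assoc, ye_yz, mul_assoc]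

/-- The product `e_{x_1} ⋯ e_{x_s}` as a linear map on `g^{∧s}`; it comes from the algebra map
from the exterior algebra. -/
def eMap (s : ℕ) : (⋀[k]^s g) →ₗ[k] P.Y :=
  (ExteriorAlgebra.lift k ⟨P.yeLin, P.ye_ye_self⟩).toLinearMap ∘ₗ (⋀[k]^s g).subtype

lemma eMap_ιMulti (s : ℕ) (x : Fin s → g) :
    P.eMap s (exteriorPower.ιMulti k s x) = P.eProd x := by
  rw [eMap, LinearMap.comp_apply, Submodule.subtype_apply, exteriorPower.ιMulti_apply_coe,
    ExteriorAlgebra.ιMulti_apply, AlgHom.toLinearMap_apply, map_list_prod, List.map_ofFn, eProd]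
  congr 2
  funext i
  exact ExteriorAlgebra.lift_ι_apply k P.yeLin P.ye_ye_self (x i)

/-- The algebra maps out of `E` given by a map on `A` and a map on `g` exist whether or not a
basis of `g` is fixed. -/
lemma exists_algHom_of_rel {R : Type*} [Ring R] [Algebra k R] (α : A →ₐ[k] R) (β : g →ₗ[k] R)
    (h1 : ∀ x a, β x * α a = α (P.actG x a) + α a * β x)
    (h2 : ∀ x y, β x * β y = β y * β x + β ⁅x, y⁆ + α (P.fhat x y)) :
    ∃ φ : P.Alg →ₐ[k] R, (∀ a, φ (P.inA a) = α a) ∧ ∀ x, φ (P.inG x) = β x := by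
  classical
  let _ : LinearOrder (Module.Basis.ofVectorSpaceIndex k g) := linearOrderOfSTO WellOrderingRel
  exact P.exists_algHom (Module.Basis.ofVectorSpace k g) α β h1 fun x y => by rw [h2 x y]; abel

/-- The algebra map `E → Y_*` with `a ↦ a` and `1 # x ↦ y_x`. -/
def toYy : P.Alg →ₐ[k] P.Y := (P.exists_algHom_of_rel P.yAHom P.yyLin P.yy_yA P.yy_yy).choose

lemma toYy_inA (a : A) : P.toYy (P.inA a) = P.yA a :=
  (P.exists_algHom_of_rel P.yAHom P.yyLin P.yy_yA P.yy_yy).choose_spec.1 a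

lemma toYy_inG (x : g) : P.toYy (P.inG x) = P.yy x :=
  (P.exists_algHom_of_rel P.yAHom P.yyLin P.yy_yA P.yy_yy).choose_spec.2 x

/-- The algebra map `E → Y_*` with `a ↦ a` and `1 # x ↦ z_x`. -/
def toYz : P.Alg →ₐ[k] P.Y := (P.exists_algHom_of_rel P.yAHom P.yzLin P.yz_yA P.yz_yz).choose

lemma toYz_inA (a : A) : P.toYz (P.inA a) = P.yA a :=
  (P.exists_algHom_of_rel P.yAHom P.yzLin P.yz_yA P.yz_yz).choose_spec.1 a

lemma toYz_inG (x : g) : P.toYz (P.inG x) = P.yz x :=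
  (P.exists_algHom_of_rel P.yAHom P.yzLin P.yz_yA P.yz_yz).choose_spec.2 x

/-- `E` is generated by `A` and `g`, by multiplications on the left. -/
lemma Alg_induction_gen {p : P.Alg → Prop} (one : p 1)
    (mulA : ∀ a u, p u → p (P.inA a * u)) (mulG : ∀ x u, p u → p (P.inG x * u))
    (add : ∀ u v, p u → p v → p (u + v)) (u : P.Alg) : p u := by
  classical
  let _ : LinearOrder (Module.Basis.ofVectorSpaceIndex k g) := linearOrderOfSTO WellOrderingRel
  exact P.Alg_induction_left (Module.Basis.ofVectorSpace k g) one mulA mulG add u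

lemma toYy_mem_Ygr (c : P.Alg) : P.toYy c ∈ P.Ygr 0 := by
  induction c using P.Alg_induction_gen with
  | one => rw [map_one]; exact P.one_mem_Ygr
  | mulA a u hu => rw [map_mul, toYy_inA]; exact mul_mem_Ygr_left (P.yA_mem_Ygr a) hu
  | mulG x u hu => rw [map_mul, toYy_inG]; exact mul_mem_Ygr_left (P.yy_mem_Ygr x) hu
  | add u v hu hv => rw [map_add]; exact add_mem hu hv

lemma toYz_mem_Ygr (c : P.Alg) : P.toYz c ∈ P.Ygr 0 := by
  induction c using P.Alg_induction_gen with
  | one => rw [map_one]; exact P.one_mem_Ygr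
  | mulA a u hu => rw [map_mul, toYz_inA]; exact mul_mem_Ygr_left (P.yA_mem_Ygr a) hu
  | mulG x u hu => rw [map_mul, toYz_inG]; exact mul_mem_Ygr_left (P.yz_mem_Ygr x) hu
  | add u v hu hv => rw [map_add]; exact add_mem hu hv

lemma eProd_mul_toYz {s : ℕ} (x : Fin s → g) (c : P.Alg) :
    P.eProd x * P.toYz c = P.toYz c * P.eProd x := by
  induction c using P.Alg_induction_gen with
  | one => rw [map_one, one_mul, mul_one]
  | mulA a u hu => rw [map_mul, toYz_inA, ← mul_assoc, eProd_mul_yA, mul_assoc, hu, mul_assoc]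
  | mulG y u hu => rw [map_mul, toYz_inG, ← mul_assoc, eProd_mul_yz, mul_assoc, hu, mul_assoc]
  | add u v hu hv => rw [map_add, mul_add, add_mul, hu, hv]

end CrossedProduct

end YBasics


/-! ### `Y_*` as a bimodule over `E` -/

section YBimodule

variable {k A g I : Type*} [Field k] [Ring A] [Algebra k A] [LieRing g] [LieAlgebra k g]
  [LinearOrder I] (P : CrossedProduct k A g) (K : Subalgebra k A)

namespace CrossedProduct

lemma stable_top : P.Stable (⊤ : Subalgebra k A) := fun _ _ _ => trivial

lemma toYz_mul_yrho (c : P.Alg) (x : g) : P.toYz c * P.yrho x = P.yrho x * P.toYz c := by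
  induction c using P.Alg_induction_gen with
  | one => rw [map_one, one_mul, mul_one]
  | mulA a u hu => rw [map_mul, toYz_inA, mul_assoc, hu, ← mul_assoc, ← mul_assoc, yrho_yA]
  | mulG y u hu => rw [map_mul, toYz_inG, mul_assoc, hu, ← mul_assoc, ← mul_assoc, yrho_yz]
  | add u v hu hv => rw [map_add, mul_add, add_mul, hu, hv]

lemma toYz_mul_ye (c : P.Alg) (x : g) : P.toYz c * P.ye x = P.ye x * P.toYz c := by
  induction c using P.Alg_induction_gen with
  | one => rw [map_one, one_mul, mul_one]
  | mulA a u hu => rw [map_mul, toYz_inA, mul_assoc, hu, ← mul_assoc, ← mul_assoc, ye_yA]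
  | mulG y u hu => rw [map_mul, toYz_inG, mul_assoc, hu, ← mul_assoc, ← mul_assoc, ye_yz]
  | add u v hu hv => rw [map_add, mul_add, add_mul, hu, hv]

lemma ye_mul_eProd {s : ℕ} (y : g) (x : Fin s → g) :
    P.ye y * P.eProd x = (-1 : k) ^ s • (P.eProd x * P.ye y) := by
  refine wedge_induction (p := fun s x =>
    P.ye y * P.eProd x = (-1 : k) ^ s • (P.eProd x * P.ye y)) (fun x => ?_)
    (fun s z x hx => ?_) s x
  · rw [eProd_zero, one_mul, mul_one, pow_zero, one_smul]
  · rw [eProd_cons, ← mul_assoc, P.ye_ye y z, Y_neg_mul, mul_assoc, hx, mul_smul_comm, mul_assoc,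
      pow_succ, mul_neg_one]
    exact (neg_smul ((-1 : k) ^ s) (P.ye z * (P.eProd x * P.ye y))).symm

/-- `c ⊗ e ⊗ c' ↦ c e c'`, for `e` in the exterior algebra. -/
def muCore (s : ℕ) : P.Alg →ₗ[k] (⋀[k]^s g) →ₗ[k] P.Alg →ₗ[k] P.Y :=
  ((((LinearMap.mul k P.Y).compr₂ (LinearMap.mul k P.Y)).compl₁₂ P.toYy.toLinearMap
    (P.eMap s)).compr₂ (LinearMap.lcomp k P.Y P.toYz.toLinearMap))

lemma muCore_apply (s : ℕ) (c : P.Alg) (w : ⋀[k]^s g) (c' : P.Alg) :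
    P.muCore s c w c' = P.toYy c * P.eMap s w * P.toYz c' := rfl

end CrossedProduct

open CrossedProduct

lemma exists_muOp : ∃ T : XX P K →ₗ[k] P.Y,
    (∀ s c (x : Fin s → g) (a : Fin 0 → A) c',
      T (elt P K c x a c') = P.toYy c * P.eProd x * P.toYz c') ∧
    ∀ r s c (x : Fin s → g) (a : Fin (r + 1) → A) c', T (elt P K c x a c') = 0 := by
  have h : ∀ s, ∃ T : X P K 0 s →ₗ[k] P.Y, ∀ c x a c',
      T (X.mk P K c x a c') = P.toYy c * P.eProd x * P.toYz c' := fun s => by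
    obtain ⟨T, hT⟩ := X.exists_lift_zero P K (P.muCore s) fun t _ c w c' => by
      rw [muCore_apply, muCore_apply, map_mul, map_mul, toYy_inA, toYz_inA]
      have h : P.eMap s w * P.yA t = P.yA t * P.eMap s w := by
        refine LinearMap.congr_fun (f := LinearMap.mulRight k (P.yA t) ∘ₗ P.eMap s)
          (g := LinearMap.mulLeft k (P.yA t) ∘ₗ P.eMap s) ?_ w
        refine exteriorPower.linearMap_ext (AlternatingMap.ext fun x => ?_)
        change P.eMap s (exteriorPower.ιMulti k s x) * P.yA t =
          P.yA t * P.eMap s (exteriorPower.ιMulti k s x)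
        rw [eMap_ιMulti, eProd_mul_yA]
      rw [mul_assoc (P.toYy c), ← h]
      simp only [mul_assoc]
    exact ⟨T, fun c x a c' => by rw [hT, muCore_apply, eMap_ιMulti]⟩
  choose T hT using h
  refine ⟨DirectSum.toModule k (ℕ × ℕ) P.Y (fun
    | (0, s) => T s
    | (_ + 1, _) => 0), fun s c x a c' => ?_, fun r s c x a c' => ?_⟩
  · exact (DirectSum.toModule_lof k (0, s) _).trans (hT s c x a c')
  · exact (DirectSum.toModule_lof k (r + 1, s) _)

/-- The maps `μ : X_{0s} → Y_s`, extended by zero to the direct sum of all the `X_{rs}`. -/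
def muOp : XX P K →ₗ[k] P.Y := (exists_muOp P K).choose

variable {P K}

lemma muOp_elt {s : ℕ} (c : P.Alg) (x : Fin s → g) (a : Fin 0 → A) (c' : P.Alg) :
    muOp P K (elt P K c x a c') = P.toYy c * P.eProd x * P.toYz c' :=
  (exists_muOp P K).choose_spec.1 s c x a c'

lemma muOp_elt_succ {r s : ℕ} (c : P.Alg) (x : Fin s → g) (a : Fin (r + 1) → A) (c' : P.Alg) :
    muOp P K (elt P K c x a c') = 0 := (exists_muOp P K).choose_spec.2 r s c x a c'

lemma muOp_XB_succ {r s : ℕ} {v : XX P K} (hv : v ∈ XB P K (r + 1) s) : muOp P K v = 0 :=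
  XB_ext (f := muOp P K) (f' := 0) muOp_elt_succ hv

lemma muOp_mem_Ygr {s : ℕ} {v : XX P K} (hv : v ∈ XB P K 0 s) : muOp P K v ∈ P.Ygr s := by
  have h : XB P K 0 s ≤ (P.Ygr s).comap (muOp P K) := XB_le fun c x a c' => by
    rw [Submodule.mem_comap, muOp_elt]
    exact mul_mem_Ygr_right (mul_mem_Ygr_left (P.toYy_mem_Ygr c) (P.eProd_mem_Ygr x))
      (P.toYz_mem_Ygr c')
  exact h hv

lemma muOp_left (c : P.Alg) (v : XX P K) : muOp P K (c • v) = P.toYy c * muOp P K v := by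
  induction v using XX.induction with
  | elt r s d x a c' =>
    rw [smul_elt]
    cases r with
    | zero => rw [muOp_elt, muOp_elt, map_mul]; simp only [mul_assoc]
    | succ r => rw [muOp_elt_succ, muOp_elt_succ, mul_zero]
  | add u v hu hv => rw [smul_add, map_add, map_add, hu, hv, mul_add]
  | smul t u hu => rw [smul_comm c t u, (muOp P K).map_smul, (muOp P K).map_smul, hu, mul_smul_comm]

lemma muOp_right (c : P.Alg) (v : XX P K) : muOp P K (op c • v) = muOp P K v * P.toYz c := by
  induction v using XX.induction with
  | elt r s d x a c' =>
    rw [op_smul_elt]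
    cases r with
    | zero => rw [muOp_elt, muOp_elt, map_mul]; simp only [mul_assoc]
    | succ r => rw [muOp_elt_succ, muOp_elt_succ, zero_mul]
  | add u v hu hv => rw [smul_add, map_add, map_add, hu, hv, add_mul]
  | smul t u hu => rw [smul_comm (op c) t u, (muOp P K).map_smul, (muOp P K).map_smul, hu, smul_mul_assoc]

variable (P K) in
/-- The operator that is `(-1)^s` on `X_{rs}`. -/
def signOp : Module.End k (XX P K) :=
  DirectSum.toModule k (ℕ × ℕ) (XX P K) fun p =>
    LinearMap.lsmul k (XX P K) ((-1 : k) ^ p.2) ∘ₗ inX P K p.1 p.2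

lemma signOp_XB {r s : ℕ} {v : XX P K} (hv : v ∈ XB P K r s) :
    signOp P K v = (-1 : k) ^ s • v := by
  obtain ⟨w, rfl⟩ := hv
  have h := DirectSum.toModule_lof (R := k) (M := fun p : ℕ × ℕ => X P K p.1 p.2)
    (φ := fun p : ℕ × ℕ => LinearMap.lsmul k (XX P K) ((-1 : k) ^ p.2) ∘ₗ inX P K p.1 p.2) (r, s) w
  rw [LinearMap.comp_apply, LinearMap.lsmul_apply] at h
  exact h

lemma signOp_elt {r s : ℕ} (c : P.Alg) (x : Fin s → g) (a : Fin r → A) (c' : P.Alg) :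
    signOp P K (elt P K c x a c') = (-1 : k) ^ s • elt P K c x a c' :=
  signOp_XB (elt_mem_XB c x a c')

lemma signOp_mem_XB {r s : ℕ} {v : XX P K} (hv : v ∈ XB P K r s) : signOp P K v ∈ XB P K r s := by
  rw [signOp_XB hv]; exact Submodule.smul_mem _ _ hv

lemma neg_one_pow_smul_smul {N : Type*} [AddCommGroup N] [Module k N] (s : ℕ) (v : N) :
    (-1 : k) ^ s • (-1 : k) ^ s • v = v := by
  rw [smul_smul, ← mul_pow, neg_one_mul, neg_neg, one_pow, one_smul]

lemma signOp_signOp (v : XX P K) : signOp P K (signOp P K v) = v := by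
  refine LinearMap.congr_fun (f := signOp P K ∘ₗ signOp P K) (g := LinearMap.id)
    (XX.hom_ext fun r s c x a c' => ?_) v
  rw [LinearMap.comp_apply, signOp_elt, map_smul, signOp_elt, neg_one_pow_smul_smul,
    LinearMap.id_apply]

lemma XX.induction_XB {p : XX P K → Prop} (mem : ∀ r s, ∀ v ∈ XB P K r s, p v)
    (add : ∀ u v, p u → p v → p (u + v)) (v : XX P K) : p v := by
  induction v using DirectSum.induction_on with
  | zero => exact mem 0 0 0 (zero_mem _)
  | of i x => exact mem i.1 i.2 _ ⟨x, rfl⟩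
  | add x y hx hy => exact add x y hx hy

lemma signOp_left (c : P.Alg) (v : XX P K) : signOp P K (c • v) = c • signOp P K v := by
  induction v using XX.induction_XB with
  | mem r s v hv => rw [signOp_XB hv, signOp_XB (smul_mem_XB c hv), smul_comm]
  | add u v hu hv => rw [smul_add, map_add, map_add, hu, hv, smul_add]

lemma signOp_right (c : P.Alg) (v : XX P K) : signOp P K (op c • v) = op c • signOp P K v := by
  induction v using XX.induction_XB with
  | mem r s v hv => rw [signOp_XB hv, signOp_XB (op_smul_mem_XB c hv), smul_comm]
  | add u v hu hv => rw [smul_add, map_add, map_add, hu, hv, smul_add]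

lemma signOp_wedgeOp (y : g) (v : XX P K) :
    signOp P K (wedgeOp P K y v) = - wedgeOp P K y (signOp P K v) := by
  induction v using XX.induction_XB with
  | mem r s v hv =>
    rw [signOp_XB hv, signOp_XB (wedgeOp_mem_XB y hv), map_smul, pow_succ, mul_neg_one, neg_smul]
  | add u v hu hv => rw [map_add, map_add, map_add, map_add, hu, hv, neg_add]

lemma signOp_cartanLie (hK : P.Stable K) (y : g) (v : XX P K) :
    signOp P K (cartanLie hK y v) = cartanLie hK y (signOp P K v) := by
  induction v using XX.induction_XB with
  | mem r s v hv => rw [signOp_XB hv, signOp_XB (cartanLie_mem_XB hK y hv), map_smul]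
  | add u v hu hv => rw [map_add, map_add, map_add, map_add, hu, hv]

lemma signOp_dOne (hK : P.Stable K) (v : XX P K) :
    signOp P K (dOne hK v) = - dOne hK (signOp P K v) := by
  induction v using XX.induction_XB with
  | mem r s v hv =>
    cases s with
    | zero => rw [signOp_XB hv, map_smul, dOne_XB_zero hK hv, map_zero, smul_zero, neg_zero]
    | succ s =>
      rw [signOp_XB hv, signOp_XB (dOne_mem_XB hK hv), map_smul, pow_succ, mul_neg_one, neg_smul,
        neg_neg]
  | add u v hu hv => rw [map_add, map_add, map_add, map_add, hu, hv, neg_add]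

lemma muOp_wedgeOp (y : g) (v : XX P K) :
    muOp P K (wedgeOp P K y (signOp P K v)) = muOp P K v * P.ye y := by
  induction v using XX.induction with
  | elt r s c x a c' =>
    rw [signOp_elt, map_smul, map_smul, wedgeOp_elt]
    cases r with
    | zero =>
      rw [muOp_elt, muOp_elt, eProd_cons, ye_mul_eProd, mul_smul_comm, smul_mul_assoc,
        Y_sign_smul, mul_assoc, mul_assoc, mul_assoc, mul_assoc, toYz_mul_ye]
    | succ r => rw [muOp_elt_succ, muOp_elt_succ, zero_mul, smul_zero]
  | add u v hu hv => simp only [map_add, hu, hv, add_mul]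
  | smul t u hu => simp only [map_smul, hu, smul_mul_assoc]

lemma muOp_wedgeOp_XB (y : g) {r s : ℕ} {v : XX P K} (hv : v ∈ XB P K r s) :
    muOp P K (wedgeOp P K y v) = (-1 : k) ^ s • (muOp P K v * P.ye y) := by
  rw [← muOp_wedgeOp, signOp_XB hv, map_smul, map_smul, Y_sign_smul]

/-- The Lie derivatives on the complex correspond to the right multiplications by the
elements `-ρ_x`. -/
lemma muOp_cartanLie (hK : P.Stable K) (x : g) (v : XX P K) :
    muOp P K (cartanLie hK x v) = - (muOp P K v * P.yrho x) := by
  induction v using XX.induction_XB with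
  | mem r s v hv =>
    cases r with
    | succ r =>
      rw [muOp_XB_succ hv, muOp_XB_succ (cartanLie_mem_XB hK x hv), zero_mul, neg_zero]
    | zero =>
      refine wedge_ext_XB (muOp P K ∘ₗ cartanLie hK x)
        (-(LinearMap.mulRight k (P.yrho x) ∘ₗ muOp P K)) (fun v hv => ?_)
        (fun s y v hv ih => ?_) hv
      · refine XB_ext (fun c y a c' => ?_) hv
        rw [LinearMap.comp_apply, cartanLie_elt, elt_eq, (lieOp_bimod hK x).left,
          (lieOp_bimod hK x).right, lieOp_elt, muOp_left, muOp_right, map_sub, muOp_left,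
          muOp_right, LinearMap.neg_apply, LinearMap.comp_apply, muOp_left, muOp_right, muOp_elt,
          map_one, map_one, eProd_zero, toYy_inG, toYz_inG, LinearMap.mulRight_apply]
        simp only [one_mul, mul_one, mul_assoc, toYz_mul_yrho]
        rw [yrho, sub_mul, sub_mul, mul_sub, mul_sub]
        abel
      · change muOp P K (cartanLie hK x v) = - (muOp P K v * P.yrho x) at ih
        change muOp P K (cartanLie hK x _) = - (muOp P K _ * P.yrho x)
        rw [cartanLie_wedgeOp, map_sub, muOp_wedgeOp_XB _ (cartanLie_mem_XB hK x hv),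
          muOp_wedgeOp_XB _ hv, muOp_wedgeOp_XB _ hv, ih, Y_smul_sub, smul_mul_assoc,
          ← Y_smul_neg, mul_assoc _ (P.ye y), ye_yrho, ← lie_skew y x, ye_neg]
        congr 1
        rw [Y_neg_mul, mul_assoc, sub_neg_eq_add, mul_add]
        abel
  | add u v hu hv => simp only [map_add, hu, hv, add_mul, neg_add]

end YBimodule


/-! ### The right action of `Y_*` -/

section YAction

variable {k A g I : Type*} [Field k] [Ring A] [Algebra k A] [LieRing g] [LieAlgebra k g]
  [LinearOrder I] (P : CrossedProduct k A g)

namespace CrossedProduct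

lemma elt_top_succ {r s : ℕ} (c : P.Alg) (x : Fin s → g) (a : Fin (r + 1) → A) (c' : P.Alg) :
    elt P (⊤ : Subalgebra k A) c x a c' = 0 :=
  elt_eq_zero P ⊤ (j := 0) c x c' trivial

lemma XB_top_succ {r s : ℕ} {v : XX P (⊤ : Subalgebra k A)} (hv : v ∈ XB P ⊤ (r + 1) s) : v = 0 :=
  XB_ext (f := LinearMap.id) (f' := 0) P.elt_top_succ hv

lemma dZero_top : dZero P (⊤ : Subalgebra k A) = 0 := by
  refine XX.hom_ext fun r s c x a c' => ?_
  cases r with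
  | zero => exact dZero_elt_zero c x a c'
  | succ r => rw [elt_top_succ, map_zero, map_zero]

lemma insOp_top (q : A) : insOp P (⊤ : Subalgebra k A) q = 0 := by
  refine XX.hom_ext fun r s c x a c' => ?_
  exact P.XB_top_succ (insOp_mem_XB (q := q) (fun _ _ => Algebra.mem_top) (elt_mem_XB c x a c'))

lemma cartanIns_top (x : g) : cartanIns P.stable_top x = 0 := by
  refine XX.hom_ext fun r s c y a c' => ?_
  cases s with
  | zero => exact cartanIns_XB_zero _ (elt_mem_XB c y a c') x
  | succ s => exact P.XB_top_succ (cartanIns_mem_XB _ x (elt_mem_XB c y a c'))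

lemma cartanLie_cartanLie_top (x y : g) (v : XX P (⊤ : Subalgebra k A)) :
    cartanLie P.stable_top x (cartanLie P.stable_top y v) =
      cartanLie P.stable_top y (cartanLie P.stable_top x v) - cartanLie P.stable_top ⁅x, y⁆ v := by
  have h := cartanLie_cartanLie P.stable_top x y v
  rw [dZero_top, insOp_top] at h
  simp only [LinearMap.zero_apply, add_zero] at h
  rw [← sub_eq_zero, ← sub_eq_zero.2 h]; abel

lemma dOne_cartanLie_top (x : g) (v : XX P (⊤ : Subalgebra k A)) :
    dOne P.stable_top (cartanLie P.stable_top x v) =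
      cartanLie P.stable_top x (dOne P.stable_top v) := by
  have h := dZero_cartanIns_add P.stable_top x v
  rw [dZero_top, cartanIns_top] at h
  simp only [LinearMap.zero_apply, sub_zero, zero_add] at h
  exact sub_eq_zero.1 h

/-- The operators by which the generators of `Y_*` act from the right on the bimodules
`E ⊗ g^{∧s} ⊗_A E`. -/
def genOp : Gen A g → Module.End k (XX P (⊤ : Subalgebra k A))
  | .a a => opMul P ⊤ (P.inA a)
  | .y x => opMul P ⊤ (P.inG x) + cartanLie P.stable_top x
  | .z x => opMul P ⊤ (P.inG x)
  | .e x => wedgeOp P ⊤ x ∘ₗ signOp P ⊤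

lemma opMul_apply {K : Subalgebra k A} (c : P.Alg) (v : XX P K) : opMul P K c v = op c • v := rfl

/-- The right action of the free algebra. -/
def freeAct : FreeAlgebra k (Gen A g) →ₐ[k] (Module.End k (XX P (⊤ : Subalgebra k A)))ᵐᵒᵖ :=
  FreeAlgebra.lift k fun t => op (P.genOp t)

lemma freeAct_gen (t : Gen A g) : P.freeAct (P.gen t) = op (P.genOp t) :=
  FreeAlgebra.lift_ι_apply _ _

lemma opMul_add {K : Subalgebra k A} (c c' : P.Alg) :
    opMul P K (c + c') = opMul P K c + opMul P K c' := by
  refine LinearMap.ext fun v => ?_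
  simp only [opMul_apply, LinearMap.add_apply, op_add, add_smul]

lemma opMul_smul {K : Subalgebra k A} (t : k) (c : P.Alg) :
    opMul P K (t • c) = t • opMul P K c := by
  refine LinearMap.ext fun v => ?_
  simp only [opMul_apply, LinearMap.smul_apply, op_smul, smul_assoc]

lemma opMul_mul {K : Subalgebra k A} (c c' : P.Alg) :
    opMul P K (c * c') = opMul P K c' * opMul P K c := by
  refine LinearMap.ext fun v => ?_
  rw [Module.End.mul_apply, opMul_apply, opMul_apply, opMul_apply, op_mul_smul]

lemma opMul_one {K : Subalgebra k A} : opMul P K 1 = 1 := by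
  refine LinearMap.ext fun v => ?_
  rw [opMul_apply, op_one, one_smul, Module.End.one_apply]

lemma opMul_comm_of_bimod {K : Subalgebra k A} {T : Module.End k (XX P K)} (hT : IsBimod T)
    (c : P.Alg) : T * opMul P K c = opMul P K c * T :=
  LinearMap.ext fun v => hT.right c v

lemma freeAct_rel {u v : FreeAlgebra k (Gen A g)} (h : P.YRel u v) :
    P.freeAct u = P.freeAct v := by
  have hL : ∀ x (c : P.Alg), cartanLie P.stable_top x * opMul P ⊤ c =
      opMul P ⊤ c * cartanLie P.stable_top x := fun x =>
    P.opMul_comm_of_bimod (cartanLie_bimod _ x)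
  have hG : ∀ x x', opMul P (⊤ : Subalgebra k A) (P.inG x) * opMul P ⊤ (P.inG x') =
      opMul P ⊤ (P.inG x') * opMul P ⊤ (P.inG x) + opMul P ⊤ (P.inG ⁅x', x⁆) +
        opMul P ⊤ (P.inA (P.fhat x' x)) := fun x x' => LinearMap.ext fun v => op_inG_comm x' x v
  have hA : ∀ x a, opMul P (⊤ : Subalgebra k A) (P.inA a) * opMul P ⊤ (P.inG x) =
      opMul P ⊤ (P.inA (P.actG x a)) + opMul P ⊤ (P.inG x) * opMul P ⊤ (P.inA a) := fun x a =>
    LinearMap.ext fun v => op_inA_inG x a v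
  have hLL : ∀ x x', cartanLie P.stable_top x * cartanLie P.stable_top x' =
      cartanLie P.stable_top x' * cartanLie P.stable_top x + cartanLie P.stable_top ⁅x', x⁆ :=
    fun x x' => LinearMap.ext fun v => by
      rw [Module.End.mul_apply, cartanLie_cartanLie_top, ← lie_skew x x', map_neg,
        LinearMap.neg_apply, sub_neg_eq_add, LinearMap.add_apply, Module.End.mul_apply]
  cases h with
  | a_add c d =>
    rw [map_add, freeAct_gen, freeAct_gen, freeAct_gen, ← op_add]
    exact congrArg op (by rw [genOp, P.inA_add, opMul_add]; rfl)
  | a_mul c d =>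
    rw [map_mul, freeAct_gen, freeAct_gen, freeAct_gen, ← op_mul]
    exact congrArg op (by rw [genOp, P.inA_mul, opMul_mul]; rfl)
  | a_scalar t =>
    rw [freeAct_gen, AlgHom.commutes]
    refine (congrArg op ?_).trans
      (Algebra.algebraMap_eq_smul_one (A := (Module.End k (XX P (⊤ : Subalgebra k A)))ᵐᵒᵖ) t).symm
    change P.genOp _ = t • (1 : Module.End k (XX P (⊤ : Subalgebra k A)))
    rw [genOp, Algebra.algebraMap_eq_smul_one, ← inAHom_apply, map_smul, map_one, opMul_smul,
      opMul_one]
  | y_lin t x x' =>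
    rw [map_add, map_smul, freeAct_gen, freeAct_gen, freeAct_gen, ← op_smul, ← op_add]
    refine congrArg op ?_
    simp only [genOp, P.inG_add, P.inG_smul, opMul_add, opMul_smul, map_add, map_smul, smul_add]
    abel
  | z_lin t x x' =>
    rw [map_add, map_smul, freeAct_gen, freeAct_gen, freeAct_gen, ← op_smul, ← op_add]
    refine congrArg op ?_
    simp only [genOp, P.inG_add, P.inG_smul, opMul_add, opMul_smul]
  | e_lin t x x' =>
    rw [map_add, map_smul, freeAct_gen, freeAct_gen, freeAct_gen, ← op_smul, ← op_add]
    refine congrArg op ?_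
    simp only [genOp, map_add, map_smul, LinearMap.add_comp, LinearMap.smul_comp]
  | y_a x c =>
    rw [map_add, map_mul, map_mul, freeAct_gen, freeAct_gen, freeAct_gen, ← op_mul, ← op_mul,
      ← op_add]
    refine congrArg op ?_
    simp only [genOp, mul_add, add_mul, hA, hL]
    abel
  | z_a x c =>
    rw [map_add, map_mul, map_mul, freeAct_gen, freeAct_gen, freeAct_gen, ← op_mul, ← op_mul,
      ← op_add]
    exact congrArg op (hA x c)
  | e_a x c =>
    rw [map_mul, map_mul, freeAct_gen, freeAct_gen, ← op_mul, ← op_mul]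
    refine congrArg op (LinearMap.ext fun v => ?_)
    change op (P.inA c) • wedgeOp P ⊤ x (signOp P ⊤ v) = wedgeOp P ⊤ x (signOp P ⊤ (op (P.inA c) • v))
    rw [signOp_right, (wedgeOp_bimod P ⊤ x).right]
  | e_y x' x =>
    rw [map_add, map_mul, map_mul, freeAct_gen, freeAct_gen, freeAct_gen, ← op_mul, ← op_mul,
      ← op_add]
    refine congrArg op (LinearMap.ext fun v => ?_)
    change op (P.inG x) • wedgeOp P ⊤ x' (signOp P ⊤ v) +
        cartanLie P.stable_top x (wedgeOp P ⊤ x' (signOp P ⊤ v)) =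
      wedgeOp P ⊤ x' (signOp P ⊤ (op (P.inG x) • v + cartanLie P.stable_top x v)) +
        wedgeOp P ⊤ ⁅x', x⁆ (signOp P ⊤ v)
    rw [map_add, map_add, signOp_right, (wedgeOp_bimod P ⊤ x').right, cartanLie_wedgeOp,
      signOp_cartanLie, ← lie_skew x' x, map_neg, LinearMap.neg_apply]
    abel
  | e_z x' x =>
    rw [map_mul, map_mul, freeAct_gen, freeAct_gen, ← op_mul, ← op_mul]
    refine congrArg op (LinearMap.ext fun v => ?_)
    change op (P.inG x) • wedgeOp P ⊤ x' (signOp P ⊤ v) =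
      wedgeOp P ⊤ x' (signOp P ⊤ (op (P.inG x) • v))
    rw [signOp_right, (wedgeOp_bimod P ⊤ x').right]
  | e_e x =>
    rw [map_mul, freeAct_gen, ← op_mul, map_zero, ← op_zero]
    refine congrArg op (LinearMap.ext fun v => ?_)
    change wedgeOp P ⊤ x (signOp P ⊤ (wedgeOp P ⊤ x (signOp P ⊤ v))) = 0
    rw [signOp_wedgeOp, map_neg, wedgeOp_self, neg_zero]
  | y_y x' x =>
    rw [map_add, map_add, map_mul, map_mul, freeAct_gen, freeAct_gen, freeAct_gen, freeAct_gen,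
      ← op_mul, ← op_mul, ← op_add, ← op_add]
    refine congrArg op ?_
    simp only [genOp, mul_add, add_mul, hL, hG x x', hLL x x']
    abel
  | z_y x' x =>
    rw [map_add, map_add, map_mul, map_mul, freeAct_gen, freeAct_gen, freeAct_gen, freeAct_gen,
      ← op_mul, ← op_mul, ← op_add, ← op_add]
    refine congrArg op ?_
    simp only [genOp, mul_add, add_mul, hL, hG x x']
    abel
  | z_z x' x =>
    rw [map_add, map_add, map_mul, map_mul, freeAct_gen, freeAct_gen, freeAct_gen, freeAct_gen,
      ← op_mul, ← op_mul, ← op_add, ← op_add]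
    exact congrArg op (hG x x')

/-- The right action of `Y_*` on the bimodules `E ⊗ g^{∧s} ⊗_A E`. -/
def yAct : P.Y →ₗ[k] Module.End k (XX P (⊤ : Subalgebra k A)) :=
  (opLinearEquiv k).symm.toLinearMap ∘ₗ
    (RingQuot.liftAlgHom k ⟨P.freeAct, fun _ _ h => P.freeAct_rel h⟩).toLinearMap

lemma yAct_one : P.yAct 1 = 1 := by
  rw [yAct, LinearMap.comp_apply, AlgHom.toLinearMap_apply, map_one]; rfl

lemma yAct_mul (t t' : P.Y) (v : XX P (⊤ : Subalgebra k A)) :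
    P.yAct (t * t') v = P.yAct t' (P.yAct t v) := by
  rw [yAct, LinearMap.comp_apply, AlgHom.toLinearMap_apply, map_mul]; rfl

lemma yAct_gen (t : Gen A g) : P.yAct (P.yGen t) = P.genOp t := by
  rw [yAct, LinearMap.comp_apply, AlgHom.toLinearMap_apply, yGen,
    RingQuot.liftAlgHom_mkAlgHom_apply]
  exact congrArg unop (P.freeAct_gen t)

end CrossedProduct

end YAction


/-! ### The derivation of `Y_*` and the maps from `Y_*` to the resolution -/

section YToX

variable {k A g I : Type*} [Field k] [Ring A] [Algebra k A] [LieRing g] [LieAlgebra k g]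
  [LinearOrder I] (P : CrossedProduct k A g)

namespace CrossedProduct

/-- The generator `1 ⊗ 1` of `E ⊗_A E`. -/
def vac : XX P (⊤ : Subalgebra k A) :=
  elt P ⊤ 1 (Fin.elim0 : Fin 0 → g) (Fin.elim0 : Fin 0 → A) 1

lemma yAct_yA (a : A) (v : XX P (⊤ : Subalgebra k A)) : P.yAct (P.yA a) v = op (P.inA a) • v :=
  LinearMap.congr_fun (P.yAct_gen (.a a)) v

lemma yAct_yy (x : g) (v : XX P (⊤ : Subalgebra k A)) :
    P.yAct (P.yy x) v = op (P.inG x) • v + cartanLie P.stable_top x v :=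
  LinearMap.congr_fun (P.yAct_gen (.y x)) v

lemma yAct_yz (x : g) (v : XX P (⊤ : Subalgebra k A)) : P.yAct (P.yz x) v = op (P.inG x) • v :=
  LinearMap.congr_fun (P.yAct_gen (.z x)) v

lemma yAct_ye (x : g) (v : XX P (⊤ : Subalgebra k A)) :
    P.yAct (P.ye x) v = wedgeOp P ⊤ x (signOp P ⊤ v) :=
  LinearMap.congr_fun (P.yAct_gen (.e x)) v

lemma yAct_yrho (x : g) (v : XX P (⊤ : Subalgebra k A)) :
    P.yAct (P.yrho x) v = - cartanLie P.stable_top x v := by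
  rw [yrho, map_sub, LinearMap.sub_apply, yAct_yy, yAct_yz]; abel

lemma yAct_left (t : P.Y) (c : P.Alg) (v : XX P (⊤ : Subalgebra k A)) :
    P.yAct t (c • v) = c • P.yAct t v := by
  let Q : Submodule k P.Y :=
    { carrier := {t | ∀ v, P.yAct t (c • v) = c • P.yAct t v}
      add_mem' := fun {t t'} ht ht' v => by
        rw [map_add, LinearMap.add_apply, LinearMap.add_apply, ht, ht', smul_add]
      zero_mem' := fun v => by rw [map_zero, LinearMap.zero_apply, LinearMap.zero_apply, smul_zero]
      smul_mem' := fun r t ht v => by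
        rw [P.yAct.map_smul, LinearMap.smul_apply, LinearMap.smul_apply, ht, smul_comm r c] }
  refine P.Y_le_of_mul (Q := Q) (fun v => by rw [yAct_one]; rfl) (fun t ht u v => ?_) t v
  rw [yAct_mul, yAct_mul, ht, yAct_gen]
  cases u with
  | a a => exact (smul_comm c (op (P.inA a)) _).symm
  | y x =>
    rw [genOp, LinearMap.add_apply, LinearMap.add_apply, opMul_apply, opMul_apply, smul_add,
      smul_comm c (op (P.inG x)), (cartanLie_bimod _ x).left]
  | z x => exact (smul_comm c (op (P.inG x)) _).symm
  | e x =>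
    rw [genOp, LinearMap.comp_apply, LinearMap.comp_apply, signOp_left, (wedgeOp_bimod P ⊤ x).left]

lemma muOp_yAct (t : P.Y) (v : XX P (⊤ : Subalgebra k A)) :
    muOp P ⊤ (P.yAct t v) = muOp P ⊤ v * t := by
  let Q : Submodule k P.Y :=
    { carrier := {t | ∀ v, muOp P ⊤ (P.yAct t v) = muOp P ⊤ v * t}
      add_mem' := fun {t t'} ht ht' v => by
        rw [map_add, LinearMap.add_apply, map_add, ht, ht', mul_add]
      zero_mem' := fun v => by rw [map_zero, LinearMap.zero_apply, map_zero, mul_zero]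
      smul_mem' := fun r t ht v => by
        rw [map_smul, LinearMap.smul_apply, map_smul, ht, mul_smul_comm] }
  refine P.Y_le_of_mul (Q := Q) (fun v => by rw [yAct_one, mul_one]; rfl)
    (fun t ht u v => ?_) t v
  rw [yAct_mul, yAct_gen, ← mul_assoc, ← ht]
  cases u with
  | a a => exact (muOp_right _ _).trans (congrArg _ (P.toYz_inA a))
  | y x =>
    rw [genOp, LinearMap.add_apply, opMul_apply, map_add, muOp_right, muOp_cartanLie, toYz_inG, yrho, mul_sub]
    abel
  | z x => exact (muOp_right _ _).trans (congrArg _ (P.toYz_inG x))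
  | e x => exact muOp_wedgeOp x _

lemma yAct_mem_XB {s t : ℕ} {u : P.Y} (hu : u ∈ P.Ygr t) {v : XX P (⊤ : Subalgebra k A)}
    (hv : v ∈ XB P ⊤ 0 s) : P.yAct u v ∈ XB P ⊤ 0 (s + t) := by
  let Q : ℕ → Submodule k P.Y := fun t => (XB P ⊤ 0 (s + t)).comap (P.yAct.flip v)
  refine Ygr_le (Q := Q) ?_ (fun t w _ hw x => ?_) t hu
  · change P.yAct 1 v ∈ XB P ⊤ 0 (s + 0)
    rw [yAct_one]; exact hv
  · change P.yAct w v ∈ XB P ⊤ 0 (s + t) at hw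
    change P.yAct (w * P.yGen x) v ∈ XB P ⊤ 0 (s + (t + Gen.deg x))
    rw [yAct_mul, yAct_gen]
    cases x with
    | a a => exact op_smul_mem_XB _ hw
    | y x => exact add_mem (op_smul_mem_XB _ hw) (cartanLie_mem_XB _ x hw)
    | z x => exact op_smul_mem_XB _ hw
    | e x => exact wedgeOp_mem_XB x (signOp_mem_XB hw)

/-- The map `Y_* → E ⊗ g^{∧*} ⊗_A E` that is inverse to `μ`. -/
def toX : P.Y →ₗ[k] XX P (⊤ : Subalgebra k A) := P.yAct.flip P.vac

lemma toX_apply (t : P.Y) : P.toX t = P.yAct t P.vac := rfl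

lemma toX_mul (t t' : P.Y) : P.toX (t * t') = P.yAct t' (P.toX t) := P.yAct_mul t t' _

lemma op_inA_vac (a : A) : op (P.inA a) • P.vac = P.inA a • P.vac :=
  op_inA_elt_zero Algebra.mem_top _ _

lemma op_inG_vac_add (x : g) :
    op (P.inG x) • P.vac + cartanLie P.stable_top x P.vac = P.inG x • P.vac := by
  rw [vac, cartanLie_elt, lieOp_elt, add_sub_cancel]

lemma toX_toYy (c : P.Alg) : P.toX (P.toYy c) = c • P.vac := by
  induction c using P.Alg_induction_gen with
  | one => rw [map_one, toX_apply, yAct_one, one_smul]; rfl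
  | mulA a u hu =>
    rw [map_mul, toX_mul, toYy_inA, toX_apply, yAct_yA, op_inA_vac,
      yAct_left, mul_smul, ← hu]
    rfl
  | mulG x u hu =>
    rw [map_mul, toX_mul, toYy_inG, toX_apply, yAct_yy, op_inG_vac_add, yAct_left, mul_smul, ← hu]
    rfl
  | add u v hu hv => rw [map_add, map_add, hu, hv, add_smul]

lemma toX_left (c : P.Alg) (t : P.Y) : P.toX (P.toYy c * t) = c • P.toX t := by
  rw [toX_mul, toX_toYy, yAct_left]; rfl

lemma toX_right (c : P.Alg) (t : P.Y) : P.toX (t * P.toYz c) = op c • P.toX t := by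
  rw [toX_mul]
  generalize P.toX t = v
  induction c using P.Alg_induction_gen generalizing v with
  | one => rw [map_one, yAct_one, op_one, one_smul]; rfl
  | mulA a u hu => rw [map_mul, yAct_mul, toYz_inA, yAct_yA, hu, op_mul_smul]
  | mulG x u hu => rw [map_mul, yAct_mul, toYz_inG, yAct_yz, hu, op_mul_smul]
  | add u w hu hw => rw [map_add, map_add, LinearMap.add_apply, hu, hw, op_add, add_smul]

lemma toX_eProd {s : ℕ} (x : Fin s → g) (a : Fin 0 → A) :
    P.toX (P.eProd x) = elt P ⊤ 1 x a 1 := by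
  refine wedge_induction (p := fun s x => P.toX (P.eProd x) = elt P ⊤ 1 x a 1) (fun x => ?_)
    (fun s y x ih => ?_) s x
  · rw [eProd_zero, toX_apply, yAct_one, Subsingleton.elim x Fin.elim0,
      Subsingleton.elim a Fin.elim0]
    rfl
  · rw [eProd_cons, ye_mul_eProd, map_smul, toX_mul, ih, yAct_ye, signOp_elt, map_smul,
      neg_one_pow_smul_smul, wedgeOp_elt]

lemma toX_muOp {K : Subalgebra k A} {s : ℕ} (c : P.Alg) (x : Fin s → g) (a : Fin 0 → A)
    (c' : P.Alg) : P.toX (muOp P K (elt P K c x a c')) = elt P ⊤ c x a c' := by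
  rw [muOp_elt, mul_assoc, toX_left, toX_right, P.toX_eProd x a, ← elt_eq]

lemma toX_muOp_top (v : XX P (⊤ : Subalgebra k A)) : P.toX (muOp P ⊤ v) = v := by
  refine LinearMap.congr_fun (f := P.toX ∘ₗ muOp P ⊤) (g := LinearMap.id)
    (XX.hom_ext fun r s c x a c' => ?_) v
  cases r with
  | zero => exact P.toX_muOp c x a c'
  | succ r => rw [elt_top_succ, map_zero, map_zero]

lemma muOp_toX (t : P.Y) : muOp P ⊤ (P.toX t) = t := by
  rw [toX_apply, muOp_yAct, vac, muOp_elt, eProd_zero, map_one, map_one, one_mul, one_mul, one_mul]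

lemma toX_mem_XB {s : ℕ} {t : P.Y} (ht : t ∈ P.Ygr s) : P.toX t ∈ XB P ⊤ 0 s := by
  have h := P.yAct_mem_XB ht (s := 0) (v := P.vac) (elt_mem_XB _ _ _ _)
  rwa [zero_add] at h

lemma signOp_toX {s : ℕ} {t : P.Y} (ht : t ∈ P.Ygr s) :
    signOp P ⊤ (P.toX t) = (-1 : k) ^ s • P.toX t := signOp_XB (P.toX_mem_XB ht)

/-- The derivation `∂` of `Y_*`: up to the sign, it corresponds to the Chevalley–Eilenberg
differential of `E ⊗ g^{∧*} ⊗_A E`. -/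
def yDel : P.Y →ₗ[k] P.Y := - (muOp P ⊤ ∘ₗ dOne P.stable_top ∘ₗ P.toX)

lemma yDel_apply (t : P.Y) : P.yDel t = - muOp P ⊤ (dOne P.stable_top (P.toX t)) := rfl

lemma yDel_mul_yA (t : P.Y) (a : A) : P.yDel (t * P.yA a) = P.yDel t * P.yA a := by
  rw [yDel_apply, toX_mul, yAct_yA, (dOne_bimod _).right, muOp_right, toYz_inA, ← Y_neg_mul]; rfl

lemma yDel_mul_yz (t : P.Y) (x : g) : P.yDel (t * P.yz x) = P.yDel t * P.yz x := by
  rw [yDel_apply, toX_mul, yAct_yz, (dOne_bimod _).right, muOp_right, toYz_inG, ← Y_neg_mul]; rfl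

lemma yDel_mul_yrho (t : P.Y) (x : g) : P.yDel (t * P.yrho x) = P.yDel t * P.yrho x := by
  rw [yDel_apply, toX_mul, yAct_yrho, map_neg, dOne_cartanLie_top, map_neg, muOp_cartanLie,
    neg_neg, ← Y_neg_mul]; rfl

lemma yDel_mul_yy (t : P.Y) (x : g) : P.yDel (t * P.yy x) = P.yDel t * P.yy x := by
  have h : P.yy x = P.yz x - P.yrho x := by rw [yrho]; abel
  rw [h, mul_sub, map_sub, yDel_mul_yz, yDel_mul_yrho, mul_sub]

lemma yDel_mul_ye {s : ℕ} {t : P.Y} (ht : t ∈ P.Ygr s) (x : g) :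
    P.yDel (t * P.ye x) = P.yDel t * P.ye x + (-1 : k) ^ s • (t * P.yrho x) := by
  have h : muOp P ⊤ (wedgeOp P ⊤ x (dOne P.stable_top (signOp P ⊤ (P.toX t)))) =
      P.yDel t * P.ye x := by
    rw [← neg_neg (dOne _ _), ← signOp_dOne, map_neg, map_neg, muOp_wedgeOp, ← Y_neg_mul]
    rfl
  rw [yDel_apply, toX_mul, yAct_ye, dOne_wedgeOp, map_add, map_neg, neg_add, neg_neg,
    muOp_cartanLie, neg_neg, h, signOp_toX P ht, map_smul, muOp_toX, smul_mul_assoc]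

lemma yDel_mul {s : ℕ} {v : P.Y} (hv : v ∈ P.Ygr s) (w : P.Y) :
    P.yDel (v * w) = P.yDel v * w + (-1 : k) ^ s • (v * P.yDel w) := by
  let T : P.Y →ₗ[k] P.Y := P.yDel ∘ₗ LinearMap.mulLeft k v
  let T' : P.Y →ₗ[k] P.Y := LinearMap.mulLeft k (P.yDel v) +
    (-1 : k) ^ s • (LinearMap.mulLeft k v ∘ₗ P.yDel)
  have h1 : P.yDel 1 = 0 := by
    rw [yDel_apply, toX_apply, yAct_one]
    have h : dOne P.stable_top P.vac = 0 := dOne_elt _ _ _ _ _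
    rw [Module.End.one_apply, h, map_zero, neg_zero]
  have h : T = T' := by
    refine Ygr_hom_ext fun t w hw => Ygr_le (Q := fun _ => LinearMap.eqLocus T T') ?_ ?_ t hw
    · change P.yDel (v * 1) = P.yDel v * 1 + (-1 : k) ^ s • (v * P.yDel 1)
      rw [h1, mul_one, mul_one, mul_zero, smul_zero, add_zero]
    · intro t w hw ih u
      change P.yDel (v * w) = P.yDel v * w + (-1 : k) ^ s • (v * P.yDel w) at ih
      change P.yDel (v * (w * P.yGen u)) =
        P.yDel v * (w * P.yGen u) + (-1 : k) ^ s • (v * P.yDel (w * P.yGen u))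
      rw [← mul_assoc]
      cases u with
      | a a =>
        change P.yDel (v * w * P.yA a) = _ * (w * P.yA a) + (-1 : k) ^ s • (v * P.yDel (w * P.yA a))
        rw [yDel_mul_yA, yDel_mul_yA, ih, add_mul, smul_mul_assoc, mul_assoc, mul_assoc]
      | y x =>
        change P.yDel (v * w * P.yy x) = _ * (w * P.yy x) + (-1 : k) ^ s • (v * P.yDel (w * P.yy x))
        rw [yDel_mul_yy, yDel_mul_yy, ih, add_mul, smul_mul_assoc, mul_assoc, mul_assoc]
      | z x =>
        change P.yDel (v * w * P.yz x) = _ * (w * P.yz x) + (-1 : k) ^ s • (v * P.yDel (w * P.yz x))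
        rw [yDel_mul_yz, yDel_mul_yz, ih, add_mul, smul_mul_assoc, mul_assoc, mul_assoc]
      | e x =>
        change P.yDel (v * w * P.ye x) = _ * (w * P.ye x) + (-1 : k) ^ s • (v * P.yDel (w * P.ye x))
        rw [P.yDel_mul_ye (mul_mem_Ygr hv hw), P.yDel_mul_ye hw, ih, add_mul, smul_mul_assoc,
          mul_assoc, mul_assoc, mul_add, smul_add, mul_smul_comm, smul_smul, ← pow_add, add_assoc,
          mul_assoc]
  exact LinearMap.congr_fun h w

lemma yDel_one : P.yDel 1 = 0 := by
  have h := P.yDel_mul P.one_mem_Ygr 1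
  rw [pow_zero, one_smul, mul_one, mul_one, one_mul] at h
  exact left_eq_add.1 h

lemma yDel_ye (x : g) : P.yDel (P.ye x) = P.yz x - P.yy x := by
  have h := P.yDel_mul_ye P.one_mem_Ygr x
  rwa [yDel_one, zero_mul, one_mul, one_mul, pow_zero, one_smul, zero_add] at h

lemma yDel_Ygr_zero {v : P.Y} (hv : v ∈ P.Ygr 0) : P.yDel v = 0 := by
  rw [yDel_apply, dOne_XB_zero _ (P.toX_mem_XB hv), map_zero, neg_zero]

lemma yDel_mem_Ygr {s : ℕ} {v : P.Y} (hv : v ∈ P.Ygr (s + 1)) : P.yDel v ∈ P.Ygr s :=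
  neg_mem (muOp_mem_Ygr (dOne_mem_XB _ (P.toX_mem_XB hv)))

lemma yDel_toYy_mul (c : P.Alg) (v : P.Y) : P.yDel (P.toYy c * v) = P.toYy c * P.yDel v := by
  rw [P.yDel_mul (P.toYy_mem_Ygr c), P.yDel_Ygr_zero (P.toYy_mem_Ygr c), zero_mul, zero_add,
    pow_zero, one_smul]

end CrossedProduct

end YToX


/-! ### Comparison of the resolution with `Y_*` -/

section Comparison

variable {k A g I : Type*} [Field k] [Ring A] [Algebra k A] [LieRing g] [LieAlgebra k g]
  [LinearOrder I] {P : CrossedProduct k A g} {K : Subalgebra k A}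

open CrossedProduct

local notation "ω" => wedgeOp P K

lemma muOp_dZero (v : XX P K) : muOp P K (dZero P K v) = 0 := by
  induction v using XX.induction with
  | elt r s c x a c' =>
    rw [elt_eq, dZero_bimod.left, dZero_bimod.right, muOp_left, muOp_right]
    suffices h : muOp P K (dZero P K (elt P K 1 x a 1)) = 0 by rw [h, zero_mul, mul_zero]
    match r with
    | 0 => rw [dZero_elt_zero, map_zero]
    | 1 =>
      have e : (-1 : k) ^ (0 + 1 + s) = -(-1 : k) ^ s := by
        rw [zero_add, pow_add, pow_one, neg_one_mul]
      rw [dZero_elt, Fin.sum_univ_zero, add_zero, e, map_add, map_smul, map_smul, muOp_elt,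
        muOp_elt, map_one, map_one, toYy_inA, toYz_inA, one_mul, mul_one, eProd_mul_yA,
        show Fin.last 0 = (0 : Fin 1) from rfl, ← add_smul, add_neg_cancel, zero_smul]
    | r + 2 =>
      have h := dZero_mem_XB (elt_mem_XB (P := P) (K := K) 1 x a 1)
      exact muOp_XB_succ (r := r) h
  | add u v hu hv => rw [map_add, map_add, hu, hv, add_zero]
  | smul t u hu => rw [map_smul, map_smul, hu, smul_zero]

variable (hK : P.Stable K)

lemma muOp_dTwo (v : XX P K) : muOp P K (dTwo hK v) = 0 := by
  induction v using XX.induction_XB with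
  | mem r s v hv =>
    match s with
    | 0 => rw [dTwo_XB_zero hK hv, map_zero]
    | 1 => rw [dTwo_XB_one hK hv, map_zero]
    | s + 2 => exact muOp_XB_succ (dTwo_mem_XB hK hv)
  | add u v hu hv => rw [map_add, map_add, hu, hv, add_zero]

lemma muOp_dOne (v : XX P K) : muOp P K (dOne hK v) = - P.yDel (muOp P K v) := by
  induction v using XX.induction_XB with
  | mem r s v hv =>
    cases r with
    | succ r =>
      rw [muOp_XB_succ hv, map_zero, neg_zero]
      cases s with
      | zero => rw [dOne_XB_zero hK hv, map_zero]
      | succ s => exact muOp_XB_succ (dOne_mem_XB hK hv)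
    | zero =>
      refine wedge_ext_XB (muOp P K ∘ₗ dOne hK) (-(P.yDel ∘ₗ muOp P K)) (fun v hv => ?_)
        (fun s y v hv ih => ?_) hv
      · change muOp P K (dOne hK v) = - P.yDel (muOp P K v)
        rw [dOne_XB_zero hK hv, map_zero, P.yDel_Ygr_zero (muOp_mem_Ygr hv), neg_zero]
      · change muOp P K (dOne hK v) = - P.yDel (muOp P K v) at ih
        change muOp P K (dOne hK (ω y v)) = - P.yDel (muOp P K (ω y v))
        have h : muOp P K (ω y (dOne hK v)) = (-1 : k) ^ s • (P.yDel (muOp P K v) * P.ye y) := by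
          rw [← signOp_signOp (dOne hK v), muOp_wedgeOp, signOp_dOne, signOp_XB hv, map_smul,
            map_neg, map_smul, ih, Y_smul_neg, neg_neg, smul_mul_assoc]
        rw [dOne_wedgeOp, map_add, map_neg, h, muOp_cartanLie, muOp_wedgeOp_XB y hv, map_smul,
          P.yDel_mul_ye (muOp_mem_Ygr hv), smul_add, Y_sign_smul, neg_add]
  | add u v hu hv => rw [map_add, map_add, hu, hv, map_add, map_add, neg_add]

variable (θ : P.Section)

variable (K) in
/-- The left `E`-linear splitting `Y_s → X_{0s}` of `μ` given by the section `θ`. -/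
def yLift : P.Y →ₗ[k] XX P K := collapseOp P ⊤ K θ ∘ₗ P.toX

lemma yLift_apply (t : P.Y) : yLift K θ t = collapseOp P ⊤ K θ (P.toX t) := rfl

lemma yLift_left (c : P.Alg) (t : P.Y) : yLift K θ (P.toYy c * t) = c • yLift K θ t := by
  rw [yLift_apply, toX_left, collapseOp_left]; rfl

lemma yLift_mem_XB {s : ℕ} {t : P.Y} (ht : t ∈ P.Ygr s) : yLift K θ t ∈ XB P K 0 s :=
  collapseOp_mem_XB θ (P.toX_mem_XB ht)

lemma yLift_right (hθ : θ.KStable K) {t : A} (ht : t ∈ K) (v : P.Y) :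
    yLift K θ (v * P.yA t) = op (P.inA t) • yLift K θ v := by
  rw [← toYz_inA, yLift_apply, yLift_apply, toX_right]
  generalize P.toX v = w
  -- the right action of `K` commutes with the splitting since `K θ(U)` is stable under it
  have h := right_of_kStable θ hθ (T := collapseOp P ⊤ K θ)
    (fun h v hv => collapseOp_op_toLin θ K h hv) (fun t ht v hv => collapseOp_op_inA θ K ht hv)
  exact h t ht w

lemma muOp_collapseOp (v : XX P (⊤ : Subalgebra k A)) :
    muOp P K (collapseOp P ⊤ K θ v) = muOp P ⊤ v := by
  refine LinearMap.congr_fun (f := muOp P K ∘ₗ collapseOp P ⊤ K θ) (g := muOp P ⊤)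
    (XX.hom_ext fun r s c x a c' => ?_) v
  rw [LinearMap.comp_apply]
  cases r with
  | succ r => rw [collapseOp_elt_succ, map_zero, muOp_elt_succ]
  | zero =>
    induction c' using θ.induction with
    | mul a' h =>
      rw [collapseOp_elt, muOp_elt, muOp_elt, map_mul, map_mul, toYy_inA, toYz_inA,
        mul_assoc (P.toYy c), ← eProd_mul_yA]
      simp only [mul_assoc]
    | add u v hu hv => rw [elt_add_right, map_add, map_add, hu, hv, map_add]

lemma muOp_yLift (t : P.Y) : muOp P K (yLift K θ t) = t := by
  rw [yLift_apply, muOp_collapseOp, muOp_toX]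

lemma yLift_muOp (v : XX P K) : yLift K θ (muOp P K v) = collapseOp P K K θ v := by
  refine LinearMap.congr_fun (f := yLift K θ ∘ₗ muOp P K) (g := collapseOp P K K θ)
    (XX.hom_ext fun r s c x a c' => ?_) v
  rw [LinearMap.comp_apply]
  cases r with
  | succ r => rw [collapseOp_elt_succ, muOp_elt_succ, map_zero]
  | zero =>
    rw [yLift_apply, toX_muOp]
    induction c' using θ.induction with
    | mul a' h => rw [collapseOp_elt, collapseOp_elt]
    | add u v hu hv => rw [elt_add_right, elt_add_right, map_add, map_add, hu, hv]

lemma muOp_appendOp (v : XX P K) : muOp P K (appendOp P K θ v) = 0 := by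
  induction v using XX.induction_XB with
  | mem r s v hv => exact muOp_XB_succ (appendOp_mem_XB θ hv)
  | add u v hu hv => rw [map_add, map_add, hu, hv, add_zero]

lemma yLift_prod (s : ℕ) (x : Fin s → g) (L : List g) (W : List (A × U k g))
    (h : (W.map fun w => P.sharp w.1 w.2).sum = (L.map P.inG).prod) :
    yLift K P.stdSection (P.eProd x * (L.map P.yz).prod) =
      (W.map fun w => elt P K (P.inA w.1) x (Fin.elim0 : Fin 0 → A) (P.inU w.2)).sum := by
  have h1 : (L.map P.yz).prod = P.toYz (L.map P.inG).prod := by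
    rw [map_list_prod, List.map_map]
    exact congrArg List.prod (List.map_congr_left fun y _ => (P.toYz_inG y).symm)
  rw [h1, ← h, yLift_apply, toX_right, P.toX_eProd x Fin.elim0, op_smul_elt, one_mul]
  clear h h1
  induction W with
  | nil =>
    rw [List.map_nil, List.sum_nil, List.map_nil, List.sum_nil, elt_inA_eq, op_zero, zero_smul,
      map_zero]
  | cons w W ih =>
    rw [List.map_cons, List.sum_cons, List.map_cons, List.sum_cons, elt_add_right, map_add, ih,
      sharp_eq]
    congr 1
    refine (collapseOp_elt P ⊤ K P.stdSection 1 x Fin.elim0 w.1 w.2).trans ?_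
    rw [one_mul]
    rfl

end Comparison

/-! ### The augmentation of `Y_*` -/

section Augmentation

variable {k A g I : Type*} [Field k] [Ring A] [Algebra k A] [LieRing g] [LieAlgebra k g]
  [LinearOrder I] (P : CrossedProduct k A g)

namespace CrossedProduct

/-- The values of the augmentation on the generators. -/
def genAug : Gen A g → P.Alg
  | .a a => P.inA a
  | .y x => P.inG x
  | .z x => P.inG x
  | .e _ => 0

/-- The augmentation of the free algebra. -/
def freeAug : FreeAlgebra k (Gen A g) →ₐ[k] P.Alg := FreeAlgebra.lift k P.genAug

lemma freeAug_gen (t : Gen A g) : P.freeAug (P.gen t) = P.genAug t :=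
  FreeAlgebra.lift_ι_apply _ _

lemma freeAug_rel {u v : FreeAlgebra k (Gen A g)} (h : P.YRel u v) :
    P.freeAug u = P.freeAug v := by
  have h1 : ∀ x (a : A), P.inG x * P.inA a = P.inA (P.actG x a) + P.inA a * P.inG x :=
    P.inG_mul_inA
  have h2 : ∀ x y, P.inG x * P.inG y = P.inG y * P.inG x + P.inG ⁅x, y⁆ + P.inA (P.fhat x y) :=
    fun x y => by
      have := P.inG_comm x y
      rw [add_assoc, ← this, add_sub_cancel]
  cases h with
  | a_scalar t =>
    rw [freeAug_gen, AlgHom.commutes]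
    exact P.inAHom.commutes t
  | y_y x' x | z_y x' x | z_z x' x =>
    simp only [map_add, map_mul, freeAug_gen, genAug]
    exact h2 x' x
  | _ => simp only [map_add, map_mul, map_smul, freeAug_gen, genAug, P.inA_add, P.inA_mul,
      P.inG_add, P.inG_smul, h1, mul_zero, zero_mul, smul_zero, add_zero, map_zero]

/-- The augmentation `Y_* → E`, which is the identity on `A` and maps `y_x` and `z_x` to
`1 # x`. -/
def yAug : P.Y →ₐ[k] P.Alg := RingQuot.liftAlgHom k ⟨P.freeAug, fun _ _ h => P.freeAug_rel h⟩

lemma yAug_gen (t : Gen A g) : P.yAug (P.yGen t) = P.genAug t := by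
  rw [yAug, yGen, RingQuot.liftAlgHom_mkAlgHom_apply]
  exact P.freeAug_gen t

lemma yAug_yA (a : A) : P.yAug (P.yA a) = P.inA a := P.yAug_gen (.a a)
lemma yAug_yy (x : g) : P.yAug (P.yy x) = P.inG x := P.yAug_gen (.y x)
lemma yAug_yz (x : g) : P.yAug (P.yz x) = P.inG x := P.yAug_gen (.z x)
lemma yAug_ye (x : g) : P.yAug (P.ye x) = 0 := P.yAug_gen (.e x)
lemma yAug_yrho (x : g) : P.yAug (P.yrho x) = 0 := by rw [yrho, map_sub, yAug_yy, yAug_yz, sub_self]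

lemma yAug_toYy (c : P.Alg) : P.yAug (P.toYy c) = c := by
  induction c using P.Alg_induction_gen with
  | one => rw [map_one, map_one]
  | mulA a u hu => rw [map_mul, map_mul, toYy_inA, yAug_yA, hu]
  | mulG x u hu => rw [map_mul, map_mul, toYy_inG, yAug_yy, hu]
  | add u v hu hv => rw [map_add, map_add, hu, hv]

lemma yAug_toYz (c : P.Alg) : P.yAug (P.toYz c) = c := by
  induction c using P.Alg_induction_gen with
  | one => rw [map_one, map_one]
  | mulA a u hu => rw [map_mul, map_mul, toYz_inA, yAug_yA, hu]
  | mulG x u hu => rw [map_mul, map_mul, toYz_inG, yAug_yz, hu]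
  | add u v hu hv => rw [map_add, map_add, hu, hv]

lemma yAug_Ygr_succ {s : ℕ} {v : P.Y} (hv : v ∈ P.Ygr (s + 1)) : P.yAug v = 0 := by
  let Q : ℕ → Submodule k P.Y := fun
    | 0 => ⊤
    | _ + 1 => LinearMap.ker P.yAug.toLinearMap
  refine (Ygr_le (Q := Q) trivial (fun s v _ hv t => ?_) (s + 1) hv : P.yAug.toLinearMap v = 0)
  cases s with
  | zero =>
    cases t with
    | e x =>
      change P.yAug (v * P.ye x) = 0
      rw [map_mul, yAug_ye, mul_zero]
    | _ => trivial
  | succ s =>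
    change P.yAug v = 0 at hv
    have h : P.yAug (v * P.yGen t) = 0 := by rw [map_mul, hv, zero_mul]
    cases t <;> exact h

lemma yAug_yDel (v : P.Y) : P.yAug (P.yDel v) = 0 := by
  refine LinearMap.congr_fun (f := P.yAug.toLinearMap ∘ₗ P.yDel) (g := 0)
    (Ygr_hom_ext fun s v hv => Ygr_le (Q := fun _ => LinearMap.ker (P.yAug.toLinearMap ∘ₗ P.yDel))
      ?_ (fun s v hv ih t => ?_) s hv) v
  · change P.yAug (P.yDel 1) = 0
    rw [yDel_one, map_zero]
  · change P.yAug (P.yDel v) = 0 at ih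
    change P.yAug (P.yDel (v * P.yGen t)) = 0
    cases t with
    | e x =>
      change P.yAug (P.yDel (v * P.ye x)) = 0
      rw [P.yDel_mul_ye hv, map_add, map_mul, ih, zero_mul, map_smul, map_mul, yAug_yrho, mul_zero,
        smul_zero, zero_add]
    | a a => exact (congrArg P.yAug (P.yDel_mul_yA v a)).trans (by rw [map_mul, ih, zero_mul])
    | y x => exact (congrArg P.yAug (P.yDel_mul_yy v x)).trans (by rw [map_mul, ih, zero_mul])
    | z x => exact (congrArg P.yAug (P.yDel_mul_yz v x)).trans (by rw [map_mul, ih, zero_mul])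

end CrossedProduct

end Augmentation


/-! ### Admissible lists -/

section Lists

variable {I : Type*} [LinearOrder I]

open CrossedProduct

/-- The indices of the factors `ρ` of the word of a list, in the order in which they occur. -/
def rhoIdx (L : List (I × ℕ × Bool)) : List I := L.flatMap fun t => List.replicate t.2.1 t.1

/-- The indices of the factors `e` of the word of a list, in the order in which they occur. -/
def eIdx (L : List (I × ℕ × Bool)) : List I := (L.filter fun t => t.2.2).map fun t => t.1

lemma mem_rhoIdx {L : List (I × ℕ × Bool)} {i : I} :
    i ∈ rhoIdx L ↔ ∃ t ∈ L, t.2.1 ≠ 0 ∧ i = t.1 := by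
  simp [rhoIdx, List.mem_replicate]

lemma mem_eIdx {L : List (I × ℕ × Bool)} {i : I} :
    i ∈ eIdx L ↔ ∃ t ∈ L, t.2.2 = true ∧ t.1 = i := by
  simp [eIdx, and_assoc]

lemma eq_of_fst_eq {L : List (I × ℕ × Bool)} (hL : L.Pairwise fun s t => s.1 < t.1)
    {s t : I × ℕ × Bool} (hs : s ∈ L) (ht : t ∈ L) (h : s.1 = t.1) : s = t :=
  List.inj_on_of_nodup_map (List.pairwise_map.2 (hL.imp fun h => h.ne)) hs ht h

lemma mem_eIdx_fst {L : List (I × ℕ × Bool)} (hL : L.Pairwise fun s t => s.1 < t.1)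
    {t : I × ℕ × Bool} (ht : t ∈ L) : t.1 ∈ eIdx L ↔ t.2.2 = true := by
  rw [mem_eIdx]
  exact ⟨fun ⟨s, hs, h, hst⟩ => eq_of_fst_eq hL hs ht hst ▸ h, fun h => ⟨t, ht, h, rfl⟩⟩

lemma count_rhoIdx {L : List (I × ℕ × Bool)} (hL : L.Pairwise fun s t => s.1 < t.1)
    {t : I × ℕ × Bool} (ht : t ∈ L) : (rhoIdx L).count t.1 = t.2.1 := by
  induction L with
  | nil => simp at ht
  | cons s L ih =>
    rw [List.pairwise_cons] at hL
    have hc : rhoIdx (s :: L) = List.replicate s.2.1 s.1 ++ rhoIdx L := rfl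
    rw [hc, List.count_append, List.count_replicate]
    rcases List.mem_cons.1 ht with rfl | ht
    · have h : t.1 ∉ rhoIdx L := fun h => by
        obtain ⟨s, hs, -, h⟩ := mem_rhoIdx.1 h
        exact (hL.1 s hs).ne h
      simp [List.count_eq_zero_of_not_mem h]
    · simp [ih hL.2 ht, (hL.1 t ht).ne]

lemma mem_iff_of_isAdmissible {L : List (I × ℕ × Bool)} (hL : IsAdmissible L) (t : I × ℕ × Bool) :
    t ∈ L ↔ (t.1 ∈ rhoIdx L ∨ t.1 ∈ eIdx L) ∧ (rhoIdx L).count t.1 = t.2.1 ∧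
      (t.1 ∈ eIdx L ↔ t.2.2 = true) := by
  constructor
  · intro ht
    refine ⟨(hL.2 t ht).imp (fun h => mem_rhoIdx.2 ⟨t, ht, h.ne', rfl⟩)
      (fun h => mem_eIdx.2 ⟨t, ht, h, rfl⟩), count_rhoIdx hL.1 ht, mem_eIdx_fst hL.1 ht⟩
  · rintro ⟨h, h1, h2⟩
    obtain ⟨s, hs, hst⟩ : ∃ s ∈ L, s.1 = t.1 := by
      rcases h with h | h
      · obtain ⟨s, hs, -, h⟩ := mem_rhoIdx.1 h; exact ⟨s, hs, h.symm⟩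
      · obtain ⟨s, hs, -, h⟩ := mem_eIdx.1 h; exact ⟨s, hs, h⟩
    have h3 := count_rhoIdx hL.1 hs
    have h4 := mem_eIdx_fst hL.1 hs
    rw [hst] at h3 h4
    have h5 : s = t := Prod.ext hst (Prod.ext (h3.symm.trans h1)
      (Bool.eq_iff_iff.2 (h4.symm.trans h2)))
    exact h5 ▸ hs

/-- An admissible list is determined by the set of the indices of its factors `e` and the
multiset of the indices of its factors `ρ`. -/
def listIdx (L : {L : List (I × ℕ × Bool) // IsAdmissible L}) : Finset I × Multiset I :=
  ((eIdx L.1).toFinset, (rhoIdx L.1 : Multiset I))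

lemma listIdx_bijective : Function.Bijective (listIdx (I := I)) := by
  constructor
  · rintro ⟨L, hL⟩ ⟨L', hL'⟩ h
    obtain ⟨h1, h2⟩ := Prod.ext_iff.1 h
    have h1 : ∀ i, i ∈ eIdx L ↔ i ∈ eIdx L' := fun i => by
      have := congrArg (i ∈ ·) h1
      simpa [listIdx] using this
    have h2 : (rhoIdx L).Perm (rhoIdx L') := Multiset.coe_eq_coe.1 h2
    have h3 : ∀ t, t ∈ L ↔ t ∈ L' := fun t => by
      rw [mem_iff_of_isAdmissible hL, mem_iff_of_isAdmissible hL', h1, h2.mem_iff, h2.count_eq]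
    have hn : ∀ {L : List (I × ℕ × Bool)}, IsAdmissible L → L.Nodup := fun hL =>
      hL.1.imp fun h h' => h.ne (congrArg Prod.fst h')
    have hp := (List.perm_ext_iff_of_nodup (hn hL) (hn hL')).2 h3
    exact Subtype.ext (hp.eq_of_pairwise (fun a b _ _ h h' => absurd h h'.asymm) hL.1 hL'.1)
  · rintro ⟨S, M⟩
    let f : I → I × ℕ × Bool := fun i => (i, M.count i, decide (i ∈ S))
    let L := ((M.toFinset ∪ S).sort (· ≤ ·)).map f
    have hp : L.Pairwise fun s t => s.1 < t.1 :=
      List.pairwise_map.2 (Finset.sortedLT_sort _).pairwise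
    have hm : ∀ i, i ∈ M ∨ i ∈ S → f i ∈ L := fun i hi =>
      List.mem_map_of_mem ((Finset.mem_sort _).2 (by simpa using hi))
    have hL : IsAdmissible L := ⟨hp, fun t ht => by
      obtain ⟨i, hi, rfl⟩ := List.mem_map.1 ht
      rw [Finset.mem_sort, Finset.mem_union, Multiset.mem_toFinset] at hi
      exact hi.imp (fun h => Multiset.count_pos.2 h) (fun h => decide_eq_true h)⟩
    have hf : ∀ t ∈ L, f t.1 = t := fun t ht => by
      obtain ⟨i, hi, rfl⟩ := List.mem_map.1 ht
      rfl
    refine ⟨⟨L, hL⟩, Prod.ext (Finset.ext fun i => ?_) (Multiset.ext.2 fun i => ?_)⟩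
    · change i ∈ (eIdx L).toFinset ↔ i ∈ S
      rw [List.mem_toFinset]
      constructor
      · intro hi
        obtain ⟨t, ht, h, rfl⟩ := mem_eIdx.1 hi
        rw [← hf t ht] at h
        exact of_decide_eq_true h
      · exact fun hi => (mem_eIdx_fst hp (hm i (Or.inr hi))).2 (decide_eq_true hi)
    · change Multiset.count i (rhoIdx L : Multiset I) = M.count i
      rw [Multiset.coe_count]
      by_cases hi : i ∈ M
      · exact count_rhoIdx hp (hm i (Or.inl hi))
      · rw [Multiset.count_eq_zero_of_notMem hi, List.count_eq_zero]
        intro h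
        obtain ⟨t, ht, h0, rfl⟩ := mem_rhoIdx.1 h
        rw [← hf t ht] at h0
        exact h0 (Multiset.count_eq_zero_of_notMem hi)

lemma eIdx_eq_sort {L : List (I × ℕ × Bool)} (hL : IsAdmissible L) :
    eIdx L = (eIdx L).toFinset.sort (· ≤ ·) := by
  have h : (eIdx L).SortedLT := by
    refine List.Pairwise.sortedLT ?_
    exact List.pairwise_map.2 (hL.1.sublist List.filter_sublist)
  exact (List.Perm.eq_of_sortedLE (Finset.sortedLT_sort _).sortedLE h.sortedLE
    ((Finset.sort_perm_toList _ _).trans (List.toFinset_toList h.nodup))).symm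

end Lists


/-! ### The basis of `Y_*` -/

section WordBasis

variable {k A g I : Type*} [Field k] [Ring A] [Algebra k A] [LieRing g] [LieAlgebra k g]
  [LinearOrder I] (P : CrossedProduct k A g) (b : Module.Basis I k g)

namespace CrossedProduct

/-- The product of the elements `e_x`, for `x` in a list. -/
def eList (l : List g) : P.Y := (l.map P.ye).prod

lemma eList_append (l : List g) (x : g) : P.eList (l ++ [x]) = P.eList l * P.ye x := by
  simp [eList]

lemma eList_eq_eMap (l : List g) :
    P.eList l = P.eMap l.length (exteriorPower.ιMulti k l.length l.get) := by
  rw [eMap_ιMulti, eProd, eList]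
  congr 1
  exact (congrArg (List.map P.ye) (List.ofFn_get l)).symm.trans List.map_ofFn

lemma eList_mul_toYz (l : List g) (c : P.Alg) : P.eList l * P.toYz c = P.toYz c * P.eList l := by
  rw [eList_eq_eMap, eMap_ιMulti, eProd_mul_toYz]

/-- The filtration of `Y_*` by the degree in `g` of the factor `h` of `c e_{x_1} ⋯ e_{x_s} h`. -/
def yFil (n : ℕ) : Submodule k P.Y :=
  Submodule.span k {v | ∃ (c : P.Alg) (l : List g), ∃ h ∈ uFil b n,
    v = P.toYy c * P.eList l * P.toYz (P.inU h)}

variable {b} in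
lemma mem_yFil (c : P.Alg) (l : List g) {n : ℕ} {h : U k g} (hh : h ∈ uFil b n) :
    P.toYy c * P.eList l * P.toYz (P.inU h) ∈ P.yFil b n :=
  Submodule.subset_span ⟨c, l, h, hh, rfl⟩

lemma yFil_mono {m n : ℕ} (h : m ≤ n) : P.yFil b m ≤ P.yFil b n :=
  Submodule.span_le.2 fun _ ⟨c, l, _, hh, hv⟩ => hv ▸ P.mem_yFil c l (uFil_mono b h hh)

variable {b} in
lemma toYy_mul_mem_yFil (c : P.Alg) {n : ℕ} {v : P.Y} (hv : v ∈ P.yFil b n) :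
    P.toYy c * v ∈ P.yFil b n := by
  induction hv using Submodule.span_induction with
  | mem v hv =>
    obtain ⟨d, l, h, hh, rfl⟩ := hv
    rw [← mul_assoc, ← mul_assoc, ← map_mul]
    exact P.mem_yFil _ l hh
  | zero => rw [mul_zero]; exact zero_mem _
  | add u v _ _ hu hv => rw [mul_add]; exact add_mem hu hv
  | smul t u _ hu => rw [mul_smul_comm]; exact Submodule.smul_mem _ _ hu

lemma mul_ye_mem_yFil (x : g) {n : ℕ} {v : P.Y} (hv : v ∈ P.yFil b n) :
    v * P.ye x ∈ P.yFil b n := by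
  induction hv using Submodule.span_induction with
  | mem v hv =>
    obtain ⟨d, l, h, hh, rfl⟩ := hv
    rw [mul_assoc, toYz_mul_ye, ← mul_assoc, mul_assoc (P.toYy d), ← eList_append]
    exact P.mem_yFil _ _ hh
  | zero => rw [zero_mul]; exact zero_mem _
  | add u v _ _ hu hv => rw [add_mul]; exact add_mem hu hv
  | smul t u _ hu => rw [smul_mul_assoc]; exact Submodule.smul_mem _ _ hu

lemma mul_toYz_mem_yFil {v : P.Y} (hv : v ∈ P.yFil b 1) {n : ℕ} {c : P.Alg}
    (hc : c ∈ P.lowFil b n) : v * P.toYz c ∈ P.yFil b n := by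
  induction hc using Submodule.span_induction with
  | mem u hu =>
    obtain ⟨a, h, hh, rfl⟩ := hu
    induction hv using Submodule.span_induction with
    | mem v hv =>
      obtain ⟨d, l, h', hh', rfl⟩ := hv
      obtain ⟨t, rfl⟩ : ∃ t : k, h' = algebraMap k _ t := by
        induction hh' using Submodule.span_induction with
        | mem h' hh' =>
          obtain ⟨t, L, hL, rfl⟩ := hh'
          exact ⟨t, by rw [List.length_eq_zero_iff.1 (Nat.lt_one_iff.1 hL)]; simp⟩
        | zero => exact ⟨0, (map_zero _).symm⟩
        | add x y _ _ hx hy =>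
          obtain ⟨s, rfl⟩ := hx; obtain ⟨t, rfl⟩ := hy; exact ⟨s + t, (map_add _ _ _).symm⟩
        | smul r x _ hx =>
          obtain ⟨s, rfl⟩ := hx; exact ⟨r * s, by rw [map_mul, Algebra.smul_def]⟩
      have h1 : P.toYz (P.inU (algebraMap k _ t)) = t • (1 : P.Y) := by
        rw [Algebra.algebraMap_eq_smul_one, ← inULin_apply, map_smul, inULin_apply,
          show P.inU 1 = 1 from rfl, map_smul, map_one]
      rw [h1, mul_smul_comm, mul_one, smul_mul_assoc]
      refine Submodule.smul_mem _ _ ?_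
      rw [map_mul, toYz_inA, ← mul_assoc, mul_assoc (P.toYy d), ← P.toYz_inA, eList_mul_toYz,
        P.toYz_inA, ← P.toYy_inA, ← mul_assoc, ← map_mul]
      exact P.mem_yFil _ l hh
    | zero => rw [zero_mul]; exact zero_mem _
    | add u v _ _ hu hv => rw [add_mul]; exact add_mem hu hv
    | smul t u _ hu => rw [smul_mul_assoc]; exact Submodule.smul_mem _ _ hu
  | zero => rw [map_zero, mul_zero]; exact zero_mem _
  | add u v _ _ hu hv => rw [map_add, mul_add]; exact add_mem hu hv
  | smul t u _ hu => rw [map_smul, mul_smul_comm]; exact Submodule.smul_mem _ _ hu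

lemma eList_mem_yFil (l : List g) : P.eList l ∈ P.yFil b 1 := by
  have h := P.mem_yFil 1 l (one_mem_uFil b one_pos)
  rwa [show P.inU 1 = 1 from rfl, map_one, map_one, one_mul, mul_one] at h

lemma eList_mul_yy_mem (l : List g) (y : g) : P.eList l * P.yy y ∈ P.yFil b 1 := by
  induction l using List.reverseRecOn with
  | nil =>
    have h := P.toYy_mul_mem_yFil (P.inG y) (P.eList_mem_yFil b [])
    rwa [eList, List.map_nil, List.prod_nil, mul_one, toYy_inG, ← one_mul (P.yy y)] at h
  | append_singleton l x ih =>
    rw [eList_append, mul_assoc, ye_yy, mul_add, ← mul_assoc, ← eList_append]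
    exact add_mem (P.mul_ye_mem_yFil b x ih) (P.eList_mem_yFil b _)

/-- Right multiplication by `ρ_x` is, up to terms of lower filtration, the multiplication by `x`
of the last factor. -/
lemma mul_yrho_sub_mem (l : List g) (x : g) {n : ℕ} {h : U k g} (hh : h ∈ uFil b n) :
    P.eList l * P.toYz (P.inU h) * P.yrho x - P.eList l * P.toYz (P.inU (uι k x * h))
      ∈ P.yFil b n := by
  have e : P.eList l * P.toYz (P.inU h) * P.yrho x - P.eList l * P.toYz (P.inU (uι k x * h)) =
      P.eList l * P.toYz (P.inG x * P.inU h - P.inU (uι k x * h)) -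
        P.eList l * P.yy x * P.toYz (P.inU h) := by
    rw [mul_assoc, toYz_mul_yrho, yrho, sub_mul, mul_sub, map_sub, map_mul, toYz_inG, mul_sub,
      mul_assoc (P.eList l)]
    abel
  have h1 : P.inU h ∈ P.lowFil b n := by
    have := P.mem_lowFil 1 hh
    rwa [P.inA_one, one_mul] at this
  rw [e]
  exact sub_mem (P.mul_toYz_mem_yFil b (P.eList_mem_yFil b l) (P.inG_mul_inU_sub_mem b x hh))
    (P.mul_toYz_mem_yFil b (P.eList_mul_yy_mem b l x) h1)

lemma mul_yrho_mem_yFil (x : g) {n : ℕ} {v : P.Y} (hv : v ∈ P.yFil b n) :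
    v * P.yrho x ∈ P.yFil b (n + 1) := by
  induction hv using Submodule.span_induction with
  | mem v hv =>
    obtain ⟨d, l, h, hh, rfl⟩ := hv
    have h1 := P.mul_yrho_sub_mem b l x hh
    have h2 := P.mem_yFil 1 l (ι_mul_mem_uFil b x hh)
    rw [map_one, one_mul] at h2
    rw [mul_assoc (P.toYy d), mul_assoc (P.toYy d)]
    refine P.toYy_mul_mem_yFil d ?_
    rw [← sub_add_cancel (P.eList l * P.toYz (P.inU h) * P.yrho x)]
    exact add_mem (P.yFil_mono b n.le_succ h1) h2
  | zero => rw [zero_mul]; exact zero_mem _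
  | add u v _ _ hu hv => rw [add_mul]; exact add_mem hu hv
  | smul t u _ hu => rw [smul_mul_assoc]; exact Submodule.smul_mem _ _ hu

lemma rhoWord_append (L : List (I × ℕ × Bool)) (t : I × ℕ × Bool) :
    P.rhoWord b (L ++ [t]) = P.rhoWord b L *
      (P.yrho (b t.1) ^ t.2.1 * (if t.2.2 then P.ye (b t.1) else 1)) := by
  simp [rhoWord]

/-- The leading term of a word. -/
lemma rhoWord_sub_mem (L : List (I × ℕ × Bool)) :
    P.rhoWord b L - P.eList ((eIdx L).map b) *
      P.toYz (P.inU (((rhoIdx L).reverse.map fun i => uι k (b i)).prod))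
      ∈ P.yFil b (rhoIdx L).length := by
  have hstep : ∀ (l : List g) (h : U k g) (n : ℕ) (v : P.Y) (x : g), h ∈ uFil b (n + 1) →
      v - P.eList l * P.toYz (P.inU h) ∈ P.yFil b n → ∀ m,
      (uι k x) ^ m * h ∈ uFil b (n + m + 1) ∧
      v * P.yrho x ^ m - P.eList l * P.toYz (P.inU ((uι k x) ^ m * h)) ∈ P.yFil b (n + m) := by
    intro l h n v x hh hv m
    induction m with
    | zero => simpa using ⟨hh, hv⟩
    | succ m ih =>
      obtain ⟨h1, h2⟩ := ih
      refine ⟨by rw [pow_succ', mul_assoc]; exact ι_mul_mem_uFil b x h1, ?_⟩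
      rw [pow_succ, pow_succ', mul_assoc (uι k x), ← mul_assoc v]
      have h3 := add_mem (P.mul_yrho_mem_yFil b x h2) (P.mul_yrho_sub_mem b l x h1)
      rwa [sub_mul, sub_add_sub_cancel] at h3
  suffices h : (((rhoIdx L).reverse.map fun i => uι k (b i)).prod ∈ uFil b ((rhoIdx L).length + 1)) ∧
      P.rhoWord b L - P.eList ((eIdx L).map b) *
      P.toYz (P.inU (((rhoIdx L).reverse.map fun i => uι k (b i)).prod))
      ∈ P.yFil b (rhoIdx L).length from h.2
  induction L using List.reverseRecOn with
  | nil =>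
    refine ⟨one_mem_uFil b (Nat.succ_pos _), ?_⟩
    have h : P.rhoWord b [] - P.eList ((eIdx ([] : List (I × ℕ × Bool))).map b) *
        P.toYz (P.inU 1) = 0 := by
      rw [show P.inU 1 = 1 from rfl, map_one, mul_one]
      exact sub_self _
    exact h ▸ zero_mem _
  | append_singleton L t ih =>
    have h1 : rhoIdx (L ++ [t]) = rhoIdx L ++ List.replicate t.2.1 t.1 := by simp [rhoIdx]
    have h2 : ((rhoIdx (L ++ [t])).reverse.map fun i => uι k (b i)).prod =
        (uι k (b t.1)) ^ t.2.1 * ((rhoIdx L).reverse.map fun i => uι k (b i)).prod := by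
      rw [h1, List.reverse_append, List.map_append, List.prod_append, List.reverse_replicate,
        List.map_replicate, List.prod_replicate]
    have h3 : (rhoIdx (L ++ [t])).length = (rhoIdx L).length + t.2.1 := by
      rw [h1, List.length_append, List.length_replicate]
    obtain ⟨h4, h5⟩ := hstep _ _ _ _ (b t.1) ih.1 ih.2 t.2.1
    rw [h2, h3, rhoWord_append]
    refine ⟨h4, ?_⟩
    cases ht : t.2.2 with
    | false =>
      have h6 : eIdx (L ++ [t]) = eIdx L := by simp [eIdx, ht]
      rw [h6, if_neg Bool.false_ne_true, mul_one]
      exact h5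
    | true =>
      have h6 : eIdx (L ++ [t]) = eIdx L ++ [t.1] := by simp [eIdx, ht]
      have h7 := P.mul_ye_mem_yFil b (b t.1) h5
      rw [h6, if_pos rfl, List.map_append, List.map_singleton, eList_append, ← mul_assoc]
      rwa [sub_mul, mul_assoc (P.eList _), toYz_mul_ye, ← mul_assoc] at h7

end CrossedProduct

end WordBasis


section WordBasis

variable {k A g I : Type*} [Field k] [Ring A] [Algebra k A] [LieRing g] [LieAlgebra k g]
  [LinearOrder I] (P : CrossedProduct k A g) (b : Module.Basis I k g)

namespace CrossedProduct

/-- The map from the free left `E`-module on the pairs of a finite set `S` and a multiset `M` to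
`Y_*`, sending `(S, M)` to the product of the `e_i`, `i ∈ S`, and of the PBW monomial of `M`. -/
def normalMap : ((Finset I × Multiset I) →₀ P.Alg) →ₗ[k] P.Y :=
  Finsupp.lsum k fun j => LinearMap.mulRight k
    (P.eList ((j.1.sort (· ≤ ·)).map b) * P.toYz (P.inU (pbwMon b j.2))) ∘ₗ P.toYy.toLinearMap

lemma normalMap_single (j : Finset I × Multiset I) (c : P.Alg) :
    P.normalMap b (Finsupp.single j c) =
      P.toYy c * P.eList ((j.1.sort (· ≤ ·)).map b) * P.toYz (P.inU (pbwMon b j.2)) := by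
  rw [normalMap, Finsupp.lsum_single]
  exact (mul_assoc _ _ _).symm

lemma eList_sort (S : Finset I) {s : ℕ} (h : S.card = s) :
    P.eList ((S.sort (· ≤ ·)).map b) = P.eProd fun i => b (S.orderEmbOfFin h i) := by
  rw [eList, eProd]
  congr 1
  refine List.ext_getElem (by simp [h]) fun i _ _ => ?_
  simp [Finset.orderEmbOfFin_apply]

/-- The coordinates of the elements of `E ⊗ E`. -/
def tensorCoord : P.Alg →ₗ[k] P.Alg →ₗ[k] (Multiset I →₀ P.Alg) :=
  LinearMap.mk₂ k (fun c c' => Finsupp.mapRange.linearMap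
      (LinearMap.mulLeft k c ∘ₗ P.inAHom.toLinearMap) ((P.monEquiv b).symm c'))
    (fun c d u => by ext; simp [add_mul])
    (fun t c u => by ext; simp)
    (fun c u u' => by rw [map_add, map_add])
    (fun t c u => by rw [map_smul, map_smul])

lemma tensorCoord_single (c : P.Alg) (M : Multiset I) (a : A) :
    P.tensorCoord b c (P.monEquiv b (Finsupp.single M a)) = Finsupp.single M (c * P.inA a) := by
  change Finsupp.mapRange.linearMap _ ((P.monEquiv b).symm _) = _
  rw [LinearEquiv.symm_apply_apply, Finsupp.mapRange.linearMap_apply, Finsupp.mapRange_single]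
  rfl

lemma tensorCoord_balanced (a : A) (c c' : P.Alg) :
    P.tensorCoord b (c * P.inA a) c' = P.tensorCoord b c (P.inA a * c') := by
  obtain ⟨v, rfl⟩ := (P.monEquiv b).surjective c'
  induction v using Finsupp.induction_linear with
  | zero => rw [map_zero, mul_zero, map_zero, map_zero]
  | add u v hu hv => rw [map_add, map_add, hu, hv, mul_add, map_add]
  | single M a' =>
    have h : P.inA a * P.monEquiv b (Finsupp.single M a') =
        P.monEquiv b (Finsupp.single M (a * a')) := by
      rw [monEquiv_single, monEquiv_single, inA_mul, mul_assoc]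
    rw [h, tensorCoord_single, tensorCoord_single, inA_mul, mul_assoc]

lemma tensorCoord_pbwMon (c : P.Alg) (M : Multiset I) :
    P.tensorCoord b c (P.inU (pbwMon b M)) = Finsupp.single M c := by
  have h : P.inU (pbwMon b M) = P.monEquiv b (Finsupp.single M 1) := by
    rw [monEquiv_single, inA_one, one_mul]
  rw [h, tensorCoord_single, inA_one, mul_one]

lemma _root_.Module.Basis.exteriorPower_ofCard (S : Finset I) :
    b.exteriorPower S.card (Set.powersetCard.ofCard (rfl : S.card = S.card)) =
      exteriorPower.ιMulti k S.card fun i => b (S.orderEmbOfFin rfl i) := by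
  rw [exteriorPower.basis_apply]
  rfl

lemma normalMap_injective : Function.Injective (P.normalMap b) := by
  classical
  let D (s : ℕ) : (⋀[k]^s g) →ₗ[k]
      (Multiset I →₀ P.Alg) →ₗ[k] ((Finset I × Multiset I) →₀ P.Alg) :=
    (b.exteriorPower s).constr k fun S => Finsupp.lmapDomain _ _ fun M => (S.1, M)
  have hT (s : ℕ) := X.exists_lift_zero P (⊤ : Subalgebra k A) (s := s)
    (LinearMap.mk₂ k (fun c ω => (D s ω) ∘ₗ P.tensorCoord b c)
      (fun c c' w => by ext; simp) (fun t c w => by ext; simp)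
      (fun c w w' => by ext; simp) (fun t c w => by ext; simp))
    (fun a _ c w c' => congrArg (D s w) (P.tensorCoord_balanced b a c c'))
  choose T hT using hT
  obtain ⟨C, hC0⟩ : ∃ C : XX P (⊤ : Subalgebra k A) →ₗ[k] ((Finset I × Multiset I) →₀ P.Alg),
      ∀ s c (x : Fin s → g) (a : Fin 0 → A) c', C (elt P ⊤ c x a c') =
        D s (exteriorPower.ιMulti k s x) (P.tensorCoord b c c') := by
    let C' : ∀ p : ℕ × ℕ, X P (⊤ : Subalgebra k A) p.1 p.2 →ₗ[k] ((Finset I × Multiset I) →₀ P.Alg)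
      | (0, s) => T s
      | (_ + 1, _) => 0
    refine ⟨DirectSum.toModule k _ _ C', fun s c x a c' => ?_⟩
    rw [elt, inX, DirectSum.toModule_lof]
    exact hT s c x a c'
  have hC : C ∘ₗ P.toX ∘ₗ P.normalMap b = LinearMap.id := by
    refine Finsupp.lhom_ext fun j c => ?_
    let a : Fin 0 → A := Fin.elim0
    change C (P.toX (P.normalMap b (Finsupp.single j c))) = Finsupp.single j c
    rw [normalMap_single, toX_right, toX_left, P.eList_sort b j.1 rfl, P.toX_eProd _ a, smul_elt,
      op_smul_elt, mul_one, one_mul]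
    rw [hC0, ← b.exteriorPower_ofCard j.1, tensorCoord_pbwMon]
    simp only [D, Module.Basis.constr_basis]
    exact Finsupp.mapDomain_single
  exact Function.LeftInverse.injective (g := C ∘ P.toX) fun v => LinearMap.congr_fun hC v

lemma yFil_le_map (n : ℕ) : P.yFil b n ≤
    (Finsupp.supported P.Alg k {j : Finset I × Multiset I | j.2.card < n}).map (P.normalMap b) := by
  refine Submodule.span_le.2 ?_
  rintro _ ⟨c, l, h, hh, rfl⟩
  rw [eList_eq_eMap]
  generalize exteriorPower.ιMulti k l.length l.get = w
  replace hh := uFil_le_span b n hh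
  induction hh using Submodule.span_induction with
  | mem h hh =>
    obtain ⟨M, hM, rfl⟩ := hh
    induction (b.exteriorPower l.length).mem_span w using Submodule.span_induction with
    | mem w hw =>
      obtain ⟨S, rfl⟩ := hw
      refine ⟨Finsupp.single (S.1, M) c, Finsupp.single_mem_supported _ _ hM, ?_⟩
      rw [normalMap_single, exteriorPower.basis_apply, P.eList_sort b S.1 S.2]
      congr 2
      exact (P.eMap_ιMulti _ _).symm
    | zero => rw [map_zero, mul_zero, zero_mul]; exact zero_mem _
    | add u v _ _ hu hv => rw [map_add, mul_add, add_mul]; exact add_mem hu hv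
    | smul t u _ hu => rw [map_smul, mul_smul_comm, smul_mul_assoc]; exact Submodule.smul_mem _ _ hu
  | zero => rw [← inULin_apply, map_zero, map_zero, mul_zero]; exact zero_mem _
  | add u v _ _ hu hv =>
    rw [← inULin_apply, map_add, map_add, mul_add]; exact add_mem hu hv
  | smul t u _ hu =>
    rw [← inULin_apply, map_smul, map_smul, mul_smul_comm]; exact Submodule.smul_mem _ _ hu

lemma exists_mem_yFil (v : P.Y) : ∃ n, v ∈ P.yFil b n := by
  rw [← P.muOp_toX v]
  induction P.toX v using XX.induction with
  | elt r s c x a c' =>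
    cases r with
    | succ r => exact ⟨0, by rw [elt_top_succ, map_zero]; exact zero_mem _⟩
    | zero =>
      rw [muOp_elt]
      induction c' using P.Alg_induction with
      | sharp a' h =>
        obtain ⟨n, hn⟩ := exists_mem_uFil b h
        refine ⟨n, ?_⟩
        rw [sharp_eq, map_mul, toYz_inA, ← toYz_inA, mul_assoc, ← mul_assoc (P.eProd x),
          eProd_mul_toYz, toYz_inA, ← toYy_inA, ← mul_assoc, ← mul_assoc, ← map_mul]
        have := P.mem_yFil (c * P.inA a') (List.ofFn x) hn
        rwa [eList, List.map_ofFn] at this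
      | add u v hu hv =>
        obtain ⟨m, hm⟩ := hu
        obtain ⟨n, hn⟩ := hv
        refine ⟨max m n, ?_⟩
        rw [map_add, mul_add]
        exact add_mem (P.yFil_mono b (le_max_left _ _) hm) (P.yFil_mono b (le_max_right _ _) hn)
  | add u v hu hv =>
    obtain ⟨m, hm⟩ := hu
    obtain ⟨n, hn⟩ := hv
    refine ⟨max m n, ?_⟩
    rw [map_add]
    exact add_mem (P.yFil_mono b (le_max_left _ _) hm) (P.yFil_mono b (le_max_right _ _) hn)
  | smul t u hu =>
    obtain ⟨m, hm⟩ := hu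
    exact ⟨m, by rw [map_smul]; exact Submodule.smul_mem _ _ hm⟩

lemma normalMap_bijective : Function.Bijective (P.normalMap b) := by
  refine ⟨P.normalMap_injective b, fun v => ?_⟩
  obtain ⟨n, hn⟩ := P.exists_mem_yFil b v
  obtain ⟨w, -, hw⟩ := P.yFil_le_map b n hn
  exact ⟨w, hw⟩

/-- The map from the free left `E`-module on the admissible lists to `Y_*`. -/
def wordMap : ({L : List (I × ℕ × Bool) // IsAdmissible L} →₀ P.Alg) →ₗ[k] P.Y :=
  Finsupp.lsum k fun L => LinearMap.mulRight k (P.rhoWord b L.1) ∘ₗ P.toYy.toLinearMap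

lemma wordMap_single (L : {L : List (I × ℕ × Bool) // IsAdmissible L}) (c : P.Alg) :
    P.wordMap b (Finsupp.single L c) = P.toYy c * P.rhoWord b L.1 := by
  rw [wordMap, Finsupp.lsum_single]
  rfl

/-- `Y_*` is a free left `E`-module on the words of the admissible lists: expressed through the
normal forms, the words are unitriangular with respect to the degree in the `ρ_i`. -/
lemma wordMap_bijective : Function.Bijective (P.wordMap b) := by
  let e := Equiv.ofBijective _ (listIdx_bijective (I := I))
  let B := LinearEquiv.ofBijective _ (P.normalMap_bijective b)
  have h := bijective_of_unitriangular (fun j : Finset I × Multiset I => j.2.card)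
    (B.symm.toLinearMap ∘ₗ P.wordMap b ∘ₗ (Finsupp.domLCongr e.symm).toLinearMap) ?_
  · have h2 : ⇑(P.wordMap b) = B ∘ (B.symm.toLinearMap ∘ₗ P.wordMap b ∘ₗ
        (Finsupp.domLCongr e.symm).toLinearMap) ∘ (Finsupp.domLCongr (M := P.Alg) (R := k) e) := by
      funext v
      refine Eq.symm ?_
      change B (B.symm (P.wordMap b (Finsupp.domLCongr e.symm (Finsupp.domLCongr e v)))) = _
      rw [B.apply_symm_apply]
      congr 1
      exact (Finsupp.domLCongr (M := P.Alg) (R := k) e).symm_apply_apply v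
    rw [h2]
    exact B.bijective.comp (h.comp (LinearEquiv.bijective _))
  · intro j c
    obtain ⟨L, rfl⟩ := e.surjective j
    change B.symm (P.wordMap b (Finsupp.domLCongr e.symm (Finsupp.single (e L) c))) - _ ∈ _
    rw [Finsupp.domLCongr_single, Equiv.symm_apply_apply, wordMap_single]
    have h1 : P.toYy c * P.rhoWord b L.1 - B (Finsupp.single (e L) c) ∈
        P.yFil b (rhoIdx L.1).length := by
      have hM : (e L).2 = (rhoIdx L.1 : Multiset I) := rfl
      have hS : ((e L).1.sort (· ≤ ·)) = eIdx L.1 := (eIdx_eq_sort L.2).symm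
      have h2 := prod_sub_prod_mem_of_perm (Algebra.ofId k (U k g)) (fun i => uι k (b i)) (uComm b)
        (uStraight b) (L := (rhoIdx L.1).reverse) (L' := (e L).2.sort (· ≤ ·))
        (Multiset.coe_eq_coe.1 (by rw [Multiset.sort_eq, hM, Multiset.coe_reverse]))
      rw [List.length_reverse] at h2
      have h3 := add_mem (P.toYy_mul_mem_yFil c (P.rhoWord_sub_mem b L.1))
        (P.mem_yFil c ((eIdx L.1).map b) h2)
      change _ - P.normalMap b _ ∈ _
      rw [normalMap_single, hS]
      convert h3 using 1
      rw [← inULin_apply, ← inULin_apply, ← inULin_apply, map_sub, map_sub, mul_sub, mul_sub,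
        ← mul_assoc, sub_add_sub_cancel]
      rfl
    obtain ⟨w, hw, hw'⟩ := P.yFil_le_map b _ h1
    have h4 : B.symm (P.toYy c * P.rhoWord b L.1) - Finsupp.single (e L) c = w := by
      apply B.injective
      rw [map_sub, B.apply_symm_apply]
      exact hw'.symm
    rw [h4]
    have h5 : (e L).2.card = (rhoIdx L.1).length := rfl
    rw [h5]
    exact hw

end CrossedProduct

end WordBasis


/-! ### The contraction of `Y_*` -/

section Contraction

variable {k A g I : Type*} [Field k] [Ring A] [Algebra k A] [LieRing g] [LieAlgebra k g]
  [LinearOrder I] (P : CrossedProduct k A g) (b : Module.Basis I k g)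

namespace CrossedProduct

/-- The value of the contraction at the word of an admissible list: a factor `ρ_i` of the first
index `i` is replaced by `e_i`. -/
def nextWord : List (I × ℕ × Bool) → P.Y
  | (i, m + 1, false) :: L => P.rhoWord b ((i, m, true) :: L)
  | _ => 0

/-- The left `E`-linear contraction `σ⁻¹` of `Y_*`. -/
def yContr : P.Y →ₗ[k] P.Y :=
  (Finsupp.lsum k fun L : {L : List (I × ℕ × Bool) // IsAdmissible L} =>
    LinearMap.mulRight k (P.nextWord b L.1) ∘ₗ P.toYy.toLinearMap) ∘ₗ
  (LinearEquiv.ofBijective _ (P.wordMap_bijective b)).symm.toLinearMap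

lemma yContr_word (c : P.Alg) {L : List (I × ℕ × Bool)} (hL : IsAdmissible L) :
    P.yContr b (P.toYy c * P.rhoWord b L) = P.toYy c * P.nextWord b L := by
  have h : (LinearEquiv.ofBijective _ (P.wordMap_bijective b)).symm
      (P.toYy c * P.rhoWord b L) = Finsupp.single ⟨L, hL⟩ c := by
    rw [LinearEquiv.symm_apply_eq]
    exact (P.wordMap_single b ⟨L, hL⟩ c).symm
  change Finsupp.lsum k _ ((LinearEquiv.ofBijective _ (P.wordMap_bijective b)).symm _) = _
  rw [h, Finsupp.lsum_single]
  rfl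

lemma yContr_rhoWord {L : List (I × ℕ × Bool)} (hL : IsAdmissible L) :
    P.yContr b (P.rhoWord b L) = P.nextWord b L := by
  have h := P.yContr_word b 1 hL
  rwa [map_one, one_mul, one_mul] at h

lemma isAdmissible_nil : IsAdmissible ([] : List (I × ℕ × Bool)) := ⟨List.Pairwise.nil, by simp⟩

lemma isAdmissible_cons {t : I × ℕ × Bool} {L : List (I × ℕ × Bool)} :
    IsAdmissible (t :: L) ↔
      (0 < t.2.1 ∨ t.2.2 = true) ∧ (∀ s ∈ L, t.1 < s.1) ∧ IsAdmissible L := by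
  simp only [IsAdmissible, List.pairwise_cons, List.forall_mem_cons]
  tauto

/-- `Y_*` is generated by the words as a left `E`-module. -/
lemma word_induction {p : P.Y → Prop}
    (word : ∀ c L, IsAdmissible L → p (P.toYy c * P.rhoWord b L))
    (add : ∀ u v, p u → p v → p (u + v)) (v : P.Y) : p v := by
  obtain ⟨w, rfl⟩ := (P.wordMap_bijective b).surjective v
  induction w using Finsupp.induction_linear with
  | zero =>
    have h := word 0 [] isAdmissible_nil
    rw [map_zero, zero_mul] at h
    rwa [map_zero]
  | add u v hu hv => rw [map_add]; exact add _ _ hu hv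
  | single L c => rw [wordMap_single]; exact word c L.1 L.2

lemma yContr_left (c : P.Alg) (v : P.Y) :
    P.yContr b (P.toYy c * v) = P.toYy c * P.yContr b v := by
  induction v using P.word_induction b with
  | word d L hL => rw [← mul_assoc, ← map_mul, yContr_word _ _ _ hL, yContr_word _ _ _ hL, map_mul,
      mul_assoc]
  | add u v hu hv => rw [mul_add, map_add, hu, hv, map_add, mul_add]

lemma rhoWord_mul_yA (L : List (I × ℕ × Bool)) (a : A) :
    P.rhoWord b L * P.yA a = P.yA a * P.rhoWord b L := by
  refine (Commute.list_prod_left _ _ fun v hv => ?_ : Commute (P.rhoWord b L) (P.yA a))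
  obtain ⟨t, -, rfl⟩ := List.mem_map.1 hv
  refine Commute.mul_left (Commute.pow_left (P.yrho_yA _ _) _) ?_
  split_ifs
  · exact P.ye_yA _ _
  · exact Commute.one_left _

lemma nextWord_mul_yA (L : List (I × ℕ × Bool)) (a : A) :
    P.nextWord b L * P.yA a = P.yA a * P.nextWord b L := by
  unfold nextWord
  split
  · exact P.rhoWord_mul_yA b _ a
  · rw [zero_mul, mul_zero]

lemma yContr_mul_yA (v : P.Y) (a : A) : P.yContr b (v * P.yA a) = P.yContr b v * P.yA a := by
  induction v using P.word_induction b with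
  | word c L hL =>
    rw [mul_assoc, rhoWord_mul_yA, yContr_word _ _ _ hL, mul_assoc, nextWord_mul_yA, ← P.toYy_inA,
      ← mul_assoc, ← mul_assoc, ← map_mul, yContr_word _ _ _ hL]
  | add u v hu hv => rw [add_mul, map_add, hu, hv, map_add, add_mul]

lemma rhoWord_cons (i : I) (m : ℕ) (δ : Bool) (L : List (I × ℕ × Bool)) :
    P.rhoWord b ((i, m, δ) :: L) =
      P.yrho (b i) ^ m * ((if δ then P.ye (b i) else 1) * P.rhoWord b L) := by
  rw [rhoWord, List.map_cons, List.prod_cons, mul_assoc]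
  rfl

lemma yrho_pow_mem_Ygr (x : g) (m : ℕ) : P.yrho x ^ m ∈ P.Ygr 0 := by
  induction m with
  | zero => rw [pow_zero]; exact P.one_mem_Ygr
  | succ m ih => rw [pow_succ]; exact mul_mem_Ygr_left ih (P.yrho_mem_Ygr x)

lemma yDel_yrho_pow_mul (x : g) (m : ℕ) (v : P.Y) :
    P.yDel (P.yrho x ^ m * v) = P.yrho x ^ m * P.yDel v := by
  have h := P.yrho_pow_mem_Ygr x m
  rw [P.yDel_mul h, P.yDel_Ygr_zero h, zero_mul, zero_add, pow_zero, one_smul]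

lemma yDel_ye_mul (x : g) (v : P.Y) :
    P.yDel (P.ye x * v) = P.yrho x * v - P.ye x * P.yDel v := by
  rw [P.yDel_mul (P.ye_mem_Ygr x), yDel_ye, pow_one, sub_eq_add_neg (P.yrho x * v)]
  exact congrArg _ (neg_one_smul k (P.ye x * P.yDel v))

/-- The span of the words in the letters with index greater than `i`. -/
def wordSpan (i : I) : Submodule k P.Y :=
  Submodule.span k {v | ∃ L, IsAdmissible L ∧ (∀ t ∈ L, i < t.1) ∧ v = P.rhoWord b L}

lemma cons_mem_wordSpan {i j : I} (hij : i < j) {m : ℕ} {δ : Bool} (hm : 0 < m ∨ δ = true) {v : P.Y}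
    (hv : v ∈ P.wordSpan b j) :
    P.yrho (b j) ^ m * ((if δ then P.ye (b j) else 1) * v) ∈ P.wordSpan b i := by
  induction hv using Submodule.span_induction with
  | mem v hv =>
    obtain ⟨L, hL, h, rfl⟩ := hv
    rw [← rhoWord_cons]
    exact Submodule.subset_span ⟨_, isAdmissible_cons.2 ⟨hm, h, hL⟩,
      List.forall_mem_cons.2 ⟨hij, fun t ht => hij.trans (h t ht)⟩, rfl⟩
  | zero => rw [mul_zero, mul_zero]; exact zero_mem _
  | add u v _ _ hu hv => rw [mul_add, mul_add]; exact add_mem hu hv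
  | smul t u _ hu => rw [mul_smul_comm, mul_smul_comm]; exact Submodule.smul_mem _ _ hu

lemma yDel_rhoWord_mem {L : List (I × ℕ × Bool)} (hL : IsAdmissible L) :
    ∀ i, (∀ t ∈ L, i < t.1) → P.yDel (P.rhoWord b L) ∈ P.wordSpan b i := by
  induction L with
  | nil =>
    intro i _
    have h : P.yDel (P.rhoWord b []) = 0 := P.yDel_one
    exact h ▸ zero_mem _
  | cons t L ih =>
    obtain ⟨j, m, δ⟩ := t
    intro i hi
    obtain ⟨hm, hj, hL⟩ := isAdmissible_cons.1 hL
    have hij := (List.forall_mem_cons.1 hi).1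
    have hW := ih hL j hj
    have h0 : P.rhoWord b L ∈ P.wordSpan b j := Submodule.subset_span ⟨L, hL, hj, rfl⟩
    have h1 := P.cons_mem_wordSpan b hij hm hW
    rw [rhoWord_cons, yDel_yrho_pow_mul]
    cases δ with
    | false => simpa using h1
    | true =>
      have h2 := P.cons_mem_wordSpan b hij (m := m + 1) (δ := false) (Or.inl m.succ_pos) h0
      simp only [if_true, if_false, one_mul, Bool.false_eq_true] at h1 h2 ⊢
      rw [yDel_ye_mul, mul_sub, ← mul_assoc, ← pow_succ]
      exact sub_mem h2 h1

lemma yContr_yrho_pow_mul (i : I) (m : ℕ) {v : P.Y} (hv : v ∈ P.wordSpan b i) :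
    P.yContr b (P.yrho (b i) ^ (m + 1) * v) = P.yrho (b i) ^ m * (P.ye (b i) * v) ∧
      P.yContr b (P.yrho (b i) ^ m * (P.ye (b i) * v)) = 0 := by
  induction hv using Submodule.span_induction with
  | mem v hv =>
    obtain ⟨L, hL, h, rfl⟩ := hv
    have h1 := P.yContr_rhoWord b (isAdmissible_cons (t := (i, m + 1, false)).2
      ⟨Or.inl m.succ_pos, h, hL⟩)
    have h2 := P.yContr_rhoWord b (isAdmissible_cons (t := (i, m, true)).2 ⟨Or.inr rfl, h, hL⟩)
    simp only [nextWord, rhoWord_cons, if_true, if_false, one_mul, Bool.false_eq_true] at h1 h2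
    exact ⟨h1, h2⟩
  | zero => simp
  | add u v _ _ hu hv =>
    simp only [mul_add, map_add, hu.1, hv.1, hu.2, hv.2, add_zero, and_self]
  | smul t u _ hu =>
    simp only [mul_smul_comm, (P.yContr b).map_smul, hu.1, hu.2, smul_zero, and_self]

lemma yContr_yDel (v : P.Y) :
    P.yContr b (P.yDel v) + P.yDel (P.yContr b v) = v - P.toYy (P.yAug v) := by
  induction v using P.word_induction b with
  | add u v hu hv =>
    simp only [map_add]
    rw [add_add_add_comm, hu, hv, add_sub_add_comm]
  | word c L hL =>
    rw [yDel_toYy_mul, yContr_left, yContr_word _ _ _ hL, yDel_toYy_mul, map_mul, yAug_toYy, map_mul,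
      ← mul_sub, ← mul_add]
    congr 1
    cases L with
    | nil =>
      have h0 : P.rhoWord b ([] : List (I × ℕ × Bool)) = 1 := rfl
      have h1 : P.nextWord b ([] : List (I × ℕ × Bool)) = 0 := rfl
      rw [h0, h1, yDel_one, map_zero, map_zero, map_one, map_one, add_zero, sub_self]
    | cons t L =>
      obtain ⟨i, m, δ⟩ := t
      obtain ⟨hm, hj, hL⟩ := isAdmissible_cons.1 hL
      have h0 : P.rhoWord b L ∈ P.wordSpan b i := Submodule.subset_span ⟨L, hL, hj, rfl⟩
      have h1 := P.yDel_rhoWord_mem b hL i hj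
      rw [rhoWord_cons, map_mul P.yAug, map_pow P.yAug, map_mul P.yAug, yAug_yrho,
        yDel_yrho_pow_mul]
      cases δ with
      | true =>
        have h2 : P.nextWord b ((i, m, true) :: L) = 0 := by cases m <;> rfl
        simp only [if_true]
        rw [h2, yDel_ye_mul, mul_sub, ← mul_assoc, ← pow_succ, map_sub,
          (P.yContr_yrho_pow_mul b i m h0).1, (P.yContr_yrho_pow_mul b i m h1).2, yAug_ye,
          zero_mul, mul_zero, map_zero, map_zero, sub_zero, add_zero]
      | false =>
        obtain ⟨m, rfl⟩ : ∃ n, m = n + 1 :=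
          ⟨m - 1, (Nat.sub_add_cancel (hm.resolve_right Bool.false_ne_true)).symm⟩
        have h2 : P.nextWord b ((i, m + 1, false) :: L) = P.rhoWord b ((i, m, true) :: L) := rfl
        simp only [if_false, one_mul, Bool.false_eq_true]
        rw [h2, rhoWord_cons, yDel_yrho_pow_mul]
        simp only [if_true]
        rw [yDel_ye_mul, (P.yContr_yrho_pow_mul b i m h1).1, mul_sub, ← mul_assoc (_ ^ m) (P.yrho _),
          ← pow_succ, zero_pow m.succ_ne_zero, zero_mul, map_zero, sub_zero, add_sub_cancel]

lemma rhoWord_mem_Ygr (L : List (I × ℕ × Bool)) : P.rhoWord b L ∈ P.Ygr (eIdx L).length := by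
  induction L with
  | nil => exact P.one_mem_Ygr
  | cons t L ih =>
    obtain ⟨i, m, δ⟩ := t
    rw [rhoWord_cons]
    refine mul_mem_Ygr_left (P.yrho_pow_mem_Ygr _ m) ?_
    cases δ with
    | false => simpa [eIdx] using ih
    | true =>
      have h1 : (eIdx ((i, m, true) :: L)).length = 1 + (eIdx L).length := by
        simp [eIdx, add_comm]
      rw [h1]
      exact mul_mem_Ygr (P.ye_mem_Ygr _) ih

lemma nextWord_mem_Ygr (L : List (I × ℕ × Bool)) :
    P.nextWord b L ∈ P.Ygr ((eIdx L).length + 1) := by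
  rcases L with _ | ⟨⟨i, _ | m, _ | _⟩, L⟩
  case cons.succ.false =>
    have h := P.rhoWord_mem_Ygr b ((i, m, true) :: L)
    rwa [show eIdx ((i, m, true) :: L) = i :: eIdx L from rfl] at h
  all_goals exact zero_mem _

/-- The projection of `Y_*` onto `Y_s`. -/
lemma exists_proj_Ygr (s : ℕ) : ∃ p : P.Y →ₗ[k] P.Y,
    (∀ v ∈ P.Ygr s, p v = v) ∧ ∀ t ≠ s, ∀ v ∈ P.Ygr t, p v = 0 := by
  refine ⟨muOp P ⊤ ∘ₗ inX P ⊤ 0 s ∘ₗ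
    DirectSum.component k (ℕ × ℕ) (fun p => X P ⊤ p.1 p.2) (0, s) ∘ₗ P.toX, fun v hv => ?_,
    fun t hts v hv => ?_⟩
  · obtain ⟨w, hw⟩ := P.toX_mem_XB hv
    rw [← P.muOp_toX v, ← hw]
    simp only [LinearMap.comp_apply]
    rw [P.toX_muOp_top]
    congr 2
    exact DirectSum.component.lof_self k (M := fun p : ℕ × ℕ => X P ⊤ p.1 p.2) (0, s) w
  · obtain ⟨w, hw⟩ := P.toX_mem_XB hv
    simp only [LinearMap.comp_apply]
    rw [← hw]
    have h : DirectSum.component k (ℕ × ℕ) (fun p => X P ⊤ p.1 p.2) (0, s) (inX P ⊤ 0 t w) = 0 := by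
      rw [inX, DirectSum.component.of, dif_neg fun h => hts (congrArg Prod.snd h)]
    rw [h, map_zero, map_zero]

lemma yContr_mem_Ygr {s : ℕ} {v : P.Y} (hv : v ∈ P.Ygr s) : P.yContr b v ∈ P.Ygr (s + 1) := by
  obtain ⟨p, hp, hp'⟩ := P.exists_proj_Ygr s
  rw [← hp v hv]
  clear hv
  induction v using P.word_induction b with
  | add u v hu hv => rw [map_add, map_add]; exact add_mem hu hv
  | word c L hL =>
    have h := mul_mem_Ygr_left (P.toYy_mem_Ygr c) (P.rhoWord_mem_Ygr b L)
    by_cases hs : (eIdx L).length = s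
    · rw [hs] at h
      rw [hp _ h, yContr_word _ _ _ hL, ← hs]
      exact mul_mem_Ygr_left (P.toYy_mem_Ygr c) (P.nextWord_mem_Ygr b L)
    · rw [hp' _ hs _ h, map_zero]
      exact zero_mem _

end CrossedProduct

end Contraction


/-! ### The perturbed contraction -/

section Perturbation

variable {k A g I : Type*} [Field k] [Ring A] [Algebra k A] [LieRing g] [LieAlgebra k g]
  [LinearOrder I] {P : CrossedProduct k A g} {K : Subalgebra k A}

variable (hK : P.Stable K)

/-- The part `d¹ + d²` of the differential. -/
def dPlus : Module.End k (XX P K) := dOne hK + dTwo hK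

/-- The total differential. -/
def dTot : Module.End k (XX P K) := dZero P K + dPlus hK

lemma dTot_apply (v : XX P K) : dTot hK v = dZero P K v + (dOne hK v + dTwo hK v) := rfl

lemma dPlus_XB_zero {r : ℕ} {v : XX P K} (hv : v ∈ XB P K r 0) : dPlus hK v = 0 := by
  rw [dPlus, LinearMap.add_apply, dOne_XB_zero hK hv, dTwo_XB_zero hK hv, add_zero]

lemma dTot_bimod : IsBimod (dTot hK) where
  left c v := by
    rw [dTot_apply, dTot_apply, dZero_bimod.left, (dOne_bimod hK).left, (dTwo_bimod hK).left,
      smul_add, smul_add]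
  right c v := by
    rw [dTot_apply, dTot_apply, dZero_bimod.right, (dOne_bimod hK).right, (dTwo_bimod hK).right,
      smul_add, smul_add]

lemma dPlus_bimod : IsBimod (dPlus hK) where
  left c v := by
    rw [dPlus, LinearMap.add_apply, LinearMap.add_apply, (dOne_bimod hK).left, (dTwo_bimod hK).left,
      smul_add]
  right c v := by
    rw [dPlus, LinearMap.add_apply, LinearMap.add_apply, (dOne_bimod hK).right,
      (dTwo_bimod hK).right, smul_add]

lemma dTot_dTot (v : XX P K) : dTot hK (dTot hK v) = 0 := by
  have h0 := sum_dMap_dMap hK 0 v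
  have h1 := sum_dMap_dMap hK 1 v
  have h2 := sum_dMap_dMap hK 2 v
  have h3 := sum_dMap_dMap hK 3 v
  have h4 := sum_dMap_dMap hK 4 v
  simp only [Finset.sum_range_succ, Finset.sum_range_zero, dMap, Nat.reduceSub, zero_add,
    LinearMap.zero_apply, map_zero, add_zero] at h0 h1 h2 h3 h4
  simp only [dTot_apply, map_add]
  linear_combination (norm := abel) h0 + h1 + h2 + h3 + h4

lemma muOp_dTot (v : XX P K) : muOp P K (dTot hK v) = - P.yDel (muOp P K v) := by
  rw [dTot_apply, map_add, map_add, muOp_dZero, muOp_dOne, muOp_dTwo, add_zero, zero_add]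

lemma sum_range_dMap {r s : ℕ} {v : XX P K} (hv : v ∈ XB P K r s) :
    ∑ l ∈ Finset.range (s + 1), dMap hK l v = dTot hK v := by
  have h : ∀ n ≥ 3, ∑ l ∈ Finset.range n, dMap hK l v = dTot hK v := fun n hn => by
    obtain ⟨n, rfl⟩ := Nat.exists_eq_add_of_le hn
    rw [Finset.sum_range_add, Finset.sum_eq_zero (s := Finset.range n), add_zero]
    · simp [Finset.sum_range_succ, dMap, dTot_apply, add_assoc]
    · intro l _
      rw [dMap_of_lt hK (by omega), LinearMap.zero_apply]
  rw [← h (s + 1 + 2) (by omega), Finset.sum_range_add _ (s + 1) 2,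
    Finset.sum_eq_zero (s := Finset.range 2), add_zero]
  intro l _
  exact dMap_of_degree_lt hK (by omega) hv

variable (θ : P.Section)

/-- The perturbation `σ⁰ (d¹ + d²)`. -/
def pert : Module.End k (XX P K) := appendOp P K θ ∘ₗ dPlus hK

lemma pert_apply (v : XX P K) : pert hK θ v = appendOp P K θ (dPlus hK v) := rfl

lemma pert_nilpotent (v : XX P K) : ∃ n, (pert hK θ ^ n) v = 0 := by
  have hadd : ∀ u v : XX P K, (∃ n, (pert hK θ ^ n) u = 0) → (∃ n, (pert hK θ ^ n) v = 0) →
      ∃ n, (pert hK θ ^ n) (u + v) = 0 := by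
    rintro u v ⟨m, hm⟩ ⟨n, hn⟩
    exact ⟨max m n, by rw [map_add, Module.End.pow_map_zero_of_le (le_max_left _ _) hm,
      Module.End.pow_map_zero_of_le (le_max_right _ _) hn, add_zero]⟩
  have hstep : ∀ v : XX P K, (∃ n, (pert hK θ ^ n) (pert hK θ v) = 0) →
      ∃ n, (pert hK θ ^ n) v = 0 :=
    fun v ⟨n, hn⟩ => ⟨n + 1, by rw [pow_succ]; exact hn⟩
  have hs : ∀ s r, ∀ v ∈ XB P K r s, ∃ n, (pert hK θ ^ n) v = 0 := by
    intro s
    induction s using Nat.strong_induction_on with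
    | _ s ih =>
      intro r v hv
      apply hstep
      rw [pert_apply, dPlus, LinearMap.add_apply, map_add]
      match s with
      | 0 =>
        rw [dOne_XB_zero hK hv, dTwo_XB_zero hK hv, map_zero, add_zero]
        exact ⟨0, rfl⟩
      | 1 =>
        rw [dTwo_XB_one hK hv, map_zero, add_zero]
        exact ih 0 one_pos _ _ (appendOp_mem_XB θ (dOne_mem_XB hK hv))
      | s + 2 =>
        exact hadd _ _ (ih (s + 1) (by omega) _ _ (appendOp_mem_XB θ (dOne_mem_XB hK hv)))
          (ih s (by omega) _ _ (appendOp_mem_XB θ (dTwo_mem_XB hK hv)))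
  induction v using XX.induction_XB with
  | mem r s v hv => exact hs s r v hv
  | add u v hu hv => exact hadd u v hu hv

/-- The automorphism `1 + σ⁰ (d¹ + d²)`. -/
def pertEquiv : XX P K ≃ₗ[k] XX P K :=
  LinearEquiv.ofBijective (1 + pert hK θ : Module.End k (XX P K))
    (exists_neumann _ (pert_nilpotent hK θ)).1

lemma pertEquiv_apply (v : XX P K) : pertEquiv hK θ v = v + appendOp P K θ (dPlus hK v) := rfl

lemma pertEquiv_symm_mem {Q : Submodule k (XX P K)} (hQ : ∀ v ∈ Q, pert hK θ v ∈ Q) {v : XX P K}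
    (hv : v ∈ Q) : (pertEquiv hK θ).symm v ∈ Q :=
  (exists_neumann _ (pert_nilpotent hK θ)).2 Q hQ _
    (((pertEquiv hK θ).apply_symm_apply v).symm ▸ hv :)

lemma pertEquiv_symm_eq (v : XX P K) : (pertEquiv hK θ).symm v =
    v - appendOp P K θ (dPlus hK ((pertEquiv hK θ).symm v)) := by
  rw [eq_sub_iff_add_eq, ← pertEquiv_apply, LinearEquiv.apply_symm_apply]

/-- The sum `∑ σ^l` of the maps `σ^l` on `X`. -/
def sigTot : Module.End k (XX P K) := (pertEquiv hK θ).symm.toLinearMap ∘ₗ appendOp P K θ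

/-- The sum `∑ σ^l` of the maps `σ^l` on `Y_*`. -/
def sigTotY : P.Y →ₗ[k] XX P K := (pertEquiv hK θ).symm.toLinearMap ∘ₗ yLift K θ

lemma muOp_pertEquiv_symm (v : XX P K) : muOp P K ((pertEquiv hK θ).symm v) = muOp P K v := by
  rw [pertEquiv_symm_eq, map_sub, muOp_appendOp, sub_zero]

lemma muOp_sigTot (v : XX P K) : muOp P K (sigTot hK θ v) = 0 :=
  (muOp_pertEquiv_symm hK θ _).trans (muOp_appendOp θ v)

lemma muOp_sigTotY (v : P.Y) : muOp P K (sigTotY hK θ v) = v :=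
  (muOp_pertEquiv_symm hK θ _).trans (muOp_yLift θ v)

lemma appendOp_dTot (v : XX P K) : appendOp P K θ (dTot hK v) =
    pertEquiv hK θ v - dZero P K (appendOp P K θ v) - collapseOp P K K θ v := by
  rw [dZero_appendOp, pertEquiv_apply, dTot, LinearMap.add_apply, map_add]
  abel

/-- The key identity of the perturbation: `1 + σ⁰ (d¹ + d²)` intertwines `d` and `d⁰` up to the
projection onto the image of `Y_*`. -/
lemma pertEquiv_dTot (v : XX P K) : pertEquiv hK θ (dTot hK v) =
    dZero P K (pertEquiv hK θ v) - yLift K θ (P.yDel (muOp P K v)) := by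
  have h1 := appendOp_dTot hK θ (dTot hK v)
  have h2 := congrArg (dZero P K) (appendOp_dTot hK θ v)
  rw [dTot_dTot, map_zero, ← yLift_muOp, muOp_dTot, map_neg] at h1
  rw [map_sub, map_sub, dZero_dZero, dZero_collapseOp, sub_zero, sub_zero] at h2
  rw [h2] at h1
  rw [eq_comm, ← sub_eq_zero, ← neg_eq_zero, h1]
  abel

lemma dTot_sigTot (v : XX P K) : dTot hK (sigTot hK θ v) + sigTot hK θ (dTot hK v) =
    v - sigTotY hK θ (muOp P K v) := by
  apply (pertEquiv hK θ).injective
  have h1 : ∀ v, pertEquiv hK θ (sigTot hK θ v) = appendOp P K θ v :=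
    fun v => (pertEquiv hK θ).apply_symm_apply _
  have h2 : ∀ v, pertEquiv hK θ (sigTotY hK θ v) = yLift K θ v :=
    fun v => (pertEquiv hK θ).apply_symm_apply _
  rw [map_add, map_sub, pertEquiv_dTot, h1, h1, h2, muOp_sigTot, map_zero, map_zero, sub_zero,
    appendOp_dTot, yLift_muOp]
  abel

lemma dTot_sigTotY (v : P.Y) : dTot hK (sigTotY hK θ v) = - sigTotY hK θ (P.yDel v) := by
  apply (pertEquiv hK θ).injective
  have h2 : ∀ v, pertEquiv hK θ (sigTotY hK θ v) = yLift K θ v :=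
    fun v => (pertEquiv hK θ).apply_symm_apply _
  rw [map_neg, pertEquiv_dTot, h2, h2, muOp_sigTotY, yLift_apply, dZero_collapseOp, zero_sub]

variable (b : Module.Basis I k g)

/-- The contracting homotopy of the total complex. -/
def homot : Module.End k (XX P K) :=
  sigTot hK θ - sigTotY hK θ ∘ₗ P.yContr b ∘ₗ muOp P K

lemma homot_apply (v : XX P K) : homot hK θ b v =
    sigTot hK θ v - sigTotY hK θ (P.yContr b (muOp P K v)) := rfl

lemma sigTotY_toYy (c : P.Alg) : sigTotY hK θ (P.toYy c) = yLift K θ (P.toYy c) := by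
  apply (pertEquiv hK θ).injective
  have h := yLift_mem_XB (K := K) θ (P.toYy_mem_Ygr c)
  rw [pertEquiv_apply hK θ (yLift K θ _), dPlus_XB_zero hK h, map_zero, add_zero]
  exact (pertEquiv hK θ).apply_symm_apply _

lemma dTot_homot (v : XX P K) : dTot hK (homot hK θ b v) + homot hK θ b (dTot hK v) =
    v - yLift K θ (P.toYy (P.yAug (muOp P K v))) := by
  have h1 := dTot_sigTot hK θ v
  have h2 := congrArg (sigTotY hK θ) (P.yContr_yDel b (muOp P K v))
  rw [map_add, map_sub, sigTotY_toYy] at h2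
  rw [homot_apply, homot_apply, map_sub, dTot_sigTotY, muOp_dTot, map_neg, map_neg]
  linear_combination (norm := abel) h1 + h2

section Linearity

lemma pertEquiv_left (c : P.Alg) (v : XX P K) :
    pertEquiv hK θ (c • v) = c • pertEquiv hK θ v := by
  rw [pertEquiv_apply, pertEquiv_apply, (dPlus_bimod hK).left, appendOp_left, smul_add]

lemma pertEquiv_symm_left (c : P.Alg) (v : XX P K) :
    (pertEquiv hK θ).symm (c • v) = c • (pertEquiv hK θ).symm v := by
  rw [LinearEquiv.symm_apply_eq, pertEquiv_left, LinearEquiv.apply_symm_apply]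

lemma homot_left (c : P.Alg) (v : XX P K) : homot hK θ b (c • v) = c • homot hK θ b v := by
  have h1 : sigTot hK θ (c • v) = c • sigTot hK θ v :=
    (congrArg _ (appendOp_left θ c v)).trans (pertEquiv_symm_left hK θ c _)
  have h2 : ∀ t, sigTotY hK θ (P.toYy c * t) = c • sigTotY hK θ t := fun t =>
    (congrArg _ (yLift_left θ c t)).trans (pertEquiv_symm_left hK θ c _)
  rw [homot_apply, homot_apply, h1, muOp_left, P.yContr_left, h2, smul_sub]

variable {θ} (hθ : θ.KStable K)

include hθ in
lemma appendOp_right : IsRightKLin P K (appendOp P K θ) :=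
  right_of_kStable θ hθ (fun h _ hv => appendOp_op_toLin θ h hv)
    (fun _ ht _ hv => appendOp_op_inA θ ht hv)

include hθ in
lemma pertEquiv_symm_right {t : A} (ht : t ∈ K) (v : XX P K) :
    (pertEquiv hK θ).symm (op (P.inA t) • v) = op (P.inA t) • (pertEquiv hK θ).symm v := by
  rw [LinearEquiv.symm_apply_eq, pertEquiv_apply, (dPlus_bimod hK).right, appendOp_right hθ _ ht,
    ← smul_add, ← pertEquiv_apply, LinearEquiv.apply_symm_apply]

include hθ in
lemma homot_right {t : A} (ht : t ∈ K) (v : XX P K) :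
    homot hK θ b (op (P.inA t) • v) = op (P.inA t) • homot hK θ b v := by
  have h1 : sigTot hK θ (op (P.inA t) • v) = op (P.inA t) • sigTot hK θ v :=
    (congrArg _ (appendOp_right hθ t ht v)).trans (pertEquiv_symm_right hK hθ ht _)
  have h2 : ∀ u, sigTotY hK θ (u * P.yA t) = op (P.inA t) • sigTotY hK θ u := fun u =>
    (congrArg _ (yLift_right θ hθ ht u)).trans (pertEquiv_symm_right hK hθ ht _)
  rw [homot_apply, homot_apply, h1, muOp_right, P.toYz_inA, P.yContr_mul_yA, h2, smul_sub]

end Linearity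

/-- The sum of the maps defined by the recursion `σ^l = -∑_{j<l} σ⁰ d^{l-j} σ^j`. -/
lemma sum_recursion {r s : ℕ} (W : ℕ → XX P K) (h0 : W 0 ∈ XB P K r s)
    (hW : ∀ l, 0 < l → W l = - ∑ j ∈ Finset.range l, appendOp P K θ (dMap hK (l - j) (W j))) :
    (∀ l ≤ s, W l ∈ XB P K (r + l) (s - l)) ∧
      pertEquiv hK θ (∑ l ∈ Finset.range (s + 1), W l) = W 0 := by
  have hmem : ∀ l ≤ s, W l ∈ XB P K (r + l) (s - l) := by
    intro l
    induction l using Nat.strong_induction_on with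
    | _ l ih =>
      intro hl
      rcases Nat.eq_zero_or_pos l with rfl | hl0
      · exact h0
      rw [hW l hl0]
      refine neg_mem (Submodule.sum_mem _ fun j hj => ?_)
      have hj := Finset.mem_range.1 hj
      have h := appendOp_mem_XB θ (dMap_mem_XB hK (l - j) _ _ (by omega) (ih j hj (by omega)))
      rwa [show r + j + (l - j) - 1 + 1 = r + l by omega, show s - j - (l - j) = s - l by omega] at h
  refine ⟨hmem, ?_⟩
  set u := ∑ l ∈ Finset.range (s + 1), W l with hu
  have h1 := Finset.sum_range_diag_flip (s + 1)
    (fun j m => appendOp P K θ (dMap hK m (W j)))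
  have h2 : ∑ j ∈ Finset.range (s + 1), ∑ m ∈ Finset.range (s + 1 - j),
      appendOp P K θ (dMap hK m (W j)) = appendOp P K θ (dTot hK u) := by
    rw [hu, map_sum, map_sum]
    refine Finset.sum_congr rfl fun j hj => ?_
    have hj := Finset.mem_range.1 hj
    rw [← map_sum, ← sum_range_dMap hK (hmem j (by omega)), show s + 1 - j = s - j + 1 by omega]
  have h3 : ∑ l ∈ Finset.range (s + 1), ∑ j ∈ Finset.range (l + 1),
      appendOp P K θ (dMap hK (l - j) (W j)) = W 0 - u + appendOp P K θ (dZero P K u) := by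
    have h4 : ∀ l, ∑ j ∈ Finset.range (l + 1), appendOp P K θ (dMap hK (l - j) (W j)) =
        (if l = 0 then W 0 else 0) - W l + appendOp P K θ (dZero P K (W l)) := by
      intro l
      rw [Finset.sum_range_succ, Nat.sub_self]
      congr 1
      rcases Nat.eq_zero_or_pos l with rfl | hl
      · simp
      · rw [if_neg hl.ne', hW l hl]
        simp
    rw [Finset.sum_congr rfl fun l _ => h4 l, Finset.sum_add_distrib, Finset.sum_sub_distrib,
      Finset.sum_ite_eq' , if_pos (Finset.mem_range.2 s.succ_pos), hu, map_sum, map_sum]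
  rw [h2, h3, dTot, LinearMap.add_apply, map_add] at h1
  rw [pertEquiv_apply]
  rw [← sub_eq_zero] at h1 ⊢
  rw [← neg_eq_zero, ← h1]
  abel

end Perturbation


/-! ### The total complex -/

section Total

variable {k A g I : Type*} [Field k] [Ring A] [Algebra k A] [LieRing g] [LieAlgebra k g]
  [LinearOrder I] {P : CrossedProduct k A g} {K : Subalgebra k A}

variable (P K) in
/-- The inclusion of `X_n` into the sum of all the `X_{rs}`. -/
def embTot (n : ℕ) : Tot P K n →ₗ[k] XX P K :=
  ∑ p : Finset.HasAntidiagonal.antidiagonal n, inX P K p.1.1 p.1.2 ∘ₗ LinearMap.proj p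

lemma embTot_apply {n : ℕ} (w : Tot P K n) :
    embTot P K n w = ∑ p : Finset.HasAntidiagonal.antidiagonal n, inX P K p.1.1 p.1.2 (w p) := by
  rw [embTot, LinearMap.sum_apply]
  rfl

lemma component_inX_self (p : ℕ × ℕ) (v : X P K p.1 p.2) :
    DirectSum.component k (ℕ × ℕ) (fun p => X P K p.1 p.2) p (inX P K p.1 p.2 v) = v :=
  DirectSum.component.lof_self k (M := fun p : ℕ × ℕ => X P K p.1 p.2) p v

lemma component_inX_ne {p q : ℕ × ℕ} (h : p ≠ q) (v : X P K p.1 p.2) :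
    DirectSum.component k (ℕ × ℕ) (fun p => X P K p.1 p.2) q (inX P K p.1 p.2 v) = 0 := by
  rw [inX, DirectSum.component.of, dif_neg h]

lemma toTot_apply {n : ℕ} (v : XX P K) (p : Finset.HasAntidiagonal.antidiagonal n) :
    toTot P K n v p = DirectSum.component k (ℕ × ℕ) (fun p => X P K p.1 p.2) p.1 v := rfl

lemma toTot_embTot {n : ℕ} (w : Tot P K n) : toTot P K n (embTot P K n w) = w := by
  funext p
  rw [embTot_apply, toTot_apply, map_sum, Finset.sum_eq_single p]
  · exact component_inX_self p.1 (w p)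
  · exact fun q _ hq => component_inX_ne (fun h => hq (Subtype.ext h)) _
  · exact fun h => absurd (Finset.mem_univ p) h

lemma embTot_left {n : ℕ} (c : P.Alg) (w : Tot P K n) :
    embTot P K n (c • w) = c • embTot P K n w := by
  simp only [embTot_apply, Finset.smul_sum, smul_inX]
  rfl

lemma embTot_right {n : ℕ} (c : P.Alg) (w : Tot P K n) :
    embTot P K n (op c • w) = op c • embTot P K n w := by
  simp only [embTot_apply, Finset.smul_sum, op_smul_inX]
  rfl

lemma toTot_left {n : ℕ} (c : P.Alg) (v : XX P K) : toTot P K n (c • v) = c • toTot P K n v := rfl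

lemma toTot_right {n : ℕ} (c : P.Alg) (v : XX P K) :
    toTot P K n (op c • v) = op c • toTot P K n v := rfl

variable (P K) in
/-- `X_n` as a subspace of the sum of all the `X_{rs}`. -/
def XT (n : ℕ) : Submodule k (XX P K) := LinearMap.range (embTot P K n)

lemma embTot_mem {n : ℕ} (w : Tot P K n) : embTot P K n w ∈ XT P K n := LinearMap.mem_range_self _ _

lemma XB_le_XT {r s n : ℕ} (h : r + s = n) : XB P K r s ≤ XT P K n := by
  rintro _ ⟨v, rfl⟩
  let p : Finset.HasAntidiagonal.antidiagonal n := ⟨(r, s), Finset.HasAntidiagonal.mem_antidiagonal.2 h⟩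
  refine ⟨Pi.single p v, ?_⟩
  rw [embTot_apply, Finset.sum_eq_single p]
  · rw [Pi.single_eq_same]
  · intro q _ hq
    rw [Pi.single_eq_of_ne hq, map_zero]
  · exact fun h => absurd (Finset.mem_univ p) h

lemma XT_le {n : ℕ} {Q : Submodule k (XX P K)} (h : ∀ r s, r + s = n → XB P K r s ≤ Q) :
    XT P K n ≤ Q := by
  rintro _ ⟨w, rfl⟩
  rw [embTot_apply]
  exact Submodule.sum_mem _ fun p _ =>
    h p.1.1 p.1.2 (Finset.HasAntidiagonal.mem_antidiagonal.1 p.2) (LinearMap.mem_range_self _ _)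

lemma embTot_toTot {n : ℕ} {v : XX P K} (hv : v ∈ XT P K n) : embTot P K n (toTot P K n v) = v := by
  obtain ⟨w, rfl⟩ := hv
  rw [toTot_embTot]

/-- A map defined on `X_n` through its components, and a map on the sum of all the `X_{rs}`. -/
lemma sum_comp_proj {N : Type*} [AddCommGroup N] [Module k N] {n : ℕ} (T : XX P K →ₗ[k] N)
    (F : ∀ p : Finset.HasAntidiagonal.antidiagonal n, X P K p.1.1 p.1.2 →ₗ[k] N)
    (hF : ∀ p v, F p v = T (inX P K p.1.1 p.1.2 v)) (w : Tot P K n) :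
    ∑ p, F p (w p) = T (embTot P K n w) := by
  rw [embTot_apply, map_sum]
  exact Finset.sum_congr rfl fun p _ => hF p _

variable (hK : P.Stable K) (θ : P.Section) (b : Module.Basis I k g)

lemma dTot_mem_XT {n : ℕ} {v : XX P K} (hv : v ∈ XT P K (n + 1)) : dTot hK v ∈ XT P K n := by
  refine XT_le (Q := (XT P K n).comap (dTot hK)) (fun r s h v hv => ?_) hv
  rw [Submodule.mem_comap, ← sum_range_dMap hK hv]
  refine Submodule.sum_mem _ fun l hl => ?_
  have hl := Finset.mem_range.1 hl
  by_cases h0 : r + l = 0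
  · obtain ⟨rfl, rfl⟩ : r = 0 ∧ l = 0 := by omega
    have : dMap hK 0 v = 0 := dZero_XB_zero hv
    exact this ▸ zero_mem _
  · exact XB_le_XT (by omega) (dMap_mem_XB hK l r s (by omega) hv)

lemma dTot_XT_zero {v : XX P K} (hv : v ∈ XT P K 0) : dTot hK v = 0 := by
  refine XT_le (Q := LinearMap.ker (dTot hK)) (fun r s h v hv => ?_) hv
  obtain ⟨rfl, rfl⟩ : r = 0 ∧ s = 0 := by omega
  rw [LinearMap.mem_ker, dTot, LinearMap.add_apply, dZero_XB_zero hv, dPlus_XB_zero hK hv, add_zero]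

lemma appendOp_mem_XT {n : ℕ} {v : XX P K} (hv : v ∈ XT P K n) :
    appendOp P K θ v ∈ XT P K (n + 1) :=
  XT_le (Q := (XT P K (n + 1)).comap (appendOp P K θ))
    (fun _ _ _ _ hv => XB_le_XT (by omega) (appendOp_mem_XB θ hv)) hv

lemma dPlus_mem_XT {n : ℕ} {v : XX P K} (hv : v ∈ XT P K (n + 1)) : dPlus hK v ∈ XT P K n := by
  have h : dPlus hK v = dTot hK v - dZero P K v := by
    rw [dTot, LinearMap.add_apply, add_sub_cancel_left]
  rw [h]
  refine sub_mem (dTot_mem_XT hK hv) ?_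
  refine XT_le (Q := (XT P K n).comap (dZero P K)) (fun r s h v hv => ?_) hv
  rw [Submodule.mem_comap]
  rcases Nat.eq_zero_or_pos r with rfl | hr
  · rw [dZero_XB_zero hv]
    exact zero_mem _
  · exact XB_le_XT (by omega) (dZero_mem_XB hv)

lemma pertEquiv_symm_mem_XT {n : ℕ} {v : XX P K} (hv : v ∈ XT P K n) :
    (pertEquiv hK θ).symm v ∈ XT P K n := by
  refine pertEquiv_symm_mem hK θ (fun v hv => ?_) hv
  rw [pert_apply]
  cases n with
  | zero =>
    have h : dPlus hK v = 0 := by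
      refine XT_le (Q := LinearMap.ker (dPlus hK)) (fun r s h v hv => ?_) hv
      obtain ⟨rfl, rfl⟩ : r = 0 ∧ s = 0 := by omega
      exact dPlus_XB_zero hK hv
    rw [h, map_zero]
    exact zero_mem _
  | succ n => exact appendOp_mem_XT θ (dPlus_mem_XT hK hv)

lemma muOp_mem_Ygr_XT {n : ℕ} {v : XX P K} (hv : v ∈ XT P K n) : muOp P K v ∈ P.Ygr n := by
  refine XT_le (Q := (P.Ygr n).comap (muOp P K)) (fun r s h v hv => ?_) hv
  rw [Submodule.mem_comap]
  cases r with
  | zero => rw [← h, zero_add]; exact muOp_mem_Ygr hv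
  | succ r => rw [muOp_XB_succ hv]; exact zero_mem _

lemma homot_mem_XT {n : ℕ} {v : XX P K} (hv : v ∈ XT P K n) : homot hK θ b v ∈ XT P K (n + 1) :=
  sub_mem (pertEquiv_symm_mem_XT hK θ (appendOp_mem_XT θ hv))
    (pertEquiv_symm_mem_XT hK θ (XB_le_XT (zero_add _)
      (yLift_mem_XB θ (P.yContr_mem_Ygr b (muOp_mem_Ygr_XT hv)))))

variable (P K) in
/-- The augmentation of the total complex. -/
def augTot : Tot P K 0 →ₗ[k] P.Alg := P.yAug.toLinearMap ∘ₗ muOp P K ∘ₗ embTot P K 0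

/-- The homotopy given by the section `θ` is a contraction of the total complex by left linear
maps. -/
lemma isContraction_homot (ε : Tot P K 0 →ₗ[k] P.Alg) (d : ∀ n, Tot P K (n + 1) →ₗ[k] Tot P K n)
    (σ₀ : P.Alg →ₗ[k] Tot P K 0) (σ : ∀ n, Tot P K n →ₗ[k] Tot P K (n + 1))
    (hε : ε = augTot P K) (hd : ∀ n, d n = toTot P K n ∘ₗ dTot hK ∘ₗ embTot P K (n + 1))
    (hσ₀ : σ₀ = toTot P K 0 ∘ₗ yLift K θ ∘ₗ P.toYy.toLinearMap)
    (hσ : ∀ n, σ n = toTot P K (n + 1) ∘ₗ homot hK θ b ∘ₗ embTot P K n) :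
    IsContraction P (C := Tot P K) ε d σ₀ σ := by
  have hL : ∀ c : P.Alg, yLift K θ (P.toYy c) ∈ XT P K 0 := fun c =>
    XB_le_XT (zero_add 0) (yLift_mem_XB θ (P.toYy_mem_Ygr c))
  have key : ∀ n (w : Tot P K n), dTot hK (homot hK θ b (embTot P K n w)) +
      homot hK θ b (dTot hK (embTot P K n w)) =
      embTot P K n w - yLift K θ (P.toYy (P.yAug (muOp P K (embTot P K n w)))) :=
    fun n w => dTot_homot hK θ b _
  refine ⟨?_, ?_, fun n => ?_⟩
  · subst hε hσ₀
    refine LinearMap.ext fun c => ?_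
    change P.yAug (muOp P K (embTot P K 0 (toTot P K 0 (yLift K θ (P.toYy c))))) = c
    rw [embTot_toTot (hL c), muOp_yLift, P.yAug_toYy]
  · refine LinearMap.ext fun w => ?_
    rw [LinearMap.add_apply, LinearMap.comp_apply, LinearMap.comp_apply, hε, hσ₀, hd, hσ]
    change toTot P K 0 (yLift K θ (P.toYy (P.yAug (muOp P K (embTot P K 0 w))))) +
      toTot P K 0 (dTot hK (embTot P K 1 (toTot P K 1 (homot hK θ b (embTot P K 0 w))))) = w
    have h := key 0 w
    rw [dTot_XT_zero hK (embTot_mem w), map_zero, add_zero] at h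
    rw [embTot_toTot (homot_mem_XT hK θ b (embTot_mem w)), h, map_sub, toTot_embTot, add_sub_cancel]
  · refine LinearMap.ext fun w => ?_
    rw [LinearMap.add_apply, LinearMap.comp_apply, LinearMap.comp_apply, hd, hd, hσ, hσ]
    change toTot P K (n + 1) (homot hK θ b (embTot P K n (toTot P K n
        (dTot hK (embTot P K (n + 1) w))))) + toTot P K (n + 1) (dTot hK (embTot P K (n + 2)
        (toTot P K (n + 2) (homot hK θ b (embTot P K (n + 1) w))))) = w
    have h := key (n + 1) w
    rw [P.yAug_Ygr_succ (muOp_mem_Ygr_XT (embTot_mem w)), map_zero, map_zero, sub_zero] at h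
    rw [embTot_toTot (homot_mem_XT hK θ b (embTot_mem w)),
      embTot_toTot (dTot_mem_XT hK (embTot_mem w)), ← map_add, add_comm (homot _ _ _ _), h,
      toTot_embTot]

end Total


/-! ### Relative projectivity -/

section Projectivity

variable {k A g I : Type*} [Field k] [Ring A] [Algebra k A] [LieRing g] [LieAlgebra k g]
  [LinearOrder I] {P : CrossedProduct k A g} {K : Subalgebra k A}

/-- A right `K`-linear map on `X_{rs}` may be changed to a right `E`-linear one with the same values
at the elements with last factor `1`. -/
lemma X.exists_lift_right {r s : ℕ} {N : Type*} [AddCommGroup N] [Module k N]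
    [Module P.Algᵐᵒᵖ N] [IsScalarTower k P.Algᵐᵒᵖ N] (G : X P K r s →ₗ[k] N)
    (hG : IsRightKLin P K G) :
    ∃ T : X P K r s →ₗ[k] N, ∀ c x a c',
      T (X.mk P K c x a c') = op c' • G (X.mk P K c x a 1) := by
  let ρ : N →ₗ[k] P.Alg →ₗ[k] N := LinearMap.mk₂ k (fun n c' => op c' • n)
    (fun n n' c => smul_add _ _ _) (fun t n c => smul_comm _ _ _)
    (fun n c c' => by rw [op_add, add_smul]) (fun t n c => by rw [op_smul, smul_assoc])
  let F : PreX P r s →ₗ[k] N :=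
    TensorProduct.lift (ρ ∘ₗ G ∘ₗ X.proj P K r s ∘ₗ LinearMap.lTensor P.Alg
      (LinearMap.lTensor (⋀[k]^s g) ((TensorProduct.mk k (⨂[k]^r A) P.Alg).flip 1))) ∘ₗ
    (TensorProduct.assoc k P.Alg ((⋀[k]^s g) ⊗[k] (⨂[k]^r A)) P.Alg).symm.toLinearMap ∘ₗ
    LinearMap.lTensor P.Alg
      (TensorProduct.assoc k (⋀[k]^s g) (⨂[k]^r A) P.Alg).symm.toLinearMap
  have hF : ∀ c x a c', F (preMk P c x a c') = op c' • G (X.mk P K c x a 1) := fun c x a c' => by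
    simp only [F, preMk, LinearMap.comp_apply, LinearMap.lTensor_tmul, LinearEquiv.coe_coe,
      TensorProduct.assoc_symm_tmul, TensorProduct.lift.tmul]
    rfl
  obtain ⟨T, hT⟩ := X.exists_desc P K F (fun i t c x a c' ht => by
    rw [hF, hF, X.mk_balanced P K i ht]
    split_ifs
    · have h := hG t ht (X.mk P K c x (fun j => if j.1 = i.1 then t * a j else a j) 1)
      rw [X.op_smul_mk, one_mul] at h
      rw [mul_one, h, op_mul, mul_smul]
    · rfl) (fun j c x a c' ha => by rw [hF, X.mk_eq_zero P K _ _ _ ha, map_zero, smul_zero])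
  exact ⟨T, fun c x a c' => by rw [hT, hF]⟩

lemma X.mk_eq {r s : ℕ} (c : P.Alg) (x : Fin s → g) (a : Fin r → A) (c' : P.Alg) :
    X.mk P K c x a c' = op c' • X.mk P K c x a 1 := by
  rw [X.op_smul_mk, one_mul]

end Projectivity

/-- The bimodules `X_{rs}` are relatively projective. -/
lemma X.relProjective {k : Type u₀} {A : Type u₁} {g : Type u₂} [Field k] [Ring A] [Algebra k A]
    [LieRing g] [LieAlgebra k g] (P : CrossedProduct k A g) (K : Subalgebra k A) (r s : ℕ) :
    RelProjective.{w₁, w₂} P K (X P K r s) := by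
  intro M N _ _ _ _ _ _ _ _ _ _ _ _ _ _ π hπl hπr ⟨τ, hτl, hτr, hπτ⟩ φ hφl hφr
  obtain ⟨ψ, hψ⟩ := X.exists_lift_right (τ ∘ₗ φ) (fun t ht m => by
    rw [LinearMap.comp_apply, hφr, hτr t ht, LinearMap.comp_apply])
  refine ⟨ψ, fun c m => ?_, fun c m => ?_, X.hom_ext fun c x a c' => ?_⟩
  · induction m using X.induction with
    | mk d x a c' =>
      rw [X.smul_mk, hψ, hψ, ← X.smul_mk, LinearMap.comp_apply, hφl, hτl]
      exact (smul_comm c (op c') _).symm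
    | add u v hu hv => rw [smul_add, map_add, hu, hv, map_add, smul_add]
    | smul t u hu => rw [smul_comm, map_smul, hu, map_smul, smul_comm]
  · induction m using X.induction with
    | mk d x a c' => rw [X.op_smul_mk, hψ, hψ, op_mul, mul_smul]
    | add u v hu hv => rw [smul_add, map_add, hu, hv, map_add, smul_add]
    | smul t u hu => rw [smul_comm, map_smul, hu, map_smul, smul_comm]
  · rw [LinearMap.comp_apply, hψ, hπr, X.mk_eq c x a c', hφr]
    congr 1
    exact LinearMap.congr_fun hπτ _

/-- A finite product of relatively projective bimodules is relatively projective. -/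
lemma RelProjective.pi {k : Type u₀} {A : Type u₁} {g : Type u₂} [Field k] [Ring A] [Algebra k A]
    [LieRing g] [LieAlgebra k g] {P : CrossedProduct k A g} {K : Subalgebra k A}
    {ι : Type} [Fintype ι] {C : ι → Type u₃} [∀ i, AddCommGroup (C i)] [∀ i, Module k (C i)]
    [∀ i, Module P.Alg (C i)] [∀ i, Module P.Algᵐᵒᵖ (C i)]
    (h : ∀ i, RelProjective.{w₁, w₂} P K (C i)) : RelProjective.{w₁, w₂} P K (∀ i, C i) := by
  classical
  intro M N _ _ _ _ _ _ _ _ _ _ _ _ _ _ π hπl hπr hτ φ hφl hφr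
  choose ψ hl hr hψ using fun i => h i M N π hπl hπr hτ (φ ∘ₗ LinearMap.single k C i)
    (fun c m => by
      rw [LinearMap.comp_apply, LinearMap.single_apply, Pi.single_smul, hφl]
      rfl)
    (fun c m => by
      rw [LinearMap.comp_apply, LinearMap.single_apply, Pi.single_smul, hφr]
      rfl)
  refine ⟨∑ i, ψ i ∘ₗ LinearMap.proj i, fun c m => ?_, fun c m => ?_, LinearMap.ext fun m => ?_⟩
  · simp only [LinearMap.sum_apply, Finset.smul_sum]
    exact Finset.sum_congr rfl fun i _ => hl i c (m i)
  · simp only [LinearMap.sum_apply, Finset.smul_sum]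
    exact Finset.sum_congr rfl fun i _ => hr i c (m i)
  · rw [LinearMap.comp_apply, LinearMap.sum_apply, map_sum]
    refine (Finset.sum_congr rfl fun i _ => LinearMap.congr_fun (hψ i) (m i)).trans ?_
    simp only [LinearMap.comp_apply]
    rw [← map_sum]
    exact congrArg φ (LinearMap.sum_single_apply C m)


/-! ### The maps of the resolution -/

section StandardMaps

variable {k A g I : Type*} [Field k] [Ring A] [Algebra k A] [LieRing g] [LieAlgebra k g]
  [LinearOrder I] {P : CrossedProduct k A g} {K : Subalgebra k A}

lemma appendOp_elt_sharp {r s : ℕ} (c : P.Alg) (x : Fin s → g) (a : Fin r → A) (a' : A) (w : U k g) :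
    appendOp P K P.stdSection (elt P K c x a (P.sharp a' w)) =
      (-1 : k) ^ (r + s + 1) • elt P K c x (Fin.snoc a a' : Fin (r + 1) → A) (P.inU w) := by
  rw [P.sharp_eq]
  exact appendOp_elt P K P.stdSection c x a a' w

/-- On `X_{0s}` the map `d¹` is determined by `∂`. -/
lemma dOne_elt_zero (hK : P.Stable K) (s : ℕ) (x : Fin s → g) (a : Fin 0 → A) (hs : 1 ≤ s) :
    dOne hK (elt P K 1 x a 1) =
      - yLift K P.stdSection (P.yDel (muOp P K (elt P K 1 x a 1))) := by
  obtain ⟨s, rfl⟩ := Nat.exists_eq_add_of_le' hs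
  have h := dZero_appendOp P.stdSection (dOne hK (elt P K 1 x a 1))
  rw [dZero_XB_zero (dOne_mem_XB hK (elt_mem_XB _ _ _ _)), appendOp_dOne hK (elt_mem_X1 _ _ _),
    map_zero, map_zero, sub_zero, ← yLift_muOp, muOp_dOne, map_neg] at h
  exact (sub_eq_zero.1 h.symm)

/-- For `r > 0` or `l > 1` the map `d^l` on `X_{rs}` satisfies the recursion. -/
lemma dMap_elt (hK : P.Stable K) {l r s : ℕ} (hl : 0 < l) (hls : l ≤ s) (hr : 1 < r + l)
    (x : Fin s → g) (a : Fin r → A) : dMap hK l (elt P K 1 x a 1) =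
      - ∑ j ∈ Finset.range l,
        appendOp P K P.stdSection (dMap hK (l - j) (dMap hK j (elt P K 1 x a 1))) := by
  refine dMap_eq hK hl (elt_mem_X1 _ _ _) ?_
  have h := dMap_mem_XB hK l r s hls (elt_mem_XB (1 : P.Alg) x a 1)
  rw [show r + l - 1 = r + l - 2 + 1 by omega] at h
  exact collapseOp_XB_succ _ h

/-- The maps of the resolution: restrictions of operators on the sum of all the `X_{rs}`, and of
maps between this sum and `Y_*`. -/
def stdMaps (hK : P.Stable K) (b : Module.Basis I k g) : Maps P K b where
  iotaY := P.toYy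
  iotaY_A := P.toYy_inA
  iotaY_G := P.toYy_inG
  iotaZ := P.toYz
  iotaZ_A := P.toYz_inA
  iotaZ_G := P.toYz_inG
  del := P.yDel
  del_zero _ hv := P.yDel_Ygr_zero hv
  del_mem _ _ hv := P.yDel_mem_Ygr hv
  del_mul _ _ hv w := P.yDel_mul hv w
  del_e := P.yDel_ye
  sigmaNeg := P.yContr b
  sigmaNeg_left := P.yContr_left b
  sigmaNeg_one := by
    have h := P.yContr_rhoWord b CrossedProduct.isAdmissible_nil
    have h0 : P.rhoWord b ([] : List (I × ℕ × Bool)) = 1 := rfl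
    rwa [h0] at h
  sigmaNeg_zero i m L hL := P.yContr_rhoWord b hL
  sigmaNeg_succ i m L hL := (P.yContr_rhoWord b hL).trans (by cases m <;> rfl)
  aug := P.yAug.toLinearMap ∘ₗ muOp P K ∘ₗ inX P K 0 0
  aug_mk c x a c' := by
    change P.yAug (muOp P K (elt P K c x a c')) = _
    rw [muOp_elt, P.eProd_zero, mul_one, map_mul, P.yAug_toYy, P.yAug_toYz]
  mu s := muOp P K ∘ₗ inX P K 0 s
  mu_mk s c x a c' := muOp_elt c x a c'
  sigmaY₀ := yLift K P.stdSection
  sigmaY₀_left := yLift_left P.stdSection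
  sigmaY₀_prod := yLift_prod
  sigmaX₀ := appendOp P K P.stdSection
  sigmaX₀_left := appendOp_left P.stdSection
  sigmaX₀_elt r s x a a' w := appendOp_elt_sharp 1 x a a' w
  d := dMap hK
  d_left l := (dMap_bimod hK l).left
  d_right l := (dMap_bimod hK l).right
  d_big l r s x a h := dMap_of_degree_lt hK h (elt_mem_XB _ _ _ _)
  d_zero_zero s x a := dZero_elt_zero 1 x a 1
  d_zero_succ := dZero_elt
  d_one_zero := dOne_elt_zero hK
  d_one_succ r s x a hs := by
    rw [dMap_elt hK one_pos hs (by omega), Finset.sum_range_one, Nat.sub_zero]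
  d_zero l s x a hl hls := by
    rw [dMap_elt hK (by omega) hls (by omega), Finset.range_eq_Ico,
      Finset.sum_eq_sum_Ico_succ_bot (by omega : 0 < l),
      show dMap hK 0 (elt P K 1 x a 1) = 0 from dZero_elt_zero 1 x a 1, map_zero, map_zero, zero_add]
  d_succ l r s x a hl hls := dMap_elt hK (by omega) hls (by omega) x a

variable (hK : P.Stable K) (b : Module.Basis I k g)

/-- The maps `σ^l` on `Y_*` in terms of the operators. -/
lemma stdMaps_sigmaY {l : ℕ} (hl : 0 < l) (v : P.Y) : (stdMaps hK b).sigmaY l v =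
    - ∑ j ∈ Finset.range l,
      appendOp P K P.stdSection (dMap hK (l - j) ((stdMaps hK b).sigmaY j v)) := by
  rw [Maps.sigmaY, if_neg hl.ne', LinearMap.neg_apply, LinearMap.sum_apply, Finset.sum_range]
  rfl

lemma stdMaps_sigmaX {l : ℕ} (hl : 0 < l) (v : XX P K) : (stdMaps hK b).sigmaX l v =
    - ∑ j ∈ Finset.range l,
      appendOp P K P.stdSection (dMap hK (l - j) ((stdMaps hK b).sigmaX j v)) := by
  rw [Maps.sigmaX, if_neg hl.ne', LinearMap.neg_apply, LinearMap.sum_apply, Finset.sum_range]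
  rfl

lemma stdMaps_sigmaY_zero : (stdMaps hK b).sigmaY 0 = yLift K P.stdSection := by
  rw [Maps.sigmaY, if_pos rfl]
  rfl

lemma stdMaps_sigmaX_zero : (stdMaps hK b).sigmaX 0 = appendOp P K P.stdSection := by
  rw [Maps.sigmaX, if_pos rfl]
  rfl

lemma stdMaps_sum_sigmaY {s : ℕ} {v : P.Y} (hv : v ∈ P.Ygr s) :
    (∀ l ≤ s, (stdMaps hK b).sigmaY l v ∈ XB P K (0 + l) (s - l)) ∧
      ∑ l ∈ Finset.range (s + 1), (stdMaps hK b).sigmaY l v = sigTotY hK P.stdSection v := by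
  obtain ⟨h1, h2⟩ := sum_recursion hK P.stdSection (fun l => (stdMaps hK b).sigmaY l v)
    (by rw [stdMaps_sigmaY_zero]; exact yLift_mem_XB _ hv) (fun l hl => stdMaps_sigmaY hK b hl v)
  rw [stdMaps_sigmaY_zero] at h2
  exact ⟨h1, ((pertEquiv hK P.stdSection).symm_apply_eq.2 h2.symm).symm⟩

lemma stdMaps_sum_sigmaX {r s : ℕ} {v : XX P K} (hv : v ∈ XB P K r s) :
    (∀ l ≤ s, (stdMaps hK b).sigmaX l v ∈ XB P K (r + 1 + l) (s - l)) ∧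
      ∑ l ∈ Finset.range (s + 1), (stdMaps hK b).sigmaX l v = sigTot hK P.stdSection v := by
  obtain ⟨h1, h2⟩ := sum_recursion hK P.stdSection (fun l => (stdMaps hK b).sigmaX l v)
    (by rw [stdMaps_sigmaX_zero]; exact appendOp_mem_XB _ hv) (fun l hl => stdMaps_sigmaX hK b hl v)
  rw [stdMaps_sigmaX_zero] at h2
  exact ⟨h1, ((pertEquiv hK P.stdSection).symm_apply_eq.2 h2.symm).symm⟩

lemma stdMaps_homogeneous : (stdMaps hK b).Homogeneous where
  iotaY_mem := P.toYy_mem_Ygr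
  sigmaNeg_mem s v hv := P.yContr_mem_Ygr b hv
  mu_mem s v := muOp_mem_Ygr (LinearMap.mem_range_self _ v)
  sigmaY_mem l s hl v hv := by
    have h := (stdMaps_sum_sigmaY hK b hv).1 l hl
    rwa [zero_add] at h
  sigmaX_mem l r s hl v := by
    have h := (stdMaps_sum_sigmaX hK b (LinearMap.mem_range_self (inX P K r s) v)).1 l hl
    rwa [add_right_comm] at h
  d_mem l r s hl _ v := dMap_mem_XB hK l r s hl (LinearMap.mem_range_self _ v)

lemma muOp_embTot {n : ℕ} (w : Tot P K n) : muOp P K (embTot P K n w) =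
    muOp P K (inX P K 0 n (w ⟨(0, n), by simp⟩)) := by
  rw [embTot_apply, map_sum]
  refine Finset.sum_eq_single (⟨(0, n), by simp⟩ : Finset.HasAntidiagonal.antidiagonal n)
    (fun q _ hq => ?_) (fun h => absurd (Finset.mem_univ _) h)
  have h := Finset.HasAntidiagonal.mem_antidiagonal.1 q.2
  obtain ⟨⟨r, s⟩, hq'⟩ := q
  cases r with
  | zero =>
    obtain rfl : s = n := by simpa using h
    exact absurd rfl hq
  | succ r => exact muOp_XB_succ (LinearMap.mem_range_self _ _)

lemma stdMaps_totAug : (stdMaps hK b).totAug = augTot P K :=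
  LinearMap.ext fun w => (congrArg P.yAug (muOp_embTot w)).symm

lemma stdMaps_totD (n : ℕ) :
    (stdMaps hK b).totD n = toTot P K n ∘ₗ dTot hK ∘ₗ embTot P K (n + 1) := by
  refine LinearMap.ext fun w => ?_
  rw [Maps.totD, LinearMap.sum_apply]
  refine sum_comp_proj (toTot P K n ∘ₗ dTot hK) (fun p => ∑ l ∈ Finset.range (p.1.2 + 1),
    toTot P K n ∘ₗ dMap hK l ∘ₗ inX P K p.1.1 p.1.2) (fun p v => ?_) w |>.symm.trans ?_ |>.symm
  · rw [LinearMap.comp_apply, ← sum_range_dMap hK (LinearMap.mem_range_self _ v), map_sum,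
      LinearMap.sum_apply]
    rfl
  · simp only [LinearMap.sum_apply]
    rfl

lemma stdMaps_totSigmaZero : (stdMaps hK b).totSigmaZero =
    toTot P K 0 ∘ₗ yLift K P.stdSection ∘ₗ P.toYy.toLinearMap := rfl

lemma stdMaps_totSigma (n : ℕ) : (stdMaps hK b).totSigma n =
    toTot P K (n + 1) ∘ₗ homot hK P.stdSection b ∘ₗ embTot P K n := by
  refine LinearMap.ext fun w => ?_
  have h1 : (stdMaps hK b).mu n (w ⟨(0, n), by simp⟩) = muOp P K (embTot P K n w) :=
    (muOp_embTot w).symm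
  have h2 : P.yContr b (muOp P K (embTot P K n w)) ∈ P.Ygr (n + 1) :=
    P.yContr_mem_Ygr b (muOp_mem_Ygr_XT (embTot_mem w))
  rw [Maps.totSigma, LinearMap.add_apply, LinearMap.neg_apply, LinearMap.sum_apply,
    LinearMap.sum_apply, LinearMap.comp_apply, LinearMap.comp_apply, homot_apply,
    ← (stdMaps_sum_sigmaY hK b h2).2, ← h1, map_sub, sub_eq_neg_add, map_sum]
  congr 1
  refine sum_comp_proj (toTot P K (n + 1) ∘ₗ sigTot hK P.stdSection)
    (fun p => ∑ l ∈ Finset.range (p.1.2 + 1),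
    toTot P K (n + 1) ∘ₗ (stdMaps hK b).sigmaX l ∘ₗ inX P K p.1.1 p.1.2) (fun p v => ?_) w
      |>.symm.trans ?_ |>.symm
  · rw [LinearMap.comp_apply,
      ← (stdMaps_sum_sigmaX hK b (LinearMap.mem_range_self (inX P K p.1.1 p.1.2) v)).2, map_sum,
      LinearMap.sum_apply]
    rfl
  · simp only [LinearMap.sum_apply]
    rfl

end StandardMaps


/-! ### Uniqueness of the maps -/

section Uniqueness

variable {k A g I : Type*} [Field k] [Ring A] [Algebra k A] [LieRing g] [LieAlgebra k g]
  [LinearOrder I] {P : CrossedProduct k A g} {K : Subalgebra k A} {b : Module.Basis I k g}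

namespace Maps

variable (M M' : Maps P K b)

lemma iotaY_eq : M.iotaY = P.toYy :=
  P.algHom_ext b (fun a => (M.iotaY_A a).trans (P.toYy_inA a).symm)
    (fun x => (M.iotaY_G x).trans (P.toYy_inG x).symm)

lemma iotaZ_eq : M.iotaZ = P.toYz :=
  P.algHom_ext b (fun a => (M.iotaZ_A a).trans (P.toYz_inA a).symm)
    (fun x => (M.iotaZ_G x).trans (P.toYz_inG x).symm)

lemma del_eq : M.del = M'.del := by
  refine P.Ygr_hom_ext fun s v hv => ?_
  refine CrossedProduct.Ygr_le (Q := fun _ => LinearMap.eqLocus M.del M'.del) ?_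
    (fun t w hw h x => ?_) s hv
  · exact (M.del_zero 1 P.one_mem_Ygr).trans (M'.del_zero 1 P.one_mem_Ygr).symm
  · have hx : M.del (P.yGen x) = M'.del (P.yGen x) := by
      cases x with
      | a a => exact (M.del_zero _ (P.yA_mem_Ygr a)).trans (M'.del_zero _ (P.yA_mem_Ygr a)).symm
      | y x => exact (M.del_zero _ (P.yy_mem_Ygr x)).trans (M'.del_zero _ (P.yy_mem_Ygr x)).symm
      | z x => exact (M.del_zero _ (P.yz_mem_Ygr x)).trans (M'.del_zero _ (P.yz_mem_Ygr x)).symm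
      | e x => exact (M.del_e x).trans (M'.del_e x).symm
    change M.del _ = M'.del _
    rw [M.del_mul t w hw, M'.del_mul t w hw, hx, show M.del w = M'.del w from h]

lemma sigmaNeg_eq : M.sigmaNeg = M'.sigmaNeg := by
  refine LinearMap.ext fun v => ?_
  induction v using P.word_induction b with
  | add u v hu hv => rw [map_add, map_add, hu, hv]
  | word c L hL =>
    have h : ∀ N : Maps P K b, N.sigmaNeg (P.toYy c * P.rhoWord b L) =
        P.toYy c * P.nextWord b L := by
      intro N
      rw [← N.iotaY_eq, N.sigmaNeg_left]
      congr 1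
      rcases L with _ | ⟨⟨i, m, _ | _⟩, L⟩
      · exact N.sigmaNeg_one
      · cases m with
        | zero => simpa using hL.2 _ List.mem_cons_self
        | succ m => exact N.sigmaNeg_zero i m L hL
      · rw [N.sigmaNeg_succ i m L hL]
        cases m <;> rfl
    rw [h, h]

lemma aug_eq : M.aug = M'.aug :=
  X.hom_ext fun c x a c' => (M.aug_mk c x a c').trans (M'.aug_mk c x a c').symm

lemma mu_eq : M.mu = M'.mu :=
  funext fun s => X.hom_ext fun c x a c' => by
    rw [M.mu_mk, M'.mu_mk, iotaY_eq, iotaY_eq, iotaZ_eq, iotaZ_eq]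

lemma exists_sum_sharp (c : P.Alg) :
    ∃ W : List (A × U k g), (W.map fun w => P.sharp w.1 w.2).sum = c := by
  induction c using P.Alg_induction with
  | sharp a h => exact ⟨[(a, h)], by simp⟩
  | add u v hu hv =>
    obtain ⟨W, rfl⟩ := hu
    obtain ⟨W', rfl⟩ := hv
    exact ⟨W ++ W', by simp⟩

lemma sigmaY₀_eq : M.sigmaY₀ = M'.sigmaY₀ := by
  have key : ∀ c s (x : Fin s → g) c', M.sigmaY₀ (P.toYy c * P.eProd x * P.toYz c') =
      M'.sigmaY₀ (P.toYy c * P.eProd x * P.toYz c') := by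
    intro c s x c'
    obtain ⟨v, rfl⟩ := (P.prodMap_bijective b).surjective c'
    induction v using Finsupp.induction_linear with
    | zero => rw [map_zero, map_zero, mul_zero, map_zero, map_zero]
    | add u v hu hv => rw [map_add, map_add, mul_add, map_add, map_add, hu, hv]
    | single S a =>
      obtain ⟨W, hW⟩ := exists_sum_sharp (((((S.sort (· ≤ ·)).map b)).map P.inG).prod)
      have h1 : P.toYy c * P.eProd x * P.toYz (prodMap P.inAHom (fun i => P.inG (b i))
          (Finsupp.single S a)) =
          P.toYy (c * P.inA a) * (P.eProd x * (((S.sort (· ≤ ·)).map b).map P.yz).prod) := by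
        have h2 : P.toYz (sortedProd (fun i => P.inG (b i)) S) =
            (((S.sort (· ≤ ·)).map b).map P.yz).prod := by
          rw [sortedProd, map_list_prod, List.map_map, List.map_map]
          congr 2
          funext i
          exact P.toYz_inG (b i)
        rw [prodMap_single, map_mul, h2, CrossedProduct.inAHom_apply, P.toYz_inA, mul_assoc,
          ← mul_assoc (P.eProd x), ← P.toYz_inA, P.eProd_mul_toYz, P.toYz_inA, ← P.toYy_inA,
          map_mul, mul_assoc, mul_assoc]
      rw [h1, ← M.iotaY_eq, M.sigmaY₀_left, M.iotaY_eq, ← M'.iotaY_eq, M'.sigmaY₀_left,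
        M.sigmaY₀_prod s x _ W hW, M'.sigmaY₀_prod s x _ W hW]
  refine LinearMap.ext fun v => ?_
  rw [← P.muOp_toX v]
  refine LinearMap.congr_fun (f := M.sigmaY₀ ∘ₗ muOp P ⊤) (g := M'.sigmaY₀ ∘ₗ muOp P ⊤)
    (XX.hom_ext fun r s c x a c' => ?_) (P.toX v)
  rw [LinearMap.comp_apply, LinearMap.comp_apply]
  cases r with
  | zero => rw [muOp_elt, key]
  | succ r => rw [muOp_elt_succ, map_zero, map_zero]

lemma sigmaX₀_eq : M.sigmaX₀ = M'.sigmaX₀ := by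
  refine XX.hom_ext fun r s c x a c' => ?_
  induction c' using P.Alg_induction with
  | sharp a' w =>
    have h : elt P K c x a (P.sharp a' w) = c • elt P K 1 x a (P.sharp a' w) := by
      rw [smul_elt, mul_one]
    rw [h, M.sigmaX₀_left, M'.sigmaX₀_left, M.sigmaX₀_elt, M'.sigmaX₀_elt]
  | add u v hu hv => rw [elt_add_right, map_add, map_add, hu, hv]

lemma d_ext {l : ℕ} (h : ∀ r s (x : Fin s → g) (a : Fin r → A),
    M.d l (elt P K 1 x a 1) = M'.d l (elt P K 1 x a 1)) : M.d l = M'.d l :=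
  XX.hom_ext fun r s c x a c' => by
    rw [elt_eq, M.d_left, M.d_right, M'.d_left, M'.d_right, h]

lemma d_zero_eq : M.d 0 = dZero P K := by
  refine XX.hom_ext fun r s c x a c' => ?_
  rw [elt_eq, M.d_left, M.d_right, dZero_bimod.left, dZero_bimod.right]
  cases r with
  | zero => rw [M.d_zero_zero, dZero_elt_zero]
  | succ r => rw [M.d_zero_succ, dZero_elt]

lemma d_eq : M.d = M'.d := by
  funext l
  induction l using Nat.strong_induction_on with
  | _ l ih =>
    rcases Nat.eq_zero_or_pos l with rfl | hl
    · rw [d_zero_eq, d_zero_eq]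
    suffices h : ∀ r s, ∀ v ∈ XB P K r s, M.d l v = M'.d l v from
      d_ext M M' fun r s x a => h r s _ (elt_mem_XB _ _ _ _)
    have hred : ∀ r s, (∀ (x : Fin s → g) (a : Fin r → A),
        M.d l (elt P K 1 x a 1) = M'.d l (elt P K 1 x a 1)) →
        ∀ v ∈ XB P K r s, M.d l v = M'.d l v := fun r s h v hv =>
      XB_ext (fun c x a c' => by
        rw [elt_eq, M.d_left, M.d_right, M'.d_left, M'.d_right, h]) hv
    intro r
    induction r with
    | zero =>
      refine fun s => hred 0 s fun x a => ?_
      rcases lt_or_ge s l with hs | hs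
      · rw [M.d_big _ _ _ _ _ hs, M'.d_big _ _ _ _ _ hs]
      rcases Nat.eq_or_lt_of_le hl with rfl | hl1
      · rw [M.d_one_zero _ _ _ hs, M'.d_one_zero _ _ _ hs, sigmaY₀_eq M M', del_eq M M', mu_eq M M']
      · rw [M.d_zero l s x a hl1 hs, M'.d_zero l s x a hl1 hs]
        refine congrArg _ (Finset.sum_congr rfl fun j hj => ?_)
        have hj := Finset.mem_Ico.1 hj
        rw [ih j hj.2, ih (l - j) (by omega), sigmaX₀_eq M M']
    | succ r ihr =>
      refine fun s => hred (r + 1) s fun x a => ?_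
      rcases lt_or_ge s l with hs | hs
      · rw [M.d_big _ _ _ _ _ hs, M'.d_big _ _ _ _ _ hs]
      have h0 : M.d l (M.d 0 (elt P K 1 x a 1)) = M'.d l (M'.d 0 (elt P K 1 x a 1)) := by
        rw [d_zero_eq, d_zero_eq]
        have h := dZero_mem_XB (elt_mem_XB (K := K) (1 : P.Alg) x a 1)
        rw [Nat.add_sub_cancel] at h
        exact ihr s _ h
      rcases Nat.eq_or_lt_of_le hl with rfl | hl1
      · rw [M.d_one_succ _ _ _ _ hs, M'.d_one_succ _ _ _ _ hs, h0, sigmaX₀_eq M M']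
      · rw [M.d_succ l r s x a hl1 hs, M'.d_succ l r s x a hl1 hs]
        refine congrArg _ (Finset.sum_congr rfl fun j hj => ?_)
        rcases Nat.eq_zero_or_pos j with rfl | hj0
        · rw [Nat.sub_zero, h0, sigmaX₀_eq M M']
        · rw [ih j (Finset.mem_range.1 hj), ih (l - j) (by omega), sigmaX₀_eq M M']

/-- The properties fix each map on generators of a left module or a bimodule; the values of the maps
`d^l` and `σ^l` there are fixed by recursion on `l`. -/
lemma eq_of_maps : M = M' := by
  have h1 := M.iotaY_eq.trans M'.iotaY_eq.symm
  have h2 := M.iotaZ_eq.trans M'.iotaZ_eq.symm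
  have h3 := del_eq M M'
  have h4 := sigmaNeg_eq M M'
  have h5 := aug_eq M M'
  have h6 := mu_eq M M'
  have h7 := sigmaY₀_eq M M'
  have h8 := sigmaX₀_eq M M'
  have h9 := d_eq M M'
  cases M
  cases M'
  simp only at h1 h2 h3 h4 h5 h6 h7 h8 h9
  subst h1 h2 h3 h4 h5 h6 h7 h8 h9
  rfl

end Maps

end Uniqueness


/-! ### The resolution -/

section Linear

variable {k A g I : Type*} [Field k] [Ring A] [Algebra k A] [LieRing g] [LieAlgebra k g]
  [LinearOrder I] {P : CrossedProduct k A g} {K : Subalgebra k A}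
  (hK : P.Stable K) (θ : P.Section) (b : Module.Basis I k g)

lemma isLeftLin_yLift :
    IsLeftLin P (toTot P K 0 ∘ₗ yLift K θ ∘ₗ P.toYy.toLinearMap) := fun c d => by
  change toTot P K 0 (yLift K θ (P.toYy (c * d))) = c • toTot P K 0 (yLift K θ (P.toYy d))
  rw [map_mul, yLift_left, toTot_left]

lemma isLeftLin_homot (n : ℕ) :
    IsLeftLin P (toTot P K (n + 1) ∘ₗ homot hK θ b ∘ₗ embTot P K n) := fun c w => by
  simp only [LinearMap.comp_apply]
  rw [embTot_left, homot_left, toTot_left]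

variable {θ} (hθ : θ.KStable K)

include hθ in
lemma isRightKLin_yLift :
    IsRightKLin P K (toTot P K 0 ∘ₗ yLift K θ ∘ₗ P.toYy.toLinearMap) := fun t ht d => by
  change toTot P K 0 (yLift K θ (P.toYy (d * P.inA t))) =
    op (P.inA t) • toTot P K 0 (yLift K θ (P.toYy d))
  rw [map_mul, P.toYy_inA, yLift_right θ hθ ht, toTot_right]

include hθ in
lemma isRightKLin_homot (n : ℕ) :
    IsRightKLin P K (toTot P K (n + 1) ∘ₗ homot hK θ b ∘ₗ embTot P K n) := fun t ht w => by
  simp only [LinearMap.comp_apply]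
  rw [embTot_right, homot_right hK b hθ ht, toTot_right]

end Linear

/-- The total complex is a relative projective resolution. For the splitting by `(E, K)`-bimodule
maps the PBW section is used: it is compatible with `K` as soon as `K` is stable under `g`. -/
lemma isRelProjectiveResolution {k : Type u₀} {A : Type u₁} {g : Type u₂} {I : Type*} [Field k]
    [Ring A] [Algebra k A] [LieRing g] [LieAlgebra k g] [LinearOrder I] {P : CrossedProduct k A g}
    {K : Subalgebra k A} (hK : P.Stable K) (b : Module.Basis I k g)
    (ε : Tot P K 0 →ₗ[k] P.Alg) (d : ∀ n, Tot P K (n + 1) →ₗ[k] Tot P K n)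
    (hε : ε = augTot P K) (hd : ∀ n, d n = toTot P K n ∘ₗ dTot hK ∘ₗ embTot P K (n + 1)) :
    IsRelProjectiveResolution.{w₁, w₂} P K (C := Tot P K) ε d where
  aug_left c w := by
    subst hε
    change P.yAug (muOp P K (embTot P K 0 (c • w))) = c * P.yAug (muOp P K (embTot P K 0 w))
    rw [embTot_left, muOp_left, map_mul, P.yAug_toYy]
  aug_right c w := by
    subst hε
    change P.yAug (muOp P K (embTot P K 0 (op c • w))) = P.yAug (muOp P K (embTot P K 0 w)) * c
    rw [embTot_right, muOp_right, map_mul, P.yAug_toYz]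
  d_left n c w := by
    simp only [hd, LinearMap.comp_apply]
    rw [embTot_left, (dTot_bimod hK).left, toTot_left]
  d_right n c w := by
    simp only [hd, LinearMap.comp_apply]
    rw [embTot_right, (dTot_bimod hK).right, toTot_right]
  aug_comp := by
    refine LinearMap.ext fun w => ?_
    rw [hε, hd]
    change P.yAug (muOp P K (embTot P K 0 (toTot P K 0 (dTot hK (embTot P K 1 w))))) = 0
    rw [embTot_toTot (dTot_mem_XT hK (embTot_mem w)), muOp_dTot, map_neg, P.yAug_yDel, neg_zero]
  d_comp n := by
    refine LinearMap.ext fun w => ?_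
    rw [hd, hd]
    simp only [LinearMap.comp_apply]
    rw [embTot_toTot (dTot_mem_XT hK (embTot_mem w)), dTot_dTot, map_zero]
    rfl
  projective n := RelProjective.pi fun p => X.relProjective P K p.1.1 p.1.2
  split := ⟨_, _, isContraction_homot hK (P.pbwSection b) b ε d _ _ hε hd rfl fun _ => rfl,
    isLeftLin_yLift _, isRightKLin_yLift (P.pbwSection_kStable b hK),
    isLeftLin_homot hK _ b, isRightKLin_homot hK b (P.pbwSection_kStable b hK)⟩

end DiffOpRing

end

theorem theorem1p3
    {k : Type u₀} {A : Type u₁} {g : Type u₂} {I : Type u₃}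
    [Field k] [Ring A] [Algebra k A] [LieRing g] [LieAlgebra k g] [LinearOrder I]
    (P : CrossedProduct k A g) (K : Subalgebra k A) (hK : P.Stable K)
    (b : Module.Basis I k g) :
    ∃ M : Maps P K b, (∀ M' : Maps P K b, M' = M) ∧ M.Homogeneous ∧
      IsRelProjectiveResolution.{w₁, w₂} P K (C := Tot P K) M.totAug M.totD ∧
      IsContraction P (C := Tot P K) M.totAug M.totD M.totSigmaZero M.totSigma ∧
      IsLeftLin P M.totSigmaZero ∧ (∀ n, IsLeftLin P (M.totSigma n)) ∧
      (P.UStable K → IsRightKLin P K M.totSigmaZero ∧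
        ∀ n, IsRightKLin P K (M.totSigma n)) := by
  have hε := stdMaps_totAug (b := b) hK
  have hd := stdMaps_totD hK b
  have hσ₀ := stdMaps_totSigmaZero hK b
  have hσ := stdMaps_totSigma hK b
  refine ⟨stdMaps hK b, fun M' => M'.eq_of_maps _, stdMaps_homogeneous hK b, ?_,
    isContraction_homot hK P.stdSection b _ _ _ _ hε hd hσ₀ hσ, ?_, fun n => ?_, fun hU => ⟨?_, ?_⟩⟩
  · exact isRelProjectiveResolution hK b _ _ hε hd
  · rw [hσ₀]
    exact isLeftLin_yLift P.stdSection
  · rw [hσ]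
    exact isLeftLin_homot hK P.stdSection b n
  · rw [hσ₀]
    exact isRightKLin_yLift (P.stdSection_kStable hU)
  · intro n
    rw [hσ]
    exact isRightKLin_homot hK b (P.stdSection_kStable hU) n
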